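/- Let $\Omega\subset\mathbb R^3$ be a nonempty bounded convex open set with smooth boundary and unit outer normal $n$, let $T>0$, $\Gamma_\pm=\{(x,v)\in\partial\Omega\times\mathbb R^3:\ \pm n(x)\cdot v>0\}$, and $d\sigma=|n(x)\cdot v|\,d\mu(x)\,dv$ with $\mu$ the surface measure of $\partial\Omega$; $L^2([0,T]\times\Gamma_\pm)$ is taken with respect to $dt\,d\sigma$. Let $\mathbf E=(E_1,E_2,E_3)\in C^1(\overline\Omega;\mathbb R^3)$ satisfy $n\cdot\mathbf E=0$ on $\partial\Omega$ and $E_j=0$ on $\overline\Omega$ for some $j\in\{1,2,3\}$. Let $\mathcal V\subset\mathbb R^3$ be open and assume: (H) $\mathbf E=-\nabla b$ in $\Omega$ for some function $b$, and there are $\varphi_0\in C^2(\overline\Omega\times\mathbb R^3)$ and constants $\beta>0$, $R>r>0$, $\gamma_0>0$, $M_0$, $M_1$ such that, with $\Psi:=-\beta+v\cdot\nabla_x\varphi_0+\mathbf E\cdot\nabla_v\varphi_0$, one has $r\le\varphi_0\le R$, $\Psi\ge\gamma_0$, $|\Psi|\le M_0$ on $\overline\Omega\times\mathcal V$, $|(v\cdot\nabla_x+\mathbf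 E\cdot\nabla_v)\Psi|\le M_1$ on $\Omega\times\mathcal V$, and $T>(R-r)/\beta$. (Here $C^k$ up to the boundary means: restriction of a $C^k$ function on the whole space.) Let $\mathcal U\subset\mathbb R^3$ be such that some open $I\subset\mathbb R$ contains the closure of $\{v_j: v\in\mathcal U\}$ and satisfies $\{v: v_j\in I\}\subset\mathcal V$. Let $q\in L^\infty(\Omega\times\mathbb R^3)$ and $C_1,C_2>0$. Denote by $\mathcal P_{\mathcal U}$ the set of functions $f(t,x,v)$ with $|f(0,x,v)|\le C_1$ and $|f(0,x,v)|\ge C_2$ for a.e. $(x,v)\in\Omega\times\mathcal U$ that are absolutely continuous in $t\in[0,T]$ for a.e. $(x,v)\in\Omega\times\mathcal U$, with $|\partial_tf|\le C_1$ a.e. on $[0,T]\times\Omega\times\mathcal U$. Then there are constants $c,C>0$, depending only on $\Omega,\mathbf E,q,T,\mathcal U,C_1,C_2$, with the following property. Let $S_i(t,x,v)=\widetilde S_i(x,v)S_0(t,x,v)$, $i=1,2$, with $S_0\in\mathcal P_{\mathcal U}$, $S_i\in L^2((0,T)\times\Omega\times\mathbb R^3)$, $\widetilde S_1-\widetilde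 S_2\in L^2(\Omega\times\mathbb R^3)$ and $\operatorname{supp}(\widetilde S_1-\widetilde S_2)(x,\cdot)\subset\mathcal U$ for all $x\in\Omega$; let $g\in L^2(\Omega\times\mathbb R^3)$, $h\in L^2([0,T]\times\Gamma_-)$, and let $u_i\in L^2((0,T)\times\Omega\times\mathbb R^3)$, with trace $u_i|_{\Gamma_+}\in L^2([0,T]\times\Gamma_+)$, be weak solutions of $$\partial_tu_i+v\cdot\nabla_xu_i+\mathbf E\cdot\nabla_vu_i+qu_i=S_i\ \text{ in }(0,T)\times\Omega\times\mathbb R^3,\qquad u_i(0,\cdot,\cdot)=g\ \text{ in }\Omega\times\mathbb R^3,\qquad u_i=h\ \text{ on }(0,T)\times\Gamma_-,$$ i.e. for every $C^1$ function $\phi$ with compact support in $(-\infty,T)\times\mathbb R^3\times\mathbb R^3$, $$\int_0^T\!\!\int_{\Omega\times\mathbb R^3}u_i\,(-\partial_t\phi-v\cdot\nabla_x\phi-\mathbf E\cdot\nabla_v\phi+q\phi)+\int_0^T\!\!\int_{\Gamma_+}u_i\phi\,d\sigma dt=\int_0^T\!\!\int_{\Omega\times\mathbb R^3}S_i\phi+\int_{\Omega\times\mathbb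 R^3}g\,\phi(0,\cdot,\cdot)+\int_0^T\!\!\int_{\Gamma_-}h\phi\,d\sigma dt .$$ Then $u_1-u_2$ has a weak time derivative $\partial_tu_1-\partial_tu_2$ on $(0,T)\times\Gamma_+$, and $$c\,\|\partial_tu_1-\partial_tu_2\|_{L^2([0,T]\times\Gamma_+)}\le\|\widetilde S_1-\widetilde S_2\|_{L^2(\Omega\times\mathbb R^3)}\le C\,\|\partial_tu_1-\partial_tu_2\|_{L^2([0,T]\times\Gamma_+)} .$$ In particular $\widetilde S_1=\widetilde S_2$ a.e. in $\Omega\times\mathbb R^3$ if $\partial_tu_1=\partial_tu_2$ on $[0,T]\times\Gamma_+$. -/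

import Mathlib

open MeasureTheory Set Topology
open scoped ENNReal

noncomputable section

/-- Euclidean three-space, used both for positions `x` and for velocities `v`. -/
abbrev R3 : Type := EuclideanSpace ℝ (Fin 3)

/-- Phase space, points `(x, v)`. -/
abbrev Phase : Type := R3 × R3

/-! ### The domain, its boundary and its unit outer normal -/

/-- Near every boundary point `Ω` is the strict sublevel set `{ρ < 0}` of a smooth function with
non-vanishing derivative at that point. -/
def HasSmoothBoundary (Ω : Set R3) : Prop :=
  ∀ x ∈ frontier Ω, ∃ ρ : R3 → ℝ, ContDiff ℝ (⊤ : ℕ∞) ρ ∧ fderiv ℝ ρ x ≠ 0 ∧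
    ∀ᶠ y in 𝓝 x, (y ∈ Ω ↔ ρ y < 0)

/-- A bounded convex domain of `ℝ³` with smooth boundary. -/
structure IsSmoothConvexDomain (Ω : Set R3) : Prop where
  isOpen : IsOpen Ω
  nonempty : Ω.Nonempty
  bounded : Bornology.IsBounded Ω
  convex : Convex ℝ Ω
  smooth_boundary : HasSmoothBoundary Ω

/-- `ν` is a unit outer normal to the convex set `Ω` at `x`. For a convex domain with smooth
boundary there is exactly one such `ν` at every boundary point, namely `∇ρ(x)/|∇ρ(x)|` for any
local defining function `ρ`. -/
def IsUnitOuterNormal (Ω : Set R3) (x ν : R3) : Prop :=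
  ‖ν‖ = 1 ∧ ∀ y ∈ Ω, inner ℝ ν (y - x) ≤ 0

open Classical in
/-- The unit outer normal `n(x)`, `x ∈ ∂Ω` (and `0` at all other points). -/
def outerNormal (Ω : Set R3) (x : R3) : R3 :=
  if h : x ∈ frontier Ω ∧ ∃ ν, IsUnitOuterNormal Ω x ν then h.2.choose else 0

/-- The outgoing set `Γ₊ = {(x, v) : x ∈ ∂Ω, n(x) · v > 0}`. -/
def GammaPlus (Ω : Set R3) : Set Phase :=
  {z | z.1 ∈ frontier Ω ∧ 0 < inner ℝ (outerNormal Ω z.1) z.2}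

/-- The incoming set `Γ₋ = {(x, v) : x ∈ ∂Ω, n(x) · v < 0}`. -/
def GammaMinus (Ω : Set R3) : Set Phase :=
  {z | z.1 ∈ frontier Ω ∧ inner ℝ (outerNormal Ω z.1) z.2 < 0}

/-- The measure `dσ = |n(x) · v| dμ(x) dv` on `∂Ω × ℝ³`, where `μ` is the surface measure of `∂Ω`
(the two-dimensional Hausdorff measure, normalized to be area on planes). -/
def boundaryMeasure (Ω : Set R3) : Measure Phase :=
  (((μHE[2] : Measure R3).restrict (frontier Ω)).prod (volume : Measure R3)).withDensity
    fun z => ENNReal.ofReal |inner ℝ (outerNormal Ω z.1) z.2|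

/-! ### The measures behind the `L²` norms; points of space-time are `(t, x, v)` -/

/-- `dx dv` on `Ω × ℝ³`. -/
def phaseMeasure (Ω : Set R3) : Measure Phase :=
  (volume : Measure Phase).restrict (Ω ×ˢ univ)

/-- `dt dx dv` on `(0, T) × Ω × ℝ³`. -/
def interiorMeasure (T : ℝ) (Ω : Set R3) : Measure (ℝ × Phase) :=
  ((volume : Measure ℝ).restrict (Ioo 0 T)).prod (phaseMeasure Ω)

/-- `dt dσ` on `(0, T) × Γ₊`. -/
def outMeasure (T : ℝ) (Ω : Set R3) : Measure (ℝ × Phase) :=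
  ((volume : Measure ℝ).restrict (Ioo 0 T)).prod ((boundaryMeasure Ω).restrict (GammaPlus Ω))

/-- `dt dσ` on `(0, T) × Γ₋`. -/
def inMeasure (T : ℝ) (Ω : Set R3) : Measure (ℝ × Phase) :=
  ((volume : Measure ℝ).restrict (Ioo 0 T)).prod ((boundaryMeasure Ω).restrict (GammaMinus Ω))

/-! ### The external field -/

/-- `E` is of class `C¹` on the closure of `Ω`: it is there the restriction of a `C¹` field on
`ℝ³`. -/
def IsC1OnClosure (Ω : Set R3) (E : R3 → R3) : Prop :=
  ∃ F : R3 → R3, ContDiff ℝ 1 F ∧ EqOn E F (closure Ω)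

/-- The derivative `v · ∇ₓ f + E · ∇ᵥ f` of a function on phase space. -/
def phaseTransport (E : R3 → R3) (f : Phase → ℝ) (z : Phase) : ℝ :=
  fderiv ℝ f z (z.2, E z.1)

/-- The function `Ψ = -β + v · ∇ₓ φ₀ + E · ∇ᵥ φ₀`, i.e. the transport operator
`∂ₜ + v · ∇ₓ + E · ∇ᵥ` applied to the weight `φ(t, x, v) = -β t + φ₀(x, v)`. -/
def weightPsi (E : R3 → R3) (β : ℝ) (φ₀ : Phase → ℝ) (z : Phase) : ℝ :=
  -β + phaseTransport E φ₀ z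

/-- The standing hypothesis on the weight: `V` is open, the field has a potential, and
there is a weight `φ = -β t + φ₀`, with `φ₀` of class `C²`, such that
`0 < r ≤ φ₀ ≤ R` on `closure Ω × V`, `T > (R - r)/β`, `γ₀ ≤ Ψ ≤ M₀` on `closure Ω × V`, and
`|(v · ∇ₓ + E · ∇ᵥ) Ψ| ≤ M₁` on `Ω × V`. -/
def CarlemanHypothesis (T : ℝ) (Ω : Set R3) (E : R3 → R3) (V : Set R3) : Prop :=
  IsOpen V ∧
  (∃ b : R3 → ℝ, ∀ x ∈ Ω, HasGradientAt b (-E x) x) ∧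
  ∃ (φ₀ : Phase → ℝ) (β r R γ₀ M₀ M₁ : ℝ),
    ContDiff ℝ 2 φ₀ ∧ 0 < β ∧ 0 < r ∧ r < R ∧ (R - r) / β < T ∧ 0 < γ₀ ∧
    (∀ x ∈ closure Ω, ∀ v ∈ V, r ≤ φ₀ (x, v) ∧ φ₀ (x, v) ≤ R) ∧
    (∀ x ∈ closure Ω, ∀ v ∈ V,
      γ₀ ≤ weightPsi E β φ₀ (x, v) ∧ |weightPsi E β φ₀ (x, v)| ≤ M₀) ∧
    (∀ x ∈ Ω, ∀ v ∈ V, |phaseTransport E (weightPsi E β φ₀) (x, v)| ≤ M₁)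

/-- The velocity set `U` is separated from the complement of `V` in the direction `v_j`: there is
an open `I ⊆ ℝ` containing the closure of `{v_j : v ∈ U}` with `{v : v_j ∈ I} ⊆ V`. (Equivalently,
there is a smooth cut-off function of `v_j` alone, equal to `1` on `U` and supported in `V`.) -/
def SeparatedInDirection (j : Fin 3) (U V : Set R3) : Prop :=
  ∃ I : Set ℝ, IsOpen I ∧ closure ((fun v : R3 => v j) '' U) ⊆ I ∧ ∀ v : R3, v j ∈ I → v ∈ V

/-! ### The class `𝒫_U` -/

/-- `f ∈ 𝒫_U`: `|f(0, ·)| ≤ C₁` and `|f(0, ·)| ≥ C₂` a.e. on `Ω × U`, and `f` is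
absolutely continuous in time on `[0, T]` with `|∂ₜ f| ≤ C₁` a.e. on `[0, T] × Ω × U`. -/
def MemP (T : ℝ) (Ω U : Set R3) (C₁ C₂ : ℝ) (f : ℝ × Phase → ℝ) : Prop :=
  (∀ᵐ z ∂(volume : Measure Phase).restrict (Ω ×ˢ U), |f (0, z)| ≤ C₁ ∧ C₂ ≤ |f (0, z)|) ∧
  ∃ f' : ℝ × Phase → ℝ,
    AEStronglyMeasurable f' (((volume : Measure ℝ).restrict (Icc 0 T)).prod
      ((volume : Measure Phase).restrict (Ω ×ˢ U))) ∧
    (∀ᵐ p ∂((volume : Measure ℝ).restrict (Icc 0 T)).prod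
      ((volume : Measure Phase).restrict (Ω ×ˢ U)), |f' p| ≤ C₁) ∧
    ∀ᵐ z ∂(volume : Measure Phase).restrict (Ω ×ˢ U), ∀ t ∈ Icc 0 T,
      f (t, z) = f (0, z) + ∫ s in (0 : ℝ)..t, f' (s, z)

/-! ### Solutions of the initial boundary value problem -/

/-- The transport operator `∂ₜ φ + v · ∇ₓ φ + E · ∇ᵥ φ`. -/
def transportOp (E : R3 → R3) (φ : ℝ × Phase → ℝ) (p : ℝ × Phase) : ℝ :=
  fderiv ℝ φ p (1, p.2.2, E p.2.1)

/-- `u ∈ L²((0, T) × Ω × ℝ³)`, with trace `uOut ∈ L²((0, T) × Γ₊)`, is a weak solution of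
`∂ₜ u + v · ∇ₓ u + E · ∇ᵥ u + q u = S` in `(0, T) × Ω × ℝ³`, `u(0, ·) = g` in `Ω × ℝ³`,
`u = h` on `(0, T) × Γ₋`: the identity obtained by multiplying with a `C¹` function
compactly supported in `(-∞, T) × ℝ³ × ℝ³` and integrating by parts holds. The test functions
need not vanish on `∂Ω`, so the identity determines the trace on `Γ₊`. -/
structure IsWeakSolution (T : ℝ) (Ω : Set R3) (E : R3 → R3) (q : Phase → ℝ)
    (S : ℝ × Phase → ℝ) (g : Phase → ℝ) (h u uOut : ℝ × Phase → ℝ) : Prop where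
  memLp : MemLp u 2 (interiorMeasure T Ω)
  memLp_out : MemLp uOut 2 (outMeasure T Ω)
  weak_eq : ∀ φ : ℝ × Phase → ℝ, ContDiff ℝ 1 φ → HasCompactSupport φ →
    tsupport φ ⊆ Iio T ×ˢ univ →
    ∫ p, u p * (-transportOp E φ p + q p.2 * φ p) ∂interiorMeasure T Ω
        + ∫ p, uOut p * φ p ∂outMeasure T Ω
      = ∫ p, S p * φ p ∂interiorMeasure T Ω
        + ∫ z, g z * φ (0, z) ∂phaseMeasure Ω
        + ∫ p, h p * φ p ∂inMeasure T Ω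

/-- `d` is the (weak) time derivative `∂ₜ w` of the function `w` on `(0, T) × Γ₊`. -/
def IsWeakTimeDeriv (T : ℝ) (Ω : Set R3) (w d : ℝ × Phase → ℝ) : Prop :=
  LocallyIntegrableOn d (Ioo 0 T ×ˢ univ) (outMeasure T Ω) ∧
  ∀ θ : ℝ × Phase → ℝ, ContDiff ℝ 1 θ → HasCompactSupport θ →
    tsupport θ ⊆ Ioo 0 T ×ˢ univ →
    ∫ p, w p * fderiv ℝ θ p (1, 0) ∂outMeasure T Ω = -∫ p, d p * θ p ∂outMeasure T Ω

end

/-! Put f = S̃₁ - S̃₂ and w = u₁ - u₂. Then w solves the transport equation with source f S₀ and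
with zero initial and inflow data. Hence z = ∂ₜw solves it with source f ∂ₜS₀, initial value f
S₀(0), zero inflow, and outgoing trace the time derivative of the trace of w. Since C₂|f| ≤ |f
S₀(0)| ≤ C₁|f|, the unknown profile has become an initial value, and both inequalities are energy
estimates for z.

The upper bound for the trace is the energy estimate with a weight exp(-λt). The lower bound is a
Carleman estimate (`IsTransportSolution.carleman_estimate`): the equation is tested with 2zθ(t)e,
where e = exp(2s(φ₀ - βt)) and θ cuts off near the final time. The transport derivative of e is 2sΨe
≥ 2sγ₀e, which absorbs the coefficient q and the Young remainder. Besides the observed flux, two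
terms remain on the right. The source term contains the time integral of exp(-2sβt), hence a factor
1/(2sβ). The term with θ' lives on t ≥ T₁ and is at most a multiple of exp(2s(R - βT₁))‖z‖², where
‖z‖² ≤ K‖f‖². As T > (R - r)/β, one can take T₁ < T with R - βT₁ < r ≤ φ₀, so for large s both are
absorbed by C₂²∫f²exp(2sφ₀) (`exists_carleman_parameter`, `exists_observability_constant`). The
weight is controlled only for velocities in V. This suffices because E_j = 0 makes v_j constant
along trajectories, so z vanishes wherever v_j is outside the closure of the v_j of U
(`IsTransportSolution.ae_eq_zero_of_velocity_notMem`).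

Energy identities have to be justified for weak solutions with an L² trace. The field (v, E(x)) is
divergence-free in phase space; after extension of E it has a complete volume-preserving C¹ flow. In
flow coordinates the measure dt dσ on Γ₊ is the image of Lebesgue measure on initial points under
the exit maps (`IsPhaseFlow.exists_exit_family`). A solution, extended by zero outside Ω, is along
almost every trajectory a primitive of the source minus jumps by the trace at the exits
(`IsTransportSolution.ae_eq_trajectoryValue`). Just after an exit the trajectory is outside the
closure of Ω, so the value there is zero, the jump is the whole value, and the square jumps by the
square of the trace (`integral_jump_sq_mul_deriv`, `IsTransportSolution.renormalized`).

Finally z itself is built as a weak L² limit of backward difference quotients in time. They are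
again solutions because the initial value is zero, and they are bounded uniformly by energy
estimates (`IsTransportSolution.diffQuot_bound`, `IsTransportSolution.exists_time_derivative`). -/

noncomputable section

/-! ### Picard iteration with parameters for globally Lipschitz equations. -/

section Picard

open Filter

variable {P E : Type*} [TopologicalSpace P] [NormedAddCommGroup E] [NormedSpace ℝ E]

/-- Picard iterates of `x' = f p t x`, `x(0) = x₀ p`, depending on a parameter `p`. -/
def picardIter (f : P → ℝ → E → E) (x₀ : P → E) : ℕ → P × ℝ → E
  | 0 => fun q => x₀ q.1
  | n + 1 => fun q => x₀ q.1 + ∫ s in (0 : ℝ)..q.2, f q.1 s (picardIter f x₀ n (q.1, s))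

lemma continuous_picardIter {f : P → ℝ → E → E} {x₀ : P → E}
    (hf : Continuous fun q : P × ℝ × E => f q.1 q.2.1 q.2.2) (hx : Continuous x₀) (n : ℕ) :
    Continuous (picardIter f x₀ n) := by
  induction n with
  | zero => exact hx.comp continuous_fst
  | succ n ih =>
    refine (hx.comp continuous_fst).add ?_
    apply intervalIntegral.continuous_parametric_intervalIntegral_of_continuous
      (f := fun (q : P × ℝ) s => f q.1 s (picardIter f x₀ n (q.1, s))) _ continuous_snd
    have : Continuous fun r : (P × ℝ) × ℝ => picardIter f x₀ n (r.1.1, r.2) := by fun_prop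
    exact hf.comp (Continuous.prodMk (by fun_prop) (Continuous.prodMk continuous_snd this))

lemma abs_integral_abs_pow (n : ℕ) (t : ℝ) :
    |∫ s in (0 : ℝ)..t, |s| ^ n| = |t| ^ (n + 1) / (n + 1) := by
  rcases le_total 0 t with ht | ht
  · have : ∫ s in (0 : ℝ)..t, |s| ^ n = ∫ s in (0 : ℝ)..t, s ^ n := by
      apply intervalIntegral.integral_congr
      intro s hs
      rw [uIcc_of_le ht] at hs
      simp [abs_of_nonneg hs.1]
    rw [this, integral_pow, abs_of_nonneg ht, zero_pow (by simp), sub_zero, abs_of_nonneg]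
    positivity
  · have : ∫ s in (0 : ℝ)..t, |s| ^ n = -∫ s in (0 : ℝ)..(-t), s ^ n := by
      have h := intervalIntegral.integral_comp_neg (fun s : ℝ => s ^ n) (a := t) (b := 0)
      rw [neg_zero] at h
      rw [intervalIntegral.integral_symm, ← h]
      congr 1
      apply intervalIntegral.integral_congr
      intro s hs
      rw [uIcc_of_le ht] at hs
      simp [abs_of_nonpos hs.2]
    rw [this, integral_pow, abs_neg, abs_of_nonpos ht, zero_pow (by simp), sub_zero, abs_of_nonneg]
    have := neg_nonneg.2 ht
    positivity

/-- Each iteration costs a factor L and one integration in time, which produces the factorial. Only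
a bound M for the field along the initial guess enters, so M can be taken uniform on compact sets of
parameters. -/
lemma norm_picardIter_succ_sub_le {f : P → ℝ → E → E} {x₀ : P → E} {L M τ : ℝ} (hL : 0 ≤ L)
    (hf : Continuous fun q : P × ℝ × E => f q.1 q.2.1 q.2.2) (hx : Continuous x₀)
    (hlip : ∀ p t x y, ‖f p t x - f p t y‖ ≤ L * ‖x - y‖) {p : P}
    (hM : ∀ s, |s| ≤ τ → ‖f p s (x₀ p)‖ ≤ M) (n : ℕ) :
    ∀ t, |t| ≤ τ → ‖picardIter f x₀ (n + 1) (p, t) - picardIter f x₀ n (p, t)‖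
      ≤ M * L ^ n * |t| ^ (n + 1) / (n + 1).factorial := by
  have hcont : ∀ n, Continuous fun s : ℝ => f p s (picardIter f x₀ n (p, s)) := fun n =>
    hf.comp (Continuous.prodMk continuous_const (Continuous.prodMk continuous_id
      ((continuous_picardIter hf hx n).comp (Continuous.prodMk continuous_const continuous_id))))
  have hsub : ∀ s t : ℝ, |t| ≤ τ → s ∈ uIoc 0 t → |s| ≤ τ := by
    intro s t ht hs
    refine le_trans ?_ ht
    have := abs_sub_left_of_mem_uIcc (uIoc_subset_uIcc hs)
    simpa using this
  induction n with
  | zero =>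
    intro t ht
    simp only [picardIter, add_sub_cancel_left, pow_zero, mul_one, zero_add, pow_one,
      Nat.factorial_one, Nat.cast_one, div_one]
    refine (intervalIntegral.norm_integral_le_of_norm_le_const fun s hs =>
      hM s (hsub s t ht hs)).trans ?_
    simp
  | succ n ih =>
    intro t ht
    rw [show picardIter f x₀ (n + 1 + 1) (p, t) - picardIter f x₀ (n + 1) (p, t)
      = ∫ s in (0 : ℝ)..t, (f p s (picardIter f x₀ (n + 1) (p, s))
        - f p s (picardIter f x₀ n (p, s))) from ?_]
    · have hle : ∀ᵐ s ∂(volume : Measure ℝ).restrict (uIoc 0 t),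
          ‖f p s (picardIter f x₀ (n + 1) (p, s)) - f p s (picardIter f x₀ n (p, s))‖
            ≤ (M * L ^ (n + 1) / (n + 1).factorial) * |s| ^ (n + 1) := by
        refine (ae_restrict_mem measurableSet_uIoc).mono fun s hs => ?_
        refine (hlip _ _ _ _).trans ?_
        refine (mul_le_mul_of_nonneg_left (ih s (hsub s t ht hs)) hL).trans (le_of_eq ?_)
        rw [pow_succ L n]; ring
      refine (intervalIntegral.norm_integral_le_abs_of_norm_le hle ?_).trans ?_
      · exact (Continuous.intervalIntegrable (by fun_prop) _ _)
      · rw [intervalIntegral.integral_const_mul, abs_mul, abs_integral_abs_pow]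
        have hM0 : 0 ≤ M := (norm_nonneg _).trans (hM 0 (by simpa using (abs_nonneg t).trans ht))
        rw [abs_of_nonneg (by positivity), Nat.factorial_succ (n + 1)]
        push_cast
        apply le_of_eq
        field_simp
    · rw [intervalIntegral.integral_sub ((hcont _).intervalIntegrable _ _)
        ((hcont _).intervalIntegrable _ _)]
      simp [picardIter]

/-- Global solvability of `x' = f p t x`, `x(0) = x₀ p` for globally Lipschitz fields, with
continuous dependence on the parameter `p`. -/
theorem exists_continuous_global_solution [LocallyCompactSpace P] [CompleteSpace E] {f : P → ℝ → E → E} {x₀ : P → E}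
    {L : ℝ} (hL : 0 ≤ L)
    (hf : Continuous fun q : P × ℝ × E => f q.1 q.2.1 q.2.2) (hx : Continuous x₀)
    (hlip : ∀ p t x y, ‖f p t x - f p t y‖ ≤ L * ‖x - y‖) :
    ∃ X : P × ℝ → E, Continuous X ∧ (∀ p, X (p, 0) = x₀ p) ∧
      ∀ p t, HasDerivAt (fun s => X (p, s)) (f p t (X (p, t))) t := by
  set D : ℕ → P × ℝ → E := fun n q => picardIter f x₀ (n + 1) q - picardIter f x₀ n q with hD
  have hDc : ∀ n, Continuous (D n) := fun n =>
    (continuous_picardIter hf hx _).sub (continuous_picardIter hf hx _)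
  have hsumm : ∀ M τ : ℝ, Summable fun n : ℕ => M * L ^ n * τ ^ (n + 1) / (n + 1).factorial := by
    intro M τ
    have h1 := (Real.summable_pow_div_factorial (L * τ)).mul_left (|M| * |τ|)
    have h2 := h1.abs
    refine Summable.of_norm_bounded h2 fun n => ?_
    rw [Real.norm_eq_abs]
    simp only [abs_mul, abs_div, abs_pow, mul_pow, abs_abs, Nat.abs_cast]
    rw [pow_succ]
    have : ((n.factorial : ℝ)) ≤ (n + 1).factorial := by
      exact_mod_cast Nat.factorial_le (Nat.le_succ n)
    have hn : (0 : ℝ) < n.factorial := by exact_mod_cast Nat.factorial_pos n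
    calc |M| * |L| ^ n * (|τ| ^ n * |τ|) / ((n + 1).factorial : ℝ)
        ≤ |M| * |L| ^ n * (|τ| ^ n * |τ|) / (n.factorial : ℝ) := by gcongr
      _ = _ := by ring
  -- Weierstrass M-test on compact sets of parameters and times. It makes the limit jointly
  -- continuous, and it supplies the dominating function for passing to the limit in the integral
  -- equation.
  have hloc : ∀ K : Set P, IsCompact K → ∀ τ : ℝ, ∃ u : ℕ → ℝ, Summable u ∧
      ∀ n, ∀ q ∈ K ×ˢ Icc (-τ) τ, ‖D n q‖ ≤ u n := by
    intro K hK τ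
    have hc : Continuous fun q : P × ℝ => f q.1 q.2 (x₀ q.1) :=
      hf.comp (continuous_fst.prodMk (continuous_snd.prodMk (hx.comp continuous_fst)))
    obtain ⟨M, hM⟩ := (hK.prod (isCompact_Icc (a := -τ) (b := τ))).exists_bound_of_continuousOn
      hc.continuousOn
    refine ⟨_, hsumm M τ, fun n q hq => ?_⟩
    have hτ : |q.2| ≤ τ := abs_le.2 hq.2
    refine (norm_picardIter_succ_sub_le (p := q.1) (τ := τ) (M := M) hL hf hx hlip
      (fun s hs => hM (q.1, s) ⟨hq.1, abs_le.1 hs⟩) n q.2 hτ).trans ?_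
    have hM0 : 0 ≤ M := (norm_nonneg _).trans (hM q hq)
    gcongr
  have hsum : ∀ q, Summable fun n => D n q := by
    intro q
    obtain ⟨K, hK, hq⟩ := exists_compact_mem_nhds q.1
    obtain ⟨u, hu, hb⟩ := hloc K hK |q.2|
    exact Summable.of_norm_bounded hu fun n => hb n q ⟨mem_of_mem_nhds hq, neg_abs_le _, le_abs_self _⟩
  set X : P × ℝ → E := fun q => x₀ q.1 + ∑' n, D n q with hX
  have hXc : Continuous X := by
    refine (hx.comp continuous_fst).add (continuous_iff_continuousAt.2 fun q => ?_)
    obtain ⟨K, hK, hq⟩ := exists_compact_mem_nhds q.1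
    obtain ⟨u, hu, hb⟩ := hloc K hK (|q.2| + 1)
    have := continuousOn_tsum (fun n => (hDc n).continuousOn) hu hb
    refine this.continuousAt (prod_mem_nhds hq (Icc_mem_nhds ?_ ?_))
    · linarith [neg_abs_le q.2]
    · linarith [le_abs_self q.2]
  have hpart : ∀ n q, picardIter f x₀ n q = x₀ q.1 + ∑ i ∈ Finset.range n, D i q := by
    intro n q
    rw [Finset.sum_range_sub (fun i => picardIter f x₀ i q)]
    simp [picardIter]
  have hlim : ∀ q, Tendsto (fun n => picardIter f x₀ n q) atTop (𝓝 (X q)) := by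
    intro q
    simp_rw [hpart]
    exact ((hsum q).hasSum.tendsto_sum_nat).const_add _
  have hfix : ∀ p t, X (p, t) = x₀ p + ∫ s in (0 : ℝ)..t, f p s (X (p, s)) := by
    intro p t
    refine tendsto_nhds_unique ((hlim (p, t)).comp (tendsto_add_atTop_nat 1)) ?_
    refine Tendsto.const_add _ ?_
    obtain ⟨u, hu, hb⟩ := hloc {p} isCompact_singleton |t|
    have hc : Continuous fun s : ℝ => f p s (x₀ p) :=
      hf.comp (continuous_const.prodMk (continuous_id.prodMk continuous_const))
    have hmem : ∀ s ∈ uIoc 0 t, s ∈ Icc (-|t|) |t| := by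
      intro s hs
      have := abs_sub_left_of_mem_uIcc (uIoc_subset_uIcc hs)
      exact abs_le.1 (by simpa using this)
    refine intervalIntegral.tendsto_integral_filter_of_dominated_convergence
      (fun s => ‖f p s (x₀ p)‖ + L * ∑' n, u n) (Eventually.of_forall fun n => ?_)
      (Eventually.of_forall fun n => Eventually.of_forall fun s hs => ?_) ?_
      (Eventually.of_forall fun s hs => ?_)
    · exact (hf.comp (Continuous.prodMk continuous_const (Continuous.prodMk continuous_id
        ((continuous_picardIter hf hx n).comp
          (Continuous.prodMk continuous_const continuous_id))))).aestronglyMeasurable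
    · have h1 := norm_add_le (f p s (x₀ p)) (f p s (picardIter f x₀ n (p, s)) - f p s (x₀ p))
      rw [add_sub_cancel] at h1
      refine h1.trans (add_le_add le_rfl ((hlip _ _ _ _).trans ?_))
      refine mul_le_mul_of_nonneg_left ?_ hL
      rw [hpart, add_sub_cancel_left]
      refine (norm_sum_le _ _).trans ((Finset.sum_le_sum fun i _ =>
        hb i (p, s) ⟨rfl, hmem s hs⟩).trans ?_)
      exact hu.sum_le_tsum _ fun i _ => (norm_nonneg _).trans (hb i (p, s) ⟨rfl, hmem s hs⟩)
    · exact (Continuous.intervalIntegrable (by fun_prop) _ _)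
    · exact ((hf.comp (Continuous.prodMk continuous_const (Continuous.prodMk continuous_const
        continuous_id))).tendsto (X (p, s))).comp (hlim (p, s))
  refine ⟨X, hXc, fun p => by simp [hfix p 0], fun p t => ?_⟩
  have hc : Continuous fun s => f p s (X (p, s)) :=
    hf.comp (Continuous.prodMk continuous_const (Continuous.prodMk continuous_id
      (hXc.comp (Continuous.prodMk continuous_const continuous_id))))
  have := (hc.integral_hasStrictDerivAt 0 t).hasDerivAt.const_add (x₀ p)
  refine this.congr_of_eventuallyEq (Eventually.of_forall fun s => hfix p s)

end Picard

/-! ### The C¹ flow of a C¹ field with bounded derivative, and Liouville's theorem. -/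

section Flow

variable {E : Type*} [NormedAddCommGroup E] [NormedSpace ℝ E]

/-- Mean of the derivative over a segment, the matrix in Hadamard's lemma. -/
def segmentMeanFDeriv (W : E → E) (y y' : E) : E →L[ℝ] E :=
  ∫ s in (0 : ℝ)..1, fderiv ℝ W (y' + s • (y - y'))

lemma continuous_segmentMeanFDeriv {W : E → E} (hW : ContDiff ℝ 1 W) :
    Continuous fun q : E × E => segmentMeanFDeriv W q.1 q.2 := by
  have h1 : Continuous (fderiv ℝ W) := hW.continuous_fderiv one_ne_zero
  exact intervalIntegral.continuous_parametric_intervalIntegral_of_continuous'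
    (f := fun (q : E × E) (s : ℝ) => fderiv ℝ W (q.2 + s • (q.1 - q.2)))
    (h1.comp (by fun_prop)) 0 1

lemma segmentMeanFDeriv_apply_sub [CompleteSpace E] {W : E → E} (hW : ContDiff ℝ 1 W) (y y' : E) :
    segmentMeanFDeriv W y y' (y - y') = W y - W y' := by
  have h1 : Continuous (fderiv ℝ W) := hW.continuous_fderiv one_ne_zero
  have hd : ∀ s ∈ uIcc (0 : ℝ) 1, HasDerivAt (fun s : ℝ => W (y' + s • (y - y')))
      (fderiv ℝ W (y' + s • (y - y')) (y - y')) s := by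
    intro s _
    have h2 : HasDerivAt (fun s : ℝ => y' + s • (y - y')) (y - y') s := by
      simpa using ((hasDerivAt_id s).smul_const (y - y')).const_add y'
    exact ((hW.differentiable one_ne_zero).differentiableAt.hasFDerivAt).comp_hasDerivAt s h2
  have hc : Continuous fun s : ℝ => fderiv ℝ W (y' + s • (y - y')) := h1.comp (by fun_prop)
  have := intervalIntegral.integral_eq_sub_of_hasDerivAt hd
    ((hc.clm_apply continuous_const).intervalIntegrable _ _)
  simp only [one_smul, add_sub_cancel, zero_smul, add_zero] at this
  rw [← this, segmentMeanFDeriv]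
  exact ContinuousLinearMap.intervalIntegral_apply (hc.intervalIntegrable _ _) _

lemma norm_segmentMeanFDeriv_le {W : E → E} {L : ℝ} (hL : ∀ y, ‖fderiv ℝ W y‖ ≤ L) (y y' : E) :
    ‖segmentMeanFDeriv W y y'‖ ≤ L := by
  have := intervalIntegral.norm_integral_le_of_norm_le_const (a := (0 : ℝ)) (b := 1)
    (f := fun s : ℝ => fderiv ℝ W (y' + s • (y - y'))) (C := L) fun s _ => hL _
  simpa [segmentMeanFDeriv] using this

lemma segmentMeanFDeriv_self [CompleteSpace E] (W : E → E) (y : E) : segmentMeanFDeriv W y y = fderiv ℝ W y := by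
  simp [segmentMeanFDeriv]

/-- A `C¹` field with bounded derivative has a `C¹` global flow. -/
theorem exists_contDiff_flow [FiniteDimensional ℝ E] {W : E → E} (hW : ContDiff ℝ 1 W) {L : ℝ}
    (hL : ∀ y, ‖fderiv ℝ W y‖ ≤ L) :
    ∃ (Φ : ℝ → E → E) (A : ℝ → E → E →L[ℝ] E),
      ContDiff ℝ 1 (fun p : ℝ × E => Φ p.1 p.2) ∧
      (∀ z, Φ 0 z = z) ∧ (∀ s t z, Φ (s + t) z = Φ s (Φ t z)) ∧
      (∀ t z, HasDerivAt (fun s => Φ s z) (W (Φ t z)) t) ∧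
      (∀ t z, HasFDerivAt (Φ t) (A t z) z) ∧
      ∀ z, HasDerivAt (fun s => A s z) (fderiv ℝ W z) 0 := by
  have hL0 : 0 ≤ L := (norm_nonneg _).trans (hL 0)
  have hlip : ∀ x y, ‖W x - W y‖ ≤ L * ‖x - y‖ := fun x y =>
    Convex.norm_image_sub_le_of_norm_fderiv_le (fun z _ => (hW.differentiable one_ne_zero) z)
      (fun z _ => hL z) convex_univ (mem_univ y) (mem_univ x)
  have hLip : LipschitzWith L.toNNReal W := LipschitzWith.of_dist_le_mul fun x y => by
    rw [dist_eq_norm, dist_eq_norm, Real.coe_toNNReal _ hL0]; exact hlip x y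
  obtain ⟨X, hXc, hX0, hXd⟩ := exists_continuous_global_solution (P := E) (E := E)
    (f := fun _ _ x => W x) (x₀ := id) hL0 (hW.continuous.comp (by fun_prop)) continuous_id
    (fun _ _ x y => hlip x y)
  have huniq : ∀ γ₁ γ₂ : ℝ → E, (∀ t, HasDerivAt γ₁ (W (γ₁ t)) t) →
      (∀ t, HasDerivAt γ₂ (W (γ₂ t)) t) → γ₁ 0 = γ₂ 0 → γ₁ = γ₂ := fun γ₁ γ₂ h₁ h₂ h0 =>
    ODE_solution_unique_univ (v := fun _ => W) (s := fun _ => univ) (K := L.toNNReal)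
      (fun _ => hLip.lipschitzOnWith) (fun t => ⟨h₁ t, mem_univ _⟩) (fun t => ⟨h₂ t, mem_univ _⟩) h0
  -- the resolvent of the linear equation satisfied by differences of trajectories
  obtain ⟨B, hBc, hB0, hBd⟩ := exists_continuous_global_solution (P := E × E) (E := E →L[ℝ] E)
    (f := fun p t a => (segmentMeanFDeriv W (X (p.1, t)) (X (p.2, t))).comp a)
    (x₀ := fun _ => ContinuousLinearMap.id ℝ E) hL0 (by
      have := continuous_segmentMeanFDeriv hW
      refine Continuous.clm_comp (this.comp (f := fun q : (E × E) × ℝ × (E →L[ℝ] E) =>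
        (X (q.1.1, q.2.1), X (q.1.2, q.2.1))) (by fun_prop)) (by fun_prop)) continuous_const
    (fun p t a b => by
      rw [← ContinuousLinearMap.comp_sub]
      exact (ContinuousLinearMap.opNorm_comp_le _ _).trans
        (mul_le_mul_of_nonneg_right (norm_segmentMeanFDeriv_le hL _ _) (norm_nonneg _)))
  -- By Hadamard's lemma the difference of two trajectories solves the linear equation whose
  -- resolvent is `B`, so by uniqueness it equals `B` applied to the initial difference.
  -- Differentiability in the initial point thereby reduces to continuity of `B` in its parameters.
  have hdiff : ∀ y y' t, X (y, t) - X (y', t) = B ((y, y'), t) (y - y') := by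
    intro y y' t
    have h := ODE_solution_unique_univ (t₀ := 0)
      (v := fun t => segmentMeanFDeriv W (X (y, t)) (X (y', t)))
      (s := fun _ => univ) (K := L.toNNReal) (f := fun t => X (y, t) - X (y', t))
      (g := fun t => B ((y, y'), t) (y - y'))
      (fun t => (ContinuousLinearMap.lipschitz _).weaken ?_ |>.lipschitzOnWith)
      (fun t => ⟨?_, mem_univ _⟩) (fun t => ⟨?_, mem_univ _⟩) ?_
    · exact congrFun h t
    · rw [← NNReal.coe_le_coe, coe_nnnorm, Real.coe_toNNReal _ hL0]
      exact norm_segmentMeanFDeriv_le hL _ _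
    · rw [segmentMeanFDeriv_apply_sub hW]
      exact (hXd y t).sub (hXd y' t)
    · have := (hBd (y, y') t).clm_apply (hasDerivAt_const t (y - y'))
      simpa using this
    · simp [hX0, hB0]
  have hfd : ∀ t y, HasFDerivAt (fun z => X (z, t)) (B ((y, y), t)) y := by
    intro t y
    rw [hasFDerivAt_iff_isLittleO]
    have h1 : ∀ z, X (z, t) - X (y, t) - B ((y, y), t) (z - y)
        = (B ((z, y), t) - B ((y, y), t)) (z - y) := fun z => by
      rw [hdiff z y t, sub_apply]
    simp_rw [h1]
    have h2 : Filter.Tendsto (fun z => ‖B ((z, y), t) - B ((y, y), t)‖) (𝓝 y) (𝓝 0) := by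
      have : Continuous fun z => ‖B ((z, y), t) - B ((y, y), t)‖ := by fun_prop
      simpa using this.tendsto y
    rw [Asymptotics.isLittleO_iff]
    intro c hc
    filter_upwards [h2.eventually (gt_mem_nhds hc)] with z hz
    exact (ContinuousLinearMap.le_opNorm _ _).trans
      (mul_le_mul_of_nonneg_right hz.le (norm_nonneg _))
  refine ⟨fun t z => X (z, t), fun t z => B ((z, z), t), ?_, fun z => hX0 z, ?_,
    fun t z => hXd z t, hfd, fun z => ?_⟩
  · set f₁ : ℝ → E → ℝ →L[ℝ] E := fun t z => ContinuousLinearMap.toSpanSingleton ℝ (W (X (z, t)))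
    set f₂ : ℝ → E → E →L[ℝ] E := fun t z => B ((z, z), t)
    have hf₁ : Continuous fun p : ℝ × E => f₁ p.1 p.2 := by
      have : Continuous fun p : ℝ × E => W (X (p.2, p.1)) := hW.continuous.comp (by fun_prop)
      exact (ContinuousLinearMap.toSpanSingletonCLE (𝕜 := ℝ) (E := E)).continuous.comp this
    have hf₂ : Continuous fun p : ℝ × E => f₂ p.1 p.2 := by fun_prop
    -- Both partial derivatives exist everywhere and are jointly continuous, hence the flow is
    -- jointly C¹.
    have hs : ∀ u : ℝ × E, HasStrictFDerivAt (fun p : ℝ × E => X (p.2, p.1))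
        ((f₁ u.1 u.2).coprod (f₂ u.1 u.2)) u := fun u =>
      hasStrictFDerivAt_uncurry_coprod (f := fun t z => X (z, t)) (f₁ := f₁) (f₂ := f₂)
        (Filter.Eventually.of_forall fun v => (hXd v.2 v.1).hasFDerivAt)
        (Filter.Eventually.of_forall fun v => hfd v.1 v.2) hf₁.continuousAt hf₂.continuousAt
    rw [contDiff_one_iff_fderiv]
    refine ⟨fun u => (hs u).hasFDerivAt.differentiableAt, ?_⟩
    rw [show fderiv ℝ (fun p : ℝ × E => X (p.2, p.1))
      = fun u => (f₁ u.1 u.2).coprod (f₂ u.1 u.2) from funext fun u => (hs u).hasFDerivAt.fderiv]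
    have hco : (fun u : ℝ × E => (f₁ u.1 u.2).coprod (f₂ u.1 u.2)) = fun u =>
        (f₁ u.1 u.2).comp (ContinuousLinearMap.fst ℝ ℝ E)
          + (f₂ u.1 u.2).comp (ContinuousLinearMap.snd ℝ ℝ E) := by
      funext u
      ext w <;> simp
    rw [hco]
    exact (hf₁.clm_comp continuous_const).add (hf₂.clm_comp continuous_const)
  · intro s t z
    have := huniq (fun s => X (z, s + t)) (fun s => X (X (z, t), s))
      (fun s => (hXd z (s + t)).comp_add_const s t) (fun s => hXd _ s) (by simp [hX0])
    exact congrFun this s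
  · have := hBd (z, z) 0
    simpa [hB0, hX0, segmentMeanFDeriv_self] using this

/-- The derivative of the determinant at the identity is the trace. -/
lemma hasDerivAt_det_of_eq_id [FiniteDimensional ℝ E] {A : ℝ → E →L[ℝ] E} {M : E →L[ℝ] E}
    (h0 : A 0 = ContinuousLinearMap.id ℝ E) (hA : HasDerivAt A M 0) :
    HasDerivAt (fun t => (A t).det) (LinearMap.trace ℝ E M) 0 := by
  set b := Module.finBasis ℝ E
  set ι := Fin (Module.finrank ℝ E)
  let D : (ι → ι → ℝ) → ℝ := fun m => (Matrix.of m).det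
  have hD : Differentiable ℝ D := by
    simp only [D, Matrix.det_apply, Matrix.of_apply]
    fun_prop
  let c : (E →L[ℝ] E) → ι → ι → ℝ := fun a i j => b.repr (a (b j)) i
  have hdet : ∀ a : E →L[ℝ] E, a.det = D (c a) := by
    intro a
    rw [ContinuousLinearMap.det, ← LinearMap.det_toMatrix b]
    simp only [D]
    congr 1
    ext i j
    simp [LinearMap.toMatrix_apply, c]
  have hc1 : c (ContinuousLinearMap.id ℝ E) = fun i j => (1 : Matrix ι ι ℝ) i j := by
    funext i j
    simp [c, Matrix.one_apply, Finsupp.single_apply, eq_comm]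
  have hline : HasDerivAt (fun r : ℝ => D (fun i j => (1 : Matrix ι ι ℝ) i j + r * c M i j))
      (LinearMap.trace ℝ E M) 0 := by
    have h1 : (fun r : ℝ => D (fun i j => (1 : Matrix ι ι ℝ) i j + r * c M i j)) = fun r =>
        1 + Matrix.trace (LinearMap.toMatrix b b (M : E →ₗ[ℝ] E)) * r +
        (Matrix.det (1 + (Polynomial.X : Polynomial ℝ) •
          (LinearMap.toMatrix b b (M : E →ₗ[ℝ] E)).map Polynomial.C)).divX.divX.eval r * r ^ 2 := by
      funext r
      rw [← Matrix.det_one_add_smul]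
      simp only [D]
      congr 1
      ext i j
      simp [LinearMap.toMatrix_apply, c]
    rw [h1, LinearMap.trace_eq_matrix_trace ℝ b]
    set p := (Matrix.det (1 + (Polynomial.X : Polynomial ℝ) •
          (LinearMap.toMatrix b b (M : E →ₗ[ℝ] E)).map Polynomial.C)).divX.divX
    set τ := Matrix.trace (LinearMap.toMatrix b b (M : E →ₗ[ℝ] E))
    have h2 := (((hasDerivAt_id (0 : ℝ)).const_mul τ).const_add 1).add
      ((p.hasDerivAt 0).mul (hasDerivAt_pow 2 (0 : ℝ)))
    refine (h2.congr_deriv (by simp)).congr_of_eventuallyEq (Filter.Eventually.of_forall fun r => ?_)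
    simp
  have hcA : HasDerivAt (fun t => c (A t)) (c M) 0 := by
    rw [hasDerivAt_pi]
    intro i
    rw [hasDerivAt_pi]
    intro j
    let ℓ : (E →L[ℝ] E) →L[ℝ] ℝ :=
      LinearMap.toContinuousLinearMap
        ((b.coord i).comp ((ContinuousLinearMap.apply ℝ E (b j) : (E →L[ℝ] E) →L[ℝ] E) :
          (E →L[ℝ] E) →ₗ[ℝ] E))
    exact ℓ.hasFDerivAt.comp_hasDerivAt 0 hA
  have hlin : HasDerivAt (fun r : ℝ => fun i j => (1 : Matrix ι ι ℝ) i j + r * c M i j) (c M) 0 := by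
    rw [hasDerivAt_pi]
    intro i
    rw [hasDerivAt_pi]
    intro j
    simpa using ((hasDerivAt_id (0 : ℝ)).mul_const (c M i j)).const_add ((1 : Matrix ι ι ℝ) i j)
  have hp : HasFDerivAt D (fderiv ℝ D (fun i j => (1 : Matrix ι ι ℝ) i j))
      (fun i j => (1 : Matrix ι ι ℝ) i j) := (hD _).hasFDerivAt
  have e1 : HasDerivAt (fun r : ℝ => D (fun i j => (1 : Matrix ι ι ℝ) i j + r * c M i j))
      (fderiv ℝ D (fun i j => (1 : Matrix ι ι ℝ) i j) (c M)) 0 :=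
    HasFDerivAt.comp_hasDerivAt (x := (0 : ℝ)) (l := D)
      (f := fun r : ℝ => fun i j => (1 : Matrix ι ι ℝ) i j + r * c M i j) (by simpa using hp) hlin
  have e2 : HasDerivAt (fun t => D (c (A t)))
      (fderiv ℝ D (fun i j => (1 : Matrix ι ι ℝ) i j) (c M)) 0 :=
    HasFDerivAt.comp_hasDerivAt (x := (0 : ℝ)) (l := D) (f := fun t => c (A t))
      (by rw [h0, hc1]; exact hp) hcA
  simp_rw [hdet]
  rw [← hline.unique e1] at e2
  exact e2

/-- Liouville's theorem: the flow of a divergence-free field has Jacobian one. -/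
theorem det_flow_eq_one [FiniteDimensional ℝ E] {W : E → E} {Φ : ℝ → E → E} {A : ℝ → E → E →L[ℝ] E}
    (h0 : ∀ z, Φ 0 z = z) (hgrp : ∀ s t z, Φ (s + t) z = Φ s (Φ t z))
    (hA : ∀ t z, HasFDerivAt (Φ t) (A t z) z) (hA0 : ∀ z, HasDerivAt (fun s => A s z) (fderiv ℝ W z) 0)
    (htr : ∀ z, LinearMap.trace ℝ E (fderiv ℝ W z : E →ₗ[ℝ] E) = 0) (t : ℝ) (z : E) :
    (A t z).det = 1 := by
  have hAz : ∀ z, A 0 z = ContinuousLinearMap.id ℝ E := fun z =>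
    (hA 0 z).unique ((hasFDerivAt_id z).congr_of_eventuallyEq (Filter.Eventually.of_forall h0))
  have hmul : ∀ s t z, (A (s + t) z).det = (A s (Φ t z)).det * (A t z).det := by
    intro s t z
    have h1 : HasFDerivAt (Φ (s + t)) ((A s (Φ t z)).comp (A t z)) z :=
      ((hA s (Φ t z)).comp z (hA t z)).congr_of_eventuallyEq
        (Filter.Eventually.of_forall fun y => hgrp s t y)
    rw [(hA (s + t) z).unique h1]
    exact LinearMap.det_comp _ _
  -- The group law makes the determinant multiplicative along a trajectory. The derivative at time t
  -- is therefore the derivative at time zero based at `Φ t z`, multiplied by the current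
  -- determinant, and the former is a trace, which vanishes.
  have hd : ∀ t, HasDerivAt (fun s => (A s z).det) 0 t := by
    intro t
    have h1 := hasDerivAt_det_of_eq_id (hAz (Φ t z)) (hA0 (Φ t z))
    rw [htr] at h1
    have h2 : HasDerivAt (fun s => (A (s - t) (Φ t z)).det) 0 t := by
      refine HasDerivAt.comp_sub_const (f := fun s => (A s (Φ t z)).det) t t ?_
      simpa using h1
    have h3 := h2.mul_const (A t z).det
    rw [zero_mul] at h3
    refine h3.congr_of_eventuallyEq (Filter.Eventually.of_forall fun s => ?_)
    show (A s z).det = (A (s - t) (Φ t z)).det * (A t z).det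
    rw [← hmul, sub_add_cancel]
  have := is_const_of_deriv_eq_zero (f := fun s => (A s z).det)
    (fun s => (hd s).differentiableAt) (fun s => (hd s).deriv) t 0
  simp only [hAz] at this
  rw [this]
  exact LinearMap.det_id

end Flow

/-! ### The volume-preserving flow of the field (v, F(x)). -/

section PhaseFlow

instance isAddHaarMeasure_volume_phase : (volume : Measure Phase).IsAddHaarMeasure :=
  Measure.prod.instIsAddHaarMeasure (volume : Measure R3) (volume : Measure R3)

/-- `Φ` is the flow of the phase space field `(v, F(x))`; it is of class `C¹` and preserves
volume. -/
structure IsPhaseFlow (F : R3 → R3) (Φ : ℝ → Phase → Phase) : Prop where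
  contDiff : ContDiff ℝ 1 (fun p : ℝ × Phase => Φ p.1 p.2)
  zero : ∀ z, Φ 0 z = z
  add : ∀ s t z, Φ (s + t) z = Φ s (Φ t z)
  hasDerivAt : ∀ t z, HasDerivAt (fun s => Φ s z) ((Φ t z).2, F (Φ t z).1) t
  det_fderiv : ∀ t z, (fderiv ℝ (Φ t) z).det = 1

theorem exists_isPhaseFlow {F : R3 → R3} (hF : ContDiff ℝ 1 F) (hFc : HasCompactSupport F) :
    ∃ Φ, IsPhaseFlow F Φ := by
  set W : Phase → Phase := fun z => (z.2, F z.1) with hW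
  have hWd : ContDiff ℝ 1 W := contDiff_snd.prodMk (hF.comp contDiff_fst)
  have hfd : ∀ z, fderiv ℝ W z = (ContinuousLinearMap.snd ℝ R3 R3).prod
      ((fderiv ℝ F z.1).comp (ContinuousLinearMap.fst ℝ R3 R3)) := fun z =>
    (HasFDerivAt.prodMk hasFDerivAt_snd
      (((hF.differentiable one_ne_zero) z.1).hasFDerivAt.comp z hasFDerivAt_fst)).fderiv
  obtain ⟨L, hL⟩ := (hFc.fderiv (𝕜 := ℝ)).exists_bound_of_continuous
    (hF.continuous_fderiv one_ne_zero)
  have hbound : ∀ z, ‖fderiv ℝ W z‖ ≤ max 1 L := by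
    intro z
    rw [hfd]
    refine (ContinuousLinearMap.opNorm_prod _ _).le.trans (max_le_max ?_ ?_)
    · exact ContinuousLinearMap.norm_snd_le _ _ _
    · refine (ContinuousLinearMap.opNorm_comp_le _ _).trans ?_
      have := mul_le_mul (hL z.1) (ContinuousLinearMap.norm_fst_le ℝ R3 R3) (norm_nonneg _)
        ((norm_nonneg _).trans (hL z.1))
      simpa using this
  obtain ⟨Φ, A, h1, h2, h3, h4, h5, h6⟩ := exists_contDiff_flow hWd hbound
  refine ⟨Φ, h1, h2, h3, h4, fun t z => ?_⟩
  rw [(h5 t z).fderiv]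
  refine det_flow_eq_one h2 h3 h5 h6 (fun z => ?_) t z
  rw [hfd]
  -- Neither block of the field depends on its own variable. The derivative is a sum of two maps,
  -- each factoring through one copy of ℝ³, and cyclicity of the trace turns them into `snd ∘ inl =
  -- 0` and a composition containing `fst ∘ inr = 0`.
  have hsum : (((ContinuousLinearMap.snd ℝ R3 R3).prod
      ((fderiv ℝ F z.1).comp (ContinuousLinearMap.fst ℝ R3 R3)) : Phase →L[ℝ] Phase) :
        Phase →ₗ[ℝ] Phase)
      = (LinearMap.inl ℝ R3 R3).comp (LinearMap.snd ℝ R3 R3)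
        + (LinearMap.inr ℝ R3 R3).comp
          ((fderiv ℝ F z.1 : R3 →ₗ[ℝ] R3).comp (LinearMap.fst ℝ R3 R3)) := by
    ext w <;> simp
  rw [hsum, map_add, LinearMap.trace_comp_comm' (LinearMap.snd ℝ R3 R3),
    LinearMap.trace_comp_comm' _ (LinearMap.inr ℝ R3 R3), LinearMap.comp_assoc,
    LinearMap.fst_comp_inr, LinearMap.snd_comp_inl]
  simp

/-- The equation sees the field only on the closure of Ω. Multiplying an extension by a bump equal
to 1 on a ball containing that closure gives a field with bounded derivative, hence a complete flow.
-/
theorem exists_compactlySupported_extension {Ω : Set R3} (hΩ : Bornology.IsBounded Ω)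
    {E : R3 → R3} (hE : IsC1OnClosure Ω E) :
    ∃ F : R3 → R3, ContDiff ℝ 1 F ∧ HasCompactSupport F ∧ EqOn E F (closure Ω) := by
  obtain ⟨F, hF, hEF⟩ := hE
  obtain ⟨r, hr⟩ := hΩ.closure.subset_closedBall (0 : R3)
  let b : ContDiffBump (0 : R3) := ⟨max r 1, max r 1 + 1, by positivity, by linarith⟩
  refine ⟨fun x => b x • F x, b.contDiff.smul hF, b.hasCompactSupport.smul_right, fun x hx => ?_⟩
  have : b x = 1 := b.one_of_mem_closedBall
    (Metric.closedBall_subset_closedBall (le_max_left r 1) (hr hx))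
  simp [this, hEF hx]

namespace IsPhaseFlow

variable {F : R3 → R3} {Φ : ℝ → Phase → Phase}

lemma neg_apply_apply (h : IsPhaseFlow F Φ) (t : ℝ) (z : Phase) : Φ (-t) (Φ t z) = z := by
  rw [← h.add, neg_add_cancel, h.zero]

lemma apply_neg_apply (h : IsPhaseFlow F Φ) (t : ℝ) (z : Phase) : Φ t (Φ (-t) z) = z := by
  rw [← h.add, add_neg_cancel, h.zero]

lemma continuous_uncurry (h : IsPhaseFlow F Φ) : Continuous fun p : ℝ × Phase => Φ p.1 p.2 := h.contDiff.continuous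

lemma contDiff_apply (h : IsPhaseFlow F Φ) (t : ℝ) : ContDiff ℝ 1 (Φ t) :=
  h.contDiff.comp (contDiff_const.prodMk contDiff_id)

lemma continuous_apply (h : IsPhaseFlow F Φ) (t : ℝ) : Continuous (Φ t) := (h.contDiff_apply t).continuous

lemma injective (h : IsPhaseFlow F Φ) (t : ℝ) : Function.Injective (Φ t) :=
  Function.LeftInverse.injective (h.neg_apply_apply t)

lemma image_eq_preimage (h : IsPhaseFlow F Φ) (t : ℝ) (s : Set Phase) : Φ t '' s = Φ (-t) ⁻¹' s := by
  ext z
  constructor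
  · rintro ⟨y, hy, rfl⟩
    simpa [h.neg_apply_apply] using hy
  · intro hz
    exact ⟨Φ (-t) z, hz, h.apply_neg_apply t z⟩

/-- A preimage under `Φ t` is an image under `Φ (-t)`, which is injective with Jacobian one, so the
change of variables formula applies. -/
lemma measurePreserving (h : IsPhaseFlow F Φ) (t : ℝ) : MeasurePreserving (Φ t) volume volume := by
  refine ⟨(h.continuous_apply t).measurable, ?_⟩
  ext s hs
  rw [Measure.map_apply (h.continuous_apply t).measurable hs]
  have h1 : Φ t ⁻¹' s = Φ (-t) '' s := by rw [h.image_eq_preimage, neg_neg]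
  rw [h1, ← lintegral_abs_det_fderiv_eq_addHaar_image volume hs
    (fun z _ => (((h.contDiff_apply (-t)).differentiable one_ne_zero) z).hasFDerivAt.hasFDerivWithinAt)
    ((h.injective (-t)).injOn)]
  simp [h.det_fderiv]

/-- The change of variables `(t, y) ↦ (t, Φ_t y)` preserves volume. -/
lemma measurePreserving_skew (h : IsPhaseFlow F Φ) :
    MeasurePreserving (fun p : ℝ × Phase => (p.1, Φ p.1 p.2)) volume volume :=
  MeasurePreserving.skew_product (MeasurePreserving.id volume)
    h.continuous_uncurry.measurable (Filter.Eventually.of_forall fun t => (h.measurePreserving t).map_eq)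

end IsPhaseFlow

end PhaseFlow

/-! ### Local defining functions, the outer normal and the surface measure. -/

section Boundary

open Filter

/-- In the open set `B` the domain `Ω` is the sublevel set `{ρ < 0}` of a `C¹` function without
critical points. -/
structure IsLocalDefining (Ω B : Set R3) (ρ : R3 → ℝ) : Prop where
  isOpen : IsOpen B
  contDiff : ContDiff ℝ 1 ρ
  gradient_ne_zero : ∀ y ∈ B, gradient ρ y ≠ 0
  mem_iff : ∀ y ∈ B, (y ∈ Ω ↔ ρ y < 0)

lemma inner_gradient (ρ : R3 → ℝ) (x y : R3) : inner ℝ (gradient ρ x) y = fderiv ℝ ρ x y := by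
  rw [← toDual_gradient, InnerProductSpace.toDual_apply_apply]

lemma continuous_gradient {ρ : R3 → ℝ} (h : ContDiff ℝ 1 ρ) : Continuous (gradient ρ) := by
  have : gradient ρ = fun x => (InnerProductSpace.toDual ℝ R3).symm (fderiv ℝ ρ x) := rfl
  rw [this]
  exact (InnerProductSpace.toDual ℝ R3).symm.continuous.comp (h.continuous_fderiv one_ne_zero)

lemma HasSmoothBoundary.exists_isLocalDefining {Ω : Set R3} (h : HasSmoothBoundary Ω) {x : R3}
    (hx : x ∈ frontier Ω) : ∃ ρ B, x ∈ B ∧ IsLocalDefining Ω B ρ := by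
  obtain ⟨ρ, hρ, hd, hev⟩ := h x hx
  have hρ1 : ContDiff ℝ 1 ρ := hρ.of_le (by exact_mod_cast le_top)
  have hne : gradient ρ x ≠ 0 := by
    intro h0
    apply hd
    rw [← toDual_gradient, h0, map_zero]
  have h2 : ∀ᶠ y in 𝓝 x, gradient ρ y ≠ 0 :=
    (continuous_gradient hρ1).continuousAt.eventually_ne hne
  obtain ⟨B, hB, hBo, hxB⟩ := eventually_nhds_iff.1 (hev.and h2)
  exact ⟨ρ, B, hxB, hBo, hρ1, fun y hy => (hB y hy).2, fun y hy => (hB y hy).1⟩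

lemma hasDerivAt_comp_line {ρ : R3 → ℝ} (h : ContDiff ℝ 1 ρ) (x e : R3) :
    HasDerivAt (fun s : ℝ => ρ (x + s • e)) (inner ℝ (gradient ρ x) e) 0 := by
  have h1 : HasDerivAt (fun s : ℝ => x + s • e) e 0 := by
    simpa using ((hasDerivAt_id (0 : ℝ)).smul_const e).const_add x
  rw [inner_gradient]
  have h2 : HasFDerivAt ρ (fderiv ℝ ρ x) (x + (0 : ℝ) • e) := by
    simpa using (h.differentiable one_ne_zero x).hasFDerivAt
  exact h2.comp_hasDerivAt (0 : ℝ) h1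

namespace IsLocalDefining

variable {Ω B : Set R3} {ρ : R3 → ℝ}

/-- The slope of ρ at 0 in the direction `e` is negative and ρ(x) = 0, so ρ is negative for small
positive steps. -/
lemma eventually_mem (h : IsLocalDefining Ω B ρ) {x e : R3} (hx : x ∈ B) (h0 : ρ x = 0)
    (he : inner ℝ (gradient ρ x) e < 0) : ∀ᶠ s : ℝ in 𝓝[>] 0, x + s • e ∈ Ω := by
  have hd := hasDerivAt_comp_line h.contDiff x e
  have h1 : ∀ᶠ s : ℝ in 𝓝[>] 0, ρ (x + s • e) < 0 := by
    have := hd.tendsto_slope_zero_right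
    simp only [zero_add, zero_smul, add_zero, h0, sub_zero] at this
    filter_upwards [this.eventually (gt_mem_nhds he), self_mem_nhdsWithin] with s hs hs0
    have hs0 : 0 < s := hs0
    rw [smul_eq_mul] at hs
    by_contra hcon
    exact absurd hs (not_lt.2 (mul_nonneg (inv_nonneg.2 hs0.le) (not_lt.1 hcon)))
  have h2 : ∀ᶠ s : ℝ in 𝓝[>] 0, x + s • e ∈ B := by
    have hc : ContinuousAt (fun s : ℝ => x + s • e) 0 := by fun_prop
    exact (hc.eventually_mem (by simpa using h.isOpen.mem_nhds hx)).filter_mono nhdsWithin_le_nhds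
  filter_upwards [h1, h2] with s hs1 hs2
  exact (h.mem_iff _ hs2).2 hs1

lemma mem_frontier_iff (h : IsLocalDefining Ω B ρ) (hΩ : IsOpen Ω) {x : R3} (hx : x ∈ B) :
    x ∈ frontier Ω ↔ ρ x = 0 := by
  rw [hΩ.frontier_eq, Set.mem_sdiff, h.mem_iff x hx, not_lt]
  constructor
  · rintro ⟨h1, h2⟩
    refine le_antisymm ?_ h2
    have : ∃ᶠ y in 𝓝 x, y ∈ Ω ∧ y ∈ B :=
      (mem_closure_iff_frequently.1 h1).and_eventually (h.isOpen.mem_nhds hx)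
    have h3 : ∃ᶠ y in 𝓝 x, ρ y ∈ Iic 0 := this.mono fun y hy => ((h.mem_iff y hy.2).1 hy.1).le
    exact isClosed_Iic.mem_of_frequently_of_tendsto h3 h.contDiff.continuous.continuousAt
  · intro h0
    refine ⟨?_, h0.ge⟩
    have he : inner ℝ (gradient ρ x) (-gradient ρ x) < 0 := by
      rw [inner_neg_right, neg_lt_zero, real_inner_self_pos]
      exact h.gradient_ne_zero x hx
    have h1 := h.eventually_mem hx h0 he
    have h2 : Tendsto (fun s : ℝ => x + s • (-gradient ρ x)) (𝓝[>] 0) (𝓝 x) := by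
      have hc : ContinuousAt (fun s : ℝ => x + s • (-gradient ρ x)) 0 := by fun_prop
      have := hc.tendsto.mono_left (nhdsWithin_le_nhds (s := Ioi (0 : ℝ)))
      simpa using this
    exact mem_closure_of_tendsto h2 h1

/-- Every direction with negative slope of ρ enters Ω, so an outer normal has nonpositive product
with it; this forces it to be the normalized gradient. Conversely, by convexity the open segment
from x to a point of Ω lies in Ω, so the slope of ρ along it is nonpositive. In particular the
normal selected by choice in `outerNormal` is the geometric one. -/
lemma isUnitOuterNormal_iff (h : IsLocalDefining Ω B ρ) (hΩ : IsOpen Ω) (hc : Convex ℝ Ω) {x ν : R3}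
    (hx : x ∈ B) (hxf : x ∈ frontier Ω) :
    IsUnitOuterNormal Ω x ν ↔ ν = ‖gradient ρ x‖⁻¹ • gradient ρ x := by
  have h0 := (h.mem_frontier_iff hΩ hx).1 hxf
  have hne := h.gradient_ne_zero x hx
  have hpos : 0 < ‖gradient ρ x‖ := norm_pos_iff.2 hne
  set a := gradient ρ x with ha
  set u := ‖a‖⁻¹ • a with hu
  have hu1 : ‖u‖ = 1 := by
    rw [hu, norm_smul, norm_inv, norm_norm, inv_mul_cancel₀ hpos.ne']
  have hau : ∀ e, inner ℝ a e = ‖a‖ * inner ℝ u e := by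
    intro e
    rw [hu, real_inner_smul_left, ← mul_assoc, mul_inv_cancel₀ hpos.ne', one_mul]
  constructor
  · rintro ⟨hν1, hν⟩
    have key : ∀ e, inner ℝ u e < 0 → inner ℝ ν e ≤ 0 := by
      intro e he
      have h1 := h.eventually_mem hx h0 (e := e) (by
        rw [← ha, hau]; exact mul_neg_of_pos_of_neg hpos he)
      obtain ⟨s, hs, hs0⟩ := (h1.and self_mem_nhdsWithin).exists
      have hs0 : 0 < s := hs0
      have := hν _ hs
      rw [add_sub_cancel_left, real_inner_smul_right] at this
      by_contra hcon
      exact absurd this (not_le.2 (mul_pos hs0 (not_le.1 hcon)))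
    set c : ℝ := inner ℝ u ν with hcdef
    have hc1 : c * c ≥ 1 := by
      -- The test direction ν - s u has slope proportional to c - s < 0, so ν · (ν - s u) = 1 - s c
      -- ≤ 0. Letting s decrease to c gives c² ≥ 1, and c = u · ν lies in [0, 1].
      have h2 : ∀ s, c < s → 1 ≤ s * c := by
        intro s hs
        have := key (ν - s • u) (by
          rw [inner_sub_right, real_inner_smul_right, real_inner_self_eq_norm_sq, hu1]
          simp only [one_pow, mul_one, sub_neg, ← hcdef]
          exact hs)
        rw [inner_sub_right, real_inner_smul_right, real_inner_self_eq_norm_sq, hν1,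
          real_inner_comm] at this
        linarith
      have ht : Tendsto (fun s => s * c) (𝓝[>] c) (𝓝 (c * c)) :=
        ((continuous_id.mul continuous_const).tendsto c).mono_left nhdsWithin_le_nhds
      refine ge_of_tendsto ht ?_
      · filter_upwards [self_mem_nhdsWithin] with s hs using h2 s hs
    have hcpos : 0 ≤ c := by
      have := key (-u) (by
        rw [inner_neg_right, real_inner_self_eq_norm_sq, hu1]; norm_num)
      rw [inner_neg_right, real_inner_comm] at this
      linarith
    have hcle : c ≤ 1 := by
      have := real_inner_le_norm u ν
      rw [hu1, hν1, one_mul] at this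
      exact this
    have hc2 : c = 1 := by nlinarith
    exact ((inner_eq_one_iff_of_norm_eq_one hu1 hν1).1 hc2).symm
  · rintro rfl
    refine ⟨hu1, fun y hy => ?_⟩
    have hd := hasDerivAt_comp_line h.contDiff x (y - x)
    have hev : ∀ᶠ s : ℝ in 𝓝[>] 0, ρ (x + s • (y - x)) ≤ 0 := by
      have hB : ∀ᶠ s : ℝ in 𝓝[>] 0, x + s • (y - x) ∈ B := by
        have hc : ContinuousAt (fun s : ℝ => x + s • (y - x)) 0 := by fun_prop
        exact (hc.eventually_mem
          (by simpa using h.isOpen.mem_nhds hx)).filter_mono nhdsWithin_le_nhds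
      have h1 : ∀ᶠ s : ℝ in 𝓝[>] 0, s ∈ Ioo (0 : ℝ) 1 := Ioo_mem_nhdsGT one_pos
      filter_upwards [hB, h1] with s hs1 hs2
      have hmem : x + s • (y - x) ∈ interior Ω := by
        apply hc.openSegment_closure_interior_subset_interior (frontier_subset_closure hxf)
          (hΩ.interior_eq.symm ▸ hy)
        rw [openSegment_eq_image']
        exact ⟨s, hs2, rfl⟩
      rw [hΩ.interior_eq] at hmem
      exact ((h.mem_iff _ hs1).1 hmem).le
    have hle : inner ℝ a (y - x) ≤ 0 := by
      have := hd.tendsto_slope_zero_right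
      simp only [zero_add, zero_smul, add_zero, h0, sub_zero] at this
      refine le_of_tendsto this ?_
      filter_upwards [hev, self_mem_nhdsWithin] with s hs hs0
      have hs0 : 0 < s := hs0
      exact mul_nonpos_of_nonneg_of_nonpos (inv_nonneg.2 hs0.le) hs
    rw [hau] at hle
    by_contra hcon
    exact absurd hle (not_le.2 (mul_pos hpos (not_le.1 hcon)))

lemma outerNormal_eq (h : IsLocalDefining Ω B ρ) (hΩ : IsOpen Ω) (hc : Convex ℝ Ω) {x : R3}
    (hx : x ∈ B) (hxf : x ∈ frontier Ω) :
    outerNormal Ω x = ‖gradient ρ x‖⁻¹ • gradient ρ x := by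
  have hex : x ∈ frontier Ω ∧ ∃ ν, IsUnitOuterNormal Ω x ν :=
    ⟨hxf, _, (h.isUnitOuterNormal_iff hΩ hc hx hxf).2 rfl⟩
  rw [outerNormal, dif_pos hex]
  exact (h.isUnitOuterNormal_iff hΩ hc hx hxf).1 hex.2.choose_spec

lemma inner_gradient_eq (h : IsLocalDefining Ω B ρ) (hΩ : IsOpen Ω) (hc : Convex ℝ Ω) {x : R3}
    (hx : x ∈ B) (hxf : x ∈ frontier Ω) (v : R3) :
    inner ℝ (gradient ρ x) v = ‖gradient ρ x‖ * inner ℝ (outerNormal Ω x) v := by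
  rw [h.outerNormal_eq hΩ hc hx hxf, real_inner_smul_left, ← mul_assoc,
    mul_inv_cancel₀ (norm_ne_zero_iff.2 (h.gradient_ne_zero x hx)), one_mul]

end IsLocalDefining

namespace IsSmoothConvexDomain

variable {Ω : Set R3}

lemma exists_isLocalDefining (h : IsSmoothConvexDomain Ω) {x : R3} (hx : x ∈ frontier Ω) :
    ∃ ρ B, x ∈ B ∧ IsLocalDefining Ω B ρ :=
  h.smooth_boundary.exists_isLocalDefining hx

lemma norm_outerNormal (h : IsSmoothConvexDomain Ω) {x : R3} (hx : x ∈ frontier Ω) :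
    ‖outerNormal Ω x‖ = 1 := by
  obtain ⟨ρ, B, hxB, hB⟩ := h.exists_isLocalDefining hx
  rw [hB.outerNormal_eq h.isOpen h.convex hxB hx, norm_smul, norm_inv, norm_norm,
    inv_mul_cancel₀ (norm_ne_zero_iff.2 (hB.gradient_ne_zero x hxB))]

lemma continuousOn_outerNormal (h : IsSmoothConvexDomain Ω) :
    ContinuousOn (outerNormal Ω) (frontier Ω) := by
  intro x hx
  obtain ⟨ρ, B, hxB, hB⟩ := h.exists_isLocalDefining hx
  have hc : ContinuousAt (fun y => ‖gradient ρ y‖⁻¹ • gradient ρ y) x := by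
    have := (continuous_gradient hB.contDiff).continuousAt (x := x)
    exact (this.norm.inv₀ (norm_ne_zero_iff.2 (hB.gradient_ne_zero x hxB))).smul this
  refine hc.continuousWithinAt.congr_of_eventuallyEq ?_
    (hB.outerNormal_eq h.isOpen h.convex hxB hx)
  filter_upwards [self_mem_nhdsWithin, mem_nhdsWithin_of_mem_nhds (hB.isOpen.mem_nhds hxB)]
    with y hy1 hy2
  exact hB.outerNormal_eq h.isOpen h.convex hy2 hy1

lemma measurable_outerNormal (h : IsSmoothConvexDomain Ω) : Measurable (outerNormal Ω) := by
  classical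
  have h1 : outerNormal Ω = (frontier Ω).piecewise (outerNormal Ω) (fun _ => 0) := by
    funext x
    by_cases hx : x ∈ frontier Ω
    · rw [piecewise_eq_of_mem _ _ _ hx]
    · rw [piecewise_eq_of_notMem _ _ _ hx, outerNormal, dif_neg fun hh => hx hh.1]
  rw [h1]
  exact h.continuousOn_outerNormal.measurable_piecewise continuousOn_const
    isClosed_frontier.measurableSet

lemma measurableSet_gammaPlus (h : IsSmoothConvexDomain Ω) : MeasurableSet (GammaPlus Ω) := by
  have h1 : Measurable fun z : Phase => inner ℝ (outerNormal Ω z.1) z.2 :=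
    (h.measurable_outerNormal.comp measurable_fst).inner measurable_snd
  exact (measurable_fst isClosed_frontier.measurableSet).inter (measurableSet_lt measurable_const h1)

/-- Near a boundary point, chords of the boundary are almost orthogonal to the normal. -/
lemma exists_abs_inner_sub_le (h : IsSmoothConvexDomain Ω) {x₀ : R3} (hx₀ : x₀ ∈ frontier Ω) {ε : ℝ}
    (hε : 0 < ε) : ∃ B, IsOpen B ∧ x₀ ∈ B ∧ ∀ x ∈ B ∩ frontier Ω, ∀ y ∈ B ∩ frontier Ω,
      |inner ℝ (outerNormal Ω x₀) (x - y)| ≤ ε * ‖x - y‖ := by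
  obtain ⟨ρ, B, hxB, hB⟩ := h.exists_isLocalDefining hx₀
  set a := gradient ρ x₀
  have hpos : 0 < ‖a‖ := norm_pos_iff.2 (hB.gradient_ne_zero x₀ hxB)
  -- Strict differentiability compares ρ at two varying points. As ρ vanishes at both, only the
  -- linear term is left, and it must be small relative to the chord.
  have hstrict : HasStrictFDerivAt ρ (fderiv ℝ ρ x₀) x₀ :=
    hB.contDiff.contDiffAt.hasStrictFDerivAt one_ne_zero
  have h1 := (hasStrictFDerivAt_iff_isLittleO.1 hstrict).def (mul_pos hε hpos)
  rw [nhds_prod_eq] at h1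
  obtain ⟨u, hu, hu2⟩ := Filter.eventually_prod_self_iff'.1 h1
  obtain ⟨O, hOu, hO, hxO⟩ := mem_nhds_iff.1 hu
  refine ⟨O ∩ B, hO.inter hB.isOpen, ⟨hxO, hxB⟩, fun x hx y hy => ?_⟩
  have h2 := hu2 x (hOu hx.1.1) y (hOu hy.1.1)
  simp only at h2
  rw [(hB.mem_frontier_iff h.isOpen hx.1.2).1 hx.2, (hB.mem_frontier_iff h.isOpen hy.1.2).1 hy.2,
    sub_zero, zero_sub, norm_neg, ← inner_gradient,
    hB.inner_gradient_eq h.isOpen h.convex hxB hx₀, norm_mul, norm_norm, Real.norm_eq_abs] at h2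
  have h3 : ‖a‖ * |inner ℝ (outerNormal Ω x₀) (x - y)| ≤ ‖a‖ * (ε * ‖x - y‖) := by
    calc _ ≤ ε * ‖a‖ * ‖x - y‖ := h2
      _ = _ := by ring
  exact le_of_mul_le_mul_left h3 hpos

end IsSmoothConvexDomain


/-- The plane through the origin orthogonal to `n`. -/
abbrev orthPlane (n : R3) : Submodule ℝ R3 := (Submodule.span ℝ {n})ᗮ

lemma euclideanHausdorffMeasure_orthPlane {n : R3} (hn : ‖n‖ = 1) :
    (μHE[2] : Measure (orthPlane n)) = volume := by
  have : Fact (Module.finrank ℝ R3 = 2 + 1) := ⟨by simp⟩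
  have h2 : Module.finrank ℝ (orthPlane n) = 2 :=
    Submodule.finrank_orthogonal_span_singleton (norm_ne_zero_iff.1 (by rw [hn]; exact one_ne_zero))
  have := InnerProductSpace.euclideanHausdorffMeasure_eq_volume (V := orthPlane n)
  rwa [h2] at this

lemma starProjection_orthPlane {n : R3} (hn : ‖n‖ = 1) (x : R3) :
    ((orthPlane n).orthogonalProjectionOnto x : R3) = x - inner ℝ n x • n := by
  rw [Submodule.coe_orthogonalProjectionOnto_apply, Submodule.starProjection_orthogonal_val,
    Submodule.starProjection_unit_singleton ℝ hn]

lemma norm_sq_eq_inner_sq_add {n : R3} (hn : ‖n‖ = 1) (x : R3) :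
    ‖x‖ ^ 2 = (inner ℝ n x) ^ 2 + ‖(orthPlane n).orthogonalProjectionOnto x‖ ^ 2 := by
  have h1 : ‖(orthPlane n).orthogonalProjectionOnto x‖ ^ 2 = ‖x - (inner ℝ n x : ℝ) • n‖ ^ 2 := by
    rw [← starProjection_orthPlane hn x]; rfl
  rw [h1, norm_sub_sq_real, real_inner_smul_right, norm_smul, hn, mul_one, Real.norm_eq_abs, sq_abs,
    real_inner_comm]
  ring

/-- Area of a piece of surface compared with the area of its projection to a plane that is almost
tangent to it. -/
lemma euclideanHausdorffMeasure_projection {n : R3} (hn : ‖n‖ = 1) {A : Set R3} {ε : ℝ}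
    (hε0 : 0 ≤ ε) (hε : ε < 1)
    (hA : ∀ x ∈ A, ∀ y ∈ A, |inner ℝ n (x - y)| ≤ ε * ‖x - y‖) :
    volume ((orthPlane n).orthogonalProjectionOnto '' A) ≤ μHE[2] A ∧
    μHE[2] A ≤ ENNReal.ofReal ((1 - ε ^ 2)⁻¹) *
      volume ((orthPlane n).orthogonalProjectionOnto '' A) := by
  have hpos : 0 < 1 - ε ^ 2 := by nlinarith
  set π := (orthPlane n).orthogonalProjectionOnto
  -- By Pythagoras a chord of slope at most ε is shortened by the projection by at most the factor
  -- √(1 - ε²). The projection is thus injective on `A` with a Lipschitz inverse, and the square of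
  -- that Lipschitz constant enters the two-dimensional measure.
  have hanti : ∀ x ∈ A, ∀ y ∈ A, ‖x - y‖ ≤ √((1 - ε ^ 2)⁻¹) * ‖π x - π y‖ := by
    intro x hx y hy
    rw [← map_sub]
    have h1 := norm_sq_eq_inner_sq_add hn (x - y)
    have h2 : (inner ℝ n (x - y)) ^ 2 ≤ (ε * ‖x - y‖) ^ 2 := by
      rw [← sq_abs]
      exact pow_le_pow_left₀ (abs_nonneg _) (hA x hx y hy) 2
    refine le_of_sq_le_sq ?_ (by positivity)
    rw [mul_pow, Real.sq_sqrt (by positivity), inv_mul_eq_div, le_div_iff₀ hpos]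
    nlinarith
  set g := Function.invFunOn π A
  have hg : ∀ p ∈ π '' A, g p ∈ A ∧ π (g p) = p := fun p hp =>
    ⟨Function.invFunOn_mem hp, Function.invFunOn_eq hp⟩
  have hgA : g '' (π '' A) = A := by
    apply subset_antisymm
    · rintro _ ⟨p, hp, rfl⟩
      exact (hg p hp).1
    · intro x hx
      refine ⟨π x, mem_image_of_mem _ hx, ?_⟩
      have h1 := hg (π x) (mem_image_of_mem _ hx)
      have h2 := hanti _ h1.1 x hx
      rw [h1.2, sub_self, norm_zero, mul_zero] at h2
      exact sub_eq_zero.1 (norm_le_zero_iff.1 h2)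
  have hlip : LipschitzOnWith (√((1 - ε ^ 2)⁻¹)).toNNReal g (π '' A) := by
    refine LipschitzOnWith.of_dist_le_mul fun p hp r hr => ?_
    rw [Real.coe_toNNReal _ (Real.sqrt_nonneg _), dist_eq_norm, dist_eq_norm]
    have := hanti _ (hg p hp).1 _ (hg r hr).1
    rwa [(hg p hp).2, (hg r hr).2] at this
  have hd : (0 : ℝ) ≤ (2 : ℕ) := by norm_num
  constructor
  · rw [← euclideanHausdorffMeasure_orthPlane hn, Measure.euclideanHausdorffMeasure_def,
      Measure.euclideanHausdorffMeasure_def, Measure.smul_apply, Measure.smul_apply]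
    gcongr
    have := (orthPlane n).lipschitzWith_orthogonalProjectionOnto.hausdorffMeasure_image_le hd A
    simpa using this
  · have h1 := hlip.hausdorffMeasure_image_le hd
    rw [hgA] at h1
    rw [← euclideanHausdorffMeasure_orthPlane hn, Measure.euclideanHausdorffMeasure_def,
      Measure.euclideanHausdorffMeasure_def, Measure.smul_apply, Measure.smul_apply, mul_smul_comm]
    gcongr
    refine h1.trans (le_of_eq ?_)
    congr 1
    rw [Nat.cast_ofNat, ENNReal.rpow_ofNat]
    change (ENNReal.ofReal _) ^ 2 = _
    rw [← ENNReal.ofReal_pow (Real.sqrt_nonneg _), Real.sq_sqrt (by positivity)]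

/-- By compactness it is enough to look near one point. There the boundary is almost flat, and its
area is at most a constant times that of its bounded planar projection. -/
lemma IsSmoothConvexDomain.euclideanHausdorffMeasure_frontier_lt_top {Ω : Set R3}
    (h : IsSmoothConvexDomain Ω) : μHE[2] (frontier Ω) < ∞ := by
  have hcomp : IsCompact (frontier Ω) :=
    Metric.isCompact_of_isClosed_isBounded isClosed_frontier
      (h.bounded.closure.subset frontier_subset_closure)
  refine hcomp.measure_lt_top_of_nhdsWithin fun x hx => ?_
  obtain ⟨B, hBo, hxB, hB⟩ := h.exists_abs_inner_sub_le hx (ε := 1 / 2) (by norm_num)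
  refine ⟨B ∩ frontier Ω, inter_mem (mem_nhdsWithin_of_mem_nhds (hBo.mem_nhds hxB))
    self_mem_nhdsWithin, ?_⟩
  refine (euclideanHausdorffMeasure_projection (h.norm_outerNormal hx) (by norm_num) (by norm_num)
    hB).2.trans_lt (ENNReal.mul_lt_top ENNReal.ofReal_lt_top ?_)
  have hb : Bornology.IsBounded (B ∩ frontier Ω) := hcomp.isBounded.subset inter_subset_right
  exact (((orthPlane (outerNormal Ω x)).lipschitzWith_orthogonalProjectionOnto).isBounded_image
    hb).measure_lt_top

end Boundary

/-! ### Boundary charts over the tangent plane and their Jacobians. -/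

section Chart

open Filter

/-- The linear map `x ↦ x + ⟨b, x⟩ n`. -/
def rankOneUpdate (b n : R3) : R3 →L[ℝ] R3 :=
  ContinuousLinearMap.id ℝ R3 + (innerSL ℝ b).smulRight n

lemma rankOneUpdate_apply (b n x : R3) : rankOneUpdate b n x = x + inner ℝ b x • n := by
  simp [rankOneUpdate]

lemma det_rankOneUpdate (b n : R3) : (rankOneUpdate b n).det = 1 + inner ℝ b n := by
  have : (rankOneUpdate b n : R3 →ₗ[ℝ] R3)
      = LinearMap.transvection ((innerSL ℝ b : R3 →L[ℝ] ℝ) : R3 →ₗ[ℝ] ℝ) n := by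
    ext x
    simp [rankOneUpdate_apply, LinearMap.transvection]
  rw [ContinuousLinearMap.det, this, LinearMap.transvection.det]
  simp

lemma exists_rankOneUpdate_equiv {b n : R3} (h : 1 + inner ℝ b n ≠ 0) :
    ∃ e : R3 ≃L[ℝ] R3, (e : R3 →L[ℝ] R3) = rankOneUpdate b n :=
  ⟨ContinuousLinearMap.toContinuousLinearEquivOfDetNeZero (rankOneUpdate b n)
    (by rwa [det_rankOneUpdate]), by ext x; simp⟩

/-- The map H(x) = x + (ρ(x) - n · x) n replaces the coordinate along n by ρ and keeps the
tangential ones, so it flattens ∂Ω to the plane through the origin orthogonal to n. The chart `g` is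
its local inverse, set to zero off the target so as to be measurable everywhere. The derivative of H
is `rankOneUpdate (∇ρ - n) n`, and ∇ρ = c ν with c = |∇ρ|. The numbers `k` and `ε` bound the tilt of
the normal and the slope of chords; both may be taken as sharp as desired at the price of a smaller
patch. -/
lemma IsSmoothConvexDomain.exists_boundary_chart {Ω : Set R3} (hΩ : IsSmoothConvexDomain Ω)
    {x₀ : R3} (hx₀ : x₀ ∈ frontier Ω) {n : R3} (hn : n = outerNormal Ω x₀) {k ε : ℝ} (hk : k < 1)
    (hε : 0 < ε) :
    ∃ (S D : Set R3) (g : R3 → R3), IsOpen S ∧ x₀ ∈ S ∧ IsOpen D ∧ Measurable g ∧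
      (∀ x ∈ S, x ∈ frontier Ω → x - inner ℝ n x • n ∈ D ∧ g (x - inner ℝ n x • n) = x) ∧
      (∀ ξ ∈ D, inner ℝ n ξ = 0 → g ξ ∈ S ∧ g ξ ∈ frontier Ω ∧
        g ξ - inner ℝ n (g ξ) • n = ξ ∧ ∃ (G : R3 →L[ℝ] R3) (c : ℝ), HasFDerivAt g G ξ ∧ 0 < c ∧
          ∀ e, rankOneUpdate (c • outerNormal Ω (g ξ) - n) n (G e) = e) ∧
      (∀ x ∈ S, x ∈ frontier Ω → k < inner ℝ (outerNormal Ω x) n) ∧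
      ∀ x ∈ S, x ∈ frontier Ω → ∀ y ∈ S, y ∈ frontier Ω → |inner ℝ n (x - y)| ≤ ε * ‖x - y‖ := by
  obtain ⟨ρ, B, hxB, hB⟩ := hΩ.exists_isLocalDefining hx₀
  obtain ⟨B₁, hB₁o, hxB₁, hB₁⟩ := hΩ.exists_abs_inner_sub_le hx₀ hε
  have hn1 : ‖n‖ = 1 := by rw [hn]; exact hΩ.norm_outerNormal hx₀
  have hcg := continuous_gradient hB.contDiff
  -- The maximum with 0 makes ∇ρ · n positive even for negative `k`. This number is the determinant
  -- of the derivative of H.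
  set B₂ : Set R3 := {x | max k 0 * ‖gradient ρ x‖ < inner ℝ (gradient ρ x) n} with hB₂
  have hB₂o : IsOpen B₂ := isOpen_lt (by fun_prop) (by fun_prop)
  have hxB₂ : x₀ ∈ B₂ := by
    have h1 : inner ℝ (gradient ρ x₀) n = ‖gradient ρ x₀‖ := by
      rw [hB.inner_gradient_eq hΩ.isOpen hΩ.convex hxB hx₀, ← hn, real_inner_self_eq_norm_sq, hn1]
      simp
    change max k 0 * _ < _
    rw [h1]
    have := norm_pos_iff.2 (hB.gradient_ne_zero x₀ hxB)
    have h2 : max k 0 < 1 := max_lt hk one_pos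
    nlinarith
  have hinv : ∀ x ∈ B₂, 1 + inner ℝ (gradient ρ x - n) n ≠ 0 := by
    intro x hx
    rw [inner_sub_left, real_inner_self_eq_norm_sq, hn1]
    have : max k 0 * ‖gradient ρ x‖ < inner ℝ (gradient ρ x) n := hx
    have h2 : 0 ≤ max k 0 * ‖gradient ρ x‖ := mul_nonneg (le_max_right _ _) (norm_nonneg _)
    intro h3
    linarith
  let H : R3 → R3 := fun x => x + (ρ x - inner ℝ n x) • n
  have hH : ∀ x, HasStrictFDerivAt H (rankOneUpdate (gradient ρ x - n) n) x := by
    intro x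
    have h1 : HasStrictFDerivAt ρ (fderiv ℝ ρ x) x :=
      hB.contDiff.contDiffAt.hasStrictFDerivAt one_ne_zero
    have h2 : HasStrictFDerivAt (fun x : R3 => (inner ℝ n x : ℝ)) (innerSL ℝ n) x :=
      (innerSL ℝ n).hasStrictFDerivAt
    have h3 := (hasStrictFDerivAt_id x).add ((h1.sub h2).smul_const n)
    refine h3.congr_fderiv ?_
    ext1 y
    simp [rankOneUpdate_apply, inner_sub_left]
  have hHn : ∀ x, inner ℝ n (H x) = ρ x := by
    intro x
    simp only [H]
    rw [inner_add_right, real_inner_smul_right, real_inner_self_eq_norm_sq, hn1]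
    ring
  obtain ⟨f', hf'⟩ := exists_rankOneUpdate_equiv (hinv x₀ hxB₂)
  have hs : HasStrictFDerivAt H (f' : R3 →L[ℝ] R3) x₀ := by rw [hf']; exact hH x₀
  set O := B ∩ B₁ ∩ B₂ with hO
  have hOo : IsOpen O := (hB.isOpen.inter hB₁o).inter hB₂o
  set e := (hs.toOpenPartialHomeomorph H).restrOpen O hOo with he
  have hcoe : ∀ x, e x = H x := fun x => rfl
  have hsrc : ∀ x ∈ e.source, x ∈ O := fun x hx => hx.2
  classical
  set g : R3 → R3 := e.target.piecewise e.symm (fun _ => 0) with hg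
  have hgD : ∀ ξ ∈ e.target, g ξ = e.symm ξ := fun ξ hξ => piecewise_eq_of_mem _ _ _ hξ
  refine ⟨e.source, e.target, g, e.open_source,
    ⟨hs.mem_toOpenPartialHomeomorph_source, ⟨⟨hxB, hxB₁⟩, hxB₂⟩⟩, e.open_target,
    e.continuousOn_symm.measurable_piecewise continuousOn_const e.open_target.measurableSet,
    ?_, ?_, ?_, ?_⟩
  · intro x hx hxf
    have h0 : ρ x = 0 := (hB.mem_frontier_iff hΩ.isOpen (hsrc x hx).1.1).1 hxf
    have h1 : x - inner ℝ n x • n = e x := by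
      rw [hcoe]; simp [H, h0, sub_eq_add_neg]
    rw [h1]
    exact ⟨e.map_source hx, by rw [hgD _ (e.map_source hx), e.left_inv hx]⟩
  · intro ξ hξ hnξ
    have hxs : g ξ ∈ e.source := by rw [hgD ξ hξ]; exact e.map_target hξ
    have hHg : H (g ξ) = ξ := by rw [hgD ξ hξ]; exact e.right_inv hξ
    have h0 : ρ (g ξ) = 0 := by rw [← hHn, hHg, hnξ]
    have hxf : g ξ ∈ frontier Ω := (hB.mem_frontier_iff hΩ.isOpen (hsrc _ hxs).1.1).2 h0
    refine ⟨hxs, hxf, ?_, ?_⟩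
    · conv_rhs => rw [← hHg]
      simp [H, h0, sub_eq_add_neg]
    · obtain ⟨f₁, hf₁⟩ := exists_rankOneUpdate_equiv (hinv _ (hsrc _ hxs).2)
      have hd : HasFDerivAt e.symm (f₁.symm : R3 →L[ℝ] R3) ξ := by
        refine e.hasFDerivAt_symm hξ ?_
        rw [← hgD ξ hξ, hf₁]
        exact (hH _).hasFDerivAt
      refine ⟨f₁.symm, ‖gradient ρ (g ξ)‖, ?_,
        norm_pos_iff.2 (hB.gradient_ne_zero _ (hsrc _ hxs).1.1), fun w => ?_⟩
      · refine hd.congr_of_eventuallyEq ?_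
        filter_upwards [e.open_target.mem_nhds hξ] with y hy using hgD y hy
      · have h1 : ‖gradient ρ (g ξ)‖ • outerNormal Ω (g ξ) = gradient ρ (g ξ) := by
          rw [hB.outerNormal_eq hΩ.isOpen hΩ.convex (hsrc _ hxs).1.1 hxf, smul_smul,
            mul_inv_cancel₀ (norm_ne_zero_iff.2 (hB.gradient_ne_zero _ (hsrc _ hxs).1.1)), one_smul]
        rw [h1, ← hf₁]
        exact f₁.apply_symm_apply w
  · intro x hx hxf
    have h1 : max k 0 * ‖gradient ρ x‖ < inner ℝ (gradient ρ x) n := (hsrc x hx).2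
    rw [hB.inner_gradient_eq hΩ.isOpen hΩ.convex (hsrc x hx).1.1 hxf, mul_comm] at h1
    exact (le_max_left k 0).trans_lt (lt_of_mul_lt_mul_left h1 (norm_nonneg _))
  · intro x hx hxf y hy hyf
    have := hB₁ x ⟨(hsrc x hx).1.2, hxf⟩ y ⟨(hsrc y hy).1.2, hyf⟩
    rwa [← hn] at this

/-- Jacobian of `(s, ξ', v) ↦ (g ξ' - s v, v - s w)` in the coordinates of a boundary chart. -/
lemma abs_det_exit_linear {n m v w : R3} (hn : ‖n‖ = 1) {G : R3 →L[ℝ] R3} {c : ℝ}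
    (hc : 0 < c) (hmn : 0 < inner ℝ m n)
    (hG : ∀ e, rankOneUpdate (c • m - n) n (G e) = e) (M : Phase →L[ℝ] Phase)
    (hM : ∀ q : Phase, M q = (G (q.1 - inner ℝ n q.1 • n) - inner ℝ n q.1 • v,
      q.2 - inner ℝ n q.1 • w)) :
    |M.det| = |inner ℝ m v| / inner ℝ m n := by
  set L : R3 →ₗ[ℝ] R3 := (G : R3 →ₗ[ℝ] R3) ∘ₗ (rankOneUpdate (-n) n : R3 →ₗ[ℝ] R3)
    - ((innerSL ℝ n).smulRight v : R3 →L[ℝ] R3) with hLdef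
  have hL : ∀ e, L e = G (e - inner ℝ n e • n) - inner ℝ n e • v := by
    intro e
    simp [hLdef, rankOneUpdate_apply, sub_eq_add_neg]
  -- The velocity component differs from the identity only by a shear, which has determinant one, so
  -- the determinant is that of the position block `L`.
  have hfac : (M : Phase →ₗ[ℝ] Phase) = (L.prodMap LinearMap.id) ∘ₗ
      LinearMap.transvection (((innerSL ℝ n : R3 →L[ℝ] ℝ) : R3 →ₗ[ℝ] ℝ) ∘ₗ LinearMap.fst ℝ R3 R3)
        ((0, -w) : Phase) := by
    refine LinearMap.ext fun q => ?_
    rw [LinearMap.comp_apply, ContinuousLinearMap.coe_coe, hM q, LinearMap.prodMap_apply, hL]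
    simp [LinearMap.transvection, sub_eq_add_neg]
  -- Composing `L` with the inverse of `G` gives another rank-one update of the identity. The two
  -- explicit determinants are c (m · n) and -c (m · v), and the unknown scale c cancels.
  have hcomp : (rankOneUpdate (c • m - n) n : R3 →ₗ[ℝ] R3) ∘ₗ L
      = (rankOneUpdate n (-n - rankOneUpdate (c • m - n) n v) : R3 →ₗ[ℝ] R3) := by
    refine LinearMap.ext fun e => ?_
    rw [LinearMap.comp_apply, hL, ContinuousLinearMap.coe_coe, map_sub, hG, map_smul,
      ContinuousLinearMap.coe_coe, rankOneUpdate_apply n]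
    simp only [smul_sub, smul_neg]
    abel
  have hdet := congrArg LinearMap.det hcomp
  rw [LinearMap.det_comp] at hdet
  change (rankOneUpdate (c • m - n) n).det * _ = (rankOneUpdate n _).det at hdet
  rw [det_rankOneUpdate, det_rankOneUpdate, rankOneUpdate_apply] at hdet
  have hnn : (inner ℝ n n : ℝ) = 1 := by rw [real_inner_self_eq_norm_sq, hn]; norm_num
  simp only [inner_sub_left, inner_sub_right, inner_add_right, inner_neg_right, hnn,
    real_inner_smul_left, real_inner_smul_right] at hdet
  have hdL : LinearMap.det L = -(inner ℝ m v / inner ℝ m n) := by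
    have h1 : c * inner ℝ m n * LinearMap.det L = c * inner ℝ m n * -(inner ℝ m v / inner ℝ m n) := by
      have h2 : inner ℝ m n * (inner ℝ m v / inner ℝ m n) = inner ℝ m v := by
        field_simp
      calc _ = -(c * inner ℝ m v) := by linear_combination hdet
        _ = _ := by rw [mul_neg, mul_assoc, h2]
    exact mul_left_cancel₀ (by positivity) h1
  rw [ContinuousLinearMap.det, hfac, LinearMap.det_comp, LinearMap.transvection.det,
    LinearMap.det_prodMap, hdL, LinearMap.det_id]
  simp [abs_div, abs_of_pos hmn]

end Chart

/-! ### Flux through a small piece of Γ₊ against the volume swept out backwards. -/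

section ExitPatch

open Filter

variable {Ω : Set R3} {F : R3 → R3} {Φ : ℝ → Phase → Phase}

/-- Trajectories leave `closure Ω` through `Γ₊`, uniformly near each point of `Γ₊`. -/
lemma IsPhaseFlow.exists_notMem_closure_after_exit (hΦ : IsPhaseFlow F Φ)
    (hΩ : IsSmoothConvexDomain Ω) {z₀ : Phase} (hz₀ : z₀ ∈ GammaPlus Ω) :
    ∃ O : Set Phase, IsOpen O ∧ z₀ ∈ O ∧ ∃ δ : ℝ, 0 < δ ∧ ∀ z ∈ O, z ∈ GammaPlus Ω →
      ∀ s ∈ Ioo 0 δ, (Φ s z).1 ∉ closure Ω := by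
  obtain ⟨ρ, B, hxB, hB⟩ := hΩ.exists_isLocalDefining hz₀.1
  have hcg := continuous_gradient hB.contDiff
  have hΦc := hΦ.continuous_uncurry
  set R : Set (ℝ × Phase) := {p | (Φ p.1 p.2).1 ∈ B ∧
    0 < inner ℝ (gradient ρ (Φ p.1 p.2).1) (Φ p.1 p.2).2} with hR
  have hRo : IsOpen R := by
    have h2 : IsOpen {p : ℝ × Phase | 0 < inner ℝ (gradient ρ (Φ p.1 p.2).1) (Φ p.1 p.2).2} :=
      isOpen_lt continuous_const
        ((hcg.comp (continuous_fst.comp hΦc)).inner (continuous_snd.comp hΦc))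
    exact (hB.isOpen.preimage (continuous_fst.comp hΦc)).inter h2
  have hmem : ((0 : ℝ), z₀) ∈ R := by
    refine ⟨by simpa [hΦ.zero] using hxB, ?_⟩
    simp only [hΦ.zero]
    rw [hB.inner_gradient_eq hΩ.isOpen hΩ.convex hxB hz₀.1]
    exact mul_pos (norm_pos_iff.2 (hB.gradient_ne_zero _ hxB)) hz₀.2
  obtain ⟨u, hu, O, hO, huO⟩ := mem_nhds_prod_iff.1 (hRo.mem_nhds hmem)
  obtain ⟨δ, hδ, hδu⟩ := Metric.mem_nhds_iff.1 hu
  obtain ⟨O', hO'O, hO'o, hz⟩ := mem_nhds_iff.1 hO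
  refine ⟨O', hO'o, hz, δ, hδ, fun z hzO hzΓ s hs => ?_⟩
  have hin : ∀ r ∈ Icc 0 s, (r, z) ∈ R := by
    intro r hr
    refine huO ⟨hδu ?_, hO'O hzO⟩
    rw [Metric.mem_ball, dist_zero_right, Real.norm_eq_abs, abs_of_nonneg hr.1]
    exact hr.2.trans_lt hs.2
  have hd : ∀ r, HasDerivAt (fun r => ρ (Φ r z).1)
      (inner ℝ (gradient ρ (Φ r z).1) (Φ r z).2) r := by
    intro r
    rw [inner_gradient]
    have h1 : HasDerivAt (fun r => (Φ r z).1) (Φ r z).2 r := (hΦ.hasDerivAt r z).fst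
    exact ((hB.contDiff.differentiable one_ne_zero) _).hasFDerivAt.comp_hasDerivAt r h1
  -- As long as ∇ρ · v > 0, the function ρ increases along the trajectory from its boundary value 0.
  -- So ρ > 0 afterwards, which excludes both Ω and its boundary.
  have hmono : StrictMonoOn (fun r => ρ (Φ r z).1) (Icc 0 s) := by
    refine strictMonoOn_of_deriv_pos (convex_Icc 0 s)
      (fun r _ => (hd r).continuousAt.continuousWithinAt) fun r hr => ?_
    rw [(hd r).deriv]
    rw [interior_Icc] at hr
    exact (hin r (Ioo_subset_Icc_self hr)).2
  have hlt := hmono (left_mem_Icc.2 hs.1.le) (right_mem_Icc.2 hs.1.le) hs.1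
  have h0B : z.1 ∈ B := by simpa [hΦ.zero] using (hin 0 (left_mem_Icc.2 hs.1.le)).1
  have hsB : (Φ s z).1 ∈ B := (hin s (right_mem_Icc.2 hs.1.le)).1
  simp only [hΦ.zero, (hB.mem_frontier_iff hΩ.isOpen h0B).1 hzΓ.1] at hlt
  intro hcl
  rw [closure_eq_self_union_frontier] at hcl
  rcases hcl with h1 | h1
  · exact lt_asymm hlt ((hB.mem_iff _ hsB).1 h1)
  · exact hlt.ne' ((hB.mem_frontier_iff hΩ.isOpen hsB).1 h1)

/-- Only time zero is needed: there the spatial derivative is the identity and the time derivative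
is the field. Other times are reached by composing with a fixed flow map. -/
lemma IsPhaseFlow.hasFDerivAt_uncurry_zero (hΦ : IsPhaseFlow F Φ) (z : Phase) :
    HasFDerivAt (fun p : ℝ × Phase => Φ p.1 p.2)
      ((ContinuousLinearMap.fst ℝ ℝ Phase).smulRight ((z.2, F z.1) : Phase)
        + ContinuousLinearMap.snd ℝ ℝ Phase) (0, z) := by
  have h1 := ((hΦ.contDiff.differentiable one_ne_zero) (0, z)).hasFDerivAt
  have h2 : HasDerivAt (fun s : ℝ => Φ s z)
      (fderiv ℝ (fun p : ℝ × Phase => Φ p.1 p.2) (0, z) (1, 0)) 0 :=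
    HasFDerivAt.comp_hasDerivAt (f := fun s : ℝ => (s, z)) (0 : ℝ) h1
      ((hasDerivAt_id (0 : ℝ)).prodMk (hasDerivAt_const (0 : ℝ) z))
  have h3 : HasFDerivAt (fun y : Phase => Φ 0 y)
      ((fderiv ℝ (fun p : ℝ × Phase => Φ p.1 p.2) (0, z)).comp
        ((0 : Phase →L[ℝ] ℝ).prod (ContinuousLinearMap.id ℝ Phase))) z :=
    h1.comp z ((hasFDerivAt_const (0 : ℝ) z).prodMk (hasFDerivAt_id z))
  have h4 : HasFDerivAt (fun y : Phase => Φ 0 y) (ContinuousLinearMap.id ℝ Phase) z :=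
    (hasFDerivAt_id z).congr_of_eventuallyEq (Eventually.of_forall hΦ.zero)
  have e1 := (hΦ.hasDerivAt 0 z).unique h2
  have e2 := h4.unique h3
  rw [hΦ.zero] at e1
  refine h1.congr_fderiv ?_
  refine ContinuousLinearMap.ext fun p => ?_
  have hp : p = p.1 • ((1, 0) : ℝ × Phase) + (0, p.2) := by
    ext <;> simp
  have e3 := congrArg (fun A : Phase →L[ℝ] Phase => A p.2) e2
  simp only [ContinuousLinearMap.id_apply, ContinuousLinearMap.comp_apply,
    ContinuousLinearMap.prod_apply, zero_apply] at e3
  conv_lhs => rw [hp]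
  rw [map_add, map_smul, ← e1, ← e3]
  simp

lemma measurePreserving_orthPlane_decomposition {n : R3} (hn : ‖n‖ = 1) :
    MeasurePreserving (fun p : ℝ × orthPlane n => p.1 • n + (p.2 : R3)) volume volume := by
  have h1 := ((Submodule.span ℝ {n}).measurePreserving_measurableEquivProd (0 : R3)).symm
  rw [InnerProductSpace.euclideanHausdorffMeasure_eq_volume] at h1
  have h2 : MeasurePreserving (LinearIsometryEquiv.toSpanUnitSingleton (𝕜 := ℝ) n hn) :=
    LinearIsometryEquiv.measurePreserving _
  have h3 := h1.comp (h2.prod (MeasurePreserving.id (volume : Measure (orthPlane n))))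
  convert! h3 using 1
  funext p
  simp

/-- The measure `dt dσ` on `ℝ × Γ₊`. -/
def exitFlux (Ω : Set R3) : Measure (ℝ × Phase) :=
  (volume : Measure ℝ).prod ((boundaryMeasure Ω).restrict (GammaPlus Ω))

lemma IsSmoothConvexDomain.isFiniteMeasure_surface (hΩ : IsSmoothConvexDomain Ω) :
    IsFiniteMeasure ((μHE[2] : Measure R3).restrict (frontier Ω)) :=
  ⟨by rw [Measure.restrict_apply_univ]; exact hΩ.euclideanHausdorffMeasure_frontier_lt_top⟩

lemma IsSmoothConvexDomain.measurable_flux (hΩ : IsSmoothConvexDomain Ω) :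
    Measurable fun z : Phase => ENNReal.ofReal |inner ℝ (outerNormal Ω z.1) z.2| := by
  have h1 : Measurable fun z : Phase => (inner ℝ (outerNormal Ω z.1) z.2 : ℝ) :=
    (hΩ.measurable_outerNormal.comp measurable_fst).inner measurable_snd
  exact (continuous_abs.measurable.comp h1).ennreal_ofReal

lemma IsSmoothConvexDomain.exitFlux_apply (hΩ : IsSmoothConvexDomain Ω) {C : Set (ℝ × Phase)}
    (hC : MeasurableSet C) (hCΓ : C ⊆ univ ×ˢ GammaPlus Ω) :
    exitFlux Ω C = ∫⁻ p in C, ENNReal.ofReal |inner ℝ (outerNormal Ω p.2.1) p.2.2|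
      ∂((volume : Measure ℝ).prod
        (((μHE[2] : Measure R3).restrict (frontier Ω)).prod (volume : Measure R3))) := by
  have := hΩ.isFiniteMeasure_surface
  rw [exitFlux, boundaryMeasure, restrict_withDensity hΩ.measurableSet_gammaPlus,
    prod_withDensity_right hΩ.measurable_flux, withDensity_apply _ hC]
  have h1 : (volume : Measure ℝ).prod
      ((((μHE[2] : Measure R3).restrict (frontier Ω)).prod (volume : Measure R3)).restrict
        (GammaPlus Ω)) = ((volume : Measure ℝ).prod
        (((μHE[2] : Measure R3).restrict (frontier Ω)).prod (volume : Measure R3))).restrict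
          (univ ×ˢ GammaPlus Ω) := by
    rw [← Measure.prod_restrict, Measure.restrict_univ]
  rw [h1, Measure.restrict_restrict hC, inter_eq_left.2 hCΓ]

/-- Comparison of the flux through a small piece of `Γ₊` with the volume that it sweeps out when
it is transported backwards. -/
lemma IsPhaseFlow.exists_exit_patch (hΦ : IsPhaseFlow F Φ) (hΩ : IsSmoothConvexDomain Ω)
    {z₀ : Phase} (hz₀ : z₀ ∈ GammaPlus Ω) {K : ℝ} (hK : 1 < K) :
    ∃ O : Set Phase, IsOpen O ∧ z₀ ∈ O ∧ ∀ C : Set (ℝ × Phase), MeasurableSet C →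
      C ⊆ univ ×ˢ (O ∩ GammaPlus Ω) → InjOn (fun p : ℝ × Phase => Φ (-p.1) p.2) C →
      volume ((fun p : ℝ × Phase => Φ (-p.1) p.2) '' C) ≤ ENNReal.ofReal K * exitFlux Ω C ∧
      exitFlux Ω C ≤ ENNReal.ofReal K * volume ((fun p : ℝ × Phase => Φ (-p.1) p.2) '' C) := by
  have hfin := hΩ.isFiniteMeasure_surface
  set n := outerNormal Ω z₀.1 with hndef
  have hn : ‖n‖ = 1 := hΩ.norm_outerNormal hz₀.1
  have hnn : (inner ℝ n n : ℝ) = 1 := by rw [real_inner_self_eq_norm_sq, hn]; norm_num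
  have hKinv : K⁻¹ < 1 := inv_lt_one_of_one_lt₀ hK
  have hK0 : 0 < K := one_pos.trans hK
  -- The choices k = 1/K and ε² = 1 - 1/K make both distortion factors, 1/k for the tilt and 1/(1 -
  -- ε²) for the area, equal to `K`.
  obtain ⟨S, D, g, hSo, hxS, hDo, hgm, hch1, hch2, hch3, hch4⟩ :=
    hΩ.exists_boundary_chart hz₀.1 hndef hKinv (ε := √(1 - K⁻¹))
      (Real.sqrt_pos.2 (sub_pos.2 hKinv))
  have hpn : ∀ ξ : R3, inner ℝ n (ξ - (inner ℝ n ξ : ℝ) • n) = (0 : ℝ) := by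
    intro ξ
    rw [inner_sub_right, real_inner_smul_right, hnn, mul_one, sub_self]
  set ν := (μHE[2] : Measure R3).restrict (frontier Ω) with hν
  set V₀ : Set (orthPlane n) := {y | (y : R3) ∈ D} with hV₀
  have hV₀m : MeasurableSet V₀ := (hDo.preimage continuous_subtype_val).measurableSet
  have hgV : Measurable fun y : orthPlane n => g y := hgm.comp measurable_subtype_coe
  have hyn : ∀ y : orthPlane n, inner ℝ n (y : R3) = (0 : ℝ) := fun y =>
    Submodule.mem_orthogonal_singleton_iff_inner_right.1 y.2
  -- Planar Lebesgue measure carried to the boundary by the chart. On the patch it is comparable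
  -- with surface measure up to the factor `K`, so the exact surface Jacobian is not required.
  set ν' : Measure R3 := ((volume : Measure (orthPlane n)).restrict V₀).map
    (fun y : orthPlane n => g y) with hν'
  have hcmp : ∀ A : Set R3, MeasurableSet A → ν' A ≤ ν.restrict S A ∧
      ν.restrict S A ≤ ENNReal.ofReal K * ν' A := by
    intro A hA
    have h1 : ν' A = volume ((orthPlane n).orthogonalProjectionOnto '' (A ∩ S ∩ frontier Ω)) := by
      rw [hν', Measure.map_apply hgV hA, Measure.restrict_apply (hgV hA)]
      congr 1
      ext y
      constructor
      · rintro ⟨hy1, hy2⟩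
        obtain ⟨h1, h2, h3, -⟩ := hch2 y hy2 (hyn y)
        refine ⟨g y, ⟨⟨hy1, h1⟩, h2⟩, Subtype.ext ?_⟩
        rw [starProjection_orthPlane hn, h3]
      · rintro ⟨x, ⟨⟨hxA, hxS⟩, hxf⟩, rfl⟩
        obtain ⟨h1, h2⟩ := hch1 x hxS hxf
        rw [← starProjection_orthPlane hn] at h1 h2
        exact ⟨by rw [mem_preimage, h2]; exact hxA, h1⟩
    have h2 : ν.restrict S A = μHE[2] (A ∩ S ∩ frontier Ω) := by
      rw [Measure.restrict_apply hA, hν, Measure.restrict_apply (hA.inter hSo.measurableSet)]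
    have h3 := euclideanHausdorffMeasure_projection hn (A := A ∩ S ∩ frontier Ω)
      (ε := √(1 - K⁻¹)) (Real.sqrt_nonneg _)
      (by rw [Real.sqrt_lt' one_pos]; have := inv_pos.2 hK0; linarith)
      (fun x hx y hy => hch4 x hx.1.2 hx.2 y hy.1.2 hy.2)
    rw [Real.sq_sqrt (sub_nonneg.2 hKinv.le), sub_sub_cancel, inv_inv] at h3
    rw [h1, h2]
    exact h3
  have hle1 : ν' ≤ ν.restrict S := Measure.le_iff.2 fun A hA => (hcmp A hA).1
  have hle2 : ν.restrict S ≤ ENNReal.ofReal K • ν' := Measure.le_iff.2 fun A hA => by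
    rw [Measure.smul_apply, smul_eq_mul]; exact (hcmp A hA).2
  have hfin' : IsFiniteMeasure ν' := ⟨(hle1 univ).trans_lt (measure_lt_top _ _)⟩
  set dens : ℝ × Phase → ℝ≥0∞ := fun p => ENNReal.ofReal |inner ℝ (outerNormal Ω p.2.1) p.2.2|
    with hdens
  have hdm : Measurable dens := hΩ.measurable_flux.comp measurable_snd
  -- the chart in phase space
  set κ : Phase → ℝ × Phase := fun q =>
    (inner ℝ n q.1, (g (q.1 - (inner ℝ n q.1 : ℝ) • n), q.2)) with hκ
  have hpm : Measurable fun q : Phase => q.1 - (inner ℝ n q.1 : ℝ) • n := by fun_prop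
  have hκm : Measurable κ :=
    Measurable.prodMk (by fun_prop) ((hgm.comp hpm).prodMk measurable_snd)
  set Q : Set Phase := {q | q.1 - (inner ℝ n q.1 : ℝ) • n ∈ D} with hQ
  have hQm : MeasurableSet Q := hpm hDo.measurableSet
  -- The chart lives on the plane orthogonal to n, so the free coordinate along n can serve as the
  -- time. The product dt × ν' × dv then becomes Lebesgue measure on six-dimensional phase space,
  -- where the change of variables formula for the backward flow is available.
  have hmap : (volume.restrict Q).map κ = (volume : Measure ℝ).prod (ν'.prod volume) := by
    set τ : ℝ × orthPlane n × R3 → Phase := fun p => (p.1 • n + (p.2.1 : R3), p.2.2) with hτ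
    have hτp : MeasurePreserving τ ((volume : Measure ℝ).prod
        ((volume : Measure (orthPlane n)).prod (volume : Measure R3))) volume := by
      have h1 := (measurePreserving_orthPlane_decomposition hn).prod
        (MeasurePreserving.id (volume : Measure R3))
      have h2 := (measurePreserving_prodAssoc (volume : Measure ℝ)
        (volume : Measure (orthPlane n)) (volume : Measure R3)).symm
      exact h1.comp h2
    have hτn : ∀ p, inner ℝ n (τ p).1 = p.1 := by
      intro p
      simp only [hτ]
      rw [inner_add_right, real_inner_smul_right, hnn, hyn, mul_one, add_zero]
    have hτ1 : ∀ p, (τ p).1 - (inner ℝ n (τ p).1 : ℝ) • n = p.2.1 := by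
      intro p
      rw [hτn]
      simp [hτ]
    have hpre : τ ⁻¹' Q = univ ×ˢ (V₀ ×ˢ univ) := by
      ext p
      simp only [mem_preimage, hQ, mem_ofPred_eq, hτ1, hV₀, mem_prod, mem_univ, true_and, and_true]
    have hr := hτp.restrict_preimage hQm
    rw [← hr.map_eq, Measure.map_map hκm hτp.measurable, hpre, ← Measure.prod_restrict,
      ← Measure.prod_restrict, Measure.restrict_univ, Measure.restrict_univ]
    have hcomp : κ ∘ τ = Prod.map id (Prod.map (fun y : orthPlane n => g y) id) := by
      funext p
      have h5 := hτ1 p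
      rw [hτn] at h5
      simp only [Function.comp_apply, hκ, hτn, h5]
      rfl
    rw [hcomp, ← Measure.map_prod_map _ _ measurable_id (hgV.prodMap measurable_id),
      ← Measure.map_prod_map _ _ hgV measurable_id, Measure.map_id, Measure.map_id]
  refine ⟨S ×ˢ univ, hSo.prod isOpen_univ, ⟨hxS, mem_univ _⟩, fun C hC hCO hinj => ?_⟩
  have hCp : ∀ p ∈ C, p.2.1 ∈ S ∧ p.2 ∈ GammaPlus Ω := fun p hp =>
    ⟨(hCO hp).2.1.1, (hCO hp).2.2⟩
  set I := ∫⁻ p in C, dens p ∂((volume : Measure ℝ).prod (ν'.prod volume)) with hI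
  have hflux : exitFlux Ω C
      = ∫⁻ p in C, dens p ∂((volume : Measure ℝ).prod ((ν.restrict S).prod volume)) := by
    rw [hΩ.exitFlux_apply hC fun p hp => ⟨mem_univ _, (hCp p hp).2⟩]
    have h1 : (volume : Measure ℝ).prod ((ν.restrict S).prod (volume : Measure R3))
        = ((volume : Measure ℝ).prod (ν.prod volume)).restrict (univ ×ˢ (S ×ˢ univ)) := by
      rw [← Measure.prod_restrict, ← Measure.prod_restrict, Measure.restrict_univ,
        Measure.restrict_univ]
    rw [h1, Measure.restrict_restrict hC, inter_eq_left.2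
      (show C ⊆ univ ×ˢ (S ×ˢ univ) from fun p hp => ⟨mem_univ _, (hCp p hp).1, mem_univ _⟩)]
  have hI1 : I ≤ exitFlux Ω C := by
    rw [hflux]
    refine lintegral_mono' (Measure.restrict_mono_measure ?_ _) le_rfl
    exact Measure.prod_mono le_rfl (Measure.prod_mono hle1 le_rfl)
  have hI2 : exitFlux Ω C ≤ ENNReal.ofReal K * I := by
    rw [hflux]
    have h1 : (volume : Measure ℝ).prod ((ν.restrict S).prod (volume : Measure R3))
        ≤ ENNReal.ofReal K • (volume : Measure ℝ).prod (ν'.prod volume) := by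
      rw [← Measure.prod_smul_right, ← Measure.prod_smul_left]
      exact Measure.prod_mono le_rfl (Measure.prod_mono hle2 le_rfl)
    refine (lintegral_mono' (Measure.restrict_mono_measure h1 _) le_rfl).trans ?_
    rw [Measure.restrict_smul, lintegral_smul_measure, smul_eq_mul]
  have hI3 : I = ∫⁻ q in κ ⁻¹' C ∩ Q, dens (κ q) := by
    rw [hI, ← hmap, setLIntegral_map hC hdm hκm, Measure.restrict_restrict (hκm hC)]
  set Dom := κ ⁻¹' C ∩ Q with hDom
  have hDm : MeasurableSet Dom := (hκm hC).inter hQm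
  set G : ℝ × Phase → Phase := fun p => Φ (-p.1) p.2 with hG
  have hκD : κ '' Dom = C := by
    apply subset_antisymm
    · rintro _ ⟨q, hq, rfl⟩
      exact hq.1
    · intro p hp
      obtain ⟨h1, h2⟩ := hch1 p.2.1 (hCp p hp).1 (hCp p hp).2.1
      have hin : inner ℝ n (p.1 • n + (p.2.1 - (inner ℝ n p.2.1 : ℝ) • n)) = p.1 := by
        rw [inner_add_right, real_inner_smul_right, hnn, hpn, mul_one, add_zero]
      have hκq : κ (p.1 • n + (p.2.1 - (inner ℝ n p.2.1 : ℝ) • n), p.2.2) = p := by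
        simp only [hκ, hin, add_sub_cancel_left, h2]
      refine ⟨_, ⟨?_, ?_⟩, hκq⟩
      · rw [mem_preimage, hκq]; exact hp
      · simp only [hQ, mem_ofPred_eq, hin, add_sub_cancel_left]
        exact h1
  have hκinj : InjOn κ Dom := by
    intro q hq q' hq' heq
    have h1 := (hch2 _ hq.2 (hpn _)).2.2.1
    have h1' := (hch2 _ hq'.2 (hpn _)).2.2.1
    simp only [hκ, Prod.mk.injEq] at heq
    obtain ⟨ha, hb, hc⟩ := heq
    rw [hb, h1'] at h1
    rw [ha] at h1
    exact Prod.ext (sub_left_injective h1).symm hc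
  have hGim : G '' C = (G ∘ κ) '' Dom := by rw [image_comp, hκD]
  have hΘinj : InjOn (G ∘ κ) Dom := by
    refine hinj.comp hκinj fun q hq => hq.1
  -- the Jacobian
  have hjac : ∀ q ∈ Dom, ∃ A : Phase →L[ℝ] Phase, HasFDerivAt (G ∘ κ) A q ∧
      dens (κ q) ≤ ENNReal.ofReal |A.det| ∧
      ENNReal.ofReal |A.det| ≤ ENNReal.ofReal K * dens (κ q) := by
    intro q hq
    obtain ⟨h1, h2, h3, Gd, c, hGd, hc, hGdc⟩ := hch2 _ hq.2 (hpn _)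
    set t₀ : ℝ := inner ℝ n q.1 with ht₀
    set x := g (q.1 - t₀ • n) with hx
    set m := outerNormal Ω x with hm
    have hmn : K⁻¹ < inner ℝ m n := hch3 _ h1 h2
    have hmn0 : 0 < (inner ℝ m n : ℝ) := (inv_pos.2 hK0).trans hmn
    have hmn1 : (inner ℝ m n : ℝ) ≤ 1 := by
      have := real_inner_le_norm m n
      rwa [hm, hΩ.norm_outerNormal h2, hn, one_mul] at this
    have hlin : HasFDerivAt (fun q : Phase => q.1 - (inner ℝ n q.1 : ℝ) • n)
        ((rankOneUpdate (-n) n).comp (ContinuousLinearMap.fst ℝ R3 R3)) q := by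
      have h5 := ((rankOneUpdate (-n) n).comp (ContinuousLinearMap.fst ℝ R3 R3)).hasFDerivAt (x := q)
      refine h5.congr_of_eventuallyEq (Eventually.of_forall fun q => ?_)
      simp [rankOneUpdate_apply, sub_eq_add_neg]
    have hk2 : HasFDerivAt (fun q : Phase => (g (q.1 - (inner ℝ n q.1 : ℝ) • n), q.2))
        ((Gd.comp ((rankOneUpdate (-n) n).comp (ContinuousLinearMap.fst ℝ R3 R3))).prod
          (ContinuousLinearMap.snd ℝ R3 R3)) q :=
      (HasFDerivAt.comp (g := g) q hGd hlin).prodMk hasFDerivAt_snd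
    have hk1 : HasFDerivAt (fun q : Phase => t₀ - inner ℝ n q.1)
        (-((innerSL ℝ n).comp (ContinuousLinearMap.fst ℝ R3 R3))) q := by
      have h5 := (((innerSL ℝ n).comp (ContinuousLinearMap.fst ℝ R3 R3)).hasFDerivAt
        (x := q)).const_sub t₀
      exact h5
    -- The time is frozen at t₀ through Φ(-t) = Φ(-t₀) ∘ Φ(t₀ - t). The inner factor is
    -- differentiated at time zero, and the outer one has Jacobian one.
    have hJ0 : HasFDerivAt (fun p : ℝ × Phase => Φ p.1 p.2)
        ((ContinuousLinearMap.fst ℝ ℝ Phase).smulRight ((q.2, F x) : Phase)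
          + ContinuousLinearMap.snd ℝ ℝ Phase)
        (t₀ - inner ℝ n q.1, (g (q.1 - (inner ℝ n q.1 : ℝ) • n), q.2)) := by
      have := hΦ.hasFDerivAt_uncurry_zero (x, q.2)
      rw [← ht₀, sub_self]
      exact this
    have hJ := HasFDerivAt.comp (f := fun q : Phase =>
      (t₀ - (inner ℝ n q.1 : ℝ), (g (q.1 - (inner ℝ n q.1 : ℝ) • n), q.2))) q hJ0 (hk1.prodMk hk2)
    set M := ((ContinuousLinearMap.fst ℝ ℝ Phase).smulRight ((q.2, F x) : Phase)
      + ContinuousLinearMap.snd ℝ ℝ Phase).comp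
      ((-((innerSL ℝ n).comp (ContinuousLinearMap.fst ℝ R3 R3))).prod
        ((Gd.comp ((rankOneUpdate (-n) n).comp (ContinuousLinearMap.fst ℝ R3 R3))).prod
          (ContinuousLinearMap.snd ℝ R3 R3))) with hM
    have hMap : ∀ w : Phase, M w = (Gd (w.1 - (inner ℝ n w.1 : ℝ) • n) - (inner ℝ n w.1 : ℝ) • q.2,
        w.2 - (inner ℝ n w.1 : ℝ) • F x) := by
      intro w
      refine Prod.ext ?_ ?_ <;>
        simp [hM, rankOneUpdate_apply, sub_eq_add_neg, add_comm]
    have hdetM := abs_det_exit_linear (v := q.2) (w := F x) hn hc hmn0 hGdc M hMap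
    refine ⟨(fderiv ℝ (Φ (-t₀)) (x, q.2)).comp M, ?_, ?_⟩
    · have hout : HasFDerivAt (Φ (-t₀)) (fderiv ℝ (Φ (-t₀)) (x, q.2))
          (Φ (t₀ - inner ℝ n q.1) (g (q.1 - (inner ℝ n q.1 : ℝ) • n), q.2)) := by
        rw [← ht₀, sub_self, hΦ.zero]
        exact (((hΦ.contDiff_apply (-t₀)).differentiable one_ne_zero) _).hasFDerivAt
      refine (hout.comp q hJ).congr_of_eventuallyEq (Eventually.of_forall fun q' => ?_)
      simp only [hG, hκ, Function.comp_apply]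
      rw [← hΦ.add]
      congr 1
      ring
    -- The Jacobian is |m · v| / (m · n) with 1/K < m · n ≤ 1, hence within the factor `K` of the
    -- flux density |m · v|.
    · have hdet : |((fderiv ℝ (Φ (-t₀)) (x, q.2)).comp M).det|
          = |inner ℝ m q.2| / inner ℝ m n := by
        rw [← hdetM]
        have : ((fderiv ℝ (Φ (-t₀)) (x, q.2)).comp M).det
            = (fderiv ℝ (Φ (-t₀)) (x, q.2)).det * M.det := LinearMap.det_comp _ _
        rw [this, hΦ.det_fderiv, one_mul]
      have hdk : dens (κ q) = ENNReal.ofReal |inner ℝ m q.2| := rfl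
      rw [hdet, hdk, ← ENNReal.ofReal_mul hK0.le]
      constructor
      · exact ENNReal.ofReal_le_ofReal (le_div_self (abs_nonneg _) hmn0 hmn1)
      · apply ENNReal.ofReal_le_ofReal
        rw [div_le_iff₀ hmn0]
        have h6 : 1 ≤ K * inner ℝ m n := by
          rw [← inv_mul_le_iff₀ hK0, mul_one]; exact hmn.le
        nlinarith [abs_nonneg (inner ℝ m q.2 : ℝ)]
  choose! A hA1 hA2 hA3 using hjac
  have hvol : volume (G '' C) = ∫⁻ q in Dom, ENNReal.ofReal |(A q).det| := by
    rw [hGim, lintegral_abs_det_fderiv_eq_addHaar_image volume hDm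
      (fun q hq => (hA1 q hq).hasFDerivWithinAt) hΘinj]
  have hv1 : I ≤ volume (G '' C) := by
    rw [hvol, hI3]
    exact setLIntegral_mono' hDm hA2
  have hv2 : volume (G '' C) ≤ ENNReal.ofReal K * I := by
    rw [hvol, hI3, ← lintegral_const_mul (f := fun q => dens (κ q)) _ (hdm.comp hκm)]
    exact setLIntegral_mono' hDm hA3
  exact ⟨hv2.trans (by gcongr), hI2.trans (by gcongr)⟩

end ExitPatch

/-! ### Exit maps and the disintegration of dt dσ along trajectories. -/

section ExitFamily

open Filter

/-- A countable measurable cover can be refined to a measurable partition indexed by `ℕ`. -/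
lemma exists_partition_subordinate {α ι : Type*} [MeasurableSpace α] [Countable ι]
    {c : ι → Set α} (hc : ∀ i, MeasurableSet (c i)) :
    ∃ X : ℕ → Set α, (∀ k, MeasurableSet (X k)) ∧ Pairwise (Function.onFun Disjoint X) ∧
      ⋃ k, X k = ⋃ i, c i ∧ ∀ k, X k = ∅ ∨ ∃ i, X k ⊆ c i := by
  rcases isEmpty_or_nonempty ι with h | h
  · exact ⟨fun _ => ∅, fun _ => MeasurableSet.empty, fun _ _ _ => disjoint_bot_left, by simp,
      fun _ => Or.inl rfl⟩
  · obtain ⟨f, hf⟩ := exists_surjective_nat ι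
    refine ⟨disjointed (c ∘ f), fun k => MeasurableSet.disjointed (fun n => hc (f n)) k,
      disjoint_disjointed _, ?_, fun k => Or.inr ⟨f k, disjointed_subset _ k⟩⟩
    rw [iUnion_disjointed]
    exact hf.iUnion_comp c

lemma le_of_forall_one_lt_mul_le {a b : ℝ≥0∞} (h : ∀ K : ℝ, 1 < K → a ≤ ENNReal.ofReal K * b) :
    a ≤ b := by
  have h1 : Tendsto (fun K : ℝ => ENNReal.ofReal K * b) (𝓝[>] 1) (𝓝 (1 * b)) := by
    refine ENNReal.Tendsto.mul_const ?_ (Or.inl one_ne_zero)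
    have := (ENNReal.continuous_ofReal.tendsto (1 : ℝ)).mono_left
      (nhdsWithin_le_nhds (s := Ioi (1 : ℝ)))
    simpa using this
  rw [one_mul] at h1
  exact ge_of_tendsto h1 (by filter_upwards [self_mem_nhdsWithin] with K hK using h K hK)

variable {Ω : Set R3} {F : R3 → R3} {Φ : ℝ → Phase → Phase}

lemma IsPhaseFlow.continuous_backward (hΦ : IsPhaseFlow F Φ) :
    Continuous fun p : ℝ × Phase => Φ (-p.1) p.2 :=
  hΦ.continuous_uncurry.comp (f := fun p : ℝ × Phase => (-p.1, p.2)) (by fun_prop)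

/-- The flux through a piece of `ℝ × Γ₊` is the volume of the set of initial points of the
trajectories that cross it. -/
lemma IsPhaseFlow.volume_image_backward (hΦ : IsPhaseFlow F Φ) (hΩ : IsSmoothConvexDomain Ω)
    {C : Set (ℝ × Phase)} (hC : MeasurableSet C) (hCΓ : C ⊆ univ ×ˢ GammaPlus Ω)
    (hinj : InjOn (fun p : ℝ × Phase => Φ (-p.1) p.2) C) :
    volume ((fun p : ℝ × Phase => Φ (-p.1) p.2) '' C) = exitFlux Ω C := by
  set G : ℝ × Phase → Phase := fun p => Φ (-p.1) p.2
  have hGc : Continuous G := hΦ.continuous_backward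
  -- The patches shrink as `K` decreases, but the set `C` does not depend on `K`. Countably many
  -- patches cover Γ₊, the estimates add up over a subordinate partition, and letting `K` decrease
  -- to 1 leaves equality.
  have key : ∀ K : ℝ, 1 < K → volume (G '' C) ≤ ENNReal.ofReal K * exitFlux Ω C ∧
      exitFlux Ω C ≤ ENNReal.ofReal K * volume (G '' C) := by
    intro K hK
    choose! O hOo hzO hO using fun (z : Phase) (hz : z ∈ GammaPlus Ω) =>
      hΦ.exists_exit_patch hΩ hz hK
    obtain ⟨t, htΓ, htc, htcov⟩ := TopologicalSpace.countable_cover_nhdsWithin (s := GammaPlus Ω)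
      (f := O) fun z hz => mem_nhdsWithin_of_mem_nhds ((hOo z hz).mem_nhds (hzO z hz))
    have := htc.to_subtype
    obtain ⟨X, hXm, hXd, hXU, hXs⟩ := exists_partition_subordinate
      (c := fun z : t => (univ : Set ℝ) ×ˢ O z)
      fun z => (isOpen_univ.prod (hOo z (htΓ z.2))).measurableSet
    have hCX : C = ⋃ k, C ∩ X k := by
      rw [← inter_iUnion, hXU, eq_comm, inter_eq_left]
      intro p hp
      have := htcov (hCΓ hp).2
      simp only [mem_iUnion] at this ⊢
      obtain ⟨z, hz, hpz⟩ := this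
      exact ⟨⟨z, hz⟩, mem_univ _, hpz⟩
    have hpiece : ∀ k, volume (G '' (C ∩ X k)) ≤ ENNReal.ofReal K * exitFlux Ω (C ∩ X k) ∧
        exitFlux Ω (C ∩ X k) ≤ ENNReal.ofReal K * volume (G '' (C ∩ X k)) := by
      intro k
      rcases hXs k with h | ⟨z, hz⟩
      · simp [h]
      · exact hO z (htΓ z.2) _ (hC.inter (hXm k))
          (fun p hp => ⟨mem_univ _, (hz hp.2).2, (hCΓ hp.1).2⟩) (hinj.mono inter_subset_left)
    have hdisj : Pairwise (Function.onFun Disjoint fun k => C ∩ X k) := fun i j hij =>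
      (hXd hij).mono inter_subset_right inter_subset_right
    have h1 : exitFlux Ω C = ∑' k, exitFlux Ω (C ∩ X k) := by
      conv_lhs => rw [hCX]
      exact measure_iUnion hdisj fun k => hC.inter (hXm k)
    have h2 : volume (G '' C) = ∑' k, volume (G '' (C ∩ X k)) := by
      conv_lhs => rw [hCX, image_iUnion]
      refine measure_iUnion (fun i j hij => ?_) fun k => (hC.inter (hXm k)).image_of_continuousOn_injOn
        hGc.continuousOn (hinj.mono inter_subset_left)
      refine Set.disjoint_left.2 ?_
      rintro _ ⟨a, ha, rfl⟩ ⟨b, hb, hab⟩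
      have : b = a := hinj hb.1 ha.1 hab
      exact (Set.disjoint_left.1 (hdisj hij) ha) (this ▸ hb)
    rw [h1, h2, ← ENNReal.tsum_mul_left, ← ENNReal.tsum_mul_left]
    exact ⟨ENNReal.tsum_le_tsum fun k => (hpiece k).1, ENNReal.tsum_le_tsum fun k => (hpiece k).2⟩
  exact le_antisymm (le_of_forall_one_lt_mul_le fun K hK => (key K hK).1)
    (le_of_forall_one_lt_mul_le fun K hK => (key K hK).2)

/-- Two points of one piece with the same initial point lie on one trajectory, at times less than δ
apart. If the times differed, the later point would be on the boundary less than δ after an exit,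
when the trajectory is still outside the closure. Hence the time slices have length δ, where δ
belongs to a neighbourhood of the exit point. -/
lemma IsPhaseFlow.exists_exit_partition (hΦ : IsPhaseFlow F Φ) (hΩ : IsSmoothConvexDomain Ω)
    (T : ℝ) : ∃ X : ℕ → Set (ℝ × Phase), (∀ k, MeasurableSet (X k)) ∧
      Pairwise (Function.onFun Disjoint X) ∧ ⋃ k, X k = Ioo 0 T ×ˢ GammaPlus Ω ∧
      ∀ k, InjOn (fun p : ℝ × Phase => Φ (-p.1) p.2) (X k) := by
  choose! O hOo hzO δ hδ hO using fun (z : Phase) (hz : z ∈ GammaPlus Ω) =>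
    hΦ.exists_notMem_closure_after_exit hΩ hz
  obtain ⟨t, htΓ, htc, htcov⟩ := TopologicalSpace.countable_cover_nhdsWithin (s := GammaPlus Ω)
    (f := O) fun z hz => mem_nhdsWithin_of_mem_nhds ((hOo z hz).mem_nhds (hzO z hz))
  have := htc.to_subtype
  obtain ⟨X, hXm, hXd, hXU, hXs⟩ := exists_partition_subordinate
    (c := fun i : t × ℤ => (Ico (i.2 * δ i.1) ((i.2 + 1) * δ i.1) ∩ Ioo 0 T) ×ˢ
      (O i.1 ∩ GammaPlus Ω))
    fun i => (measurableSet_Ico.inter measurableSet_Ioo).prod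
      ((hOo _ (htΓ i.1.2)).measurableSet.inter hΩ.measurableSet_gammaPlus)
  refine ⟨X, hXm, hXd, ?_, fun k => ?_⟩
  · rw [hXU]
    apply subset_antisymm
    · refine iUnion_subset fun i p hp => ⟨hp.1.2, hp.2.2⟩
    · rintro p ⟨hp1, hp2⟩
      have := htcov hp2
      simp only [mem_iUnion] at this ⊢
      obtain ⟨z, hz, hpz⟩ := this
      have hδz := hδ z (htΓ hz)
      refine ⟨(⟨z, hz⟩, ⌊p.1 / δ z⌋), ⟨⟨?_, ?_⟩, hp1⟩, hpz, hp2⟩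
      · exact (le_div_iff₀ hδz).1 (Int.floor_le _)
      · exact (div_lt_iff₀ hδz).1 (Int.lt_floor_add_one _)
  · rcases hXs k with h | ⟨⟨z, m⟩, hz⟩
    · simp [h]
    · have haux : ∀ p ∈ X k, ∀ p' ∈ X k, Φ (-p.1) p.2 = Φ (-p'.1) p'.2 → ¬ p.1 < p'.1 := by
        intro p hp p' hp' heq hlt
        have h1 := hz hp
        have h2 := hz hp'
        have h3 : Φ (p'.1 - p.1) p.2 = p'.2 := by
          have : Φ (p'.1 - p.1) p.2 = Φ p'.1 (Φ (-p.1) p.2) := by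
            rw [← hΦ.add, sub_eq_add_neg]
          rw [this, heq, hΦ.apply_neg_apply]
        refine hO z (htΓ z.2) p.2 h1.2.1 h1.2.2 (p'.1 - p.1) ⟨sub_pos.2 hlt, ?_⟩ ?_
        · have := h1.1.1.1
          have := h2.1.1.2
          linarith
        · rw [h3]
          exact frontier_subset_closure h2.2.2.1
      intro p hp p' hp' heq
      have ht : p.1 = p'.1 :=
        le_antisymm (not_lt.1 (haux p' hp' p hp heq.symm)) (not_lt.1 (haux p hp p' hp' heq))
      refine Prod.ext ht ?_
      simp only [ht] at heq
      exact hΦ.injective _ heq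

/-- The family of exit times: the measure `dt dσ` on `(0, T) × Γ₊` is the image of Lebesgue measure
on the initial points of the outgoing trajectories. -/
theorem IsPhaseFlow.exists_exit_family (hΦ : IsPhaseFlow F Φ) (hΩ : IsSmoothConvexDomain Ω)
    (T : ℝ) : ∃ (Y : ℕ → Set Phase) (τ : ℕ → Phase → ℝ), (∀ k, MeasurableSet (Y k)) ∧
      (∀ k, Measurable (τ k)) ∧
      (∀ k, ∀ y ∈ Y k, τ k y ∈ Ioo 0 T ∧ Φ (τ k y) y ∈ GammaPlus Ω) ∧
      (∀ k l, k ≠ l → ∀ y, y ∈ Y k → y ∈ Y l → τ k y ≠ τ l y) ∧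
      outMeasure T Ω = Measure.sum fun k =>
        (volume.restrict (Y k)).map fun y => (τ k y, Φ (τ k y) y) := by
  classical
  obtain ⟨X, hXm, hXd, hXU, hXi⟩ := hΦ.exists_exit_partition hΩ T
  have hfin := hΩ.isFiniteMeasure_surface
  set G : ℝ × Phase → Phase := fun p => Φ (-p.1) p.2 with hG
  have hGc : Continuous G := hΦ.continuous_backward
  have hXsub : ∀ k, X k ⊆ Ioo 0 T ×ˢ GammaPlus Ω := fun k => hXU ▸ subset_iUnion X k
  -- Injectivity of the backward map on `X k` makes the chosen exit time unique. The default 0 is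
  -- used exactly where the trajectory misses `X k`.
  set τ : ℕ → Phase → ℝ := fun k y => if h : ∃ t, (t, Φ t y) ∈ X k then h.choose else 0 with hτ
  have hmemim : ∀ (A : Set (ℝ × Phase)) y, y ∈ G '' A ↔ ∃ t, (t, Φ t y) ∈ A := by
    intro A y
    constructor
    · rintro ⟨p, hp, rfl⟩
      exact ⟨p.1, by simpa [hG, hΦ.apply_neg_apply] using hp⟩
    · rintro ⟨t, ht⟩
      exact ⟨_, ht, by simp [hG, hΦ.neg_apply_apply]⟩
  have hτX : ∀ k, ∀ y ∈ G '' X k, (τ k y, Φ (τ k y) y) ∈ X k := by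
    intro k y hy
    have h := (hmemim (X k) y).1 hy
    simp only [hτ, dif_pos h]
    exact h.choose_spec
  have hτu : ∀ k y t, (t, Φ t y) ∈ X k → τ k y = t := by
    intro k y t ht
    have h1 := hτX k y ((hmemim _ _).2 ⟨t, ht⟩)
    have := hXi k h1 ht (by
      change Φ (-(τ k y)) (Φ (τ k y) y) = Φ (-t) (Φ t y)
      rw [hΦ.neg_apply_apply, hΦ.neg_apply_apply])
    exact congrArg Prod.fst this
  -- Injective continuous images of Borel sets are Borel (Lusin–Souslin). This gives measurability
  -- both of the sets of initial points and of the chosen exit times.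
  have him : ∀ k (A : Set (ℝ × Phase)), MeasurableSet A → MeasurableSet (G '' (X k ∩ A)) :=
    fun k A hA => ((hXm k).inter hA).image_of_continuousOn_injOn hGc.continuousOn
      ((hXi k).mono inter_subset_left)
  have hpre : ∀ k (A : Set (ℝ × Phase)),
      {y | (τ k y, Φ (τ k y) y) ∈ A} ∩ G '' X k = G '' (X k ∩ A) := by
    intro k A
    ext y
    constructor
    · rintro ⟨h1, h2⟩
      exact (hmemim _ _).2 ⟨τ k y, hτX k y h2, h1⟩
    · intro h
      obtain ⟨t, ht⟩ := (hmemim _ _).1 h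
      have := hτu k y t ht.1
      exact ⟨by change (τ k y, Φ (τ k y) y) ∈ A; rw [this]; exact ht.2,
        (hmemim _ _).2 ⟨t, ht.1⟩⟩
  have hYm : ∀ k, MeasurableSet (G '' X k) := fun k => by
    simpa using him k univ MeasurableSet.univ
  have hτm : ∀ k, Measurable (τ k) := by
    intro k A hA
    have h1 : τ k ⁻¹' A = G '' (X k ∩ (A ×ˢ univ)) ∪ ((G '' X k)ᶜ ∩ {_y | (0 : ℝ) ∈ A}) := by
      rw [← hpre]
      ext y
      by_cases hy : y ∈ G '' X k
      · simp [hy]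
      · have : τ k y = 0 := by
          simp only [hτ]
          rw [dif_neg fun h => hy ((hmemim _ _).2 h)]
        simp [hy, this]
    rw [h1]
    exact (him k _ (hA.prod MeasurableSet.univ)).union ((hYm k).compl.inter (MeasurableSet.const _))
  have hmapm : ∀ k, Measurable fun y => (τ k y, Φ (τ k y) y) := fun k =>
    (hτm k).prodMk (hΦ.continuous_uncurry.measurable.comp ((hτm k).prodMk measurable_id))
  refine ⟨fun k => G '' X k, τ, hYm, hτm, fun k y hy => hXsub k (hτX k y hy), ?_, ?_⟩
  · intro k l hkl y hyk hyl heq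
    have h1 := hτX k y hyk
    have h2 := hτX l y hyl
    rw [← heq] at h2
    exact (hXd hkl).le_bot ⟨h1, h2⟩
  · ext C hC
    rw [Measure.sum_apply _ hC]
    have hterm : ∀ k, (volume.restrict (G '' X k)).map (fun y => (τ k y, Φ (τ k y) y)) C
        = exitFlux Ω (X k ∩ C) := by
      intro k
      rw [Measure.map_apply (hmapm k) hC, Measure.restrict_apply (hmapm k hC)]
      have := hpre k C
      change volume ({y | (τ k y, Φ (τ k y) y) ∈ C} ∩ G '' X k) = _
      rw [this, hΦ.volume_image_backward hΩ ((hXm k).inter hC)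
        (fun p hp => ⟨mem_univ _, (hXsub k hp.1).2⟩) ((hXi k).mono inter_subset_left)]
    simp_rw [hterm]
    rw [← measure_iUnion (fun i j hij => (hXd hij).mono inter_subset_left inter_subset_left)
      fun k => (hXm k).inter hC, ← iUnion_inter, hXU]
    have := hΩ.isFiniteMeasure_surface
    have : SFinite (boundaryMeasure Ω) := by unfold boundaryMeasure; infer_instance
    have h1 : outMeasure T Ω = (exitFlux Ω).restrict (Ioo 0 T ×ˢ GammaPlus Ω) := by
      rw [outMeasure, exitFlux, ← Measure.prod_restrict,
        Measure.restrict_restrict hΩ.measurableSet_gammaPlus, inter_self]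
    rw [h1, Measure.restrict_apply hC, inter_comm]

end ExitFamily

/-! ### One-dimensional calculus for a primitive minus countably many jumps. -/

section JumpFunctions

/-- Product rule for two primitives. -/
lemma primitive_mul_primitive {T a b t : ℝ} {H K : ℝ → ℝ} (hH : IntervalIntegrable H volume 0 T)
    (hK : IntervalIntegrable K volume 0 T) (ht : t ∈ Icc 0 T) :
    (a + ∫ s in (0 : ℝ)..t, H s) * (b + ∫ s in (0 : ℝ)..t, K s) = a * b +
      ∫ s in (0 : ℝ)..t, (H s * (b + ∫ r in (0 : ℝ)..s, K r) + (a + ∫ r in (0 : ℝ)..s, H r) * K s) := by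
  have hsub : uIcc 0 t ⊆ uIcc 0 T := by
    rw [uIcc_of_le ht.1, uIcc_of_le (ht.1.trans ht.2)]
    exact Icc_subset_Icc_right ht.2
  have hac : ∀ {c : ℝ} {K : ℝ → ℝ}, IntervalIntegrable K volume 0 T →
      AbsolutelyContinuousOnInterval (fun x => c + ∫ s in (0 : ℝ)..x, K s) 0 t := by
    intro c K hK
    have h1 : AbsolutelyContinuousOnInterval (fun _ : ℝ => c) 0 t :=
      (LipschitzWith.const c).lipschitzOnWith.absolutelyContinuousOnInterval
    exact h1.add ((hK.mono_set hsub).absolutelyContinuousOnInterval_intervalIntegral left_mem_uIcc)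
  have h := (hac (c := a) hH).integral_deriv_mul_eq_sub (hac (c := b) hK)
  simp only [intervalIntegral.integral_same, add_zero] at h
  rw [eq_sub_iff_add_eq, add_comm] at h
  rw [← h]
  congr 1
  have hd : ∀ {c : ℝ} {K : ℝ → ℝ}, IntervalIntegrable K volume 0 T →
      ∀ᵐ x, x ∈ uIcc 0 t → deriv (fun x => c + ∫ s in (0 : ℝ)..x, K s) x = K x := by
    intro c K hK
    filter_upwards [(hK.mono_set hsub).ae_hasDerivAt_integral] with x hx hxt
    exact ((hx hxt 0 left_mem_uIcc).const_add c).deriv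
  refine intervalIntegral.integral_congr_ae ?_
  filter_upwards [hd (c := a) hH, hd (c := b) hK] with x h1 h2 hx
  rw [h1 (uIoc_subset_uIcc hx), h2 (uIoc_subset_uIcc hx)]

/-- The pure jump function with jumps `d k` at the times `τ k`. -/
def jumpSum (d τ : ℕ → ℝ) (t : ℝ) : ℝ := ∑' k, if τ k ≤ t then d k else 0

variable {d τ : ℕ → ℝ} {T : ℝ}

lemma summable_jump (hd : Summable fun k => |d k|) (t : ℝ) :
    Summable fun k => if τ k ≤ t then d k else 0 :=
  Summable.of_norm_bounded hd fun k => by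
    split_ifs <;> simp

lemma abs_jumpSum_le (hd : Summable fun k => |d k|) (t : ℝ) : |jumpSum d τ t| ≤ ∑' k, |d k| := by
  rw [← Real.norm_eq_abs, jumpSum]
  refine tsum_of_norm_bounded hd.hasSum fun k => ?_
  split_ifs <;> simp

lemma measurable_jumpSum : Measurable (jumpSum d τ) :=
  Measurable.tsum fun _ => Measurable.ite measurableSet_Ici measurable_const measurable_const

/-- With the convention τ ≤ t the value at a jump already includes it, so the value right after an
exit can be read off at the exit time. -/
lemma jumpSum_tendsto_right (hd : Summable fun k => |d k|) (t : ℝ) :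
    Filter.Tendsto (jumpSum d τ) (𝓝[>] t) (𝓝 (jumpSum d τ t)) := by
  refine tendsto_tsum_of_dominated_convergence hd (fun k => ?_) (Filter.Eventually.of_forall
    fun s k => by split_ifs <;> simp)
  refine tendsto_const_nhds.congr' ?_
  by_cases h : τ k ≤ t
  · filter_upwards [self_mem_nhdsWithin] with s hs
    rw [if_pos h, if_pos (h.trans (le_of_lt hs))]
  · filter_upwards [mem_nhdsWithin_of_mem_nhds (Iio_mem_nhds (not_le.1 h))] with s hs
    rw [if_neg h, if_neg (not_le.2 hs)]

lemma intervalIntegrable_jumpSum_mul (hd : Summable fun k => |d k|) {G : ℝ → ℝ} {a b : ℝ}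
    (hG : IntervalIntegrable G volume a b) :
    IntervalIntegrable (fun t => jumpSum d τ t * G t) volume a b := by
  rw [intervalIntegrable_iff] at hG ⊢
  exact hG.bdd_mul measurable_jumpSum.aestronglyMeasurable
    (Filter.Eventually.of_forall fun t => abs_jumpSum_le hd t)

lemma abs_integral_tail_le {G : ℝ → ℝ} (hG : IntervalIntegrable G volume 0 T) {s : ℝ}
    (hs : s ∈ Icc 0 T) : |∫ t in s..T, G t| ≤ ∫ t in (0 : ℝ)..T, |G t| := by
  refine (intervalIntegral.abs_integral_le_integral_abs hs.2).trans ?_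
  exact intervalIntegral.integral_mono_interval hs.1 hs.2 le_rfl
    (Filter.Eventually.of_forall fun t => abs_nonneg _) hG.abs

lemma summable_mul_of_bounded (hd : Summable fun k => |d k|) {c : ℕ → ℝ} {B : ℝ}
    (hc : ∀ k, |c k| ≤ B) : Summable fun k => |d k * c k| := by
  refine Summable.of_nonneg_of_le (fun k => abs_nonneg _) (fun k => ?_) (hd.mul_right B)
  rw [abs_mul]
  exact mul_le_mul_of_nonneg_left (hc k) (abs_nonneg _)

/-- Each jump contributes the indicator of [τ k, T]; absolute summability of the jumps allows sum
and integral to be exchanged. -/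
lemma integral_jumpSum_mul (hd : Summable fun k => |d k|) (hτ : ∀ k, τ k ∈ Icc 0 T) {G : ℝ → ℝ}
    (hG : IntervalIntegrable G volume 0 T) :
    ∫ t in (0 : ℝ)..T, jumpSum d τ t * G t = ∑' k, d k * ∫ t in (τ k)..T, G t := by
  have hT : 0 ≤ T := (hτ 0).1.trans (hτ 0).2
  have hG' : IntegrableOn G (Ioc 0 T) := (intervalIntegrable_iff_integrableOn_Ioc_of_le hT).1 hG
  have hterm : ∀ k, IntegrableOn (fun t => (if τ k ≤ t then d k else 0) * G t) (Ioc 0 T) := by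
    intro k
    refine hG'.bdd_mul (c := |d k|) (Measurable.ite measurableSet_Ici measurable_const
      measurable_const).aestronglyMeasurable (Filter.Eventually.of_forall fun t => ?_)
    split_ifs <;> simp
  have hval : ∀ k, ∫ t in Ioc 0 T, (if τ k ≤ t then d k else 0) * G t
      = d k * ∫ t in (τ k)..T, G t := by
    intro k
    rw [intervalIntegral.integral_of_le (hτ k).2, ← integral_Icc_eq_integral_Ioc,
      ← integral_const_mul, ← integral_indicator measurableSet_Icc,
      ← integral_Icc_eq_integral_Ioc, ← integral_indicator measurableSet_Icc]
    congr 1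
    ext t
    simp only [indicator, mem_Icc]
    have := (hτ k).1
    by_cases h1 : τ k ≤ t
    · by_cases h2 : t ≤ T
      · simp [h1, h2, this.trans h1]
      · simp [h2]
    · simp [h1]
  have hsum : Summable fun k => ∫ t in Ioc 0 T, ‖(if τ k ≤ t then d k else 0) * G t‖ := by
    refine Summable.of_nonneg_of_le (fun k => integral_nonneg fun t => norm_nonneg _) (fun k => ?_)
      (hd.mul_right (∫ t in Ioc 0 T, ‖G t‖))
    rw [← integral_const_mul]
    refine integral_mono (hterm k).norm (hG'.norm.const_mul _) fun t => ?_
    simp only [norm_mul]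
    refine mul_le_mul_of_nonneg_right ?_ (norm_nonneg _)
    split_ifs <;> simp
  have h := hasSum_integral_of_summable_integral_norm hterm hsum
  simp_rw [hval] at h
  rw [h.tsum_eq, intervalIntegral.integral_of_le hT]
  congr 1
  ext t
  rw [jumpSum, tsum_mul_right]

variable {g : ℝ} {H α α' : ℝ → ℝ}

/-- Integration by parts on [s, T], obtained by subtracting the product rule on [0, s] from that on
[0, T]. The boundary term at T is removed by α(T) = 0. -/
lemma integral_primitive_mul_deriv_tail (hH : IntervalIntegrable H volume 0 T)
    (hα : ∀ t, HasDerivAt α (α' t) t) (hα' : Continuous α') (hαT : α T = 0) {s : ℝ}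
    (hs : s ∈ Icc 0 T) :
    ∫ t in s..T, (g + ∫ r in (0 : ℝ)..t, H r) * α' t
      = -((g + ∫ r in (0 : ℝ)..s, H r) * α s) - ∫ t in s..T, H t * α t := by
  have hT : 0 ≤ T := hs.1.trans hs.2
  have hαeq : ∀ t, α t = α 0 + ∫ r in (0 : ℝ)..t, α' r := by
    intro t
    rw [intervalIntegral.integral_eq_sub_of_hasDerivAt (fun x _ => hα x) (hα'.intervalIntegrable _ _)]
    ring
  have hαc : Continuous α := continuous_iff_continuousAt.2 fun t => (hα t).continuousAt
  have hAc : ContinuousOn (fun t => g + ∫ r in (0 : ℝ)..t, H r) (uIcc 0 T) :=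
    continuousOn_const.add (intervalIntegral.continuousOn_primitive_interval' hH left_mem_uIcc)
  have hHα : IntervalIntegrable (fun t => H t * α t) volume 0 T := hH.mul_continuousOn hαc.continuousOn
  have hAα : IntervalIntegrable (fun t => (g + ∫ r in (0 : ℝ)..t, H r) * α' t) volume 0 T :=
    (hα'.intervalIntegrable 0 T).continuousOn_mul hAc
  have hp := fun t (ht : t ∈ Icc 0 T) => primitive_mul_primitive (a := g) (b := α 0) hH
    (hα'.intervalIntegrable 0 T) ht
  simp_rw [← hαeq] at hp
  have h1 := hp T ⟨hT, le_rfl⟩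
  have h2 := hp s hs
  have hsT : uIcc s T ⊆ uIcc 0 T := by
    rw [uIcc_of_le hs.2, uIcc_of_le hT]; exact Icc_subset_Icc_left hs.1
  have h0s : uIcc 0 s ⊆ uIcc 0 T := by
    rw [uIcc_of_le hs.1, uIcc_of_le hT]; exact Icc_subset_Icc_right hs.2
  have h3 := intervalIntegral.integral_add_adjacent_intervals ((hHα.add hAα).mono_set h0s)
    ((hHα.add hAα).mono_set hsT)
  have h4 := intervalIntegral.integral_add (hHα.mono_set hsT) (hAα.mono_set hsT)
  rw [hαT, mul_zero] at h1
  linarith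

/-- Integration by parts against a function with an absolutely continuous part and jumps. -/
theorem integral_jump_mul_deriv (hd : Summable fun k => |d k|) (hτ : ∀ k, τ k ∈ Icc 0 T)
    (hH : IntervalIntegrable H volume 0 T) (hα : ∀ t, HasDerivAt α (α' t) t)
    (hα' : Continuous α') (hαT : α T = 0) :
    ∫ t in (0 : ℝ)..T, ((g + ∫ r in (0 : ℝ)..t, H r) - jumpSum d τ t) * α' t
      = -(g * α 0) - (∫ t in (0 : ℝ)..T, H t * α t) + ∑' k, d k * α (τ k) := by
  have hT : 0 ≤ T := (hτ 0).1.trans (hτ 0).2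
  have hAc : ContinuousOn (fun t => g + ∫ r in (0 : ℝ)..t, H r) (uIcc 0 T) :=
    continuousOn_const.add (intervalIntegral.continuousOn_primitive_interval' hH left_mem_uIcc)
  have hα'i := hα'.intervalIntegrable (μ := volume) 0 T
  simp_rw [sub_mul]
  rw [intervalIntegral.integral_sub (hα'i.continuousOn_mul hAc) (intervalIntegrable_jumpSum_mul hd hα'i),
    integral_primitive_mul_deriv_tail hH hα hα' hαT ⟨le_rfl, hT⟩, integral_jumpSum_mul hd hτ hα'i]
  have : ∀ k, ∫ t in (τ k)..T, α' t = -α (τ k) := fun k => by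
    rw [intervalIntegral.integral_eq_sub_of_hasDerivAt (fun x _ => hα x) (hα'.intervalIntegrable _ _),
      hαT, zero_sub]
  simp_rw [this, mul_neg, tsum_neg]
  simp

/-- Expanding the square gives -∑ d_k d_l α(max(τ_k, τ_l)). Pairs with different times are counted
twice with the later time, which is almost 2∑ d_k α(τ_k) J(τ_k). Since J(τ_k) contains the jump d_k
itself, the diagonal is then counted twice instead of once, and the last sum corrects this. Nonzero
jumps at a common time would spoil the count, hence the hypothesis that their times differ. -/
lemma integral_jumpSum_sq_mul_deriv (hd : Summable fun k => |d k|) (hτ : ∀ k, τ k ∈ Icc 0 T)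
    (hinj : ∀ k l, k ≠ l → d k ≠ 0 → d l ≠ 0 → τ k ≠ τ l) (hα : ∀ t, HasDerivAt α (α' t) t)
    (hα' : Continuous α') (hαT : α T = 0) :
    ∫ t in (0 : ℝ)..T, jumpSum d τ t * (jumpSum d τ t * α' t)
      = -(2 * ∑' k, (d k * α (τ k)) * jumpSum d τ (τ k)) + ∑' k, d k ^ 2 * α (τ k) := by
  have hT : 0 ≤ T := (hτ 0).1.trans (hτ 0).2
  set J := jumpSum d τ with hJ
  have hα'i := hα'.intervalIntegrable (μ := volume) 0 T
  have hαc : Continuous α := continuous_iff_continuousAt.2 fun t => (hα t).continuousAt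
  have hJα' := intervalIntegrable_jumpSum_mul (τ := τ) hd hα'i
  simp only [← hJ] at hJα'
  obtain ⟨B', hB'⟩ := isCompact_Icc.exists_bound_of_continuousOn (s := Icc 0 T) hαc.continuousOn
  have hs3 : Summable fun k => d k * α (τ k) :=
    (summable_mul_of_bounded hd fun k => hB' _ (hτ k)).of_abs
  have hs4 : Summable fun k => (d k * α (τ k)) * J (τ k) :=
    (summable_mul_of_bounded (summable_mul_of_bounded hd fun k => hB' _ (hτ k))
      fun k => abs_jumpSum_le hd (τ k)).of_abs
  have hs5 : Summable fun k => d k ^ 2 * α (τ k) := by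
    have : ∀ k, |d k| ≤ ∑' k, |d k| := fun k => hd.le_tsum k fun j _ => abs_nonneg _
    have := (summable_mul_of_bounded (summable_mul_of_bounded hd fun k => hB' _ (hτ k)) this).of_abs
    refine this.congr fun k => ?_
    ring
  -- The formula for jump sums is applied to α' cut off below s; the cut-off turns the lower limit
  -- τ_l into max(τ_l, s).
  have htail : ∀ s ∈ Icc 0 T, ∫ t in s..T, J t * α' t = -∑' l, d l * α (max (τ l) s) := by
    intro s hs
    have hG : IntervalIntegrable (fun t => if s < t then α' t else 0) volume 0 T := by
      rw [intervalIntegrable_iff] at hα'i ⊢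
      exact Integrable.indicator hα'i (measurableSet_Ioi (a := s))
    have hval : ∀ (K : ℝ → ℝ) (a : ℝ), a ∈ Icc 0 T →
        ∫ t in a..T, (if s < t then K t else 0) = ∫ t in (max a s)..T, K t := by
      intro K a ha
      rw [intervalIntegral.integral_of_le ha.2, intervalIntegral.integral_of_le (max_le ha.2 hs.2),
        ← integral_indicator measurableSet_Ioc, ← integral_indicator measurableSet_Ioc]
      congr 1
      ext t
      simp only [indicator, mem_Ioc, max_lt_iff]
      by_cases h1 : s < t <;> simp [h1]
    have h1 := integral_jumpSum_mul hd hτ hG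
    have h2 : ∫ t in (0 : ℝ)..T, jumpSum d τ t * (if s < t then α' t else 0)
        = ∫ t in s..T, J t * α' t := by
      rw [← max_eq_right hs.1, ← hval _ 0 ⟨le_rfl, hT⟩, max_eq_right hs.1]
      congr 1
      ext t
      split_ifs <;> simp [hJ]
    rw [← h2, h1, ← tsum_neg]
    congr 1
    ext l
    rw [hval _ _ (hτ l), intervalIntegral.integral_eq_sub_of_hasDerivAt (fun x _ => hα x)
      (hα'.intervalIntegrable _ _), hαT]
    ring
  have hprod : Summable fun p : ℕ × ℕ => if τ p.1 ≤ τ p.2 then d p.1 * (d p.2 * α (τ p.2)) else 0 := by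
    have hsabs : Summable fun k => |d k * α (τ k)| :=
      summable_mul_of_bounded hd fun k => hB' _ (hτ k)
    have hb : Summable fun p : ℕ × ℕ => |d p.1| * |d p.2 * α (τ p.2)| :=
      Summable.mul_of_nonneg hd hsabs
        (fun k => abs_nonneg (d k)) fun k => abs_nonneg (d k * α (τ k))
    refine Summable.of_norm_bounded hb fun p => ?_
    split_ifs
    · rw [norm_mul, Real.norm_eq_abs, Real.norm_eq_abs]
    · rw [norm_zero]; exact mul_nonneg (abs_nonneg _) (abs_nonneg _)
  have hswap : ∑' k, ∑' l, (if τ k ≤ τ l then d k * (d l * α (τ l)) else 0)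
      = ∑' k, (d k * α (τ k)) * J (τ k) := by
    have hc := Summable.tsum_comm
      (f := fun k l => if τ k ≤ τ l then d k * (d l * α (τ l)) else 0) hprod
    rw [← hc]
    congr 1
    ext l
    rw [hJ, jumpSum, ← tsum_mul_left]
    congr 1
    ext k
    split_ifs <;> ring
  have hrow : ∀ k, d k * (∑' l, d l * α (max (τ l) (τ k)))
      = (∑' l, (if τ k ≤ τ l then d k * (d l * α (τ l)) else 0)) + (d k * α (τ k)) * J (τ k)
        - d k ^ 2 * α (τ k) := by
    intro k
    have e3 : d k ^ 2 * α (τ k) = ∑' l, if l = k then d k ^ 2 * α (τ k) else 0 := by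
      rw [tsum_ite_eq]
    have es3 : Summable fun l => if l = k then d k ^ 2 * α (τ k) else 0 :=
      (hasSum_ite_eq k _).summable
    have es1 : Summable fun l => if τ k ≤ τ l then d k * (d l * α (τ l)) else 0 :=
      hprod.prod_factor k
    have es2 : Summable fun l => (d k * α (τ k)) * if τ l ≤ τ k then d l else 0 :=
      (summable_jump hd (τ k)).mul_left _
    rw [hJ, jumpSum, ← tsum_mul_left, ← tsum_mul_left, e3, ← es1.tsum_add es2,
      ← (es1.add es2).tsum_sub es3]
    congr 1
    ext l
    by_cases hlk : l = k
    · subst hlk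
      simp
      ring
    · rw [if_neg hlk]
      by_cases hk0 : d k = 0
      · simp [hk0]
      by_cases hl0 : d l = 0
      · simp [hl0]
      have hne := hinj l k hlk hl0 hk0
      rcases lt_or_gt_of_ne hne with h | h
      · rw [max_eq_right h.le, if_neg (not_le.2 h), if_pos h.le]; ring
      · rw [max_eq_left h.le, if_pos h.le, if_neg (not_le.2 h)]; ring
  rw [hJ, integral_jumpSum_mul hd hτ hJα', ← hJ]
  have : ∀ k, d k * ∫ t in (τ k)..T, J t * α' t
      = -((∑' l, (if τ k ≤ τ l then d k * (d l * α (τ l)) else 0)) + (d k * α (τ k)) * J (τ k)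
        - d k ^ 2 * α (τ k)) := fun k => by
    rw [htail _ (hτ k), mul_neg, hrow]
  simp_rw [this]
  have hs6 : Summable fun k => ∑' l, (if τ k ≤ τ l then d k * (d l * α (τ l)) else 0) := hprod.prod
  rw [tsum_neg, (hs6.add hs4).tsum_sub hs5, hs6.tsum_add hs4, hswap]
  ring

/-- The renormalized version of `integral_jump_mul_deriv`: if the function vanishes right after each
of its jumps, then its square jumps by `-(d k)²`. -/
theorem integral_jump_sq_mul_deriv (hd : Summable fun k => |d k|) (hτ : ∀ k, τ k ∈ Icc 0 T)
    (hinj : ∀ k l, k ≠ l → d k ≠ 0 → d l ≠ 0 → τ k ≠ τ l)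
    (hH : IntervalIntegrable H volume 0 T) (hα : ∀ t, HasDerivAt α (α' t) t)
    (hα' : Continuous α') (hαT : α T = 0)
    (hzero : ∀ k, d k ≠ 0 → (g + ∫ r in (0 : ℝ)..(τ k), H r) - jumpSum d τ (τ k) = 0) :
    ∫ t in (0 : ℝ)..T, ((g + ∫ r in (0 : ℝ)..t, H r) - jumpSum d τ t) ^ 2 * α' t
      = -(g ^ 2 * α 0)
        - 2 * (∫ t in (0 : ℝ)..T, ((g + ∫ r in (0 : ℝ)..t, H r) - jumpSum d τ t) * (H t * α t))
        + ∑' k, d k ^ 2 * α (τ k) := by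
  have hT : 0 ≤ T := (hτ 0).1.trans (hτ 0).2
  set A : ℝ → ℝ := fun t => g + ∫ r in (0 : ℝ)..t, H r with hA
  set J := jumpSum d τ with hJ
  have hAc : ContinuousOn A (uIcc 0 T) :=
    continuousOn_const.add (intervalIntegral.continuousOn_primitive_interval' hH left_mem_uIcc)
  have hα'i := hα'.intervalIntegrable (μ := volume) 0 T
  have hαc : Continuous α := continuous_iff_continuousAt.2 fun t => (hα t).continuousAt
  have hHα : IntervalIntegrable (fun t => H t * α t) volume 0 T := hH.mul_continuousOn hαc.continuousOn
  have hAα' := hα'i.continuousOn_mul hAc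
  have hAAα' := hAα'.continuousOn_mul hAc
  have hJα' := intervalIntegrable_jumpSum_mul (τ := τ) hd hα'i
  have hJJα' := intervalIntegrable_jumpSum_mul (τ := τ) hd hJα'
  have hJAα' := intervalIntegrable_jumpSum_mul (τ := τ) hd hAα'
  have hAHα := hHα.continuousOn_mul hAc
  have hJHα := intervalIntegrable_jumpSum_mul (τ := τ) hd hHα
  simp only [← hJ] at hJα' hJJα' hJAα' hJHα
  have hαeq : ∀ t, α t = α 0 + ∫ r in (0 : ℝ)..t, α' r := by
    intro t
    rw [intervalIntegral.integral_eq_sub_of_hasDerivAt (fun x _ => hα x) (hα'.intervalIntegrable _ _)]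
    ring
  -- the absolutely continuous part
  have hAA : ∫ t in (0 : ℝ)..T, A t * (A t * α' t)
      = -(g ^ 2 * α 0) - 2 * ∫ t in (0 : ℝ)..T, A t * (H t * α t) := by
    have hp : ∀ t ∈ Icc 0 T, A t * α t = g * α 0 + ∫ s in (0 : ℝ)..t, (H s * α s + A s * α' s) := by
      intro t ht
      have := primitive_mul_primitive (a := g) (b := α 0) hH hα'i ht
      simp_rw [← hαeq] at this
      exact this
    have h1 := primitive_mul_primitive (a := g) (b := g * α 0) hH (hHα.add hAα') ⟨hT, le_rfl⟩
    rw [← hp T ⟨hT, le_rfl⟩, hαT] at h1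
    have h2 : ∫ s in (0 : ℝ)..T, (H s * (g * α 0 + ∫ r in (0 : ℝ)..s, (H r * α r + A r * α' r))
        + (g + ∫ r in (0 : ℝ)..s, H r) * (H s * α s + A s * α' s))
        = ∫ s in (0 : ℝ)..T, (2 * (A s * (H s * α s)) + A s * (A s * α' s)) := by
      refine intervalIntegral.integral_congr fun s hs => ?_
      rw [uIcc_of_le hT] at hs
      change H s * (g * α 0 + ∫ r in (0 : ℝ)..s, (H r * α r + A r * α' r)) + A s * (H s * α s + A s * α' s)
        = 2 * (A s * (H s * α s)) + A s * (A s * α' s)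
      rw [← hp s hs]
      ring
    rw [h2, intervalIntegral.integral_add (hAHα.const_mul 2) hAAα',
      intervalIntegral.integral_const_mul] at h1
    simp only [mul_zero] at h1
    linarith
  -- the mixed part
  have hbA : ∃ B, ∀ t ∈ Icc 0 T, |A t * α t| ≤ B := by
    rw [uIcc_of_le hT] at hAc
    obtain ⟨B, hB⟩ := isCompact_Icc.exists_bound_of_continuousOn (hAc.mul hαc.continuousOn)
    exact ⟨B, hB⟩
  obtain ⟨B, hB⟩ := hbA
  have hs1 : Summable fun k => d k * (A (τ k) * α (τ k)) :=
    (summable_mul_of_bounded hd fun k => hB _ (hτ k)).of_abs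
  have hs2 : Summable fun k => d k * ∫ t in (τ k)..T, H t * α t :=
    (summable_mul_of_bounded hd fun k => abs_integral_tail_le hHα (hτ k)).of_abs
  have hJA : ∫ t in (0 : ℝ)..T, J t * (A t * α' t)
      = -(∑' k, d k * (A (τ k) * α (τ k))) - ∫ t in (0 : ℝ)..T, J t * (H t * α t) := by
    rw [hJ, integral_jumpSum_mul hd hτ hAα', integral_jumpSum_mul hd hτ hHα, ← tsum_neg,
      ← hs1.neg.tsum_sub hs2]
    congr 1
    ext k
    rw [integral_primitive_mul_deriv_tail hH hα hα' hαT (hτ k)]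
    ring
  have hJJ := integral_jumpSum_sq_mul_deriv hd hτ hinj hα hα' hαT
  simp only [← hJ] at hJJ
  have hexp : ∫ t in (0 : ℝ)..T, (A t - J t) ^ 2 * α' t = (∫ t in (0 : ℝ)..T, A t * (A t * α' t))
      - 2 * (∫ t in (0 : ℝ)..T, J t * (A t * α' t)) + ∫ t in (0 : ℝ)..T, J t * (J t * α' t) := by
    rw [← intervalIntegral.integral_const_mul, ← intervalIntegral.integral_sub hAAα' (hJAα'.const_mul 2),
      ← intervalIntegral.integral_add (hAAα'.sub (hJAα'.const_mul 2)) hJJα']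
    congr 1
    ext t
    ring
  have hexp2 : ∫ t in (0 : ℝ)..T, (A t - J t) * (H t * α t) = (∫ t in (0 : ℝ)..T, A t * (H t * α t))
      - ∫ t in (0 : ℝ)..T, J t * (H t * α t) := by
    rw [← intervalIntegral.integral_sub hAHα hJHα]
    congr 1
    ext t
    ring
  -- The function vanishes at each of its jumps, so the primitive equals the jump sum there. The two
  -- cross terms cancel and only the squares of the jumps survive.
  have hz : ∑' k, d k * (A (τ k) * α (τ k)) = ∑' k, (d k * α (τ k)) * J (τ k) := by
    congr 1
    ext k
    by_cases hk : d k = 0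
    · simp [hk]
    · have : A (τ k) = J (τ k) := sub_eq_zero.1 (hzero k hk)
      rw [this]; ring
  rw [hexp, hexp2, hAA, hJA, hJJ, hz]
  ring

end JumpFunctions

/-! ### The time slab over the whole phase space. -/

section SlabMeasure

variable {T : ℝ} {Ω : Set R3} {F : R3 → R3} {Φ : ℝ → Phase → Phase}

/-- `dt dx dv` on `(0, T) × ℝ³ × ℝ³`. -/
def slabMeasure (T : ℝ) : Measure (ℝ × Phase) :=
  ((volume : Measure ℝ).restrict (Ioo 0 T)).prod (volume : Measure Phase)

lemma slabMeasure_eq (T : ℝ) : slabMeasure T = volume.restrict (Ioo 0 T ×ˢ univ) := by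
  rw [slabMeasure, Measure.volume_eq_prod ℝ Phase, ← Measure.prod_restrict, Measure.restrict_univ]

instance isLocallyFiniteMeasure_slabMeasure : IsLocallyFiniteMeasure (slabMeasure T) := by
  rw [slabMeasure_eq]; infer_instance

lemma interiorMeasure_eq_restrict (T : ℝ) (Ω : Set R3) :
    interiorMeasure T Ω = (slabMeasure T).restrict (univ ×ˢ (Ω ×ˢ univ)) := by
  rw [interiorMeasure, phaseMeasure, slabMeasure, ← Measure.prod_restrict, Measure.restrict_univ]

lemma measurableSet_cylinder (hΩ : IsOpen Ω) :
    MeasurableSet ((univ : Set ℝ) ×ˢ (Ω ×ˢ (univ : Set R3))) :=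
  (isOpen_univ.prod (hΩ.prod isOpen_univ)).measurableSet

lemma integral_interiorMeasure {G : ℝ × Phase → ℝ}
    (hG : ∀ p, p.2.1 ∉ Ω → G p = 0) :
    ∫ p, G p ∂interiorMeasure T Ω = ∫ p, G p ∂slabMeasure T := by
  rw [interiorMeasure_eq_restrict, setIntegral_eq_integral_of_forall_compl_eq_zero]
  intro p hp
  exact hG p fun h => hp ⟨mem_univ _, h, mem_univ _⟩

lemma integral_phaseMeasure {G : Phase → ℝ} (hG : ∀ z, z.1 ∉ Ω → G z = 0) :
    ∫ z, G z ∂phaseMeasure Ω = ∫ z, G z := by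
  rw [phaseMeasure, setIntegral_eq_integral_of_forall_compl_eq_zero]
  intro p hp
  exact hG p fun h => hp ⟨h, mem_univ _⟩

lemma integral_slab_eq {G : ℝ × Phase → ℝ} (hT : 0 ≤ T) (hG : Integrable G (slabMeasure T)) :
    ∫ p, G p ∂slabMeasure T = ∫ y, ∫ t in (0 : ℝ)..T, G (t, y) := by
  rw [slabMeasure, integral_prod_symm _ hG]
  congr 1
  ext y
  rw [intervalIntegral.integral_of_le hT, integral_Ioc_eq_integral_Ioo]

end SlabMeasure

/-! ### Flow coordinates, in which transport is differentiation in time. -/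

section FlowCoordinates

variable {T : ℝ} {Ω : Set R3} {F : R3 → R3} {Φ : ℝ → Phase → Phase}

/-- The change of variables `(t, y) ↦ (t, Φ t y)`. -/
def IsPhaseFlow.straighten (hΦ : IsPhaseFlow F Φ) : (ℝ × Phase) ≃ₜ (ℝ × Phase) where
  toFun p := (p.1, Φ p.1 p.2)
  invFun p := (p.1, Φ (-p.1) p.2)
  left_inv p := by simp [hΦ.neg_apply_apply]
  right_inv p := by simp [hΦ.apply_neg_apply]
  continuous_toFun := continuous_fst.prodMk hΦ.continuous_uncurry
  continuous_invFun := continuous_fst.prodMk hΦ.continuous_backward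

lemma IsPhaseFlow.straighten_apply (hΦ : IsPhaseFlow F Φ) (p : ℝ × Phase) :
    hΦ.straighten p = (p.1, Φ p.1 p.2) := rfl

lemma IsPhaseFlow.straighten_symm_apply (hΦ : IsPhaseFlow F Φ) (p : ℝ × Phase) :
    hΦ.straighten.symm p = (p.1, Φ (-p.1) p.2) := rfl

lemma IsPhaseFlow.measurePreserving_straighten (hΦ : IsPhaseFlow F Φ) :
    MeasurePreserving hΦ.straighten (slabMeasure T) (slabMeasure T) := by
  rw [slabMeasure_eq]
  exact hΦ.measurePreserving_skew.restrict_preimage (s := Ioo 0 T ×ˢ univ)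
    (measurableSet_Ioo.prod MeasurableSet.univ)

lemma IsPhaseFlow.integral_comp_straighten (hΦ : IsPhaseFlow F Φ) (G : ℝ × Phase → ℝ) :
    ∫ p, G (hΦ.straighten p) ∂slabMeasure T = ∫ p, G p ∂slabMeasure T :=
  hΦ.measurePreserving_straighten.integral_comp hΦ.straighten.measurableEmbedding G

lemma IsPhaseFlow.hasDerivAt_comp (hΦ : IsPhaseFlow F Φ) {φ : ℝ × Phase → ℝ}
    (hφ : Differentiable ℝ φ) (y : Phase) (t : ℝ) :
    HasDerivAt (fun s => φ (s, Φ s y)) (transportOp F φ (t, Φ t y)) t :=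
  HasFDerivAt.comp_hasDerivAt (f := fun s : ℝ => (s, Φ s y)) t (hφ _).hasFDerivAt
    ((hasDerivAt_id t).prodMk (hΦ.hasDerivAt t y))

lemma IsPhaseFlow.contDiff_straighten_symm (hΦ : IsPhaseFlow F Φ) :
    ContDiff ℝ 1 hΦ.straighten.symm :=
  contDiff_fst.prodMk (hΦ.contDiff.comp (contDiff_fst.neg.prodMk contDiff_snd))

/-- Along s ↦ (s, Φ s y) the composed function is s ↦ α(s, y). Differentiating it in both
descriptions gives the identity. -/
lemma IsPhaseFlow.transportOp_comp_symm (hΦ : IsPhaseFlow F Φ) {α : ℝ × Phase → ℝ}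
    (hα : ContDiff ℝ 1 α) (p : ℝ × Phase) :
    transportOp F (α ∘ hΦ.straighten.symm) (hΦ.straighten p) = fderiv ℝ α p (1, 0) := by
  have h1 := hΦ.hasDerivAt_comp ((hα.comp hΦ.contDiff_straighten_symm).differentiable one_ne_zero)
    p.2 p.1
  have h2 : (fun s => (α ∘ hΦ.straighten.symm) (s, Φ s p.2)) = fun s => α (s, p.2) := by
    ext s
    simp [hΦ.straighten_symm_apply, hΦ.neg_apply_apply]
  rw [h2] at h1
  have h3 : HasDerivAt (fun s => α (s, p.2)) (fderiv ℝ α p (1, 0)) p.1 :=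
    HasFDerivAt.comp_hasDerivAt (f := fun s : ℝ => (s, p.2)) p.1
      (hα.differentiable one_ne_zero _).hasFDerivAt ((hasDerivAt_id _).prodMk (hasDerivAt_const _ _))
  exact h1.unique h3

lemma IsPhaseFlow.tsupport_comp_symm_subset (hΦ : IsPhaseFlow F Φ) {α : ℝ × Phase → ℝ}
    (hα : tsupport α ⊆ Iio T ×ˢ univ) : tsupport (α ∘ hΦ.straighten.symm) ⊆ Iio T ×ˢ univ := by
  rw [tsupport_comp_eq_preimage]
  intro p hp
  exact ⟨(hα hp).1, mem_univ _⟩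

lemma transportOp_congr {E : R3 → R3} (hEF : EqOn E F (closure Ω)) (φ : ℝ × Phase → ℝ)
    {p : ℝ × Phase} (hp : p.2.1 ∈ closure Ω) : transportOp E φ p = transportOp F φ p := by
  rw [transportOp, transportOp, hEF hp]

/-- The negative primitive in time of a compactly supported function. -/
lemma exists_time_primitive {c : ℝ × Phase → ℝ} (hc : ContDiff ℝ 1 c) (hcs : HasCompactSupport c)
    (hT : 0 < T) (hsupp : tsupport c ⊆ Ioo 0 T ×ˢ univ) :
    ∃ α : ℝ × Phase → ℝ, ContDiff ℝ 1 α ∧ HasCompactSupport α ∧ tsupport α ⊆ Iio T ×ˢ univ ∧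
      ∀ p : ℝ × Phase, 0 < p.1 → fderiv ℝ α p (1, 0) = c p := by
  -- The primitive is α(t, y) = -∫ c(s, y) ds over [t, t + T]. Writing it as a convolution with this
  -- measure gives C¹ regularity at once. The window of length T keeps the support compact, while
  -- for t > 0 its upper end lies beyond the support of c and does not contribute to ∂ₜα.
  set μ : Measure (ℝ × Phase) := ((volume : Measure ℝ).restrict (Icc (-T) 0)).prod
    (Measure.dirac (0 : Phase)) with hμ
  set α : ℝ × Phase → ℝ := convolution (fun _ => (-1 : ℝ)) c (ContinuousLinearMap.mul ℝ ℝ) μ with hα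
  have hαC : ContDiff ℝ 1 α := by
    refine HasCompactSupport.contDiff_convolution_right (n := 1) _ hcs ?_ hc
    exact (integrable_const _).locallyIntegrable
  have hval : ∀ p : ℝ × Phase, α p = -∫ s in p.1..(p.1 + T), c (s, p.2) := by
    intro p
    have hcont : Continuous fun s : ℝ × Phase => c (p - s) := hc.continuous.comp (by fun_prop)
    have h1 : α p = -∫ s in Icc (-T) 0, c (p - (s, 0)) := by
      simp only [hα, convolution_def, ContinuousLinearMap.mul_apply', neg_mul, one_mul]
      rw [integral_neg, hμ, integral_prod]
      · simp
      · exact hcont.integrable_of_hasCompactSupport (hcs.comp_homeomorph (Homeomorph.subLeft p))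
    rw [h1, integral_Icc_eq_integral_Ioc, ← intervalIntegral.integral_of_le (by linarith)]
    have := intervalIntegral.integral_comp_sub_left (fun s => c (s, p.2)) p.1 (a := -T) (b := 0)
    simp only [sub_zero, sub_neg_eq_add] at this
    rw [← this]
    congr 2
    ext s
    congr 1
    ext <;> simp
  set K : Set (ℝ × Phase) := (fun q : (ℝ × Phase) × ℝ => q.1 - (q.2, 0)) '' (tsupport c ×ˢ Icc 0 T)
    with hK
  have hKc : IsCompact K := (hcs.isCompact.prod isCompact_Icc).image (by fun_prop)
  have hK0 : ∀ p ∉ K, α p = 0 := by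
    intro p hp
    rw [hval, neg_eq_zero]
    refine intervalIntegral.integral_zero_ae (Filter.Eventually.of_forall fun s hs => ?_)
    rw [uIoc_of_le (by linarith)] at hs
    by_contra h
    refine hp ⟨((s, p.2), s - p.1), ⟨subset_tsupport _ h, ?_, ?_⟩, ?_⟩
    · linarith [hs.1]
    · linarith [hs.2]
    · ext <;> simp
  refine ⟨α, hαC, HasCompactSupport.intro hKc hK0, ?_, ?_⟩
  · have h1 : tsupport α ⊆ K := closure_minimal (fun p hp => by
      by_contra h
      exact hp (hK0 p h)) hKc.isClosed
    refine h1.trans ?_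
    rintro _ ⟨⟨q, s⟩, ⟨hq, hs⟩, rfl⟩
    refine ⟨?_, mem_univ _⟩
    have := (hsupp hq).1.2
    have := hs.1
    simp only [Prod.fst_sub, mem_Iio]
    linarith
  · intro p hp
    have h3 : HasDerivAt (fun s => α (s, p.2)) (fderiv ℝ α p (1, 0)) p.1 :=
      HasFDerivAt.comp_hasDerivAt (f := fun s : ℝ => (s, p.2)) p.1
        (hαC.differentiable one_ne_zero _).hasFDerivAt ((hasDerivAt_id _).prodMk (hasDerivAt_const _ _))
    have hcc : Continuous fun s => c (s, p.2) := hc.continuous.comp (by fun_prop)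
    have h4 : HasDerivAt (fun s => α (s, p.2)) (c p) p.1 := by
      have he : (fun s => α (s, p.2))
          = fun s => (∫ r in (0 : ℝ)..s, c (r, p.2)) - ∫ r in (0 : ℝ)..(s + T), c (r, p.2) := by
        ext s
        rw [hval, ← intervalIntegral.integral_interval_sub_left (hcc.intervalIntegrable _ _)
          (hcc.intervalIntegrable _ _)]
        ring
      have h5 : ∀ s, HasDerivAt (fun s => ∫ r in (0 : ℝ)..s, c (r, p.2)) (c (s, p.2)) s := fun s =>
        intervalIntegral.integral_hasDerivAt_right (hcc.intervalIntegrable _ _)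
          (hcc.stronglyMeasurableAtFilter _ _) hcc.continuousAt
      have h6 : c (p.1 + T, p.2) = 0 := by
        by_contra h
        have := (hsupp (subset_tsupport _ h)).1.2
        simp only at this
        linarith
      rw [he]
      have h7 := (h5 p.1).sub ((h5 (p.1 + T)).comp_add_const p.1 T)
      rw [h6, sub_zero] at h7
      exact h7
    exact h3.unique h4

end FlowCoordinates

/-! ### Local finiteness of the outgoing flux and integration over exits. -/

section OutMeasure

variable {T : ℝ} {Ω : Set R3}

lemma IsSmoothConvexDomain.norm_outerNormal_le_one (hΩ : IsSmoothConvexDomain Ω) (x : R3) :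
    ‖outerNormal Ω x‖ ≤ 1 := by
  by_cases hx : x ∈ frontier Ω
  · exact (hΩ.norm_outerNormal hx).le
  · rw [outerNormal, dif_neg fun h => hx h.1]
    simp

/-- The boundary has finite area and the density |n · v| ≤ |v| is bounded on balls of velocities. -/
lemma IsSmoothConvexDomain.isLocallyFiniteMeasure_outMeasure (hΩ : IsSmoothConvexDomain Ω) (T : ℝ) :
    IsLocallyFiniteMeasure (outMeasure T Ω) := by
  have := hΩ.isFiniteMeasure_surface
  have : SFinite (boundaryMeasure Ω) := by unfold boundaryMeasure; infer_instance
  refine ⟨fun p => ⟨univ ×ˢ (univ ×ˢ Metric.ball 0 (‖p.2.2‖ + 1)), ?_, ?_⟩⟩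
  · refine (isOpen_univ.prod (isOpen_univ.prod Metric.isOpen_ball)).mem_nhds ⟨mem_univ _, mem_univ _, ?_⟩
    simp
  · rw [outMeasure, Measure.prod_prod]
    refine ENNReal.mul_lt_top (by simp) ((Measure.restrict_apply_le _ _).trans_lt ?_)
    have hm : MeasurableSet ((univ : Set R3) ×ˢ Metric.ball (0 : R3) (‖p.2.2‖ + 1)) :=
      (isOpen_univ.prod Metric.isOpen_ball).measurableSet
    rw [boundaryMeasure, withDensity_apply _ hm]
    refine (setLIntegral_mono' (g := fun _ => ENNReal.ofReal (‖p.2.2‖ + 1)) hm fun z hz => ?_).trans_lt ?_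
    · refine ENNReal.ofReal_le_ofReal ((abs_real_inner_le_norm _ _).trans ?_)
      have h1 := hΩ.norm_outerNormal_le_one z.1
      have h2 : ‖z.2‖ ≤ ‖p.2.2‖ + 1 := by simpa using (mem_ball_zero_iff.1 hz.2).le
      nlinarith [norm_nonneg z.2, norm_nonneg (outerNormal Ω z.1)]
    · rw [setLIntegral_const, Measure.prod_prod]
      exact ENNReal.mul_lt_top ENNReal.ofReal_lt_top
        (ENNReal.mul_lt_top (measure_lt_top _ _) measure_ball_lt_top)

/-- Integration against a countable sum of images of restricted measures, as an iterated
sum. -/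
lemma integral_sum_map {X Z : Type*} [MeasurableSpace X] [MeasurableSpace Z] {μ : Measure X}
    {ν : Measure Z} {Y : ℕ → Set X} {e : ℕ → X → Z} (hY : ∀ k, MeasurableSet (Y k))
    (he : ∀ k, Measurable (e k)) (hν : ν = Measure.sum fun k => (μ.restrict (Y k)).map (e k))
    {K : Z → ℝ} (hK : Measurable K) (hKi : Integrable K ν) :
    (∀ᵐ y ∂μ, Summable fun k => |(Y k).indicator (fun y => K (e k y)) y|) ∧
    Integrable (fun y => ∑' k, |(Y k).indicator (fun y => K (e k y)) y|) μ ∧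
    Integrable (fun y => ∑' k, (Y k).indicator (fun y => K (e k y)) y) μ ∧
    ∫ p, K p ∂ν = ∫ y, ∑' k, (Y k).indicator (fun y => K (e k y)) y ∂μ := by
  set f : ℕ → X → ℝ := fun k => (Y k).indicator (fun y => K (e k y)) with hf
  have hfm : ∀ k, Measurable (f k) := fun k => (hK.comp (he k)).indicator (hY k)
  have hfin : ∑' k, ∫⁻ y, ‖f k y‖ₑ ∂μ ≠ ∞ := by
    have h1 := hKi.2
    rw [HasFiniteIntegral, hν, lintegral_sum_measure] at h1
    convert h1.ne using 3 with k
    rw [lintegral_map hK.enorm (he k), ← lintegral_indicator (hY k)]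
    congr 1
    ext y
    by_cases hy : y ∈ Y k <;> simp [hf, hy]
  have hlt : ∫⁻ y, ∑' k, ‖f k y‖ₑ ∂μ < ∞ := by
    rw [lintegral_tsum fun k => (hfm k).enorm.aemeasurable]
    exact hfin.lt_top
  have hsum : ∀ᵐ y ∂μ, Summable fun k => |f k y| := by
    filter_upwards [ae_lt_top (Measurable.tsum fun k => (hfm k).enorm) hlt.ne] with y hy
    have : Summable fun k => ‖f k y‖₊ := ENNReal.tsum_coe_ne_top_iff_summable.1 hy.ne
    exact NNReal.summable_coe.2 this
  have habs : Integrable (fun y => ∑' k, |f k y|) μ := by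
    refine ⟨(Measurable.tsum fun k => (hfm k).abs).aestronglyMeasurable, ?_⟩
    rw [HasFiniteIntegral]
    refine lt_of_le_of_lt (lintegral_mono_ae ?_) hlt
    filter_upwards [hsum] with y hy
    rw [Real.enorm_of_nonneg (tsum_nonneg fun k => abs_nonneg _),
      ENNReal.ofReal_tsum_of_nonneg (fun k => abs_nonneg _) hy]
    refine ENNReal.tsum_le_tsum fun k => ?_
    rw [← Real.norm_eq_abs, ofReal_norm]
  refine ⟨hsum, habs, ?_, ?_⟩
  · refine habs.mono' (Measurable.tsum hfm).aestronglyMeasurable ?_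
    filter_upwards [hsum] with y hy
    exact norm_tsum_le_tsum_norm hy
  · rw [integral_tsum (fun k => (hfm k).aestronglyMeasurable) hfin]
    conv_lhs => rw [hν]
    rw [hν] at hKi
    rw [integral_sum_measure hKi]
    congr 1
    ext k
    rw [integral_map (he k).aemeasurable hK.aestronglyMeasurable, ← integral_indicator (hY k)]

end OutMeasure

/-- `z` is a weak solution of `∂ₜ z + v · ∇ₓ z + E · ∇ᵥ z = h` in `(0, T) × Ω × ℝ³` with
`z(0, ·) = g`, zero inflow, and trace `d` on `(0, T) × Γ₊`. -/
structure IsTransportSolution (T : ℝ) (Ω : Set R3) (E : R3 → R3) (h z d : ℝ × Phase → ℝ)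
    (g : Phase → ℝ) : Prop where
  memLp_source : MemLp h 2 (interiorMeasure T Ω)
  memLp : MemLp z 2 (interiorMeasure T Ω)
  memLp_trace : MemLp d 2 (outMeasure T Ω)
  memLp_initial : MemLp g 2 (phaseMeasure Ω)
  weak_eq : ∀ φ : ℝ × Phase → ℝ, ContDiff ℝ 1 φ → HasCompactSupport φ →
    tsupport φ ⊆ Iio T ×ˢ univ →
    ∫ p, z p * transportOp E φ p ∂interiorMeasure T Ω
      = ∫ p, d p * φ p ∂outMeasure T Ω - ∫ p, h p * φ p ∂interiorMeasure T Ω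
        - ∫ y, g y * φ (0, y) ∂phaseMeasure Ω

/-! ### Values of a solution along trajectories, with measurability and integrability. -/

section Characteristics

variable {T : ℝ} {Ω : Set R3} {E F : R3 → R3} {Φ : ℝ → Phase → Phase}

/-- The exits of the trajectories of `Φ` from `Ω` in the time interval `(0, T)`: the trajectories
starting in `Y k` exit at time `τ k`, and these exits account for the measure `dt dσ`. -/
structure IsExitFamily (T : ℝ) (Ω : Set R3) (Φ : ℝ → Phase → Phase) (Y : ℕ → Set Phase)
    (τ : ℕ → Phase → ℝ) : Prop where
  measurableSet : ∀ k, MeasurableSet (Y k)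
  measurable : ∀ k, Measurable (τ k)
  mem : ∀ k, ∀ y ∈ Y k, τ k y ∈ Ioo 0 T ∧ Φ (τ k y) y ∈ GammaPlus Ω
  ne : ∀ k l, k ≠ l → ∀ y, y ∈ Y k → y ∈ Y l → τ k y ≠ τ l y
  outMeasure_eq : outMeasure T Ω
    = Measure.sum fun k => (volume.restrict (Y k)).map fun y => (τ k y, Φ (τ k y) y)

variable {Y : ℕ → Set Phase} {τ : ℕ → Phase → ℝ}

/-- The values of `d` at the exits of the trajectory of `y`. -/
def exitValue (Φ : ℝ → Phase → Phase) (Y : ℕ → Set Phase) (τ : ℕ → Phase → ℝ) (d : ℝ × Phase → ℝ)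
    (y : Phase) (k : ℕ) : ℝ :=
  (Y k).indicator (fun y => d (τ k y, Φ (τ k y) y)) y

/-- The exit times of the trajectory of `y`, with value `0` for a missing exit. -/
def exitTime (Y : ℕ → Set Phase) (τ : ℕ → Phase → ℝ) (y : Phase) (k : ℕ) : ℝ :=
  (Y k).indicator (τ k) y

/-- The solution along the trajectory of `y`, computed from the initial value, the source and the
outgoing trace. -/
def trajectoryValue (Φ : ℝ → Phase → Phase) (Y : ℕ → Set Phase) (τ : ℕ → Phase → ℝ)
    (h d : ℝ × Phase → ℝ) (g : Phase → ℝ) (p : ℝ × Phase) : ℝ :=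
  (g p.2 + ∫ r in (0 : ℝ)..p.1, h (r, Φ r p.2)) - jumpSum (exitValue Φ Y τ d p.2) (exitTime Y τ p.2) p.1

lemma IsExitFamily.exitTime_mem (hY : IsExitFamily T Ω Φ Y τ) (hT : 0 < T) (y : Phase) (k : ℕ) :
    exitTime Y τ y k ∈ Icc 0 T := by
  by_cases hy : y ∈ Y k
  · simp only [exitTime, indicator_of_mem hy]
    exact Ioo_subset_Icc_self (hY.mem k y hy).1
  · simp [exitTime, hy, hT.le]

lemma IsExitFamily.measurable_exit (hY : IsExitFamily T Ω Φ Y τ) (hΦ : IsPhaseFlow F Φ) (k : ℕ) :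
    Measurable fun y => (τ k y, Φ (τ k y) y) :=
  (hY.measurable k).prodMk (hΦ.continuous_uncurry.measurable.comp ((hY.measurable k).prodMk measurable_id))

/-- An oriented integral is a difference of integrals of indicators over measurable sets that depend
on the upper limit; measurability then follows from that of parameter integrals. -/
lemma measurable_time_primitive {H : ℝ × Phase → ℝ} (hH : Measurable H) :
    Measurable fun p : ℝ × Phase => ∫ r in (0 : ℝ)..p.1, H (r, p.2) := by
  have key : ∀ S : Set ((ℝ × Phase) × ℝ), MeasurableSet S →
      Measurable fun p : ℝ × Phase => ∫ r, S.indicator (fun q => H (q.2, q.1.2)) (p, r) := by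
    intro S hS
    refine StronglyMeasurable.measurable ?_
    exact StronglyMeasurable.integral_prod_right'
      (f := S.indicator (fun q => H (q.2, q.1.2)))
      ((hH.comp (by fun_prop : Measurable fun q : (ℝ × Phase) × ℝ => (q.2, q.1.2))).indicator hS).stronglyMeasurable
  have h1 := key ({q | 0 < q.2} ∩ {q | q.2 ≤ q.1.1}) ((measurableSet_lt measurable_const
    measurable_snd).inter (measurableSet_le measurable_snd (measurable_fst.comp measurable_fst)))
  have h2 := key ({q | q.1.1 < q.2} ∩ {q | q.2 ≤ 0}) ((measurableSet_lt (measurable_fst.comp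
    measurable_fst) measurable_snd).inter (measurableSet_le measurable_snd measurable_const))
  convert h1.sub h2 using 2 with p
  rw [intervalIntegral, ← integral_indicator measurableSet_Ioc, ← integral_indicator measurableSet_Ioc]
  rfl

lemma IsExitFamily.measurable_exitValue (hY : IsExitFamily T Ω Φ Y τ) (hΦ : IsPhaseFlow F Φ)
    {d : ℝ × Phase → ℝ} (hd : Measurable d) (k : ℕ) : Measurable fun y => exitValue Φ Y τ d y k :=
  (hd.comp (hY.measurable_exit hΦ k)).indicator (hY.measurableSet k)

lemma IsExitFamily.measurable_trajectoryValue (hY : IsExitFamily T Ω Φ Y τ) (hΦ : IsPhaseFlow F Φ)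
    {h d : ℝ × Phase → ℝ} {g : Phase → ℝ} (hh : Measurable h) (hd : Measurable d)
    (hg : Measurable g) : Measurable (trajectoryValue Φ Y τ h d g) := by
  refine ((hg.comp measurable_snd).add (measurable_time_primitive
    (H := fun p => h (p.1, Φ p.1 p.2)) (hh.comp hΦ.straighten.continuous.measurable))).sub ?_
  refine Measurable.tsum fun k => Measurable.ite (measurableSet_le ?_ measurable_fst)
    ((hY.measurable_exitValue hΦ hd k).comp measurable_snd) measurable_const
  exact ((hY.measurable k).indicator (hY.measurableSet k)).comp measurable_snd

/-- Dominating function for `trajectoryValue`. -/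
def trajectoryBound (T : ℝ) (Φ : ℝ → Phase → Phase) (Y : ℕ → Set Phase) (τ : ℕ → Phase → ℝ)
    (h d : ℝ × Phase → ℝ) (g : Phase → ℝ) (y : Phase) : ℝ :=
  |g y| + (∫ t in Ioo 0 T, ‖h (t, Φ t y)‖) + ∑' k, |exitValue Φ Y τ d y k|

/-- Measurable data of a solution, vanishing outside `Ω`. -/
structure IsRegularData (T : ℝ) (Ω : Set R3) (h z d : ℝ × Phase → ℝ) (g : Phase → ℝ) : Prop where
  measurable_source : Measurable h
  measurable : Measurable z
  measurable_trace : Measurable d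
  measurable_initial : Measurable g
  source_eq_zero : ∀ p, p.2.1 ∉ Ω → h p = 0
  eq_zero : ∀ p, p.2.1 ∉ Ω → z p = 0
  initial_eq_zero : ∀ y, y.1 ∉ Ω → g y = 0

variable {h z d : ℝ × Phase → ℝ} {g : Phase → ℝ}

lemma memLp_slab_of_interior (hΩ : IsOpen Ω) {G : ℝ × Phase → ℝ}
    (hG0 : ∀ p, p.2.1 ∉ Ω → G p = 0) (hG : MemLp G 2 (interiorMeasure T Ω)) :
    MemLp G 2 (slabMeasure T) := by
  rw [interiorMeasure_eq_restrict, ← memLp_indicator_iff_restrict (measurableSet_cylinder hΩ)] at hG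
  convert hG using 1
  ext p
  by_cases hp : p ∈ (univ : Set ℝ) ×ˢ (Ω ×ˢ (univ : Set R3))
  · rw [indicator_of_mem hp]
  · rw [indicator_of_notMem hp]
    exact hG0 p fun h => hp ⟨mem_univ _, h, mem_univ _⟩

lemma memLp_volume_of_phase (hΩ : IsOpen Ω) {G : Phase → ℝ}
    (hG0 : ∀ y, y.1 ∉ Ω → G y = 0) (hG : MemLp G 2 (phaseMeasure Ω)) : MemLp G 2 volume := by
  rw [phaseMeasure, ← memLp_indicator_iff_restrict (hΩ.prod isOpen_univ).measurableSet] at hG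
  have hGe : (Ω ×ˢ univ : Set Phase).indicator G = G := by
    funext p
    by_cases hp : p ∈ (Ω ×ˢ univ : Set Phase)
    · rw [indicator_of_mem hp]
    · rw [indicator_of_notMem hp]
      exact (hG0 p fun h => hp ⟨h, mem_univ _⟩).symm
  rwa [hGe] at hG

lemma slabMeasure_restrict (K : Set Phase) :
    (slabMeasure T).restrict (univ ×ˢ K) = ((volume : Measure ℝ).restrict (Ioo 0 T)).prod
      ((volume : Measure Phase).restrict K) := by
  rw [slabMeasure, ← Measure.prod_restrict, Measure.restrict_univ]

lemma slabMeasure_restrict_Icc (K : Set Phase) :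
    (slabMeasure T).restrict (univ ×ˢ K) = (slabMeasure T).restrict (Icc 0 T ×ˢ K) := by
  rw [slabMeasure_restrict, slabMeasure, ← Measure.prod_restrict,
    Measure.restrict_restrict measurableSet_Icc, inter_eq_right.2 Ioo_subset_Icc_self]

lemma integrableOn_slab_of_locallyIntegrable {G : ℝ × Phase → ℝ}
    (hG : LocallyIntegrable G (slabMeasure T)) {K : Set Phase} (hK : IsCompact K) :
    Integrable G (((volume : Measure ℝ).restrict (Ioo 0 T)).prod
      ((volume : Measure Phase).restrict K)) := by
  rw [← slabMeasure_restrict, slabMeasure_restrict_Icc]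
  exact hG.integrableOn_isCompact (isCompact_Icc.prod hK)

lemma locallyIntegrable_slab {G : ℝ × Phase → ℝ}
    (hG : ∀ K : Set Phase, IsCompact K → Integrable G (((volume : Measure ℝ).restrict (Ioo 0 T)).prod
      ((volume : Measure Phase).restrict K))) : LocallyIntegrable G (slabMeasure T) := by
  rw [locallyIntegrable_iff]
  intro C hC
  have := hG (Prod.snd '' C) (hC.image continuous_snd)
  rw [← slabMeasure_restrict] at this
  exact IntegrableOn.mono_set this fun p hp => ⟨mem_univ _, p, hp, rfl⟩

lemma ae_of_forall_isCompact {P : Phase → Prop}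
    (hP : ∀ K : Set Phase, IsCompact K → ∀ᵐ y ∂(volume : Measure Phase).restrict K, P y) :
    ∀ᵐ y : Phase, P y := by
  have h1 : ∀ n : ℕ, ∀ᵐ y : Phase, y ∈ Metric.closedBall (0 : Phase) n → P y := fun n =>
    (ae_restrict_iff' measurableSet_closedBall).1 (hP _ (isCompact_closedBall _ _))
  filter_upwards [ae_all_iff.2 h1] with y hy
  obtain ⟨n, hn⟩ := exists_nat_ge ‖y‖
  exact hy n (by simpa using hn)

/-- The exits from a compact set of initial points, for a locally integrable trace. -/
lemma IsExitFamily.summable_exitValue (hY : IsExitFamily T Ω Φ Y τ) (hΦ : IsPhaseFlow F Φ)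
    (hd : Measurable d) (hdi : LocallyIntegrable d (outMeasure T Ω)) {K : Set Phase} (hK : IsCompact K) :
    (∀ᵐ y ∂(volume : Measure Phase).restrict K, Summable fun k => |exitValue Φ Y τ d y k|) ∧
    IntegrableOn (fun y => ∑' k, |exitValue Φ Y τ d y k|) K := by
  -- All exits from initial points in `K` lie in this compact set, swept out by the flow. Truncating
  -- `d` to it changes none of them and makes `d` integrable.
  set C := hΦ.straighten '' (Icc 0 T ×ˢ K) with hC
  have hCc : IsCompact C := (isCompact_Icc.prod hK).image hΦ.straighten.continuous
  have hdom : Integrable (C.indicator d) (outMeasure T Ω) :=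
    (hdi.integrableOn_isCompact hCc).integrable_indicator hCc.measurableSet
  obtain ⟨h1, h2, -, -⟩ := integral_sum_map hY.measurableSet (hY.measurable_exit hΦ)
    hY.outMeasure_eq (hd.indicator hCc.measurableSet) hdom
  have heq : ∀ y ∈ K, ∀ k, (Y k).indicator (fun y => C.indicator d (τ k y, Φ (τ k y) y)) y
      = exitValue Φ Y τ d y k := by
    intro y hy k
    by_cases hyk : y ∈ Y k
    · have : (τ k y, Φ (τ k y) y) ∈ C :=
        ⟨(τ k y, y), ⟨Ioo_subset_Icc_self (hY.mem k y hyk).1, hy⟩, rfl⟩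
      simp only [exitValue, indicator_of_mem hyk, indicator_of_mem this]
    · simp [exitValue, hyk]
  constructor
  · filter_upwards [ae_restrict_of_ae h1, ae_restrict_mem hK.measurableSet] with y hy hyK
    simpa only [heq y hyK] using hy
  · refine h2.integrableOn.congr_fun (fun y hy => ?_) hK.measurableSet
    simp only [heq y hy]

end Characteristics

/-! ### Representation along trajectories and the equation for the square. -/

section Renormalization

lemma integral_sub_sub {X : Type*} [MeasurableSpace X] {μ : Measure X} {f₁ f₂ f₃ : X → ℝ}
    (h₁ : Integrable f₁ μ) (h₂ : Integrable f₂ μ) (h₃ : Integrable f₃ μ) :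
    ∫ x, (f₁ x - f₂ x - f₃ x) ∂μ = (∫ x, f₁ x ∂μ) - (∫ x, f₂ x ∂μ) - ∫ x, f₃ x ∂μ := by
  have h := integral_sub (h₁.sub h₂) h₃
  simp only [Pi.sub_apply] at h
  rw [h, integral_sub h₁ h₂]

variable {T : ℝ} {Ω : Set R3} {E F : R3 → R3} {Φ : ℝ → Phase → Phase}
  {Y : ℕ → Set Phase} {τ : ℕ → Phase → ℝ} {h z d : ℝ × Phase → ℝ} {g : Phase → ℝ}

lemma memLp_comp_straighten (hΦ : IsPhaseFlow F Φ) {G : ℝ × Phase → ℝ} (hG : MemLp G 2 (slabMeasure T)) :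
    MemLp (fun p : ℝ × Phase => G (p.1, Φ p.1 p.2)) 2 (slabMeasure T) :=
  hG.comp_measurePreserving hΦ.measurePreserving_straighten

lemma ae_intervalIntegrable_of_slab (hT : 0 < T) {G : ℝ × Phase → ℝ}
    (hG : LocallyIntegrable G (slabMeasure T)) :
    ∀ᵐ y : Phase, IntervalIntegrable (fun t => G (t, y)) volume 0 T := by
  refine ae_of_forall_isCompact fun K hK => ?_
  filter_upwards [(integrableOn_slab_of_locallyIntegrable hG hK).prod_left_ae] with y hy
  rw [intervalIntegrable_iff_integrableOn_Ioo_of_le hT.le]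
  exact hy

lemma IsExitFamily.ae_regular (hY : IsExitFamily T Ω Φ Y τ) (hΦ : IsPhaseFlow F Φ)
    (hΩ : IsSmoothConvexDomain Ω) (hT : 0 < T) (hsol : IsTransportSolution T Ω E h z d g)
    (hreg : IsRegularData T Ω h z d g) :
    ∀ᵐ y : Phase, IntervalIntegrable (fun t => h (t, Φ t y)) volume 0 T ∧
      Summable fun k => |exitValue Φ Y τ d y k| := by
  have := hΩ.isLocallyFiniteMeasure_outMeasure T
  have h1 := ae_intervalIntegrable_of_slab hT ((memLp_comp_straighten hΦ (memLp_slab_of_interior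
    hΩ.isOpen hreg.source_eq_zero hsol.memLp_source)).locallyIntegrable one_le_two)
  have h2 : ∀ᵐ y : Phase, Summable fun k => |exitValue Φ Y τ d y k| :=
    ae_of_forall_isCompact fun K hK => (hY.summable_exitValue hΦ hreg.measurable_trace
      (hsol.memLp_trace.locallyIntegrable one_le_two) hK).1
  filter_upwards [h1, h2] with y hy1 hy2 using ⟨hy1, hy2⟩

lemma abs_trajectoryValue_le {y : Phase} (hT : 0 < T)
    (hh : IntervalIntegrable (fun t => h (t, Φ t y)) volume 0 T)
    (hd : Summable fun k => |exitValue Φ Y τ d y k|) {t : ℝ} (ht : t ∈ Ioo 0 T) :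
    |trajectoryValue Φ Y τ h d g (t, y)| ≤ trajectoryBound T Φ Y τ h d g y := by
  have h1 : |∫ r in (0 : ℝ)..t, h (r, Φ r y)| ≤ ∫ t in Ioo 0 T, ‖h (t, Φ t y)‖ := by
    refine (intervalIntegral.abs_integral_le_integral_abs ht.1.le).trans ?_
    rw [intervalIntegral.integral_of_le ht.1.le]
    rw [intervalIntegrable_iff_integrableOn_Ioo_of_le hT.le] at hh
    exact setIntegral_mono_set hh.norm (Filter.Eventually.of_forall fun t => abs_nonneg _)
      (LE.le.eventuallyLE fun s hs => ⟨hs.1, hs.2.trans_lt ht.2⟩)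
  have h2 := abs_jumpSum_le (τ := exitTime Y τ y) hd t
  refine (abs_sub _ _).trans (add_le_add ((abs_add_le _ _).trans (add_le_add le_rfl h1)) h2)

/-- The values on a trajectory are dominated by `trajectoryBound`, which does not depend on time and
is integrable over compact sets of initial points. -/
lemma IsExitFamily.locallyIntegrable_trajectoryValue (hY : IsExitFamily T Ω Φ Y τ)
    (hΦ : IsPhaseFlow F Φ) (hΩ : IsSmoothConvexDomain Ω) (hT : 0 < T)
    (hsol : IsTransportSolution T Ω E h z d g) (hreg : IsRegularData T Ω h z d g) :
    LocallyIntegrable (trajectoryValue Φ Y τ h d g) (slabMeasure T) := by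
  have := hΩ.isLocallyFiniteMeasure_outMeasure T
  refine locallyIntegrable_slab fun K hK => ?_
  have hb : IntegrableOn (trajectoryBound T Φ Y τ h d g) K := by
    refine (Integrable.add ?_ ?_).add (hY.summable_exitValue hΦ hreg.measurable_trace
      (hsol.memLp_trace.locallyIntegrable one_le_two) hK).2
    · exact (((memLp_volume_of_phase hΩ.isOpen hreg.initial_eq_zero
        hsol.memLp_initial).locallyIntegrable one_le_two).integrableOn_isCompact hK).norm
    · exact (integrableOn_slab_of_locallyIntegrable ((memLp_comp_straighten hΦ (memLp_slab_of_interior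
        hΩ.isOpen hreg.source_eq_zero hsol.memLp_source)).locallyIntegrable one_le_two)
        hK).integral_norm_prod_right
  have hfin : IsFiniteMeasure ((volume : Measure Phase).restrict K) :=
    ⟨by rw [Measure.restrict_apply_univ]; exact hK.measure_lt_top⟩
  refine Integrable.mono' (hb.comp_snd ((volume : Measure ℝ).restrict (Ioo 0 T)))
    (hY.measurable_trajectoryValue hΦ hreg.measurable_source hreg.measurable_trace
      hreg.measurable_initial).aestronglyMeasurable ?_
  have h1 : ∀ᵐ p ∂((volume : Measure ℝ).restrict (Ioo 0 T)).prod ((volume : Measure Phase).restrict K),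
      IntervalIntegrable (fun t => h (t, Φ t p.2)) volume 0 T ∧
      Summable fun k => |exitValue Φ Y τ d p.2 k| :=
    Measure.quasiMeasurePreserving_snd.ae (ae_restrict_of_ae (hY.ae_regular hΦ hΩ hT hsol hreg))
  have h2 : ∀ᵐ p ∂((volume : Measure ℝ).restrict (Ioo 0 T)).prod ((volume : Measure Phase).restrict K),
      p.1 ∈ Ioo 0 T :=
    Measure.quasiMeasurePreserving_fst.ae (ae_restrict_mem measurableSet_Ioo)
  filter_upwards [h1, h2] with p hp1 hp2
  exact abs_trajectoryValue_le hT hp1.1 hp1.2 hp2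

lemma ae_slab_pos : ∀ᵐ p ∂slabMeasure T, p.1 ∈ Ioo 0 T :=
  Measure.quasiMeasurePreserving_fst.ae (ae_restrict_mem measurableSet_Ioo)

lemma exitValue_mul {φ : ℝ × Phase → ℝ} (y : Phase) (k : ℕ) :
    exitValue Φ Y τ (fun p => d p * φ p) y k
      = exitValue Φ Y τ d y k * φ (exitTime Y τ y k, Φ (exitTime Y τ y k) y) := by
  by_cases hy : y ∈ Y k
  · simp [exitValue, exitTime, hy]
  · simp [exitValue, hy]

lemma apply_time_eq_zero_of_tsupport {φ : ℝ × Phase → ℝ} (hφ : tsupport φ ⊆ Iio T ×ˢ univ) {t : ℝ}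
    (ht : T ≤ t) (y : Phase) : φ (t, y) = 0 := by
  by_contra hne
  exact absurd (hφ (subset_tsupport _ hne)).1 (not_lt.2 ht)

/-- In flow coordinates a solution is given by its values along the trajectories. -/
theorem IsTransportSolution.ae_eq_trajectoryValue (hsol : IsTransportSolution T Ω E h z d g)
    (hreg : IsRegularData T Ω h z d g) (hY : IsExitFamily T Ω Φ Y τ) (hΦ : IsPhaseFlow F Φ)
    (hEF : EqOn E F (closure Ω)) (hΩ : IsSmoothConvexDomain Ω) (hT : 0 < T) :
    ∀ᵐ p ∂slabMeasure T, z (p.1, Φ p.1 p.2) = trajectoryValue Φ Y τ h d g p := by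
  have := hΩ.isLocallyFiniteMeasure_outMeasure T
  set R := trajectoryValue Φ Y τ h d g with hR
  have hRl := hY.locallyIntegrable_trajectoryValue hΦ hΩ hT hsol hreg
  have hNl : LocallyIntegrable (fun p : ℝ × Phase => z (p.1, Φ p.1 p.2)) (slabMeasure T) :=
    (memLp_comp_straighten hΦ (memLp_slab_of_interior hΩ.isOpen hreg.eq_zero
      hsol.memLp)).locallyIntegrable one_le_two
  have hHl : LocallyIntegrable (fun p : ℝ × Phase => h (p.1, Φ p.1 p.2)) (slabMeasure T) :=
    (memLp_comp_straighten hΦ (memLp_slab_of_interior hΩ.isOpen hreg.source_eq_zero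
      hsol.memLp_source)).locallyIntegrable one_le_two
  have hgl : LocallyIntegrable g (volume : Measure Phase) :=
    (memLp_volume_of_phase hΩ.isOpen hreg.initial_eq_zero hsol.memLp_initial).locallyIntegrable one_le_two
  have hdl : LocallyIntegrable d (outMeasure T Ω) := hsol.memLp_trace.locallyIntegrable one_le_two
  -- Fundamental lemma of the calculus of variations: both functions have the same integral against
  -- every smooth c supported in the open slab.
  have key : ∀ᵐ p ∂slabMeasure T, p ∈ (Ioo 0 T ×ˢ univ : Set (ℝ × Phase)) →
      z (p.1, Φ p.1 p.2) - R p = 0 := by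
    refine IsOpen.ae_eq_zero_of_integral_contDiff_smul_eq_zero (isOpen_Ioo.prod isOpen_univ)
      ((hNl.sub hRl).locallyIntegrableOn _) fun c hc hcs hcT => ?_
    have hc1 : ContDiff ℝ 1 c := hc.of_le (by exact_mod_cast le_top)
    have hcN : Integrable (fun p => c p • z (p.1, Φ p.1 p.2)) (slabMeasure T) :=
      hNl.integrable_smul_left_of_hasCompactSupport hc.continuous hcs
    have hcR : Integrable (fun p => c p • R p) (slabMeasure T) :=
      hRl.integrable_smul_left_of_hasCompactSupport hc.continuous hcs
    simp_rw [smul_sub]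
    rw [integral_sub hcN hcR, sub_eq_zero]
    -- The test function for the weak formulation must have c as its transport derivative. In flow
    -- coordinates this is a primitive in time, with support allowed to reach below time zero, so
    -- that the initial value enters.
    obtain ⟨α, hα, hαs, hαT, hαc⟩ := exists_time_primitive hc1 hcs hT hcT
    set φ := α ∘ hΦ.straighten.symm with hφ
    have hφs : HasCompactSupport φ := hαs.comp_homeomorph _
    have hφC : ContDiff ℝ 1 φ := hα.comp hΦ.contDiff_straighten_symm
    have hφT : tsupport φ ⊆ Iio T ×ˢ univ := hΦ.tsupport_comp_symm_subset hαT
    have hφα : ∀ t y, φ (t, Φ t y) = α (t, y) := fun t y => by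
      simp [hφ, hΦ.straighten_symm_apply, hΦ.neg_apply_apply]
    have hweak := hsol.weak_eq φ hφC hφs hφT
    -- the four terms of the weak formulation in flow coordinates
    have e1 : ∫ p, z p * transportOp E φ p ∂interiorMeasure T Ω
        = ∫ p, c p • z (p.1, Φ p.1 p.2) ∂slabMeasure T := by
      rw [integral_interiorMeasure fun p hp => by rw [hreg.eq_zero p hp, zero_mul],
        ← hΦ.integral_comp_straighten]
      refine integral_congr_ae ?_
      filter_upwards [ae_slab_pos] with p hp
      by_cases hpΩ : (hΦ.straighten p).2.1 ∈ Ω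
      · rw [transportOp_congr hEF _ (subset_closure hpΩ), hφ, hΦ.transportOp_comp_symm hα, hαc p hp.1,
          smul_eq_mul, mul_comm]
        rfl
      · have h0 := hreg.eq_zero _ hpΩ
        rw [h0, zero_mul]
        rw [hΦ.straighten_apply] at h0
        rw [h0, smul_zero]
    have e2 := (integral_sum_map (K := fun p => d p * φ p) hY.measurableSet (hY.measurable_exit hΦ)
      hY.outMeasure_eq (hreg.measurable_trace.mul hφC.continuous.measurable)
      (hdl.integrable_smul_right_of_hasCompactSupport hφC.continuous hφs)).2.2
    have e3 : ∫ p, h p * φ p ∂interiorMeasure T Ω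
        = ∫ p, h (p.1, Φ p.1 p.2) * α p ∂slabMeasure T := by
      rw [integral_interiorMeasure fun p hp => by rw [hreg.source_eq_zero p hp, zero_mul],
        ← hΦ.integral_comp_straighten]
      congr 1
      ext p
      rw [hΦ.straighten_apply, hφα]
    have e4 : ∫ y, g y * φ (0, y) ∂phaseMeasure Ω = ∫ y, g y * α (0, y) := by
      rw [integral_phaseMeasure fun p hp => by rw [hreg.initial_eq_zero p hp, zero_mul]]
      congr 1
      ext y
      have := hφα 0 y
      rw [hΦ.zero] at this
      rw [this]
    have hHα : Integrable (fun p : ℝ × Phase => h (p.1, Φ p.1 p.2) * α p) (slabMeasure T) :=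
      hHl.integrable_smul_right_of_hasCompactSupport hα.continuous hαs
    have hα0s : HasCompactSupport fun y : Phase => α (0, y) := by
      refine HasCompactSupport.intro (hαs.isCompact.image continuous_snd) fun y hy => ?_
      by_contra hne
      exact hy ⟨(0, y), subset_tsupport _ hne, rfl⟩
    have hgα : Integrable (fun y : Phase => g y * α (0, y)) :=
      hgl.integrable_smul_right_of_hasCompactSupport (hα.continuous.comp (by fun_prop)) hα0s
    rw [e1, e2.2, e3, e4] at hweak
    rw [hweak, integral_slab_eq hT.le hcR, integral_slab_eq hT.le hHα]
    have hHα' : Integrable fun y => ∫ t in (0 : ℝ)..T, h (t, Φ t y) * α (t, y) := by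
      have := hHα.integral_prod_right
      refine this.congr (Filter.Eventually.of_forall fun y => ?_)
      simp only
      rw [intervalIntegral.integral_of_le hT.le, integral_Ioc_eq_integral_Ioo]
    rw [← integral_sub_sub e2.1 hHα' hgα]
    refine integral_congr_ae ?_
    filter_upwards [hY.ae_regular hΦ hΩ hT hsol hreg] with y hy
    have hderiv : ∀ t, HasDerivAt (fun s => α (s, y)) (fderiv ℝ α (t, y) (1, 0)) t := fun t =>
      HasFDerivAt.comp_hasDerivAt (f := fun s : ℝ => (s, y)) t
        (hα.differentiable one_ne_zero _).hasFDerivAt ((hasDerivAt_id _).prodMk (hasDerivAt_const _ _))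
    have hcont : Continuous fun t : ℝ => fderiv ℝ α (t, y) (1, 0) :=
      ((hα.continuous_fderiv one_ne_zero).comp (by fun_prop : Continuous fun t : ℝ => (t, y))).clm_apply
        continuous_const
    -- For almost every initial point the one-dimensional integration by parts reproduces the exit,
    -- source and initial terms of the weak formulation.
    have h1d := integral_jump_mul_deriv (g := g y) hy.2 (hY.exitTime_mem hT y) hy.1 hderiv hcont
      (apply_time_eq_zero_of_tsupport hαT le_rfl y)
    have h2 : ∫ t in (0 : ℝ)..T, c (t, y) • R (t, y)
        = ∫ t in (0 : ℝ)..T, ((g y + ∫ r in (0 : ℝ)..t, h (r, Φ r y))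
          - jumpSum (exitValue Φ Y τ d y) (exitTime Y τ y) t) * fderiv ℝ α (t, y) (1, 0) := by
      refine intervalIntegral.integral_congr_ae (Filter.Eventually.of_forall fun t ht => ?_)
      rw [uIoc_of_le hT.le] at ht
      rw [hαc (t, y) ht.1, smul_eq_mul, mul_comm]
      rfl
    have h3 : ∑' k, (Y k).indicator (fun y => d (τ k y, Φ (τ k y) y) * φ (τ k y, Φ (τ k y) y)) y
        = ∑' k, exitValue Φ Y τ d y k * α (exitTime Y τ y k, y) := by
      congr 1
      ext k
      rw [← hφα, ← exitValue_mul]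
      rfl
    rw [h2, h1d, h3]
    ring
  filter_upwards [key, ae_slab_pos] with p hp hp2
  exact sub_eq_zero.1 (hp ⟨hp2, mem_univ _⟩)

/-- A nonzero value would persist on an interval to the right, which has positive length. -/
lemma eq_zero_of_ae_eq_zero_right {f : ℝ → ℝ} {a b : ℝ} (hab : a < b)
    (hf : Filter.Tendsto f (𝓝[>] a) (𝓝 (f a))) (h0 : ∀ᵐ t, t ∈ Ioo a b → f t = 0) : f a = 0 := by
  by_contra hne
  have h1 := hf.eventually_ne hne
  obtain ⟨u, hu, hsub⟩ := (mem_nhdsGT_iff_exists_Ioo_subset).1 h1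
  have h2 : volume (Ioo a (min u b)) = 0 := by
    refine measure_mono_null (fun t ht => ?_) (ae_iff.1 h0)
    have h3 : f t ≠ 0 := hsub ⟨ht.1, ht.2.trans_le (min_le_left _ _)⟩
    simp only [mem_ofPred_eq, not_forall]
    exact ⟨⟨ht.1, ht.2.trans_le (min_le_right _ _)⟩, h3⟩
  rw [Real.volume_Ioo, ENNReal.ofReal_eq_zero] at h2
  have : a < min u b := lt_min hu hab
  linarith

/-- The weak formulation for the square of a solution. -/
theorem IsTransportSolution.renormalized_of_regular (hsol : IsTransportSolution T Ω E h z d g)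
    (hreg : IsRegularData T Ω h z d g) (hE : IsC1OnClosure Ω E) (hΩ : IsSmoothConvexDomain Ω)
    (hT : 0 < T) {ψ : ℝ × Phase → ℝ} (hψ : ContDiff ℝ 1 ψ) (hψs : HasCompactSupport ψ)
    (hψT : tsupport ψ ⊆ Iio T ×ˢ univ) :
    ∫ p, z p ^ 2 * transportOp E ψ p ∂interiorMeasure T Ω
      = ∫ p, d p ^ 2 * ψ p ∂outMeasure T Ω - 2 * ∫ p, h p * z p * ψ p ∂interiorMeasure T Ω
        - ∫ y, g y ^ 2 * ψ (0, y) ∂phaseMeasure Ω := by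
  obtain ⟨F, hF, hFs, hEF⟩ := exists_compactlySupported_extension hΩ.bounded hE
  obtain ⟨Φ, hΦ⟩ := exists_isPhaseFlow hF hFs
  obtain ⟨Y, τ, hYm, hτm, hmem, hne, hout⟩ := hΦ.exists_exit_family hΩ T
  have hY : IsExitFamily T Ω Φ Y τ := ⟨hYm, hτm, hmem, hne, hout⟩
  have hNR := hsol.ae_eq_trajectoryValue hreg hY hΦ hEF hΩ hT
  set R := trajectoryValue Φ Y τ h d g with hR
  obtain ⟨B, hB⟩ := hψs.exists_bound_of_continuous hψ.continuous
  have hPψ : Continuous (transportOp F ψ) :=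
    (hψ.continuous_fderiv one_ne_zero).clm_apply (by
      have := hF.continuous
      fun_prop)
  have hPψs : HasCompactSupport (transportOp F ψ) :=
    (hψs.fderiv ℝ).mono' fun p hp => by
      refine subset_tsupport _ fun h0 => hp ?_
      simp [transportOp, h0]
  obtain ⟨B', hB'⟩ := hPψs.exists_bound_of_continuous hPψ
  have hz2 := memLp_slab_of_interior hΩ.isOpen hreg.eq_zero hsol.memLp
  have hh2 := memLp_slab_of_interior hΩ.isOpen hreg.source_eq_zero hsol.memLp_source
  have hN2 := memLp_comp_straighten hΦ hz2
  have hH2 := memLp_comp_straighten hΦ hh2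
  have hstc : Continuous fun p : ℝ × Phase => (p.1, Φ p.1 p.2) := hΦ.straighten.continuous
  have i1 : Integrable (fun p : ℝ × Phase => z (p.1, Φ p.1 p.2) ^ 2 * transportOp F ψ (p.1, Φ p.1 p.2))
      (slabMeasure T) :=
    hN2.integrable_sq.mul_bdd (c := B') (hPψ.comp hstc).aestronglyMeasurable
      (Filter.Eventually.of_forall fun p => hB' _)
  have i3 : Integrable (fun p : ℝ × Phase => h (p.1, Φ p.1 p.2) * z (p.1, Φ p.1 p.2)
      * ψ (p.1, Φ p.1 p.2)) (slabMeasure T) :=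
    (hH2.integrable_mul hN2).mul_bdd (c := B) (hψ.continuous.comp hstc).aestronglyMeasurable
      (Filter.Eventually.of_forall fun p => hB _)
  have i4 : Integrable (fun y : Phase => g y ^ 2 * ψ (0, y)) :=
    (memLp_volume_of_phase hΩ.isOpen hreg.initial_eq_zero hsol.memLp_initial).integrable_sq.mul_bdd (c := B)
      (hψ.continuous.comp (by fun_prop : Continuous fun y : Phase => ((0 : ℝ), y))).aestronglyMeasurable (Filter.Eventually.of_forall fun p => hB _)
  have e1 : ∫ p, z p ^ 2 * transportOp E ψ p ∂interiorMeasure T Ω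
      = ∫ p, z (p.1, Φ p.1 p.2) ^ 2 * transportOp F ψ (p.1, Φ p.1 p.2) ∂slabMeasure T := by
    rw [integral_interiorMeasure fun p hp => by rw [hreg.eq_zero p hp]; ring,
      ← hΦ.integral_comp_straighten]
    congr 1
    ext p
    by_cases hpΩ : (hΦ.straighten p).2.1 ∈ Ω
    · rw [transportOp_congr hEF _ (subset_closure hpΩ)]
      rfl
    · have h0 := hreg.eq_zero _ hpΩ
      rw [h0]
      rw [hΦ.straighten_apply] at h0
      rw [h0]
      ring
  have e2 := (integral_sum_map (K := fun p => d p ^ 2 * ψ p) hY.measurableSet (hY.measurable_exit hΦ)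
    hY.outMeasure_eq ((hreg.measurable_trace.pow_const 2).mul hψ.continuous.measurable)
    (hsol.memLp_trace.integrable_sq.mul_bdd (c := B) hψ.continuous.aestronglyMeasurable
      (Filter.Eventually.of_forall fun p => hB _))).2.2
  have e3 : ∫ p, h p * z p * ψ p ∂interiorMeasure T Ω
      = ∫ p, h (p.1, Φ p.1 p.2) * z (p.1, Φ p.1 p.2) * ψ (p.1, Φ p.1 p.2) ∂slabMeasure T := by
    rw [integral_interiorMeasure fun p hp => by rw [hreg.eq_zero p hp]; ring,
      ← hΦ.integral_comp_straighten]
    rfl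
  have e4 : ∫ y, g y ^ 2 * ψ (0, y) ∂phaseMeasure Ω = ∫ y, g y ^ 2 * ψ (0, y) :=
    integral_phaseMeasure fun p hp => by rw [hreg.initial_eq_zero p hp]; ring
  have i3' : Integrable fun y => ∫ t in (0 : ℝ)..T, h (t, Φ t y) * z (t, Φ t y) * ψ (t, Φ t y) := by
    refine i3.integral_prod_right.congr (Filter.Eventually.of_forall fun y => ?_)
    simp only
    rw [intervalIntegral.integral_of_le hT.le, integral_Ioc_eq_integral_Ioo]
  rw [e1, e2.2, e3, e4, integral_slab_eq hT.le i1, integral_slab_eq hT.le i3, ← integral_const_mul,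
    ← integral_sub_sub e2.1 (i3'.const_mul 2) i4]
  refine integral_congr_ae ?_
  have hNR' : ∀ᵐ y : Phase, ∀ᵐ t ∂(volume : Measure ℝ).restrict (Ioo 0 T),
      z (t, Φ t y) = R (t, y) :=
    Measure.ae_ae_of_ae_prod (Measure.measurePreserving_swap.quasiMeasurePreserving.ae hNR)
  filter_upwards [hY.ae_regular hΦ hΩ hT hsol hreg, hNR'] with y hy hyNR
  have hyNR' : ∀ᵐ t, t ∈ Ioo 0 T → z (t, Φ t y) = R (t, y) :=
    (ae_restrict_iff' measurableSet_Ioo).1 hyNR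
  -- Right after an exit the trajectory is outside the closure of Ω, where z is zero. The
  -- representative is continuous from the right at the exit time, so it vanishes there too; this is
  -- what allows the square to be taken.
  have hzero : ∀ k, exitValue Φ Y τ d y k ≠ 0 → (g y + ∫ r in (0 : ℝ)..(exitTime Y τ y k), h (r, Φ r y))
      - jumpSum (exitValue Φ Y τ d y) (exitTime Y τ y) (exitTime Y τ y k) = 0 := by
    intro k hk
    have hyk : y ∈ Y k := by
      by_contra hyk
      exact hk (by simp [exitValue, hyk])
    have hek : exitTime Y τ y k = τ k y := by simp [exitTime, hyk]
    obtain ⟨hτ0, hτΓ⟩ := hY.mem k y hyk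
    obtain ⟨O, -, hzO, δ, hδ, hO⟩ := hΦ.exists_notMem_closure_after_exit hΩ hτΓ
    rw [hek]
    refine eq_zero_of_ae_eq_zero_right (f := fun t => R (t, y)) (a := τ k y)
      (b := min (τ k y + δ) T) (lt_min (by linarith) hτ0.2) ?_ ?_
    · refine Filter.Tendsto.sub ?_ (jumpSum_tendsto_right hy.2 _)
      have hc : ContinuousOn (fun t => g y + ∫ r in (0 : ℝ)..t, h (r, Φ r y)) (uIcc 0 T) :=
        continuousOn_const.add (intervalIntegral.continuousOn_primitive_interval' hy.1 left_mem_uIcc)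
      rw [uIcc_of_le hT.le] at hc
      exact ((hc.continuousAt (Icc_mem_nhds hτ0.1 hτ0.2)).tendsto).mono_left nhdsWithin_le_nhds
    · filter_upwards [hyNR'] with t ht htI
      have ht1 : t < τ k y + δ := htI.2.trans_le (min_le_left _ _)
      have ht2 : t < T := htI.2.trans_le (min_le_right _ _)
      rw [← ht ⟨hτ0.1.trans htI.1, ht2⟩]
      refine hreg.eq_zero _ fun hmemΩ => ?_
      refine hO _ hzO hτΓ (t - τ k y) ⟨by linarith [htI.1], by linarith⟩ ?_
      rw [← hΦ.add, sub_add_cancel]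
      exact subset_closure hmemΩ
  have hinj : ∀ k l, k ≠ l → exitValue Φ Y τ d y k ≠ 0 → exitValue Φ Y τ d y l ≠ 0 →
      exitTime Y τ y k ≠ exitTime Y τ y l := by
    intro k l hkl hk hl
    have hyk : y ∈ Y k := by
      by_contra hyk
      exact hk (by simp [exitValue, hyk])
    have hyl : y ∈ Y l := by
      by_contra hyl
      exact hl (by simp [exitValue, hyl])
    simpa [exitTime, hyk, hyl] using hY.ne k l hkl y hyk hyl
  have hcont : Continuous fun t : ℝ => transportOp F ψ (t, Φ t y) :=
    hPψ.comp (hstc.comp (by fun_prop : Continuous fun t : ℝ => (t, y)))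
  have h1d := integral_jump_sq_mul_deriv hy.2 (hY.exitTime_mem hT y) hinj hy.1
    (hΦ.hasDerivAt_comp (hψ.differentiable one_ne_zero) y) hcont
    (apply_time_eq_zero_of_tsupport hψT le_rfl _) hzero
  have hcongr : ∀ {G₁ G₂ : ℝ → ℝ}, (∀ t, z (t, Φ t y) = R (t, y) → G₁ t = G₂ t) →
      ∫ t in (0 : ℝ)..T, G₁ t = ∫ t in (0 : ℝ)..T, G₂ t := by
    intro G₁ G₂ hG
    rw [intervalIntegral.integral_of_le hT.le, intervalIntegral.integral_of_le hT.le,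
      integral_Ioc_eq_integral_Ioo, integral_Ioc_eq_integral_Ioo]
    refine integral_congr_ae ?_
    filter_upwards [hyNR] with t ht using hG t ht
  have h2 : ∫ t in (0 : ℝ)..T, z (t, Φ t y) ^ 2 * transportOp F ψ (t, Φ t y)
      = ∫ t in (0 : ℝ)..T, ((g y + ∫ r in (0 : ℝ)..t, h (r, Φ r y))
        - jumpSum (exitValue Φ Y τ d y) (exitTime Y τ y) t) ^ 2 * transportOp F ψ (t, Φ t y) :=
    hcongr fun t ht => by rw [ht]; rfl
  have h3 : ∫ t in (0 : ℝ)..T, h (t, Φ t y) * z (t, Φ t y) * ψ (t, Φ t y)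
      = ∫ t in (0 : ℝ)..T, ((g y + ∫ r in (0 : ℝ)..t, h (r, Φ r y))
        - jumpSum (exitValue Φ Y τ d y) (exitTime Y τ y) t) * (h (t, Φ t y) * ψ (t, Φ t y)) :=
    hcongr fun t ht => by
      rw [ht, mul_comm (h (t, Φ t y)), mul_assoc]; rfl
  have h4 : ∑' k, (Y k).indicator (fun y => d (τ k y, Φ (τ k y) y) ^ 2 * ψ (τ k y, Φ (τ k y) y)) y
      = ∑' k, exitValue Φ Y τ d y k ^ 2 * ψ (exitTime Y τ y k, Φ (exitTime Y τ y k) y) := by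
    congr 1
    ext k
    by_cases hyk : y ∈ Y k
    · simp [exitValue, exitTime, hyk]
    · simp [exitValue, hyk]
  rw [h2, h1d, h3, h4, hΦ.zero]
  ring

end Renormalization

/-! ### Energy identities for weak solutions and unbounded weights. -/

section EnergyIdentity

variable {T : ℝ} {Ω : Set R3} {E : R3 → R3} {h z d : ℝ × Phase → ℝ} {g : Phase → ℝ}

lemma ae_interior_mem (hΩ : IsOpen Ω) :
    ∀ᵐ p ∂interiorMeasure T Ω, p.1 ∈ Ioo 0 T ∧ p.2.1 ∈ Ω := by
  have h1 : ∀ᵐ p ∂interiorMeasure T Ω, p.1 ∈ Ioo 0 T :=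
    Measure.quasiMeasurePreserving_fst.ae (ae_restrict_mem measurableSet_Ioo)
  have h2 : ∀ᵐ y ∂phaseMeasure Ω, y ∈ Ω ×ˢ univ := ae_restrict_mem (hΩ.prod isOpen_univ).measurableSet
  filter_upwards [h1, Measure.quasiMeasurePreserving_snd.ae h2] with p hp1 hp2 using ⟨hp1, hp2.1⟩

lemma IsSmoothConvexDomain.ae_out_mem (hΩ : IsSmoothConvexDomain Ω) :
    ∀ᵐ p ∂outMeasure T Ω, p.1 ∈ Ioo 0 T ∧ p.2 ∈ GammaPlus Ω := by
  have := hΩ.isFiniteMeasure_surface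
  have : SFinite (boundaryMeasure Ω) := by unfold boundaryMeasure; infer_instance
  have h1 : ∀ᵐ p ∂outMeasure T Ω, p.1 ∈ Ioo 0 T :=
    Measure.quasiMeasurePreserving_fst.ae (ae_restrict_mem measurableSet_Ioo)
  have h2 : ∀ᵐ y ∂(boundaryMeasure Ω).restrict (GammaPlus Ω), y ∈ GammaPlus Ω :=
    ae_restrict_mem hΩ.measurableSet_gammaPlus
  filter_upwards [h1, Measure.quasiMeasurePreserving_snd.ae h2] with p hp1 hp2 using ⟨hp1, hp2⟩

lemma ae_phase_mem (hΩ : IsOpen Ω) : ∀ᵐ y ∂phaseMeasure Ω, y.1 ∈ Ω := by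
  filter_upwards [ae_restrict_mem (hΩ.prod isOpen_univ).measurableSet] with y hy using hy.1

/-- Every term is an integral, so the data may be replaced by Borel representatives that vanish
outside Ω. -/
theorem IsTransportSolution.renormalized (hsol : IsTransportSolution T Ω E h z d g)
    (hE : IsC1OnClosure Ω E) (hΩ : IsSmoothConvexDomain Ω)
    (hT : 0 < T) {ψ : ℝ × Phase → ℝ} (hψ : ContDiff ℝ 1 ψ) (hψs : HasCompactSupport ψ)
    (hψT : tsupport ψ ⊆ Iio T ×ˢ univ) :
    ∫ p, z p ^ 2 * transportOp E ψ p ∂interiorMeasure T Ω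
      = ∫ p, d p ^ 2 * ψ p ∂outMeasure T Ω - 2 * ∫ p, h p * z p * ψ p ∂interiorMeasure T Ω
        - ∫ y, g y ^ 2 * ψ (0, y) ∂phaseMeasure Ω := by
  have hcyl := measurableSet_cylinder hΩ.isOpen
  have hcylg : MeasurableSet (Ω ×ˢ univ : Set Phase) := (hΩ.isOpen.prod isOpen_univ).measurableSet
  have hrep : ∀ {G : ℝ × Phase → ℝ}, MemLp G 2 (interiorMeasure T Ω) →
      ∃ G', Measurable G' ∧ (∀ p, p.2.1 ∉ Ω → G' p = 0) ∧ G =ᵐ[interiorMeasure T Ω] G' := by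
    intro G hG
    refine ⟨(univ ×ˢ (Ω ×ˢ univ)).indicator (hG.1.mk G),
      hG.1.stronglyMeasurable_mk.measurable.indicator hcyl, fun p hp => ?_, ?_⟩
    · exact indicator_of_notMem (fun hp' => hp hp'.2.1) _
    · filter_upwards [hG.1.ae_eq_mk, ae_interior_mem hΩ.isOpen] with p hp1 hp2
      have : p ∈ (univ : Set ℝ) ×ˢ (Ω ×ˢ (univ : Set R3)) := ⟨mem_univ _, hp2.2, mem_univ _⟩
      rw [indicator_of_mem this, hp1]
  obtain ⟨z', hz'm, hz'0, hzz'⟩ := hrep hsol.memLp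
  obtain ⟨h', hh'm, hh'0, hhh'⟩ := hrep hsol.memLp_source
  set d' := hsol.memLp_trace.1.mk d with hd'
  have hdd' : d =ᵐ[outMeasure T Ω] d' := hsol.memLp_trace.1.ae_eq_mk
  set g' : Phase → ℝ := (Ω ×ˢ univ : Set Phase).indicator (hsol.memLp_initial.1.mk g) with hg'
  have hgg' : g =ᵐ[phaseMeasure Ω] g' := by
    filter_upwards [hsol.memLp_initial.1.ae_eq_mk, ae_phase_mem hΩ.isOpen] with y hy1 hy2
    have : y ∈ (Ω ×ˢ univ : Set Phase) := ⟨hy2, mem_univ _⟩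
    rw [hg', indicator_of_mem this, hy1]
  have hsol' : IsTransportSolution T Ω E h' z' d' g' := by
    refine ⟨hsol.memLp_source.ae_eq hhh', hsol.memLp.ae_eq hzz', hsol.memLp_trace.ae_eq hdd',
      hsol.memLp_initial.ae_eq hgg', fun φ hφ hφs hφT => ?_⟩
    have q1 : ∫ p, z' p * transportOp E φ p ∂interiorMeasure T Ω
        = ∫ p, z p * transportOp E φ p ∂interiorMeasure T Ω :=
      integral_congr_ae (hzz'.mono fun p hp => by simp only [hp])
    have q2 : ∫ p, d' p * φ p ∂outMeasure T Ω = ∫ p, d p * φ p ∂outMeasure T Ω :=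
      integral_congr_ae (hdd'.mono fun p hp => by simp only [hp])
    have q3 : ∫ p, h' p * φ p ∂interiorMeasure T Ω = ∫ p, h p * φ p ∂interiorMeasure T Ω :=
      integral_congr_ae (hhh'.mono fun p hp => by simp only [hp])
    have q4 : ∫ y, g' y * φ (0, y) ∂phaseMeasure Ω = ∫ y, g y * φ (0, y) ∂phaseMeasure Ω :=
      integral_congr_ae (hgg'.mono fun p hp => by simp only [hp])
    rw [q1, q2, q3, q4]
    exact hsol.weak_eq φ hφ hφs hφT
  have hreg : IsRegularData T Ω h' z' d' g' :=
    ⟨hh'm, hz'm, hsol.memLp_trace.1.stronglyMeasurable_mk.measurable,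
      hsol.memLp_initial.1.stronglyMeasurable_mk.measurable.indicator hcylg, hh'0, hz'0,
      fun y hy => indicator_of_notMem (fun hy' => hy hy'.1) _⟩
  have key := hsol'.renormalized_of_regular hreg hE hΩ hT hψ hψs hψT
  have q1 : ∫ p, z' p ^ 2 * transportOp E ψ p ∂interiorMeasure T Ω
      = ∫ p, z p ^ 2 * transportOp E ψ p ∂interiorMeasure T Ω :=
    integral_congr_ae (hzz'.mono fun p hp => by simp only [hp])
  have q2 : ∫ p, d' p ^ 2 * ψ p ∂outMeasure T Ω = ∫ p, d p ^ 2 * ψ p ∂outMeasure T Ω :=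
    integral_congr_ae (hdd'.mono fun p hp => by simp only [hp])
  have q3 : ∫ p, h' p * z' p * ψ p ∂interiorMeasure T Ω = ∫ p, h p * z p * ψ p ∂interiorMeasure T Ω :=
    integral_congr_ae ((hhh'.and hzz').mono fun p hp => by simp only [hp.1, hp.2])
  have q4 : ∫ y, g' y ^ 2 * ψ (0, y) ∂phaseMeasure Ω = ∫ y, g y ^ 2 * ψ (0, y) ∂phaseMeasure Ω :=
    integral_congr_ae (hgg'.mono fun p hp => by simp only [hp])
  rw [q1, q2, q3, q4] at key
  exact key

/-- Cut-off functions exhausting space-time, along which the transport operator stays bounded. -/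
lemma exists_cutoff (hE : IsC1OnClosure Ω E) (hΩ : IsSmoothConvexDomain Ω) :
    ∃ (χ : ℕ → ℝ × Phase → ℝ) (B : ℝ), (∀ n, ContDiff ℝ 1 (χ n)) ∧ (∀ n, HasCompactSupport (χ n)) ∧
      (∀ n p, |χ n p| ≤ 1) ∧ (∀ n p, p.2.1 ∈ closure Ω → |transportOp E (χ n) p| ≤ B) ∧
      ∀ p, ∀ᶠ n in Filter.atTop, χ n p = 1 ∧ transportOp E (χ n) p = 0 := by
  obtain ⟨F, hF, hFs, hEF⟩ := exists_compactlySupported_extension hΩ.bounded hE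
  obtain ⟨M, hM⟩ := hFs.exists_bound_of_continuous hF.continuous
  let f : ContDiffBump (0 : ℝ × Phase) := ⟨1, 2, one_pos, one_lt_two⟩
  have hf1 : ContDiff ℝ 1 f := f.contDiff
  obtain ⟨C, hC⟩ := (f.hasCompactSupport.fderiv ℝ).exists_bound_of_continuous
    (hf1.continuous_fderiv one_ne_zero)
  have hC0 : 0 ≤ C := (norm_nonneg _).trans (hC 0)
  have hM0 : 0 ≤ M := (norm_nonneg _).trans (hM 0)
  -- The cut-off is f(c_n p), whose gradient is of size c_n, while the field (1, v, E) grows at most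
  -- linearly. On the support |c_n p| ≤ 2, which gives the uniform bound C(3 + M).
  set c : ℕ → ℝ := fun n => ((n : ℝ) + 1)⁻¹ with hc
  have hcpos : ∀ n, 0 < c n := fun n => by positivity
  have hc1 : ∀ n, c n ≤ 1 := fun n => inv_le_one_of_one_le₀ (by
    have : (0 : ℝ) ≤ n := Nat.cast_nonneg n
    linarith)
  have hfd : ∀ n p, fderiv ℝ (fun p => f (c n • p)) p = c n • fderiv ℝ f (c n • p) := by
    intro n p
    have h1 : HasFDerivAt (fun p : ℝ × Phase => c n • p) (c n • ContinuousLinearMap.id ℝ (ℝ × Phase)) p :=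
      (hasFDerivAt_id p).const_smul (c n)
    have h2 : HasFDerivAt f (fderiv ℝ f (c n • p)) (c n • p) :=
      (hf1.differentiable one_ne_zero _).hasFDerivAt
    have h3 : HasFDerivAt (fun p => f (c n • p)) (c n • fderiv ℝ f (c n • p)) p := by
      have h4 := h2.comp p h1
      rw [ContinuousLinearMap.comp_smul, ContinuousLinearMap.comp_id] at h4
      exact h4
    exact h3.fderiv
  refine ⟨fun n p => f (c n • p), C * (3 + M), fun n => hf1.comp (contDiff_id.const_smul _),
    fun n => f.hasCompactSupport.comp_homeomorph (Homeomorph.smulOfNeZero (c n) (hcpos n).ne'),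
    fun n p => ?_, fun n p hp => ?_, fun p => ?_⟩
  · rw [abs_of_nonneg f.nonneg]; exact f.le_one
  · rw [transportOp, hfd, smul_apply, smul_eq_mul, abs_mul, abs_of_pos (hcpos n)]
    by_cases hp2 : ‖c n • p‖ ≤ 2
    · have h1 := (fderiv ℝ f (c n • p)).le_opNorm (1, p.2.2, E p.2.1)
      have h2 : c n * ‖((1 : ℝ), p.2.2, E p.2.1)‖ ≤ 3 + M := by
        have h3 : ‖((1 : ℝ), p.2.2, E p.2.1)‖ ≤ 1 + ‖p‖ + M := by
          rw [hEF hp, Prod.norm_def, Prod.norm_def]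
          have : ‖p.2.2‖ ≤ ‖p‖ := (norm_snd_le p.2).trans (norm_snd_le p)
          refine max_le ?_ (max_le ?_ ?_)
          · simp only [norm_one]; linarith [norm_nonneg p]
          · simp only; linarith
          · simp only; linarith [hM p.2.1, norm_nonneg p]
        have h4 : c n * ‖p‖ ≤ 2 := by
          rwa [norm_smul, Real.norm_of_nonneg (hcpos n).le] at hp2
        calc c n * ‖((1 : ℝ), p.2.2, E p.2.1)‖ ≤ c n * (1 + ‖p‖ + M) :=
              mul_le_mul_of_nonneg_left h3 (hcpos n).le
          _ ≤ 3 + M := by nlinarith [hc1 n, hcpos n]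
      calc c n * |fderiv ℝ f (c n • p) (1, p.2.2, E p.2.1)|
          ≤ c n * (C * ‖((1 : ℝ), p.2.2, E p.2.1)‖) := by
            refine mul_le_mul_of_nonneg_left (h1.trans ?_) (hcpos n).le
            exact mul_le_mul_of_nonneg_right (hC _) (norm_nonneg _)
        _ = C * (c n * ‖((1 : ℝ), p.2.2, E p.2.1)‖) := by ring
        _ ≤ C * (3 + M) := mul_le_mul_of_nonneg_left h2 hC0
    · have : fderiv ℝ f (c n • p) = 0 := by
        refine image_eq_zero_of_notMem_tsupport fun hmem => hp2 ?_
        have := tsupport_fderiv_subset ℝ hmem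
        rw [f.tsupport_eq] at this
        simpa using this
      rw [this]
      simp
      positivity
  · have hlim : Filter.Tendsto (fun n : ℕ => c n • p) Filter.atTop (𝓝 ((0 : ℝ) • p)) :=
      (tendsto_inv_atTop_zero.comp (Filter.tendsto_atTop_add_const_right _ 1
        tendsto_natCast_atTop_atTop)).smul_const p
    rw [zero_smul] at hlim
    filter_upwards [hlim.eventually f.eventuallyEq_one.eventually_nhds] with n hn
    refine ⟨hn.self_of_nhds, ?_⟩
    have : fderiv ℝ f (c n • p) = 0 := by
      rw [Filter.EventuallyEq.fderiv_eq hn]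
      simp
    rw [transportOp, hfd, this]
    simp

lemma transportOp_mul {φ ψ : ℝ × Phase → ℝ} {p : ℝ × Phase} (hφ : DifferentiableAt ℝ φ p)
    (hψ : DifferentiableAt ℝ ψ p) :
    transportOp E (fun p => φ p * ψ p) p = φ p * transportOp E ψ p + ψ p * transportOp E φ p := by
  simp [transportOp, fderiv_fun_mul hφ hψ]

/-- Off the closure of Ω the field is arbitrary, so measurability is borrowed from the C¹ field with
which it agrees on the closure. -/
lemma IsC1OnClosure.aestronglyMeasurable_transportOp (hE : IsC1OnClosure Ω E) (hΩ : IsOpen Ω)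
    {ψ : ℝ × Phase → ℝ} (hψ : ContDiff ℝ 1 ψ) :
    AEStronglyMeasurable (transportOp E ψ) (interiorMeasure T Ω) := by
  obtain ⟨F, hF, hEF⟩ := hE
  have hc : Continuous (transportOp F ψ) :=
    (hψ.continuous_fderiv one_ne_zero).clm_apply (by
      have := hF.continuous
      fun_prop)
  refine hc.aestronglyMeasurable.congr ?_
  filter_upwards [ae_interior_mem hΩ] with p hp
  exact (transportOp_congr hEF ψ (subset_closure hp.2)).symm

/-- The energy identity, for weights that need only be bounded, together with their transport
derivative, on the velocities that occur in the solution. -/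
theorem IsTransportSolution.energy_identity (hsol : IsTransportSolution T Ω E h z d g)
    (hE : IsC1OnClosure Ω E) (hΩ : IsSmoothConvexDomain Ω) (hT : 0 < T) {W : Set R3} {T' B : ℝ}
    {ψ : ℝ × Phase → ℝ} (hψ : ContDiff ℝ 1 ψ) (hT' : T' < T) (hψT : ∀ t y, T' ≤ t → ψ (t, y) = 0)
    (hzW : ∀ᵐ p ∂interiorMeasure T Ω, p.2.2 ∉ W → z p = 0)
    (hdW : ∀ᵐ p ∂outMeasure T Ω, p.2.2 ∉ W → d p = 0)
    (hgW : ∀ᵐ y ∂phaseMeasure Ω, y.2 ∉ W → g y = 0)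
    (hB : ∀ t ∈ Icc 0 T, ∀ x ∈ closure Ω, ∀ v ∈ W, |ψ (t, x, v)| ≤ B ∧
      |transportOp E ψ (t, x, v)| ≤ B) :
    ∫ p, z p ^ 2 * transportOp E ψ p ∂interiorMeasure T Ω
      = ∫ p, d p ^ 2 * ψ p ∂outMeasure T Ω - 2 * ∫ p, h p * z p * ψ p ∂interiorMeasure T Ω
        - ∫ y, g y ^ 2 * ψ (0, y) ∂phaseMeasure Ω := by
  obtain ⟨χ, B', hχ, hχs, hχ1, hχB, hχlim⟩ := exists_cutoff hE hΩ
  -- Truncation makes the weight an admissible test function. The bounds on ψ and on its transport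
  -- derivative over `W` dominate all terms, because the solution vanishes for velocities outside
  -- `W`.
  set ψn : ℕ → ℝ × Phase → ℝ := fun n p => χ n p * ψ p with hψn
  have hψnC : ∀ n, ContDiff ℝ 1 (ψn n) := fun n => (hχ n).mul hψ
  have hψnT : ∀ n, tsupport (ψn n) ⊆ Iio T ×ˢ univ := by
    intro n
    have h1 : tsupport (ψn n) ⊆ Iic T' ×ˢ univ := by
      refine closure_minimal (fun p hp => ⟨?_, mem_univ _⟩) (isClosed_Iic.prod isClosed_univ)
      by_contra hlt
      refine hp ?_
      have := hψT p.1 p.2 (not_le.1 hlt).le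
      simp only [Prod.mk.eta] at this
      simp [hψn, this]
    exact h1.trans (prod_mono (Iic_subset_Iio.2 hT') le_rfl)
  have hid := fun n => hsol.renormalized hE hΩ hT (hψnC n) (hχs n).mul_right (hψnT n)
  have hop : ∀ n p, transportOp E (ψn n) p = χ n p * transportOp E ψ p + ψ p * transportOp E (χ n) p :=
    fun n p => transportOp_mul ((hχ n).differentiable one_ne_zero p) (hψ.differentiable one_ne_zero p)
  have hz2 := hsol.memLp.integrable_sq
  have hd2 := hsol.memLp_trace.integrable_sq
  have hg2 := hsol.memLp_initial.integrable_sq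
  have hhz := hsol.memLp_source.integrable_mul hsol.memLp
  have l1 : Filter.Tendsto (fun n => ∫ p, z p ^ 2 * transportOp E (ψn n) p ∂interiorMeasure T Ω)
      Filter.atTop (𝓝 (∫ p, z p ^ 2 * transportOp E ψ p ∂interiorMeasure T Ω)) := by
    refine tendsto_integral_of_dominated_convergence (fun p => z p ^ 2 * (B + B * B'))
      (fun n => hz2.1.mul (hE.aestronglyMeasurable_transportOp hΩ.isOpen (hψnC n)))
      (hz2.mul_const _) (fun n => ?_) (Filter.Eventually.of_forall fun p => ?_)
    · filter_upwards [hzW, ae_interior_mem hΩ.isOpen] with p hpW hp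
      by_cases hv : p.2.2 ∈ W
      · obtain ⟨hb1, hb2⟩ := hB p.1 (Ioo_subset_Icc_self hp.1) p.2.1 (subset_closure hp.2) _ hv
        simp only [Prod.mk.eta] at hb1 hb2
        rw [norm_mul, Real.norm_of_nonneg (sq_nonneg (z p)), hop]
        refine mul_le_mul_of_nonneg_left ((norm_add_le _ _).trans (add_le_add ?_ ?_)) (sq_nonneg _)
        · rw [norm_mul]
          exact (mul_le_of_le_one_left (norm_nonneg _) (hχ1 n p)).trans hb2
        · rw [norm_mul]
          exact mul_le_mul hb1 (hχB n p (subset_closure hp.2)) (norm_nonneg _)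
            ((abs_nonneg _).trans hb1)
      · simp [hpW hv]
    · refine tendsto_const_nhds.congr' ?_
      filter_upwards [hχlim p] with n hn
      rw [hop, hn.1, hn.2]
      ring
  have l2 : Filter.Tendsto (fun n => ∫ p, d p ^ 2 * ψn n p ∂outMeasure T Ω)
      Filter.atTop (𝓝 (∫ p, d p ^ 2 * ψ p ∂outMeasure T Ω)) := by
    refine tendsto_integral_of_dominated_convergence (fun p => d p ^ 2 * B)
      (fun n => hd2.1.mul (hψnC n).continuous.aestronglyMeasurable)
      (hd2.mul_const _) (fun n => ?_) (Filter.Eventually.of_forall fun p => ?_)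
    · filter_upwards [hdW, hΩ.ae_out_mem] with p hpW hp
      by_cases hv : p.2.2 ∈ W
      · obtain ⟨hb1, -⟩ := hB p.1 (Ioo_subset_Icc_self hp.1) p.2.1
          (frontier_subset_closure hp.2.1) _ hv
        rw [norm_mul, Real.norm_of_nonneg (sq_nonneg (d p))]
        refine mul_le_mul_of_nonneg_left ?_ (sq_nonneg _)
        rw [norm_mul]
        exact (mul_le_of_le_one_left (norm_nonneg _) (hχ1 n p)).trans hb1
      · simp [hpW hv]
    · refine tendsto_const_nhds.congr' ?_
      filter_upwards [hχlim p] with n hn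
      simp [hψn, hn.1]
  have l3 : Filter.Tendsto (fun n => ∫ p, h p * z p * ψn n p ∂interiorMeasure T Ω)
      Filter.atTop (𝓝 (∫ p, h p * z p * ψ p ∂interiorMeasure T Ω)) := by
    refine tendsto_integral_of_dominated_convergence (fun p => ‖h p * z p‖ * B)
      (fun n => hhz.1.mul (hψnC n).continuous.aestronglyMeasurable)
      (hhz.norm.mul_const _) (fun n => ?_) (Filter.Eventually.of_forall fun p => ?_)
    · filter_upwards [hzW, ae_interior_mem hΩ.isOpen] with p hpW hp
      by_cases hv : p.2.2 ∈ W
      · obtain ⟨hb1, -⟩ := hB p.1 (Ioo_subset_Icc_self hp.1) p.2.1 (subset_closure hp.2) _ hv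
        rw [norm_mul]
        refine mul_le_mul_of_nonneg_left ?_ (norm_nonneg _)
        rw [norm_mul]
        exact (mul_le_of_le_one_left (norm_nonneg _) (hχ1 n p)).trans hb1
      · simp [hpW hv]
    · refine tendsto_const_nhds.congr' ?_
      filter_upwards [hχlim p] with n hn
      simp [hψn, hn.1]
  have l4 : Filter.Tendsto (fun n => ∫ y, g y ^ 2 * ψn n (0, y) ∂phaseMeasure Ω)
      Filter.atTop (𝓝 (∫ y, g y ^ 2 * ψ (0, y) ∂phaseMeasure Ω)) := by
    refine tendsto_integral_of_dominated_convergence (fun p => g p ^ 2 * B)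
      (fun n => hg2.1.mul ((hψnC n).continuous.comp
        (by fun_prop : Continuous fun y : Phase => ((0 : ℝ), y))).aestronglyMeasurable)
      (hg2.mul_const _) (fun n => ?_) (Filter.Eventually.of_forall fun p => ?_)
    · filter_upwards [hgW, ae_phase_mem hΩ.isOpen] with y hyW hy
      by_cases hv : y.2 ∈ W
      · obtain ⟨hb1, -⟩ := hB 0 ⟨le_rfl, hT.le⟩ y.1 (subset_closure hy) _ hv
        rw [norm_mul, Real.norm_of_nonneg (sq_nonneg (g y))]
        refine mul_le_mul_of_nonneg_left ?_ (sq_nonneg _)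
        rw [norm_mul]
        exact (mul_le_of_le_one_left (norm_nonneg _) (hχ1 n _)).trans hb1
      · simp [hyW hv]
    · refine tendsto_const_nhds.congr' ?_
      filter_upwards [hχlim (0, p)] with n hn
      simp [hψn, hn.1]
  refine tendsto_nhds_unique l1 ?_
  simp_rw [hid]
  exact (l2.sub (l3.const_mul 2)).sub l4

end EnergyIdentity

/-! ### Removing the condition at the final time. -/

section EnergyInequality

variable {T : ℝ} {Ω : Set R3} {E : R3 → R3} {h z d : ℝ × Phase → ℝ} {g : Phase → ℝ}

/-- Smooth cut-off functions in time, equal to `1` before and vanishing near the final time. -/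
lemma exists_time_cutoff (T : ℝ) : ∃ θ : ℕ → ℝ → ℝ, (∀ n, ContDiff ℝ 1 (θ n)) ∧
    (∀ n t, 0 ≤ θ n t ∧ θ n t ≤ 1) ∧ (∀ n t, deriv (θ n) t ≤ 0) ∧
    (∀ n, ∃ T' < T, ∀ t, T' ≤ t → θ n t = 0) ∧ (∀ n, ∃ M, ∀ t, |deriv (θ n) t| ≤ M) ∧
    ∀ t < T, ∀ᶠ n in Filter.atTop, θ n t = 1 := by
  -- With this scaling the cut-off equals 1 up to T - 2/(n+1) and vanishes from T - 1/(n+1) on,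
  -- strictly before T.
  set θ : ℕ → ℝ → ℝ := fun n t => Real.smoothTransition (((n : ℝ) + 1) * (T - t) - 1) with hθ
  have hpos : ∀ n : ℕ, (0 : ℝ) < (n : ℝ) + 1 := fun n => by positivity
  have hC : ∀ n, ContDiff ℝ 1 (θ n) := fun n =>
    (Real.smoothTransition.contDiff (n := 1)).comp (by fun_prop)
  have hanti : ∀ n, Antitone (θ n) := fun n s t hst =>
    Real.smoothTransition.monotone (by nlinarith [hpos n])
  have hzero : ∀ (n : ℕ) t, T - ((n : ℝ) + 1)⁻¹ ≤ t → θ n t = 0 := by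
    intro n t ht
    refine Real.smoothTransition.zero_of_nonpos ?_
    have := mul_inv_cancel₀ (hpos n).ne'
    nlinarith [hpos n]
  have hone : ∀ (n : ℕ) t, t ≤ T - 2 * ((n : ℝ) + 1)⁻¹ → θ n t = 1 := by
    intro n t ht
    refine Real.smoothTransition.one_of_one_le ?_
    have := mul_inv_cancel₀ (hpos n).ne'
    nlinarith [hpos n]
  refine ⟨θ, hC, fun n t => ⟨Real.smoothTransition.nonneg _, Real.smoothTransition.le_one _⟩,
    fun n t => (hanti n).deriv_nonpos, fun n => ⟨T - ((n : ℝ) + 1)⁻¹, ?_, hzero n⟩, fun n => ?_, ?_⟩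
  · have : (0 : ℝ) < ((n : ℝ) + 1)⁻¹ := inv_pos.2 (hpos n)
    linarith
  · set a := T - 2 * ((n : ℝ) + 1)⁻¹ with ha
    set b := T - ((n : ℝ) + 1)⁻¹ with hb
    obtain ⟨M, hM⟩ := (isCompact_Icc (a := a) (b := b)).exists_bound_of_continuousOn
      ((hC n).continuous_deriv le_rfl).continuousOn
    refine ⟨max M 0, fun t => ?_⟩
    by_cases ht : t ∈ Icc a b
    · exact (hM t ht).trans (le_max_left _ _)
    · have h0 : deriv (θ n) t = 0 := by
        rcases lt_or_ge t a with h1 | h1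
        · have : θ n =ᶠ[𝓝 t] fun _ => 1 := by
            filter_upwards [Iio_mem_nhds h1] with s hs using hone n s (le_of_lt hs)
          rw [this.deriv_eq, deriv_const]
        · have h2 : b < t := by
            by_contra h3
            exact ht ⟨h1, not_lt.1 h3⟩
          have : θ n =ᶠ[𝓝 t] fun _ => 0 := by
            filter_upwards [Ioi_mem_nhds h2] with s hs using hzero n s (le_of_lt hs)
          rw [this.deriv_eq, deriv_const]
      rw [h0, abs_zero]
      exact le_max_right _ _
  · intro t ht
    have hlim : Filter.Tendsto (fun n : ℕ => T - 2 * ((n : ℝ) + 1)⁻¹) Filter.atTop (𝓝 (T - 2 * 0)) :=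
      ((tendsto_inv_atTop_zero.comp (Filter.tendsto_atTop_add_const_right _ 1
        tendsto_natCast_atTop_atTop)).const_mul 2).const_sub T
    rw [mul_zero, sub_zero] at hlim
    filter_upwards [hlim.eventually (lt_mem_nhds ht)] with n hn using hone n t hn.le

lemma transportOp_comp_fst {η : ℝ → ℝ} (hη : Differentiable ℝ η) (p : ℝ × Phase) :
    transportOp E (fun p => η p.1) p = deriv η p.1 := by
  have h1 : HasFDerivAt (fun p : ℝ × Phase => η p.1)
      ((deriv η p.1) • ContinuousLinearMap.fst ℝ ℝ Phase) p :=
    (hη p.1).hasDerivAt.comp_hasFDerivAt p hasFDerivAt_fst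
  rw [transportOp, h1.fderiv]
  simp

/-- The energy inequality for nonnegative weights that need not vanish at the final time. -/
theorem IsTransportSolution.energy_inequality (hsol : IsTransportSolution T Ω E h z d g)
    (hE : IsC1OnClosure Ω E) (hΩ : IsSmoothConvexDomain Ω) (hT : 0 < T) {B : ℝ}
    {ψ : ℝ × Phase → ℝ} (hψ : ContDiff ℝ 1 ψ) (hψ0 : ∀ p, 0 ≤ ψ p)
    (hB : ∀ t ∈ Icc 0 T, ∀ x ∈ closure Ω, ∀ v, |ψ (t, x, v)| ≤ B ∧
      |transportOp E ψ (t, x, v)| ≤ B) :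
    ∫ p, d p ^ 2 * ψ p ∂outMeasure T Ω ≤ ∫ p, z p ^ 2 * transportOp E ψ p ∂interiorMeasure T Ω
      + 2 * ∫ p, h p * z p * ψ p ∂interiorMeasure T Ω + ∫ y, g y ^ 2 * ψ (0, y) ∂phaseMeasure Ω := by
  obtain ⟨θ, hθC, hθ01, hθd, hθT, hθM, hθ1⟩ := exists_time_cutoff T
  have hB0 : 0 ≤ B := by
    obtain ⟨x, hx⟩ := hΩ.nonempty
    exact (abs_nonneg _).trans (hB 0 ⟨le_rfl, hT.le⟩ x (subset_closure hx) 0).1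
  have hz2 := hsol.memLp.integrable_sq
  have hd2 := hsol.memLp_trace.integrable_sq
  have hg2 := hsol.memLp_initial.integrable_sq
  have hhz := hsol.memLp_source.integrable_mul hsol.memLp
  have hθfst : ∀ n, ContDiff ℝ 1 fun p : ℝ × Phase => θ n p.1 := fun n => (hθC n).comp contDiff_fst
  have hθabs : ∀ n t, |θ n t| ≤ 1 := fun n t => by
    rw [abs_of_nonneg (hθ01 n t).1]; exact (hθ01 n t).2
  have hPm := hE.aestronglyMeasurable_transportOp (T := T) hΩ.isOpen hψ
  have hop : ∀ n p, transportOp E (fun p => θ n p.1 * ψ p) p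
      = θ n p.1 * transportOp E ψ p + ψ p * deriv (θ n) p.1 := by
    intro n p
    rw [transportOp_mul ((hθfst n).differentiable one_ne_zero p) (hψ.differentiable one_ne_zero p),
      transportOp_comp_fst ((hθC n).differentiable one_ne_zero)]
  have hbP : ∀ᵐ p ∂interiorMeasure T Ω, |ψ p| ≤ B ∧ |transportOp E ψ p| ≤ B := by
    filter_upwards [ae_interior_mem hΩ.isOpen] with p hp
    exact hB p.1 (Ioo_subset_Icc_self hp.1) p.2.1 (subset_closure hp.2) p.2.2
  have hineq : ∀ n, ∫ p, d p ^ 2 * (θ n p.1 * ψ p) ∂outMeasure T Ω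
      ≤ ∫ p, z p ^ 2 * (θ n p.1 * transportOp E ψ p) ∂interiorMeasure T Ω
        + 2 * ∫ p, h p * z p * (θ n p.1 * ψ p) ∂interiorMeasure T Ω
        + ∫ y, g y ^ 2 * (θ n 0 * ψ (0, y)) ∂phaseMeasure Ω := by
    intro n
    obtain ⟨T', hT', hθ0⟩ := hθT n
    obtain ⟨M, hM⟩ := hθM n
    have hM0 : 0 ≤ M := (abs_nonneg _).trans (hM 0)
    have hid := hsol.energy_identity hE hΩ hT (W := univ) (T' := T') (B := B + B * M)
      (ψ := fun p => θ n p.1 * ψ p) ((hθfst n).mul hψ) hT'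
      (fun t y ht => by simp only [hθ0 t ht, zero_mul]) (Filter.Eventually.of_forall fun p hp => absurd (mem_univ _) hp)
      (Filter.Eventually.of_forall fun p hp => absurd (mem_univ _) hp)
      (Filter.Eventually.of_forall fun p hp => absurd (mem_univ _) hp) (by
        intro t ht x hx v _
        obtain ⟨hb1, hb2⟩ := hB t ht x hx v
        constructor
        · rw [abs_mul]
          have := mul_le_of_le_one_left (abs_nonneg (ψ (t, x, v))) (hθabs n t)
          nlinarith
        · rw [hop]
          refine (abs_add_le _ _).trans (add_le_add ?_ ?_)
          · rw [abs_mul]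
            exact (mul_le_of_le_one_left (abs_nonneg _) (hθabs n t)).trans hb2
          · rw [abs_mul]
            exact mul_le_mul hb1 (hM t) (abs_nonneg _) hB0)
    -- The term with the derivative of the cut-off represents the energy at the final time. It is
    -- nonpositive, as the cut-off decreases and ψ ≥ 0, and dropping it turns the identity into an
    -- inequality.
    have hle : ∫ p, z p ^ 2 * transportOp E (fun p => θ n p.1 * ψ p) p ∂interiorMeasure T Ω
        ≤ ∫ p, z p ^ 2 * (θ n p.1 * transportOp E ψ p) ∂interiorMeasure T Ω := by
      refine integral_mono_ae ?_ ?_ (Filter.Eventually.of_forall fun p => ?_)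
      · refine hz2.mul_bdd (c := B + B * M)
          (hE.aestronglyMeasurable_transportOp hΩ.isOpen ((hθfst n).mul hψ)) ?_
        filter_upwards [hbP] with p hp
        rw [hop]
        refine (norm_add_le _ _).trans (add_le_add ?_ ?_)
        · rw [norm_mul]
          exact (mul_le_of_le_one_left (abs_nonneg _) (hθabs n _)).trans hp.2
        · rw [norm_mul]
          exact mul_le_mul hp.1 (hM _) (abs_nonneg _) hB0
      · refine hz2.mul_bdd (c := B) ((hθfst n).continuous.aestronglyMeasurable.mul hPm) ?_
        filter_upwards [hbP] with p hp
        rw [norm_mul]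
        exact (mul_le_of_le_one_left (abs_nonneg _) (hθabs n _)).trans hp.2
      · simp only [hop]
        refine mul_le_mul_of_nonneg_left ?_ (sq_nonneg _)
        have := mul_nonpos_of_nonneg_of_nonpos (hψ0 p) (hθd n p.1)
        linarith
    linarith
  have hlim1 : ∀ᵐ p ∂interiorMeasure T Ω, ∀ᶠ n in Filter.atTop, θ n p.1 = 1 := by
    filter_upwards [ae_interior_mem hΩ.isOpen] with p hp using hθ1 _ hp.1.2
  have l1 : Filter.Tendsto (fun n => ∫ p, z p ^ 2 * (θ n p.1 * transportOp E ψ p) ∂interiorMeasure T Ω)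
      Filter.atTop (𝓝 (∫ p, z p ^ 2 * transportOp E ψ p ∂interiorMeasure T Ω)) := by
    refine tendsto_integral_of_dominated_convergence (fun p => z p ^ 2 * B)
      (fun n => hz2.1.mul ((hθfst n).continuous.aestronglyMeasurable.mul hPm))
      (hz2.mul_const _) (fun n => ?_) ?_
    · filter_upwards [hbP] with p hp
      rw [norm_mul, norm_mul, Real.norm_of_nonneg (sq_nonneg (z p))]
      exact mul_le_mul_of_nonneg_left ((mul_le_of_le_one_left (abs_nonneg _) (hθabs n _)).trans hp.2)
        (sq_nonneg _)
    · filter_upwards [hlim1] with p hp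
      refine tendsto_const_nhds.congr' ?_
      filter_upwards [hp] with n hn
      rw [hn, one_mul]
  have l2 : Filter.Tendsto (fun n => ∫ p, d p ^ 2 * (θ n p.1 * ψ p) ∂outMeasure T Ω)
      Filter.atTop (𝓝 (∫ p, d p ^ 2 * ψ p ∂outMeasure T Ω)) := by
    refine tendsto_integral_of_dominated_convergence (fun p => d p ^ 2 * B)
      (fun n => hd2.1.mul ((hθfst n).mul hψ).continuous.aestronglyMeasurable)
      (hd2.mul_const _) (fun n => ?_) ?_
    · filter_upwards [hΩ.ae_out_mem] with p hp
      rw [norm_mul, norm_mul, Real.norm_of_nonneg (sq_nonneg (d p))]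
      exact mul_le_mul_of_nonneg_left ((mul_le_of_le_one_left (abs_nonneg _) (hθabs n _)).trans
        (hB p.1 (Ioo_subset_Icc_self hp.1) p.2.1 (frontier_subset_closure hp.2.1) p.2.2).1)
        (sq_nonneg _)
    · filter_upwards [hΩ.ae_out_mem] with p hp
      refine tendsto_const_nhds.congr' ?_
      filter_upwards [hθ1 _ hp.1.2] with n hn
      rw [hn, one_mul]
  have l3 : Filter.Tendsto (fun n => ∫ p, h p * z p * (θ n p.1 * ψ p) ∂interiorMeasure T Ω)
      Filter.atTop (𝓝 (∫ p, h p * z p * ψ p ∂interiorMeasure T Ω)) := by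
    refine tendsto_integral_of_dominated_convergence (fun p => ‖h p * z p‖ * B)
      (fun n => hhz.1.mul ((hθfst n).mul hψ).continuous.aestronglyMeasurable)
      (hhz.norm.mul_const _) (fun n => ?_) ?_
    · filter_upwards [hbP] with p hp
      rw [norm_mul, norm_mul (θ n p.1)]
      exact mul_le_mul_of_nonneg_left ((mul_le_of_le_one_left (abs_nonneg _) (hθabs n _)).trans hp.1)
        (norm_nonneg _)
    · filter_upwards [hlim1] with p hp
      refine tendsto_const_nhds.congr' ?_
      filter_upwards [hp] with n hn
      rw [hn, one_mul]
  have l4 : Filter.Tendsto (fun n => ∫ y, g y ^ 2 * (θ n 0 * ψ (0, y)) ∂phaseMeasure Ω)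
      Filter.atTop (𝓝 (∫ y, g y ^ 2 * ψ (0, y) ∂phaseMeasure Ω)) := by
    refine tendsto_const_nhds.congr' ?_
    filter_upwards [hθ1 0 hT] with n hn
    rw [hn]
    simp only [one_mul]
  exact le_of_tendsto_of_tendsto' l2 ((l1.add (l3.const_mul 2)).add l4) hineq

end EnergyInequality

/-! ### Energy estimate with exponential decay in time. -/

section ExponentialWeight

variable {T : ℝ} {Ω : Set R3} {E : R3 → R3} {q : Phase → ℝ} {S z d : ℝ × Phase → ℝ} {g : Phase → ℝ}

lemma ae_interior_of_ae_phase {P : Phase → Prop} (hP : ∀ᵐ y ∂phaseMeasure Ω, P y) :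
    ∀ᵐ p ∂interiorMeasure T Ω, P p.2 :=
  Measure.quasiMeasurePreserving_snd.ae hP

/-- Energy inequality with the weight `exp (-λ t)`. -/
lemma IsTransportSolution.energy_exp {Q : ℝ}
    (hsol : IsTransportSolution T Ω E (fun p => S p - q p.2 * z p) z d g)
    (hE : IsC1OnClosure Ω E) (hΩ : IsSmoothConvexDomain Ω) (hT : 0 < T)
    (hS : MemLp S 2 (interiorMeasure T Ω)) (hQ : ∀ᵐ y ∂phaseMeasure Ω, |q y| ≤ Q)
    {l : ℝ} (hl : 0 ≤ l) :
    ∫ p, d p ^ 2 * Real.exp (-l * p.1) ∂outMeasure T Ω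
      + (l - 2 * Q) * ∫ p, z p ^ 2 * Real.exp (-l * p.1) ∂interiorMeasure T Ω
      ≤ 2 * ∫ p, S p * z p * Real.exp (-l * p.1) ∂interiorMeasure T Ω
        + ∫ y, g y ^ 2 ∂phaseMeasure Ω := by
  have hη : ContDiff ℝ 1 fun t : ℝ => Real.exp (-l * t) := by fun_prop
  have hηp : ContDiff ℝ 1 fun p : ℝ × Phase => Real.exp (-l * p.1) := hη.comp contDiff_fst
  have hderiv : ∀ t, deriv (fun t : ℝ => Real.exp (-l * t)) t = -l * Real.exp (-l * t) := by
    intro t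
    have h1 : HasDerivAt (fun t : ℝ => -l * t) (-l) t := by
      simpa using (hasDerivAt_id t).const_mul (-l)
    rw [h1.exp.deriv]
    ring
  have hle1 : ∀ t ∈ Icc 0 T, Real.exp (-l * t) ≤ 1 := fun t ht =>
    Real.exp_le_one_iff.2 (by nlinarith [ht.1])
  have hop : ∀ p, transportOp E (fun p : ℝ × Phase => Real.exp (-l * p.1)) p
      = -l * Real.exp (-l * p.1) := fun p => by
    rw [transportOp_comp_fst (η := fun t => Real.exp (-l * t)) (hη.differentiable one_ne_zero), hderiv]
  have hen := hsol.energy_inequality hE hΩ hT hηp (fun p => (Real.exp_pos _).le) (B := 1 + l) (by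
    intro t ht x _ v
    have h0 := Real.exp_pos (-l * t)
    have h1 := hle1 t ht
    constructor
    · rw [abs_of_pos h0]; linarith
    · rw [hop, abs_mul, abs_neg, abs_of_nonneg hl, abs_of_pos h0]
      nlinarith)
  have hbd : ∀ᵐ p ∂interiorMeasure T Ω, ‖Real.exp (-l * p.1)‖ ≤ 1 := by
    filter_upwards [ae_interior_mem hΩ.isOpen] with p hp
    rw [Real.norm_of_nonneg (Real.exp_pos _).le]
    exact hle1 _ (Ioo_subset_Icc_self hp.1)
  have hz2 := hsol.memLp.integrable_sq
  have iz : Integrable (fun p => z p ^ 2 * Real.exp (-l * p.1)) (interiorMeasure T Ω) :=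
    hz2.mul_bdd hηp.continuous.aestronglyMeasurable hbd
  have iS : Integrable (fun p => S p * z p * Real.exp (-l * p.1)) (interiorMeasure T Ω) :=
    (hS.integrable_mul hsol.memLp).mul_bdd hηp.continuous.aestronglyMeasurable hbd
  have ih : Integrable (fun p => (S p - q p.2 * z p) * z p * Real.exp (-l * p.1)) (interiorMeasure T Ω) :=
    (hsol.memLp_source.integrable_mul hsol.memLp).mul_bdd hηp.continuous.aestronglyMeasurable hbd
  have h1 : ∫ p, z p ^ 2 * transportOp E (fun p : ℝ × Phase => Real.exp (-l * p.1)) p ∂interiorMeasure T Ω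
      = -l * ∫ p, z p ^ 2 * Real.exp (-l * p.1) ∂interiorMeasure T Ω := by
    rw [← integral_const_mul]
    congr 1
    ext p
    rw [hop]
    ring
  have h2 : ∫ p, (S p - q p.2 * z p) * z p * Real.exp (-l * p.1) ∂interiorMeasure T Ω
      ≤ ∫ p, S p * z p * Real.exp (-l * p.1) ∂interiorMeasure T Ω
        + Q * ∫ p, z p ^ 2 * Real.exp (-l * p.1) ∂interiorMeasure T Ω := by
    rw [← integral_const_mul, ← integral_add iS (iz.const_mul Q)]
    refine integral_mono_ae ih (iS.add (iz.const_mul Q)) ?_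
    filter_upwards [ae_interior_of_ae_phase hQ] with p hp
    have := (abs_le.1 hp).1
    have h3 : 0 ≤ z p ^ 2 * Real.exp (-l * p.1) := by positivity
    nlinarith
  simp only [mul_zero, Real.exp_zero, mul_one] at hen
  linarith

end ExponentialWeight

/-! ### Translations and difference quotients in time. -/

section TimeShift

variable {T δ : ℝ} {m : Measure Phase}

/-- Translation by `δ` in time, with value zero up to time `δ`. -/
def shiftBack (δ : ℝ) (G : ℝ × Phase → ℝ) (p : ℝ × Phase) : ℝ :=
  if δ < p.1 then G (p.1 - δ, p.2) else 0

/-- The backward difference quotient in time. -/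
def diffQuot (δ : ℝ) (G : ℝ × Phase → ℝ) (p : ℝ × Phase) : ℝ := (G p - shiftBack δ G p) / δ

lemma measurePreserving_time_translation [SFinite m] (δ : ℝ) :
    MeasurePreserving (fun p : ℝ × Phase => (p.1 + δ, p.2)) ((volume : Measure ℝ).prod m)
      ((volume : Measure ℝ).prod m) :=
  (measurePreserving_add_right volume δ).prod (MeasurePreserving.id m)

lemma measurableEmbedding_time_translation (δ : ℝ) :
    MeasurableEmbedding (fun p : ℝ × Phase => (p.1 + δ, p.2)) :=
  ((Homeomorph.addRight δ).prodCongr (Homeomorph.refl Phase)).measurableEmbedding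

lemma prod_Ioo_eq_restrict [SFinite m] : ((volume : Measure ℝ).restrict (Ioo 0 T)).prod m
    = ((volume : Measure ℝ).prod m).restrict (Ioo 0 T ×ˢ univ) := by
  rw [← Measure.prod_restrict, Measure.restrict_univ]

/-- The shifted function is zero up to time δ and `K` vanishes from T on, so translation by δ
produces no boundary contribution on (0, T). -/
lemma integral_shiftBack_mul [SFinite m] (hδ : 0 < δ) {G K : ℝ × Phase → ℝ}
    (hK : ∀ t y, T ≤ t → K (t, y) = 0) :
    ∫ p, shiftBack δ G p * K p ∂((volume : Measure ℝ).restrict (Ioo 0 T)).prod m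
      = ∫ p, G p * K (p.1 + δ, p.2) ∂((volume : Measure ℝ).restrict (Ioo 0 T)).prod m := by
  have hm : MeasurableSet (Ioo 0 T ×ˢ univ : Set (ℝ × Phase)) := measurableSet_Ioo.prod MeasurableSet.univ
  rw [prod_Ioo_eq_restrict, ← integral_indicator hm, ← integral_indicator hm,
    ← (measurePreserving_time_translation δ).integral_comp (measurableEmbedding_time_translation δ)]
  congr 1
  ext p
  simp only [indicator, mem_prod, mem_univ, and_true, mem_Ioo, shiftBack, lt_add_iff_pos_left,
    add_sub_cancel_right]
  by_cases h0 : 0 < p.1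
  · by_cases h1 : p.1 + δ < T
    · rw [if_pos ⟨by linarith, h1⟩, if_pos h0, if_pos ⟨h0, by linarith⟩]
    · rw [if_neg fun h => h1 h.2, hK _ _ (not_lt.1 h1)]
      simp
  · simp [h0]

lemma memLp_shiftBack [SFinite m] {G : ℝ × Phase → ℝ} (hδ : 0 < δ)
    (hG : MemLp G 2 (((volume : Measure ℝ).restrict (Ioo 0 T)).prod m)) :
    MemLp (shiftBack δ G) 2 (((volume : Measure ℝ).restrict (Ioo 0 T)).prod m) := by
  have hm : MeasurableSet (Ioo 0 T ×ˢ univ : Set (ℝ × Phase)) := measurableSet_Ioo.prod MeasurableSet.univ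
  rw [prod_Ioo_eq_restrict] at hG ⊢
  have h1 := ((memLp_indicator_iff_restrict hm).2 hG).comp_measurePreserving
    (measurePreserving_time_translation (m := m) (-δ))
  refine (h1.restrict (Ioo 0 T ×ˢ univ)).ae_eq ?_
  filter_upwards [ae_restrict_mem hm] with p hp
  simp only [Function.comp_apply, indicator, mem_prod, mem_univ, and_true, mem_Ioo, shiftBack,
    ← sub_eq_add_neg]
  have h2 := hp.1.2
  by_cases h3 : δ < p.1
  · rw [if_pos ⟨by linarith, by linarith⟩, if_pos h3]
  · rw [if_neg fun h => h3 (by linarith [h.1]), if_neg h3]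

lemma memLp_diffQuot [SFinite m] {G : ℝ × Phase → ℝ} (hδ : 0 < δ)
    (hG : MemLp G 2 (((volume : Measure ℝ).restrict (Ioo 0 T)).prod m)) :
    MemLp (diffQuot δ G) 2 (((volume : Measure ℝ).restrict (Ioo 0 T)).prod m) := by
  have h1 := (hG.sub (memLp_shiftBack hδ hG)).mul_const δ⁻¹
  refine h1.ae_eq (Filter.Eventually.of_forall fun p => ?_)
  simp only [diffQuot, div_eq_mul_inv, Pi.sub_apply]

/-- Summation by parts: the difference quotient can be moved to the other factor. -/
lemma integral_diffQuot_mul [SFinite m] {G K : ℝ × Phase → ℝ} (hδ : 0 < δ)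
    (hG : MemLp G 2 (((volume : Measure ℝ).restrict (Ioo 0 T)).prod m))
    (hK : MemLp K 2 (((volume : Measure ℝ).restrict (Ioo 0 T)).prod m))
    (hK' : MemLp (fun p : ℝ × Phase => K (p.1 + δ, p.2)) 2
      (((volume : Measure ℝ).restrict (Ioo 0 T)).prod m))
    (hKT : ∀ t y, T ≤ t → K (t, y) = 0) :
    ∫ p, diffQuot δ G p * K p ∂((volume : Measure ℝ).restrict (Ioo 0 T)).prod m
      = ∫ p, G p * ((K p - K (p.1 + δ, p.2)) / δ) ∂((volume : Measure ℝ).restrict (Ioo 0 T)).prod m := by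
  set μ := ((volume : Measure ℝ).restrict (Ioo 0 T)).prod m with hμ
  have i1 : Integrable (fun p => G p * K p) μ := hG.integrable_mul hK
  have i2 : Integrable (fun p => shiftBack δ G p * K p) μ := (memLp_shiftBack hδ hG).integrable_mul hK
  have i3 : Integrable (fun p : ℝ × Phase => G p * K (p.1 + δ, p.2)) μ := hG.integrable_mul hK'
  have e1 : ∀ p, diffQuot δ G p * K p = δ⁻¹ * (G p * K p - shiftBack δ G p * K p) := fun p => by
    rw [diffQuot]; ring
  have e2 : ∀ p : ℝ × Phase, G p * ((K p - K (p.1 + δ, p.2)) / δ)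
      = δ⁻¹ * (G p * K p - G p * K (p.1 + δ, p.2)) := fun p => by ring
  simp_rw [e1, e2]
  rw [integral_const_mul, integral_const_mul, integral_sub i1 i2, integral_sub i1 i3,
    hμ, integral_shiftBack_mul hδ hKT]

end TimeShift

/-! ### Difference quotients of solutions. -/

section DifferenceQuotientSolution

variable {T : ℝ} {Ω : Set R3} {E : R3 → R3} {h z d : ℝ × Phase → ℝ} {g : Phase → ℝ}

instance isLocallyFiniteMeasure_interiorMeasure : IsLocallyFiniteMeasure (interiorMeasure T Ω) := by
  rw [interiorMeasure_eq_restrict]; infer_instance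

lemma IsC1OnClosure.memLp_transportOp (hE : IsC1OnClosure Ω E) (hΩ : IsOpen Ω) {φ : ℝ × Phase → ℝ}
    (hφ : ContDiff ℝ 1 φ) (hφs : HasCompactSupport φ) :
    MemLp (transportOp E φ) 2 (interiorMeasure T Ω) := by
  obtain ⟨F, hF, hEF⟩ := hE
  have hc : Continuous (transportOp F φ) :=
    (hφ.continuous_fderiv one_ne_zero).clm_apply (by
      have := hF.continuous
      fun_prop)
  have hcs : HasCompactSupport (transportOp F φ) :=
    (hφs.fderiv ℝ).mono' fun p hp => by
      refine subset_tsupport _ fun h0 => hp ?_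
      simp [transportOp, h0]
  refine (hc.memLp_of_hasCompactSupport hcs).ae_eq ?_
  filter_upwards [ae_interior_mem hΩ] with p hp
  exact (transportOp_congr hEF φ (subset_closure hp.2)).symm

lemma hasCompactSupport_time_translation {φ : ℝ × Phase → ℝ} (hφs : HasCompactSupport φ) (δ : ℝ) :
    HasCompactSupport fun p : ℝ × Phase => φ (p.1 + δ, p.2) :=
  hφs.comp_homeomorph ((Homeomorph.addRight δ).prodCongr (Homeomorph.refl Phase))

lemma tsupport_time_translation {φ : ℝ × Phase → ℝ} (hφ : tsupport φ ⊆ Iio T ×ˢ univ) {δ : ℝ}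
    (hδ : 0 ≤ δ) : tsupport (fun p : ℝ × Phase => φ (p.1 + δ, p.2)) ⊆ Iio T ×ˢ univ := by
  have := tsupport_comp_eq_preimage φ ((Homeomorph.addRight δ).prodCongr (Homeomorph.refl Phase))
  intro p hp
  have hp' : (p.1 + δ, p.2) ∈ tsupport φ := by
    have h1 : p ∈ tsupport (φ ∘ ((Homeomorph.addRight δ).prodCongr (Homeomorph.refl Phase))) := hp
    rw [this] at h1
    exact h1
  have := (hφ hp').1
  refine ⟨?_, mem_univ _⟩
  simp only [mem_Iio] at this ⊢
  linarith

lemma transportOp_time_translation {φ : ℝ × Phase → ℝ} (δ : ℝ) (p : ℝ × Phase) :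
    transportOp E (fun p : ℝ × Phase => φ (p.1 + δ, p.2)) p = transportOp E φ (p.1 + δ, p.2) := by
  have h1 : (fun p : ℝ × Phase => φ (p.1 + δ, p.2)) = fun p => φ (p + (δ, 0)) := by
    ext p
    congr 1
    ext <;> simp
  rw [transportOp, h1, fderiv_comp_add_right]
  have h2 : p + (δ, 0) = (p.1 + δ, p.2) := by ext <;> simp
  rw [h2]
  rfl

lemma transportOp_eq_zero_of_tsupport {φ : ℝ × Phase → ℝ} (hφ : tsupport φ ⊆ Iio T ×ˢ univ) {t : ℝ}
    (ht : T ≤ t) (y : Phase) : transportOp E φ (t, y) = 0 := by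
  have : fderiv ℝ φ (t, y) = 0 := by
    refine image_eq_zero_of_notMem_tsupport fun hmem => ?_
    exact absurd (hφ (tsupport_fderiv_subset ℝ hmem)).1 (not_lt.2 ht)
  simp [transportOp, this]

/-- Difference quotients in time of a solution with zero initial value are solutions. -/
lemma IsTransportSolution.isTransportSolution_diffQuot (hsol : IsTransportSolution T Ω E h z d fun _ => 0)
    (hE : IsC1OnClosure Ω E) (hΩ : IsSmoothConvexDomain Ω) {δ : ℝ} (hδ : 0 < δ) :
    IsTransportSolution T Ω E (diffQuot δ h) (diffQuot δ z) (diffQuot δ d) fun _ => 0 := by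
  have := hΩ.isFiniteMeasure_surface
  have : SFinite (boundaryMeasure Ω) := by unfold boundaryMeasure; infer_instance
  have : SFinite (phaseMeasure Ω) := by unfold phaseMeasure; infer_instance
  have hlf := hΩ.isLocallyFiniteMeasure_outMeasure T
  have hlf' : IsLocallyFiniteMeasure (interiorMeasure T Ω) := inferInstance
  refine ⟨memLp_diffQuot hδ hsol.memLp_source, memLp_diffQuot hδ hsol.memLp,
    memLp_diffQuot hδ hsol.memLp_trace, hsol.memLp_initial, fun φ hφ hφs hφT => ?_⟩
  set φ' : ℝ × Phase → ℝ := fun p => φ (p.1 + δ, p.2) with hφ'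
  have hφ'C : ContDiff ℝ 1 φ' := hφ.comp (by fun_prop)
  have hφ's : HasCompactSupport φ' := hasCompactSupport_time_translation hφs δ
  have hφ'T : tsupport φ' ⊆ Iio T ×ˢ univ := tsupport_time_translation hφT hδ.le
  -- The solution is tested with the difference quotient (φ(t) - φ(t + δ))/δ, then summed by parts.
  -- The forward shift keeps the support below T, and the zero initial value makes the extension by
  -- zero to negative times consistent.
  have hw := hsol.weak_eq (fun p => (φ p - φ' p) / δ) ((hφ.sub hφ'C).div_const δ)
    ((hφs.sub hφ's).comp_left (g := fun x => x / δ) (zero_div _)) (by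
      have h1 : tsupport (fun p => (φ p - φ' p) / δ) ⊆ tsupport φ ∪ tsupport φ' := by
        refine closure_minimal (fun p hp => ?_) ((isClosed_tsupport _).union (isClosed_tsupport _))
        by_contra hne
        rw [mem_union, not_or] at hne
        refine hp ?_
        simp [image_eq_zero_of_notMem_tsupport hne.1, image_eq_zero_of_notMem_tsupport hne.2]
      exact h1.trans (union_subset hφT hφ'T))
  have hop : ∀ p, transportOp E (fun p => (φ p - φ' p) / δ) p
      = (transportOp E φ p - transportOp E φ (p.1 + δ, p.2)) / δ := by
    intro p
    rw [← transportOp_time_translation, transportOp, transportOp, transportOp]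
    have h1 : HasFDerivAt (fun p => (φ p - φ' p) / δ) (δ⁻¹ • (fderiv ℝ φ p - fderiv ℝ φ' p)) p := by
      have h3 := (((hφ.differentiable one_ne_zero p).hasFDerivAt).sub
        ((hφ'C.differentiable one_ne_zero p).hasFDerivAt)).const_smul δ⁻¹
      refine h3.congr_of_eventuallyEq (Filter.Eventually.of_forall fun p => ?_)
      simp [div_eq_inv_mul]
    rw [h1.fderiv]
    simp only [smul_apply, sub_apply, smul_eq_mul, div_eq_inv_mul]
    rfl
  have e1 := integral_diffQuot_mul (m := phaseMeasure Ω) hδ hsol.memLp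
    (hE.memLp_transportOp (T := T) hΩ.isOpen hφ hφs) (by
      have := hE.memLp_transportOp (T := T) hΩ.isOpen hφ'C hφ's
      exact this.ae_eq (Filter.Eventually.of_forall fun p => transportOp_time_translation δ p)) (fun t y ht => transportOp_eq_zero_of_tsupport hφT ht y)
  have e2 := integral_diffQuot_mul (m := (boundaryMeasure Ω).restrict (GammaPlus Ω)) hδ hsol.memLp_trace
    (K := φ) (Continuous.memLp_of_hasCompactSupport (μ := outMeasure T Ω) hφ.continuous hφs)
    (Continuous.memLp_of_hasCompactSupport (μ := outMeasure T Ω) hφ'C.continuous hφ's)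
    (fun t y ht => apply_time_eq_zero_of_tsupport hφT ht y)
  have e3 := integral_diffQuot_mul (m := phaseMeasure Ω) hδ hsol.memLp_source
    (K := φ) (Continuous.memLp_of_hasCompactSupport (μ := interiorMeasure T Ω) hφ.continuous hφs)
    (Continuous.memLp_of_hasCompactSupport (μ := interiorMeasure T Ω) hφ'C.continuous hφ's)
    (fun t y ht => apply_time_eq_zero_of_tsupport hφT ht y)
  simp only [hop, zero_mul] at hw
  simp only [interiorMeasure, outMeasure] at hw ⊢
  rw [e1, e2, e3, hw]
  simp [hφ']

end DifferenceQuotientSolution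

/-! ### Energy bounds for difference quotients, uniform in the step. -/

section UniformBound

variable {T C₁ C₂ : ℝ} {Ω : Set R3} {E : R3 → R3} {q f g₀ : Phase → ℝ} {S σ w d : ℝ × Phase → ℝ}

/-- A source `S` with initial value `g₀` and time derivative `f σ`, where `σ` is bounded by `C₁` and
`g₀` is comparable to `f`. -/
structure IsSourceData (T : ℝ) (Ω : Set R3) (C₁ C₂ : ℝ) (f g₀ : Phase → ℝ) (S σ : ℝ × Phase → ℝ) :
    Prop where
  memLp_profile : MemLp f 2 (phaseMeasure Ω)
  memLp : MemLp S 2 (interiorMeasure T Ω)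
  measurable : Measurable σ
  abs_le : ∀ p, |σ p| ≤ C₁
  memLp_initial : MemLp g₀ 2 (phaseMeasure Ω)
  eq_primitive : ∀ᵐ y ∂phaseMeasure Ω, ∀ t ∈ Icc 0 T, S (t, y) = g₀ y + ∫ s in (0 : ℝ)..t, f y * σ (s, y)
  bounds : ∀ᵐ y ∂phaseMeasure Ω, |g₀ y| ≤ C₁ * |f y| ∧ C₂ * |f y| ≤ |g₀ y|

lemma IsSourceData.intervalIntegrable (hS : IsSourceData T Ω C₁ C₂ f g₀ S σ) (y : Phase) (a b : ℝ) :
    IntervalIntegrable (fun s => f y * σ (s, y)) volume a b := by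
  refine IntervalIntegrable.mono_fun (g := fun s => f y * σ (s, y)) (f := fun _ => |f y| * C₁)
    intervalIntegrable_const ((hS.measurable.comp (by fun_prop)).const_mul _).aestronglyMeasurable ?_
  refine Filter.Eventually.of_forall fun s => ?_
  have h1 := hS.abs_le (s, y)
  have h0 := (abs_nonneg _).trans h1
  simp only [norm_mul, Real.norm_eq_abs, abs_abs, abs_of_nonneg h0]
  exact mul_le_mul_of_nonneg_left h1 (abs_nonneg _)

lemma IsSourceData.ae_abs_sub_le (hS : IsSourceData T Ω C₁ C₂ f g₀ S σ) :
    ∀ᵐ y ∂phaseMeasure Ω, ∀ s ∈ Icc 0 T, ∀ t ∈ Icc 0 T, s ≤ t →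
      |S (t, y) - S (s, y)| ≤ C₁ * (t - s) * |f y| := by
  filter_upwards [hS.eq_primitive] with y hy s hs t ht hst
  rw [hy s hs, hy t ht, add_sub_add_left_eq_sub, intervalIntegral.integral_interval_sub_left
    (hS.intervalIntegrable y _ _) (hS.intervalIntegrable y _ _)]
  have h1 := intervalIntegral.norm_integral_le_of_norm_le_const (a := s) (b := t)
    (f := fun r => f y * σ (r, y)) (C := |f y| * C₁) (fun r _ => by
      rw [norm_mul]
      exact mul_le_mul_of_nonneg_left (hS.abs_le _) (abs_nonneg _))
  rw [abs_of_nonneg (sub_nonneg.2 hst)] at h1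
  refine h1.trans (le_of_eq ?_)
  ring

lemma IsSourceData.ae_abs_le (hS : IsSourceData T Ω C₁ C₂ f g₀ S σ) (hT : 0 < T) :
    ∀ᵐ y ∂phaseMeasure Ω, ∀ t ∈ Icc 0 T, |S (t, y)| ≤ C₁ * (1 + T) * |f y| := by
  have hC : 0 ≤ C₁ := (abs_nonneg _).trans (hS.abs_le 0)
  filter_upwards [hS.eq_primitive, hS.ae_abs_sub_le, hS.bounds] with y hy1 hy2 hy3 t ht
  have h0 : S (0, y) = g₀ y := by rw [hy1 0 ⟨le_rfl, hT.le⟩]; simp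
  have h1 := hy2 0 ⟨le_rfl, hT.le⟩ t ht ht.1
  rw [h0, sub_zero] at h1
  have h2 := abs_add_le (S (t, y) - g₀ y) (g₀ y)
  rw [sub_add_cancel] at h2
  have h3 : C₁ * t * |f y| ≤ C₁ * T * |f y| := by
    have := ht.2
    gcongr
  have h4 := hy3.1
  nlinarith

lemma integral_interior_mul (T : ℝ) (η : ℝ → ℝ) (f : Phase → ℝ) :
    ∫ p, η p.1 * f p.2 ∂interiorMeasure T Ω
      = (∫ t in Ioo 0 T, η t) * ∫ y, f y ∂phaseMeasure Ω := by
  have : SFinite (phaseMeasure Ω) := by unfold phaseMeasure; infer_instance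
  rw [interiorMeasure, integral_prod_mul]

lemma integrable_interior_mul {η : ℝ → ℝ} (hη : IntegrableOn η (Ioo 0 T))
    (hf : Integrable f (phaseMeasure Ω)) :
    Integrable (fun p : ℝ × Phase => η p.1 * f p.2) (interiorMeasure T Ω) := by
  have : SFinite (phaseMeasure Ω) := by unfold phaseMeasure; infer_instance
  exact Integrable.mul_prod hη hf

lemma setIntegral_exp_neg_le (hT : 0 < T) {l : ℝ} (hl : 0 < l) :
    ∫ t in Ioo 0 T, Real.exp (-l * t) ≤ l⁻¹ := by
  rw [← integral_Ioc_eq_integral_Ioo, ← intervalIntegral.integral_of_le hT.le,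
    intervalIntegral.integral_comp_mul_left (fun x => Real.exp x) (neg_ne_zero.2 hl.ne'), integral_exp,
    mul_zero, Real.exp_zero, smul_eq_mul, inv_neg]
  have h1 := Real.exp_pos (-l * T)
  have h2 : 0 < l⁻¹ := inv_pos.2 hl
  nlinarith

/-- For small times a solution with zero initial value is small. -/
lemma IsTransportSolution.small_time_bound
    (hsol : IsTransportSolution T Ω E (fun p => S p - q p.2 * w p) w d fun _ => 0)
    (hS : IsSourceData T Ω C₁ C₂ f g₀ S σ) (hE : IsC1OnClosure Ω E) (hΩ : IsSmoothConvexDomain Ω)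
    (hT : 0 < T) {Q : ℝ} (hQ : ∀ᵐ y ∂phaseMeasure Ω, |q y| ≤ Q) {δ : ℝ} (hδ : 0 < δ)
    (hδQ : 8 * Q * δ ≤ 1) :
    ∫ p, w p ^ 2 * Real.exp (-δ⁻¹ * p.1) ∂interiorMeasure T Ω
      ≤ 8 * δ ^ 3 * (C₁ * (1 + T)) ^ 2 * ∫ y, f y ^ 2 ∂phaseMeasure Ω := by
  -- The rate 1/δ concentrates the weight on times of order δ. The power δ³ collects one factor from
  -- Young's inequality, one from the time integral of the weight, and one from division by the
  -- damping coefficient.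
  have hen := hsol.energy_exp hE hΩ hT hS.memLp hQ (l := δ⁻¹) (by positivity)
  set X := ∫ p, w p ^ 2 * Real.exp (-δ⁻¹ * p.1) ∂interiorMeasure T Ω with hX
  have hX0 : 0 ≤ X := integral_nonneg fun p => by positivity
  have hd0 : 0 ≤ ∫ p, d p ^ 2 * Real.exp (-δ⁻¹ * p.1) ∂outMeasure T Ω :=
    integral_nonneg fun p => by positivity
  have hcont : Continuous fun p : ℝ × Phase => Real.exp (-δ⁻¹ * p.1) := by fun_prop
  have hbd : ∀ᵐ p ∂interiorMeasure T Ω, ‖Real.exp (-δ⁻¹ * p.1)‖ ≤ 1 := by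
    filter_upwards [ae_interior_mem hΩ.isOpen] with p hp
    rw [Real.norm_of_nonneg (Real.exp_pos _).le]
    have : 0 < δ⁻¹ * p.1 := mul_pos (by positivity) hp.1.1
    exact Real.exp_le_one_iff.2 (by linarith)
  have iw : Integrable (fun p => w p ^ 2 * Real.exp (-δ⁻¹ * p.1)) (interiorMeasure T Ω) :=
    hsol.memLp.integrable_sq.mul_bdd hcont.aestronglyMeasurable hbd
  have iS : Integrable (fun p => S p * w p * Real.exp (-δ⁻¹ * p.1)) (interiorMeasure T Ω) :=
    (hS.memLp.integrable_mul hsol.memLp).mul_bdd hcont.aestronglyMeasurable hbd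
  have hexpi : IntegrableOn (fun t : ℝ => Real.exp (-δ⁻¹ * t)) (Ioo 0 T) :=
    ((by fun_prop : Continuous fun t : ℝ => Real.exp (-δ⁻¹ * t)).integrableOn_Icc).mono_set
      Ioo_subset_Icc_self
  have i_f := integrable_interior_mul hexpi hS.memLp_profile.integrable_sq
  set L := C₁ * (1 + T) with hL
  have hbound : 2 * ∫ p, S p * w p * Real.exp (-δ⁻¹ * p.1) ∂interiorMeasure T Ω
      ≤ (2 * δ)⁻¹ * X + 2 * δ * L ^ 2 * (δ * ∫ y, f y ^ 2 ∂phaseMeasure Ω) := by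
    have h1 : ∫ p, (Real.exp (-δ⁻¹ * p.1) * f p.2 ^ 2) ∂interiorMeasure T Ω
        ≤ δ * ∫ y, f y ^ 2 ∂phaseMeasure Ω := by
      rw [integral_interior_mul T (fun t => Real.exp (-δ⁻¹ * t)) (fun y => f y ^ 2)]
      refine mul_le_mul_of_nonneg_right ?_ (integral_nonneg fun y => sq_nonneg _)
      have := setIntegral_exp_neg_le hT (inv_pos.2 hδ)
      rwa [inv_inv] at this
    have h2 : 2 * ∫ p, S p * w p * Real.exp (-δ⁻¹ * p.1) ∂interiorMeasure T Ω
        ≤ (2 * δ)⁻¹ * X + 2 * δ * L ^ 2 *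
          ∫ p, (Real.exp (-δ⁻¹ * p.1) * f p.2 ^ 2) ∂interiorMeasure T Ω := by
      rw [hX, ← integral_const_mul, ← integral_const_mul, ← integral_const_mul,
        ← integral_add (iw.const_mul _) (i_f.const_mul _)]
      refine integral_mono_ae (iS.const_mul 2) ((iw.const_mul _).add (i_f.const_mul _)) ?_
      filter_upwards [ae_interior_of_ae_phase (hS.ae_abs_le hT), ae_interior_mem hΩ.isOpen] with p hp hpm
      have h3 := hp p.1 (Ioo_subset_Icc_self hpm.1)
      have h4 : S p ^ 2 ≤ L ^ 2 * f p.2 ^ 2 := by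
        rw [← sq_abs (S p), ← sq_abs (f p.2), ← mul_pow]
        exact pow_le_pow_left₀ (abs_nonneg _) h3 2
      have h5 : 2 * (S p * w p) ≤ (2 * δ)⁻¹ * w p ^ 2 + 2 * δ * S p ^ 2 := by
        have h6 : (2 * δ)⁻¹ * w p ^ 2 + 2 * δ * S p ^ 2 - 2 * (S p * w p)
            = (2 * δ)⁻¹ * (w p - 2 * δ * S p) ^ 2 := by
          field_simp
          ring
        have : 0 ≤ (2 * δ)⁻¹ * (w p - 2 * δ * S p) ^ 2 := by positivity
        linarith
      have h7 : 2 * δ * S p ^ 2 ≤ 2 * δ * (L ^ 2 * f p.2 ^ 2) := by gcongr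
      have h8 := Real.exp_pos (-δ⁻¹ * p.1)
      calc 2 * (S p * w p * Real.exp (-δ⁻¹ * p.1)) = 2 * (S p * w p) * Real.exp (-δ⁻¹ * p.1) := by ring
        _ ≤ ((2 * δ)⁻¹ * w p ^ 2 + 2 * δ * (L ^ 2 * f p.2 ^ 2)) * Real.exp (-δ⁻¹ * p.1) :=
          mul_le_mul_of_nonneg_right (by linarith) h8.le
        _ = _ := by ring
    refine h2.trans (add_le_add le_rfl (mul_le_mul_of_nonneg_left h1 (by positivity)))
  have h9 : (4 * δ)⁻¹ * X ≤ 2 * δ * L ^ 2 * (δ * ∫ y, f y ^ 2 ∂phaseMeasure Ω) := by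
    -- The condition 8Qδ ≤ 1 bounds 2Q by 1/(4δ), so after Young's inequality has taken 1/(2δ) at
    -- least 1/(4δ) of the damping remains.
    have hc : (4 * δ)⁻¹ ≤ δ⁻¹ - 2 * Q - (2 * δ)⁻¹ := by
      have h10 : δ⁻¹ - 2 * Q - (2 * δ)⁻¹ - (4 * δ)⁻¹ = (1 - 8 * Q * δ) * (4 * δ)⁻¹ := by
        field_simp
        ring
      have : 0 ≤ (1 - 8 * Q * δ) * (4 * δ)⁻¹ := mul_nonneg (by linarith) (by positivity)
      linarith
    have h11 := mul_le_mul_of_nonneg_right hc hX0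
    simp only [ne_eq, OfNat.ofNat_ne_zero, not_false_eq_true, zero_pow, integral_zero, add_zero] at hen
    nlinarith
  have h12 : X = 4 * δ * ((4 * δ)⁻¹ * X) := by field_simp
  rw [h12]
  calc 4 * δ * ((4 * δ)⁻¹ * X) ≤ 4 * δ * (2 * δ * L ^ 2 * (δ * ∫ y, f y ^ 2 ∂phaseMeasure Ω)) :=
        mul_le_mul_of_nonneg_left h9 (by positivity)
    _ = _ := by ring

/-- Uniform bound for the difference quotients in time. -/
lemma IsTransportSolution.diffQuot_bound
    (hsol : IsTransportSolution T Ω E (fun p => S p - q p.2 * w p) w d fun _ => 0)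
    (hS : IsSourceData T Ω C₁ C₂ f g₀ S σ) (hE : IsC1OnClosure Ω E) (hΩ : IsSmoothConvexDomain Ω)
    (hT : 0 < T) {Q : ℝ} (hQ : ∀ᵐ y ∂phaseMeasure Ω, |q y| ≤ Q) (hQ0 : 0 ≤ Q) {δ : ℝ} (hδ : 0 < δ)
    (hδT : δ < T) (hδQ : 8 * Q * δ ≤ 1) :
    ∫ p, diffQuot δ d p ^ 2 ∂outMeasure T Ω + ∫ p, diffQuot δ w p ^ 2 ∂interiorMeasure T Ω
      ≤ Real.exp ((2 * Q + 2) * T) * (C₁ ^ 2 * T + (C₁ * (1 + T)) ^ 2 * (1 + 8 * Real.exp 1))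
        * ∫ y, f y ^ 2 ∂phaseMeasure Ω := by
  set z := diffQuot δ w with hz
  set S' := diffQuot δ S with hS'
  have hSF : SFinite (phaseMeasure Ω) := by unfold phaseMeasure; infer_instance
  have hsolz : IsTransportSolution T Ω E (fun p => S' p - q p.2 * z p) z (diffQuot δ d) fun _ => 0 := by
    have h1 := hsol.isTransportSolution_diffQuot hE hΩ hδ
    have h2 : diffQuot δ (fun p => S p - q p.2 * w p) = fun p => S' p - q p.2 * z p := by
      ext p
      simp only [hS', hz, diffQuot, shiftBack]
      split_ifs <;> ring
    rwa [h2] at h1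
  have hS'2 : MemLp S' 2 (interiorMeasure T Ω) := memLp_diffQuot hδ hS.memLp
  -- The damping coefficient l - 2Q is then 2: one unit absorbs the z² of Young's inequality, the
  -- other yields the bound for z.
  set l := 2 * Q + 2 with hl
  have hl0 : 0 ≤ l := by positivity
  have hen := hsolz.energy_exp hE hΩ hT hS'2 hQ hl0
  have hsmall := hsol.small_time_bound hS hE hΩ hT hQ hδ hδQ
  set N := ∫ y, f y ^ 2 ∂phaseMeasure Ω with hN
  have hN0 : 0 ≤ N := integral_nonneg fun y => sq_nonneg _
  set L := C₁ * (1 + T) with hL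
  have hbd : ∀ {k : ℝ}, 0 ≤ k → ∀ᵐ p ∂interiorMeasure T Ω, ‖Real.exp (-k * p.1)‖ ≤ 1 := by
    intro k hk
    filter_upwards [ae_interior_mem hΩ.isOpen] with p hp
    rw [Real.norm_of_nonneg (Real.exp_pos _).le]
    have : 0 ≤ k * p.1 := mul_nonneg hk hp.1.1.le
    exact Real.exp_le_one_iff.2 (by linarith)
  have hcont : ∀ k : ℝ, Continuous fun p : ℝ × Phase => Real.exp (-k * p.1) := fun k => by fun_prop
  have iz : Integrable (fun p => z p ^ 2 * Real.exp (-l * p.1)) (interiorMeasure T Ω) :=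
    hsolz.memLp.integrable_sq.mul_bdd (hcont l).aestronglyMeasurable (hbd hl0)
  have iS : Integrable (fun p => S' p * z p * Real.exp (-l * p.1)) (interiorMeasure T Ω) :=
    (hS'2.integrable_mul hsolz.memLp).mul_bdd (hcont l).aestronglyMeasurable (hbd hl0)
  have iw : Integrable (fun p => w p ^ 2 * Real.exp (-δ⁻¹ * p.1)) (interiorMeasure T Ω) :=
    hsol.memLp.integrable_sq.mul_bdd (hcont δ⁻¹).aestronglyMeasurable (hbd (by positivity))
  -- For t > δ the quotient of the source is at most C₁|f|. For t ≤ δ it is S/δ, and the weighted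
  -- Young inequality below leaves S²/δ; on an interval of length δ this integrates to a bounded
  -- amount.
  set η : ℝ → ℝ := fun t => C₁ ^ 2 + (Iic δ).indicator (fun _ => L ^ 2 / δ) t with hη
  have hηi : IntegrableOn η (Ioo 0 T) :=
    (integrable_const _).add ((integrable_const _).indicator measurableSet_Iic)
  have i_f := integrable_interior_mul hηi hS.memLp_profile.integrable_sq
  have hηv : ∫ t in Ioo 0 T, η t = C₁ ^ 2 * T + L ^ 2 := by
    rw [hη, integral_add (integrable_const _) ((integrable_const _).indicator measurableSet_Iic),
      integral_indicator measurableSet_Iic, Measure.restrict_restrict measurableSet_Iic]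
    have : Iic δ ∩ Ioo 0 T = Ioc 0 δ := by
      ext t
      simp only [mem_inter_iff, mem_Iic, mem_Ioo, mem_Ioc]
      constructor
      · rintro ⟨h1, h2, h3⟩; exact ⟨h2, h1⟩
      · rintro ⟨h1, h2⟩; exact ⟨h2, h1, by linarith⟩
    rw [this]
    simp [hT.le, hδ.le]
    field_simp
  have hmain : 2 * ∫ p, S' p * z p * Real.exp (-l * p.1) ∂interiorMeasure T Ω
      ≤ ∫ p, z p ^ 2 * Real.exp (-l * p.1) ∂interiorMeasure T Ω
        + ∫ p, η p.1 * f p.2 ^ 2 ∂interiorMeasure T Ω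
        + Real.exp 1 / δ ^ 3 * ∫ p, w p ^ 2 * Real.exp (-δ⁻¹ * p.1) ∂interiorMeasure T Ω := by
    have i_sum : Integrable (fun p => z p ^ 2 * Real.exp (-l * p.1) + η p.1 * f p.2 ^ 2)
      (interiorMeasure T Ω) := iz.add i_f
    rw [← integral_const_mul, ← integral_const_mul, ← integral_add iz i_f,
      ← integral_add i_sum (iw.const_mul _)]
    refine integral_mono_ae (iS.const_mul 2) (i_sum.add (iw.const_mul _)) ?_
    filter_upwards [ae_interior_of_ae_phase (hS.ae_abs_le hT), ae_interior_of_ae_phase hS.ae_abs_sub_le,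
      ae_interior_mem hΩ.isOpen] with p hp1 hp2 hpm
    have he0 := Real.exp_pos (-l * p.1)
    have he1 : Real.exp (-l * p.1) ≤ 1 := by
      have : 0 ≤ l * p.1 := mul_nonneg hl0 hpm.1.1.le
      exact Real.exp_le_one_iff.2 (by linarith)
    by_cases ht : δ < p.1
    · have h1 : |S' p| ≤ C₁ * |f p.2| := by
        have h2 := hp2 (p.1 - δ) ⟨by linarith, by linarith [hpm.1.2]⟩ p.1
          (Ioo_subset_Icc_self hpm.1) (by linarith)
        simp only [hS', diffQuot, shiftBack, if_pos ht]
        rw [abs_div, abs_of_pos hδ, div_le_iff₀ hδ]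
        refine h2.trans (le_of_eq ?_)
        ring
      have h3 : S' p ^ 2 ≤ C₁ ^ 2 * f p.2 ^ 2 := by
        rw [← sq_abs (S' p), ← sq_abs (f p.2), ← mul_pow]
        exact pow_le_pow_left₀ (abs_nonneg _) h1 2
      have h4 : η p.1 = C₁ ^ 2 := by
        simp [hη, not_le.2 ht]
      rw [h4]
      have h5 : 0 ≤ Real.exp 1 / δ ^ 3 * (w p ^ 2 * Real.exp (-δ⁻¹ * p.1)) := by positivity
      have h6 : 2 * (S' p * z p) ≤ z p ^ 2 + C₁ ^ 2 * f p.2 ^ 2 := by nlinarith [sq_nonneg (S' p - z p)]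
      have h7 : 2 * (S' p * z p) * Real.exp (-l * p.1)
          ≤ (z p ^ 2 + C₁ ^ 2 * f p.2 ^ 2) * Real.exp (-l * p.1) :=
        mul_le_mul_of_nonneg_right h6 he0.le
      have h8 : C₁ ^ 2 * f p.2 ^ 2 * Real.exp (-l * p.1) ≤ C₁ ^ 2 * f p.2 ^ 2 :=
        mul_le_of_le_one_right (by positivity) he1
      nlinarith
    · have hSp : S' p = S p / δ := by simp [hS', diffQuot, shiftBack, ht]
      have hzp : z p = w p / δ := by simp [hz, diffQuot, shiftBack, ht]
      have h1 := hp1 p.1 (Ioo_subset_Icc_self hpm.1)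
      have h3 : S p ^ 2 ≤ L ^ 2 * f p.2 ^ 2 := by
        rw [← sq_abs (S p), ← sq_abs (f p.2), ← mul_pow]
        exact pow_le_pow_left₀ (abs_nonneg _) h1 2
      have h4 : η p.1 = C₁ ^ 2 + L ^ 2 / δ := by
        simp [hη, not_lt.1 ht]
      have h5 : 1 ≤ Real.exp 1 * Real.exp (-δ⁻¹ * p.1) := by
        rw [← Real.exp_add]
        refine Real.one_le_exp ?_
        have : δ⁻¹ * p.1 ≤ 1 := by
          rw [inv_mul_le_iff₀ hδ]
          linarith
        linarith
      -- The remainder w²/δ³ is what the small-time bound of order δ³ controls, once exp(1 - t/δ) ≥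
      -- 1 is inserted for t ≤ δ.
      have h6 : 2 * (S' p * z p) ≤ S p ^ 2 / δ + w p ^ 2 / δ ^ 3 := by
        rw [hSp, hzp]
        have : S p ^ 2 / δ + w p ^ 2 / δ ^ 3 - 2 * (S p / δ * (w p / δ))
            = (δ ^ 3)⁻¹ * (w p - δ * S p) ^ 2 := by
          field_simp
          ring
        have h0 : 0 ≤ (δ ^ 3)⁻¹ * (w p - δ * S p) ^ 2 := by positivity
        linarith
      have h7 : S p ^ 2 / δ ≤ L ^ 2 / δ * f p.2 ^ 2 := by
        rw [div_mul_eq_mul_div]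
        gcongr
      have h8 : w p ^ 2 / δ ^ 3 ≤ Real.exp 1 / δ ^ 3 * (w p ^ 2 * Real.exp (-δ⁻¹ * p.1)) := by
        have h9 : w p ^ 2 / δ ^ 3 * 1 ≤ w p ^ 2 / δ ^ 3 * (Real.exp 1 * Real.exp (-δ⁻¹ * p.1)) :=
          mul_le_mul_of_nonneg_left h5 (by positivity)
        calc w p ^ 2 / δ ^ 3 = w p ^ 2 / δ ^ 3 * 1 := by ring
          _ ≤ _ := h9
          _ = _ := by ring
      have h10 : 2 * (S' p * z p * Real.exp (-l * p.1)) ≤ S p ^ 2 / δ + w p ^ 2 / δ ^ 3 := by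
        have h11 : 2 * (S' p * z p) * Real.exp (-l * p.1)
            ≤ (S p ^ 2 / δ + w p ^ 2 / δ ^ 3) * Real.exp (-l * p.1) :=
          mul_le_mul_of_nonneg_right h6 he0.le
        have h12 : (S p ^ 2 / δ + w p ^ 2 / δ ^ 3) * Real.exp (-l * p.1) ≤ S p ^ 2 / δ + w p ^ 2 / δ ^ 3 :=
          mul_le_of_le_one_right (by positivity) he1
        linarith
      have h13 : 0 ≤ z p ^ 2 * Real.exp (-l * p.1) := by positivity
      have h14 : 0 ≤ C₁ ^ 2 * f p.2 ^ 2 := by positivity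
      rw [h4, add_mul]
      linarith
  rw [integral_interior_mul T η (fun y => f y ^ 2), hηv] at hmain
  have hw' : Real.exp 1 / δ ^ 3 * ∫ p, w p ^ 2 * Real.exp (-δ⁻¹ * p.1) ∂interiorMeasure T Ω
      ≤ Real.exp 1 * (8 * L ^ 2) * N := by
    refine (mul_le_mul_of_nonneg_left hsmall (by positivity)).trans (le_of_eq ?_)
    field_simp
  have hfin : ∫ p, diffQuot δ d p ^ 2 * Real.exp (-l * p.1) ∂outMeasure T Ω
      + ∫ p, z p ^ 2 * Real.exp (-l * p.1) ∂interiorMeasure T Ω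
      ≤ (C₁ ^ 2 * T + L ^ 2 * (1 + 8 * Real.exp 1)) * N := by
    simp only [ne_eq, OfNat.ofNat_ne_zero, not_false_eq_true, zero_pow, integral_zero, add_zero] at hen
    have : l - 2 * Q = 2 := by rw [hl]; ring
    rw [this] at hen
    linarith
  have hbd' : ∀ t ∈ Ioo 0 T, 1 ≤ Real.exp (l * T) * Real.exp (-l * t) := fun t ht => by
    rw [← Real.exp_add]
    refine Real.one_le_exp ?_
    nlinarith [ht.2]
  have hz1 : ∫ p, z p ^ 2 ∂interiorMeasure T Ω
      ≤ Real.exp (l * T) * ∫ p, z p ^ 2 * Real.exp (-l * p.1) ∂interiorMeasure T Ω := by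
    rw [← integral_const_mul]
    refine integral_mono_ae hsolz.memLp.integrable_sq (iz.const_mul _) ?_
    filter_upwards [ae_interior_mem hΩ.isOpen] with p hp
    have := mul_le_mul_of_nonneg_left (hbd' _ hp.1) (sq_nonneg (z p))
    nlinarith
  have id : Integrable (fun p => diffQuot δ d p ^ 2 * Real.exp (-l * p.1)) (outMeasure T Ω) := by
    refine hsolz.memLp_trace.integrable_sq.mul_bdd (c := 1) (hcont l).aestronglyMeasurable ?_
    filter_upwards [hΩ.ae_out_mem] with p hp
    rw [Real.norm_of_nonneg (Real.exp_pos _).le]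
    have : 0 ≤ l * p.1 := mul_nonneg hl0 hp.1.1.le
    exact Real.exp_le_one_iff.2 (by linarith)
  have hd1 : ∫ p, diffQuot δ d p ^ 2 ∂outMeasure T Ω
      ≤ Real.exp (l * T) * ∫ p, diffQuot δ d p ^ 2 * Real.exp (-l * p.1) ∂outMeasure T Ω := by
    rw [← integral_const_mul]
    refine integral_mono_ae hsolz.memLp_trace.integrable_sq (id.const_mul _) ?_
    filter_upwards [hΩ.ae_out_mem] with p hp
    have := mul_le_mul_of_nonneg_left (hbd' _ hp.1) (sq_nonneg (diffQuot δ d p))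
    nlinarith
  have := mul_le_mul_of_nonneg_left hfin (Real.exp_pos (l * T)).le
  calc _ ≤ _ := add_le_add hd1 hz1
    _ = _ := (mul_add _ _ _).symm
    _ ≤ _ := this
    _ = _ := by ring

end UniformBound

/-! ### Weak compactness along ultrafilters. -/

section WeakLimits

/-- Bounded sequences in a Hilbert space converge weakly along an ultrafilter. -/
lemma exists_weak_limit {H : Type*} [NormedAddCommGroup H] [InnerProductSpace ℝ H] [CompleteSpace H]
    {ι : Type*} (𝒰 : Ultrafilter ι) {x : ι → H} {C : ℝ} (hx : ∀ i, ‖x i‖ ≤ C) :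
    ∃ a : H, ‖a‖ ≤ C ∧ ∀ y, Filter.Tendsto (fun i => (inner ℝ (x i) y : ℝ)) 𝒰 (𝓝 (inner ℝ a y)) := by
  set e := InnerProductSpace.toDual ℝ H with he
  set ℓ : ι → WeakDual ℝ H := fun i => StrongDual.toWeakDual (e (x i)) with hℓ
  have hmem : ∀ i, ℓ i ∈ (WeakDual.toStrongDual ⁻¹' Metric.closedBall (0 : StrongDual ℝ H) C) := by
    intro i
    have : ‖e (x i)‖ ≤ C := by rw [LinearIsometryEquiv.norm_map]; exact hx i
    simpa [hℓ] using this
  -- Banach–Alaoglu in the dual. A limit along an ultrafilter requires no separability and no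
  -- extraction of subsequences.
  obtain ⟨L, hL, hlim⟩ := (WeakDual.isCompact_closedBall (0 : StrongDual ℝ H) C).ultrafilter_le_nhds
    (𝒰.map ℓ) (by
      rw [Filter.le_principal_iff]
      change _ ∈ Filter.map ℓ 𝒰
      exact Filter.mem_map.2 (Filter.univ_mem' hmem))
  refine ⟨e.symm (WeakDual.toStrongDual L), ?_, fun y => ?_⟩
  · rw [LinearIsometryEquiv.norm_map]
    simpa using hL
  · have h1 : Filter.Tendsto ℓ 𝒰 (𝓝 L) := hlim
    have h2 := (WeakDual.eval_continuous y).tendsto L |>.comp h1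
    rw [InnerProductSpace.toDual_symm_apply]
    refine h2.congr fun i => ?_
    simp [hℓ, he]

/-- Transfer from the Hilbert space of classes to functions; the norm bound survives because a
closed ball is weakly closed. -/
lemma exists_weak_limit_L2 {X : Type*} [MeasurableSpace X] {μ : Measure X} {ι : Type*}
    (𝒰 : Ultrafilter ι) {x : ι → X → ℝ} {C : ℝ} (hx : ∀ i, MemLp (x i) 2 μ)
    (hC : ∀ i, ∫ p, x i p ^ 2 ∂μ ≤ C) :
    ∃ a : X → ℝ, MemLp a 2 μ ∧ ∫ p, a p ^ 2 ∂μ ≤ C ∧ ∀ y : X → ℝ, MemLp y 2 μ →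
      Filter.Tendsto (fun i => ∫ p, x i p * y p ∂μ) 𝒰 (𝓝 (∫ p, a p * y p ∂μ)) := by
  have hinner : ∀ {a b : X → ℝ} (ha : MemLp a 2 μ) (hb : MemLp b 2 μ),
      (inner ℝ (ha.toLp a) (hb.toLp b) : ℝ) = ∫ p, a p * b p ∂μ := by
    intro a b ha hb
    rw [L2.inner_def]
    refine integral_congr_ae ?_
    filter_upwards [ha.coeFn_toLp, hb.coeFn_toLp] with p h1 h2
    rw [h1, h2]
    simp [mul_comm]
  have hnorm : ∀ {a : X → ℝ} (ha : MemLp a 2 μ), ‖ha.toLp a‖ ^ 2 = ∫ p, a p ^ 2 ∂μ := by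
    intro a ha
    rw [← real_inner_self_eq_norm_sq, hinner ha ha]
    simp only [sq]
  obtain ⟨a, ha, hlim⟩ := exists_weak_limit 𝒰 (x := fun i => (hx i).toLp (x i)) (C := √C) fun i => by
    refine Real.le_sqrt_of_sq_le ?_
    rw [hnorm]
    exact hC i
  have ha2 : MemLp a 2 μ := Lp.memLp a
  have haa : ha2.toLp a = a := Lp.toLp_coeFn a ha2
  have hne : (𝒰 : Filter ι).NeBot := inferInstance
  have hC0 : 0 ≤ C := by
    obtain ⟨i⟩ := 𝒰.neBot.nonempty
    exact (integral_nonneg fun p => sq_nonneg _).trans (hC i)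
  refine ⟨a, ha2, ?_, fun y hy => ?_⟩
  · rw [← hnorm ha2, haa]
    calc ‖a‖ ^ 2 ≤ √C ^ 2 := pow_le_pow_left₀ (norm_nonneg _) ha 2
      _ = C := Real.sq_sqrt hC0
  · have h1 := hlim (hy.toLp y)
    rw [← haa, hinner ha2 hy] at h1
    exact h1.congr fun i => hinner (hx i) hy

end WeakLimits

/-! ### Limits of difference quotients of test functions. -/

section DifferenceQuotientLimit

/-- Difference quotients of a test function converge, tested against a locally integrable
function. -/
lemma tendsto_integral_diffQuot {μ : Measure (ℝ × Phase)} {G φ : ℝ × Phase → ℝ}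
    (hG : LocallyIntegrable G μ) (hφ : ContDiff ℝ 1 φ) (hφs : HasCompactSupport φ) {δ : ℕ → ℝ}
    (hδ : ∀ n, 0 < δ n) (hδ1 : ∀ n, δ n ≤ 1) (hδ0 : Filter.Tendsto δ Filter.atTop (𝓝 0)) :
    Filter.Tendsto (fun n => ∫ p, G p * ((φ p - φ (p.1 + δ n, p.2)) / δ n) ∂μ) Filter.atTop
      (𝓝 (-∫ p, G p * fderiv ℝ φ p (1, 0) ∂μ)) := by
  -- For steps at most 1 all the difference quotients are supported in this one compact set, on
  -- which G is integrable.
  set K : Set (ℝ × Phase) := (fun r : (ℝ × Phase) × ℝ => r.1 - (r.2, 0)) '' (tsupport φ ×ˢ Icc 0 1) with hK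
  have hKc : IsCompact K := (hφs.isCompact.prod isCompact_Icc).image (by fun_prop)
  have hderiv : ∀ (p : ℝ × Phase) (s : ℝ),
      HasDerivAt (fun s => φ (p.1 + s, p.2)) (fderiv ℝ φ (p.1 + s, p.2) (1, 0)) s := by
    intro p s
    refine HasFDerivAt.comp_hasDerivAt (f := fun s : ℝ => (p.1 + s, p.2)) s
      (hφ.differentiable one_ne_zero _).hasFDerivAt (HasDerivAt.prodMk ?_ (hasDerivAt_const _ _))
    simpa using (hasDerivAt_id s).const_add p.1
  have hcont : Continuous fun p : ℝ × Phase => fderiv ℝ φ p (1, 0) :=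
    (hφ.continuous_fderiv one_ne_zero).clm_apply continuous_const
  have hcs : HasCompactSupport fun p : ℝ × Phase => fderiv ℝ φ p (1, 0) :=
    (hφs.fderiv ℝ).mono' fun p hp => by
      refine subset_tsupport _ fun h0 => hp ?_
      simp [h0]
  obtain ⟨M, hM⟩ := hcs.exists_bound_of_continuous hcont
  have hM0 : 0 ≤ M := (norm_nonneg _).trans (hM 0)
  have hlip : ∀ (p : ℝ × Phase) n, ‖(φ p - φ (p.1 + δ n, p.2)) / δ n‖ ≤ M := by
    intro p n
    have h1 := Convex.norm_image_sub_le_of_norm_hasDerivWithin_le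
      (f := fun s => φ (p.1 + s, p.2)) (f' := fun s => fderiv ℝ φ (p.1 + s, p.2) (1, 0)) (C := M)
      (s := univ) (x := 0) (y := δ n) (fun s _ => (hderiv p s).hasDerivWithinAt)
      (fun s _ => hM _) convex_univ (mem_univ _) (mem_univ _)
    simp only [add_zero, Prod.mk.eta, sub_zero] at h1
    rw [norm_div, div_le_iff₀ (by rw [Real.norm_of_nonneg (hδ n).le]; exact hδ n), norm_sub_rev]
    exact h1
  have hzero : ∀ p ∉ K, ∀ n, (φ p - φ (p.1 + δ n, p.2)) / δ n = 0 := by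
    intro p hp n
    have h1 : ∀ s ∈ Icc (0 : ℝ) 1, φ (p.1 + s, p.2) = 0 := by
      intro s hs
      by_contra hne
      refine hp ⟨((p.1 + s, p.2), s), ⟨subset_tsupport _ hne, hs⟩, ?_⟩
      ext <;> simp
    have h2 := h1 0 ⟨le_rfl, zero_le_one⟩
    simp only [add_zero, Prod.mk.eta] at h2
    rw [h2, h1 _ ⟨(hδ n).le, hδ1 n⟩]
    simp
  have hGK : Integrable (fun p => K.indicator (fun p => ‖G p‖ * M) p) μ :=
    (integrable_indicator_iff hKc.measurableSet).2 ((hG.integrableOn_isCompact hKc).norm.mul_const M)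
  rw [← integral_neg]
  refine tendsto_integral_of_dominated_convergence _ (fun n => ?_) hGK (fun n => ?_) ?_
  · refine hG.aestronglyMeasurable.mul (Continuous.aestronglyMeasurable ?_)
    have := hφ.continuous
    fun_prop
  · refine Filter.Eventually.of_forall fun p => ?_
    by_cases hp : p ∈ K
    · rw [indicator_of_mem hp, norm_mul]
      exact mul_le_mul_of_nonneg_left (hlip p n) (norm_nonneg _)
    · rw [hzero p hp n, indicator_of_notMem hp]
      simp
  · refine Filter.Eventually.of_forall fun p => ?_
    rw [← mul_neg]
    refine Filter.Tendsto.const_mul _ ?_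
    have h1 := (hderiv p 0).tendsto_slope_zero
    simp only [add_zero, zero_add, Prod.mk.eta, smul_eq_mul] at h1
    have h2 : Filter.Tendsto δ Filter.atTop (𝓝[≠] 0) :=
      tendsto_nhdsWithin_iff.2 ⟨hδ0, Filter.Eventually.of_forall fun n => (hδ n).ne'⟩
    refine (h1.comp h2).neg.congr fun n => ?_
    simp only [Function.comp_apply]
    field_simp
    ring

end DifferenceQuotientLimit

/-! ### The time derivative as a weak solution. -/

section TimeDerivative

variable {T C₁ C₂ Q : ℝ} {Ω : Set R3} {E : R3 → R3} {q f g₀ : Phase → ℝ} {S σ w d : ℝ × Phase → ℝ}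

lemma integral_interior_eq {G : ℝ × Phase → ℝ} (hT : 0 ≤ T) (hG : Integrable G (interiorMeasure T Ω)) :
    ∫ p, G p ∂interiorMeasure T Ω = ∫ y, (∫ t in (0 : ℝ)..T, G (t, y)) ∂phaseMeasure Ω := by
  have : SFinite (phaseMeasure Ω) := by unfold phaseMeasure; infer_instance
  rw [interiorMeasure, integral_prod_symm _ hG]
  congr 1
  ext y
  rw [intervalIntegral.integral_of_le hT, integral_Ioc_eq_integral_Ioo]

lemma integrable_interior_section {G : ℝ × Phase → ℝ} (hT : 0 ≤ T)
    (hG : Integrable G (interiorMeasure T Ω)) :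
    Integrable (fun y => ∫ t in (0 : ℝ)..T, G (t, y)) (phaseMeasure Ω) := by
  have : SFinite (phaseMeasure Ω) := by unfold phaseMeasure; infer_instance
  refine (Integrable.integral_prod_right hG).congr (Filter.Eventually.of_forall fun y => ?_)
  simp only
  rw [intervalIntegral.integral_of_le hT, integral_Ioc_eq_integral_Ioo]

lemma aestronglyMeasurable_comp_snd_interior {k : Phase → ℝ}
    (hk : AEStronglyMeasurable k (phaseMeasure Ω)) :
    AEStronglyMeasurable (fun p : ℝ × Phase => k p.2) (interiorMeasure T Ω) :=
  AEStronglyMeasurable.comp_snd hk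

lemma memLp_coefficient_mul (hqm : AEStronglyMeasurable q (phaseMeasure Ω))
    (hQ : ∀ᵐ y ∂phaseMeasure Ω, |q y| ≤ Q) {G : ℝ × Phase → ℝ} (hG : MemLp G 2 (interiorMeasure T Ω)) :
    MemLp (fun p => q p.2 * G p) 2 (interiorMeasure T Ω) := by
  refine hG.of_le_mul (c := Q) ((aestronglyMeasurable_comp_snd_interior hqm).mul hG.1) ?_
  filter_upwards [ae_interior_of_ae_phase hQ] with p hp
  rw [norm_mul]
  exact mul_le_mul_of_nonneg_right hp (norm_nonneg _)

lemma memLp_comp_snd_interior {k : Phase → ℝ} (hk : MemLp k 2 (phaseMeasure Ω)) :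
    MemLp (fun p : ℝ × Phase => k p.2) 2 (interiorMeasure T Ω) := by
  have : SFinite (phaseMeasure Ω) := by unfold phaseMeasure; infer_instance
  exact MemLp.comp_snd hk _

lemma IsSourceData.memLp_derivative (hS : IsSourceData T Ω C₁ C₂ f g₀ S σ) :
    MemLp (fun p : ℝ × Phase => f p.2 * σ p) 2 (interiorMeasure T Ω) := by
  refine (memLp_comp_snd_interior hS.memLp_profile).of_le_mul (c := C₁)
    ((aestronglyMeasurable_comp_snd_interior hS.memLp_profile.1).mul
      hS.measurable.aestronglyMeasurable) (Filter.Eventually.of_forall fun p => ?_)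
  rw [norm_mul, mul_comm]
  exact mul_le_mul_of_nonneg_right (hS.abs_le p) (norm_nonneg _)

/-- Integration by parts in time for the source. -/
lemma IsSourceData.integral_mul_fderiv (hS : IsSourceData T Ω C₁ C₂ f g₀ S σ) (hT : 0 < T)
    {φ : ℝ × Phase → ℝ} (hφ : ContDiff ℝ 1 φ)
    (hφs : HasCompactSupport φ) (hφT : tsupport φ ⊆ Iio T ×ˢ univ) :
    -∫ p, S p * fderiv ℝ φ p (1, 0) ∂interiorMeasure T Ω
      = ∫ p, f p.2 * σ p * φ p ∂interiorMeasure T Ω + ∫ y, g₀ y * φ (0, y) ∂phaseMeasure Ω := by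
  have hcont : Continuous fun p : ℝ × Phase => fderiv ℝ φ p (1, 0) :=
    (hφ.continuous_fderiv one_ne_zero).clm_apply continuous_const
  have hcs : HasCompactSupport fun p : ℝ × Phase => fderiv ℝ φ p (1, 0) :=
    (hφs.fderiv ℝ).mono' fun p hp => by
      refine subset_tsupport _ fun h0 => hp ?_
      simp [h0]
  have hc1 : MemLp (fun p : ℝ × Phase => fderiv ℝ φ p (1, 0)) 2 (interiorMeasure T Ω) :=
    hcont.memLp_of_hasCompactSupport hcs
  have hc2 : MemLp φ 2 (interiorMeasure T Ω) := hφ.continuous.memLp_of_hasCompactSupport hφs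
  have i1 : Integrable (fun p => S p * fderiv ℝ φ p (1, 0)) (interiorMeasure T Ω) :=
    hS.memLp.integrable_mul hc1
  have i2 : Integrable (fun p => f p.2 * σ p * φ p) (interiorMeasure T Ω) :=
    hS.memLp_derivative.integrable_mul hc2
  have hφ0s : HasCompactSupport fun y : Phase => φ (0, y) := by
    refine HasCompactSupport.intro (hφs.isCompact.image continuous_snd) fun y hy => ?_
    by_contra hne
    exact hy ⟨(0, y), subset_tsupport _ hne, rfl⟩
  have hlf : IsLocallyFiniteMeasure (phaseMeasure Ω) := by unfold phaseMeasure; infer_instance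
  have hc3 : MemLp (fun y : Phase => φ (0, y)) 2 (phaseMeasure Ω) :=
    Continuous.memLp_of_hasCompactSupport
      (hφ.continuous.comp (by fun_prop : Continuous fun y : Phase => ((0 : ℝ), y))) hφ0s
  have i3 : Integrable (fun y => g₀ y * φ (0, y)) (phaseMeasure Ω) :=
    hS.memLp_initial.integrable_mul hc3
  rw [integral_interior_eq hT.le i1, integral_interior_eq hT.le i2,
    ← integral_add (integrable_interior_section hT.le i2) i3, ← integral_neg]
  refine integral_congr_ae ?_
  filter_upwards [hS.eq_primitive] with y hy
  have hderiv : ∀ t, HasDerivAt (fun s => φ (s, y)) (fderiv ℝ φ (t, y) (1, 0)) t := fun t =>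
    HasFDerivAt.comp_hasDerivAt (f := fun s : ℝ => (s, y)) t
      (hφ.differentiable one_ne_zero _).hasFDerivAt ((hasDerivAt_id _).prodMk (hasDerivAt_const _ _))
  have h1 := integral_primitive_mul_deriv_tail (g := g₀ y) (s := 0) (hS.intervalIntegrable y 0 T) hderiv
    (hcont.comp (by fun_prop : Continuous fun t : ℝ => (t, y)))
    (apply_time_eq_zero_of_tsupport hφT le_rfl y) ⟨le_rfl, hT.le⟩
  have h2 : ∫ t in (0 : ℝ)..T, S (t, y) * fderiv ℝ φ (t, y) (1, 0)
      = ∫ t in (0 : ℝ)..T, (g₀ y + ∫ s in (0 : ℝ)..t, f y * σ (s, y)) * fderiv ℝ φ (t, y) (1, 0) := by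
    refine intervalIntegral.integral_congr fun t ht => ?_
    rw [uIcc_of_le hT.le] at ht
    rw [hy t ht]
  rw [h2, h1]
  simp

/-- The time derivative of a solution with zero initial value is a solution, with the time
derivative of the source as source and the initial value of the source as initial value. -/
theorem IsTransportSolution.exists_time_derivative
    (hsol : IsTransportSolution T Ω E (fun p => S p - q p.2 * w p) w d fun _ => 0)
    (hS : IsSourceData T Ω C₁ C₂ f g₀ S σ) (hE : IsC1OnClosure Ω E) (hΩ : IsSmoothConvexDomain Ω)
    (hT : 0 < T) (hqm : AEStronglyMeasurable q (phaseMeasure Ω))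
    (hQ : ∀ᵐ y ∂phaseMeasure Ω, |q y| ≤ Q) (hQ0 : 0 ≤ Q) :
    ∃ z d', IsTransportSolution T Ω E (fun p => f p.2 * σ p - q p.2 * z p) z d' g₀ ∧
      (∀ θ : ℝ × Phase → ℝ, ContDiff ℝ 1 θ → HasCompactSupport θ → tsupport θ ⊆ Iio T ×ˢ univ →
        ∫ p, d p * fderiv ℝ θ p (1, 0) ∂outMeasure T Ω = -∫ p, d' p * θ p ∂outMeasure T Ω) ∧
      ∫ p, d' p ^ 2 ∂outMeasure T Ω
        ≤ Real.exp ((2 * Q + 2) * T) * (C₁ ^ 2 * T + (C₁ * (1 + T)) ^ 2 * (1 + 8 * Real.exp 1))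
        * ∫ y, f y ^ 2 ∂phaseMeasure Ω ∧
      ∫ p, z p ^ 2 ∂interiorMeasure T Ω
        ≤ Real.exp ((2 * Q + 2) * T) * (C₁ ^ 2 * T + (C₁ * (1 + T)) ^ 2 * (1 + 8 * Real.exp 1))
        * ∫ y, f y ^ 2 ∂phaseMeasure Ω := by
  set B := Real.exp ((2 * Q + 2) * T) * (C₁ ^ 2 * T + (C₁ * (1 + T)) ^ 2 * (1 + 8 * Real.exp 1))
    * ∫ y, f y ^ 2 ∂phaseMeasure Ω with hB
  have := hΩ.isFiniteMeasure_surface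
  have : SFinite (boundaryMeasure Ω) := by unfold boundaryMeasure; infer_instance
  have : SFinite (phaseMeasure Ω) := by unfold phaseMeasure; infer_instance
  have hlf := hΩ.isLocallyFiniteMeasure_outMeasure T
  -- a sequence of step sizes
  obtain ⟨δ, hδpos, hδ1, hδT, hδQ, hδ0⟩ : ∃ δ : ℕ → ℝ, (∀ n, 0 < δ n) ∧ (∀ n, δ n ≤ 1) ∧ (∀ n, δ n < T) ∧
      (∀ n, 8 * Q * δ n ≤ 1) ∧ Filter.Tendsto δ Filter.atTop (𝓝 0) := by
    -- The three entries of the minimum guarantee δ ≤ 1, δ < T and 8Qδ ≤ 1, respectively.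
    set a := min (min 1 (T / 2)) (8 * Q + 1)⁻¹ with ha
    have ha0 : 0 < a := lt_min (lt_min one_pos (by linarith)) (by positivity)
    have h1 : ∀ n : ℕ, a * ((n : ℝ) + 1)⁻¹ ≤ a := fun n => by
      refine mul_le_of_le_one_right ha0.le (inv_le_one_of_one_le₀ ?_)
      have : (0 : ℝ) ≤ n := Nat.cast_nonneg n
      linarith
    refine ⟨fun n => a * ((n : ℝ) + 1)⁻¹, fun n => by positivity, fun n => ?_, fun n => ?_,
      fun n => ?_, ?_⟩
    · exact (h1 n).trans ((min_le_left _ _).trans (min_le_left _ _))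
    · exact ((h1 n).trans ((min_le_left _ _).trans (min_le_right _ _))).trans_lt (by linarith)
    · have h2 := (h1 n).trans (min_le_right _ _)
      calc 8 * Q * (a * ((n : ℝ) + 1)⁻¹) ≤ 8 * Q * (8 * Q + 1)⁻¹ :=
            mul_le_mul_of_nonneg_left h2 (by positivity)
        _ ≤ 1 := by
          rw [← div_eq_mul_inv, div_le_one (by positivity)]
          linarith
    · have h3 := (tendsto_inv_atTop_zero.comp (Filter.tendsto_atTop_add_const_right _ (1 : ℝ)
        tendsto_natCast_atTop_atTop)).const_mul a
      rw [mul_zero] at h3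
      exact h3
  have hbound := fun n => hsol.diffQuot_bound hS hE hΩ hT hQ hQ0 (hδpos n) (hδT n) (hδQ n)
  -- One ultrafilter serves for the interior and the boundary quotients simultaneously; limits along
  -- `atTop` are inherited by it.
  set 𝒰 : Ultrafilter ℕ := Ultrafilter.of Filter.atTop with h𝒰
  have h𝒰le : (𝒰 : Filter ℕ) ≤ Filter.atTop := Ultrafilter.of_le _
  obtain ⟨z, hz2, hzB, hzlim⟩ := exists_weak_limit_L2 (μ := interiorMeasure T Ω) 𝒰 (x := fun n => diffQuot (δ n) w) (C := B)
    (fun n => memLp_diffQuot (hδpos n) hsol.memLp) (fun n => by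
      have h0 : 0 ≤ ∫ p, diffQuot (δ n) d p ^ 2 ∂outMeasure T Ω := integral_nonneg fun p => sq_nonneg _
      linarith [hbound n])
  obtain ⟨d', hd2, hdB, hdlim⟩ := exists_weak_limit_L2 (μ := outMeasure T Ω) 𝒰 (x := fun n => diffQuot (δ n) d) (C := B)
    (fun n => memLp_diffQuot (hδpos n) hsol.memLp_trace) (fun n => by
      have h0 : 0 ≤ ∫ p, diffQuot (δ n) w p ^ 2 ∂interiorMeasure T Ω := integral_nonneg fun p => sq_nonneg _
      linarith [hbound n])
  refine ⟨z, d', ⟨hS.memLp_derivative.sub (memLp_coefficient_mul hqm hQ hz2), hz2, hd2,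
    hS.memLp_initial, fun φ hφ hφs hφT => ?_⟩, fun θ hθ hθs hθT => ?_, hdB, hzB⟩
  · have hφ2 : MemLp φ 2 (interiorMeasure T Ω) := hφ.continuous.memLp_of_hasCompactSupport hφs
    have hφ2' : MemLp φ 2 (outMeasure T Ω) := hφ.continuous.memLp_of_hasCompactSupport hφs
    have hqφ := memLp_coefficient_mul hqm hQ hφ2
    have l1 := hzlim _ (hE.memLp_transportOp (T := T) hΩ.isOpen hφ hφs)
    have l2 := hdlim φ hφ2'
    have l3 := hzlim _ hqφ
    -- Here the initial value of the derivative appears. Extended by zero to negative times, the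
    -- source jumps by g₀ at time zero, and its difference quotients converge to the derivative plus
    -- this jump.
    have l4 : Filter.Tendsto (fun n => ∫ p, diffQuot (δ n) S p * φ p ∂interiorMeasure T Ω) 𝒰
        (𝓝 (∫ p, f p.2 * σ p * φ p ∂interiorMeasure T Ω + ∫ y, g₀ y * φ (0, y) ∂phaseMeasure Ω)) := by
      rw [← hS.integral_mul_fderiv hT hφ hφs hφT]
      have h1 := tendsto_integral_diffQuot (hS.memLp.locallyIntegrable one_le_two) hφ hφs hδpos hδ1 hδ0
      refine (h1.mono_left h𝒰le).congr fun n => ?_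
      exact (integral_diffQuot_mul (m := phaseMeasure Ω) (hδpos n) hS.memLp hφ2
        (Continuous.memLp_of_hasCompactSupport (μ := interiorMeasure T Ω)
          (hφ.continuous.comp (by fun_prop)) (hasCompactSupport_time_translation hφs _))
        (fun t y ht => apply_time_eq_zero_of_tsupport hφT ht y)).symm
    have hweak : ∀ n, ∫ p, diffQuot (δ n) w p * transportOp E φ p ∂interiorMeasure T Ω
        = ∫ p, diffQuot (δ n) d p * φ p ∂outMeasure T Ω
          - (∫ p, diffQuot (δ n) S p * φ p ∂interiorMeasure T Ω
            - ∫ p, diffQuot (δ n) w p * (q p.2 * φ p) ∂interiorMeasure T Ω) := by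
      intro n
      have h1 := (hsol.isTransportSolution_diffQuot hE hΩ (hδpos n)).weak_eq φ hφ hφs hφT
      rw [h1]
      have i1 : Integrable (fun p => diffQuot (δ n) S p * φ p) (interiorMeasure T Ω) :=
        (memLp_diffQuot (hδpos n) hS.memLp).integrable_mul hφ2
      have i2 : Integrable (fun p => diffQuot (δ n) w p * (q p.2 * φ p)) (interiorMeasure T Ω) :=
        (memLp_diffQuot (hδpos n) hsol.memLp).integrable_mul hqφ
      rw [← integral_sub i1 i2]
      simp only [zero_mul, integral_zero, sub_zero]
      congr 2
      ext p
      simp only [diffQuot, shiftBack]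
      split_ifs <;> ring
    have l5 := l2.sub (l4.sub l3)
    have huniq := tendsto_nhds_unique (l1.congr hweak) l5
    rw [huniq]
    have i1 : Integrable (fun p => f p.2 * σ p * φ p) (interiorMeasure T Ω) :=
      hS.memLp_derivative.integrable_mul hφ2
    have i2 : Integrable (fun p => z p * (q p.2 * φ p)) (interiorMeasure T Ω) := hz2.integrable_mul hqφ
    have h2 : ∫ p, (f p.2 * σ p - q p.2 * z p) * φ p ∂interiorMeasure T Ω
        = ∫ p, f p.2 * σ p * φ p ∂interiorMeasure T Ω - ∫ p, z p * (q p.2 * φ p) ∂interiorMeasure T Ω := by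
      rw [← integral_sub i1 i2]
      congr 1
      ext p
      ring
    rw [h2]
    ring
  · have hθ2 : MemLp θ 2 (outMeasure T Ω) := hθ.continuous.memLp_of_hasCompactSupport hθs
    have l1 := hdlim θ hθ2
    have h1 := tendsto_integral_diffQuot (hsol.memLp_trace.locallyIntegrable one_le_two) hθ hθs hδpos hδ1 hδ0
    have h2 : Filter.Tendsto (fun n => ∫ p, diffQuot (δ n) d p * θ p ∂outMeasure T Ω) 𝒰
        (𝓝 (-∫ p, d p * fderiv ℝ θ p (1, 0) ∂outMeasure T Ω)) := by
      refine (h1.mono_left h𝒰le).congr fun n => ?_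
      exact (integral_diffQuot_mul (m := (boundaryMeasure Ω).restrict (GammaPlus Ω)) (hδpos n)
        hsol.memLp_trace hθ2 (Continuous.memLp_of_hasCompactSupport (μ := outMeasure T Ω)
          (hθ.continuous.comp (by fun_prop)) (hasCompactSupport_time_translation hθs _))
        (fun t y ht => apply_time_eq_zero_of_tsupport hθT ht y)).symm
    have := tendsto_nhds_unique l1 h2
    rw [this, neg_neg]

end TimeDerivative

/-! ### Conservation of the velocity component v_j. -/

section Localization

variable {T Q : ℝ} {Ω : Set R3} {E : R3 → R3} {q g : Phase → ℝ} {S z d : ℝ × Phase → ℝ} {j : Fin 3}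

lemma transportOp_comp_velocity {κ : ℝ → ℝ} (hκ : Differentiable ℝ κ) (p : ℝ × Phase) :
    transportOp E (fun p => κ (p.2.2 j)) p = deriv κ (p.2.2 j) * E p.2.1 j := by
  have h0 : HasFDerivAt (fun p : ℝ × Phase => p.2.2 j)
      ((EuclideanSpace.proj (𝕜 := ℝ) j).comp ((ContinuousLinearMap.snd ℝ R3 R3).comp
        (ContinuousLinearMap.snd ℝ ℝ Phase))) p :=
    ContinuousLinearMap.hasFDerivAt ((EuclideanSpace.proj (𝕜 := ℝ) j).comp
      ((ContinuousLinearMap.snd ℝ R3 R3).comp (ContinuousLinearMap.snd ℝ ℝ Phase)))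
  have h1 := (hκ (p.2.2 j)).hasDerivAt.comp_hasFDerivAt p h0
  rw [transportOp]
  erw [h1.fderiv]
  simp

lemma contDiff_comp_velocity {κ : ℝ → ℝ} (hκ : ContDiff ℝ 1 κ) :
    ContDiff ℝ 1 fun p : ℝ × Phase => κ (p.2.2 j) :=
  hκ.comp (((EuclideanSpace.proj (𝕜 := ℝ) j).comp ((ContinuousLinearMap.snd ℝ R3 R3).comp
        (ContinuousLinearMap.snd ℝ ℝ Phase))).contDiff)

/-- If the field has no component in the direction `j`, the velocity component `v_j` is preserved
by the flow, so that solutions vanish wherever `v_j` avoids the data. -/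
theorem IsTransportSolution.ae_eq_zero_of_velocity_notMem
    (hsol : IsTransportSolution T Ω E (fun p => S p - q p.2 * z p) z d g)
    (hE : IsC1OnClosure Ω E) (hΩ : IsSmoothConvexDomain Ω) (hT : 0 < T)
    (hEj : ∀ x ∈ closure Ω, E x j = 0) (hQ : ∀ᵐ y ∂phaseMeasure Ω, |q y| ≤ Q) (hQ0 : 0 ≤ Q)
    {K : Set ℝ} (hK : IsClosed K)
    (hSK : ∀ᵐ p ∂interiorMeasure T Ω, p.2.2 j ∉ K → S p = 0)
    (hgK : ∀ᵐ y ∂phaseMeasure Ω, y.2 j ∉ K → g y = 0) :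
    (∀ᵐ p ∂interiorMeasure T Ω, p.2.2 j ∉ K → z p = 0) ∧
      ∀ᵐ p ∂outMeasure T Ω, p.2.2 j ∉ K → d p = 0 := by
  -- A C¹ function whose zero set is exactly `K`. As E_j = 0, the factor κ(v_j) is annihilated by
  -- the transport operator. The weight κ(v_j)exp(-lt) therefore only decays in time, and it kills
  -- the source and the initial value.
  obtain ⟨κ, hκs, hκC, hκr⟩ := hK.isOpen_compl.exists_contDiff_support_eq (n := 1)
  have hκ1 : ContDiff ℝ 1 κ := by exact_mod_cast hκC
  have hκ01 : ∀ a, 0 ≤ κ a ∧ κ a ≤ 1 := fun a => hκr ⟨a, rfl⟩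
  have hκ0 : ∀ a ∈ K, κ a = 0 := fun a ha => by
    by_contra hne
    have : a ∈ Function.support κ := hne
    rw [hκs] at this
    exact this ha
  have hκpos : ∀ a ∉ K, 0 < κ a := fun a ha => by
    have : a ∈ Function.support κ := by rw [hκs]; exact ha
    exact lt_of_le_of_ne (hκ01 a).1 (Ne.symm this)
  set l := 2 * Q + 1 with hl
  set ψ : ℝ × Phase → ℝ := fun p => κ (p.2.2 j) * Real.exp (-l * p.1) with hψ
  have hη : ContDiff ℝ 1 fun t : ℝ => Real.exp (-l * t) := by fun_prop
  have hηp : ContDiff ℝ 1 fun p : ℝ × Phase => Real.exp (-l * p.1) := hη.comp contDiff_fst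
  have hderiv : ∀ t, deriv (fun t : ℝ => Real.exp (-l * t)) t = -l * Real.exp (-l * t) := by
    intro t
    have h1 : HasDerivAt (fun t : ℝ => -l * t) (-l) t := by
      simpa using (hasDerivAt_id t).const_mul (-l)
    rw [h1.exp.deriv]
    ring
  have hψC : ContDiff ℝ 1 ψ := (contDiff_comp_velocity hκ1).mul hηp
  have hψ0 : ∀ p, 0 ≤ ψ p := fun p => mul_nonneg (hκ01 _).1 (Real.exp_pos _).le
  have hop : ∀ p : ℝ × Phase, p.2.1 ∈ closure Ω → transportOp E ψ p = -l * ψ p := by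
    intro p hp
    rw [hψ, transportOp_mul ((contDiff_comp_velocity hκ1).differentiable one_ne_zero p)
      (hηp.differentiable one_ne_zero p),
      transportOp_comp_fst (η := fun t => Real.exp (-l * t)) (hη.differentiable one_ne_zero), hderiv,
      transportOp_comp_velocity (hκ1.differentiable one_ne_zero), hEj _ hp]
    ring
  have hψ1 : ∀ p : ℝ × Phase, 0 ≤ p.1 → |ψ p| ≤ 1 := by
    intro p hp
    rw [abs_of_nonneg (hψ0 p)]
    exact mul_le_one₀ (hκ01 _).2 (Real.exp_pos _).le (Real.exp_le_one_iff.2 (by nlinarith))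
  have hl0 : 0 ≤ l := by linarith
  have hen := hsol.energy_inequality hE hΩ hT hψC hψ0 (B := 1 + l) (by
    intro t ht x hx v
    have h1 := hψ1 (t, x, v) ht.1
    refine ⟨by linarith, ?_⟩
    rw [hop _ hx, abs_mul, abs_neg, abs_of_nonneg hl0]
    nlinarith)
  have hz2 := hsol.memLp.integrable_sq
  have hψm : ∀ μ : Measure (ℝ × Phase), AEStronglyMeasurable ψ μ :=
    fun μ => hψC.continuous.aestronglyMeasurable
  have hmem := ae_interior_mem (T := T) hΩ.isOpen
  have hψb : ∀ᵐ p ∂interiorMeasure T Ω, ‖ψ p‖ ≤ 1 := by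
    filter_upwards [hmem] with p hp using hψ1 p hp.1.1.le
  have i1 : Integrable (fun p => z p ^ 2 * ψ p) (interiorMeasure T Ω) := hz2.mul_bdd (hψm _) hψb
  have i2 : Integrable (fun p => z p ^ 2 * transportOp E ψ p) (interiorMeasure T Ω) := by
    refine (i1.const_mul (-l)).congr ?_
    filter_upwards [hmem] with p hp
    rw [hop p (subset_closure hp.2)]
    ring
  have i3 : Integrable (fun p => (S p - q p.2 * z p) * z p * ψ p) (interiorMeasure T Ω) :=
    (hsol.memLp_source.integrable_mul hsol.memLp).mul_bdd (hψm _) hψb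
  -- The rate l = 2Q + 1 beats the coefficient and leaves -∫z²ψ. Both this integral and the outgoing
  -- flux must then vanish, and ψ is positive off `K`.
  have hle : ∫ p, z p ^ 2 * transportOp E ψ p ∂interiorMeasure T Ω
      + 2 * ∫ p, (S p - q p.2 * z p) * z p * ψ p ∂interiorMeasure T Ω
      ≤ -∫ p, z p ^ 2 * ψ p ∂interiorMeasure T Ω := by
    rw [← integral_const_mul, ← integral_add i2 (i3.const_mul 2), ← integral_neg]
    refine integral_mono_ae (i2.add (i3.const_mul 2)) i1.neg ?_
    filter_upwards [hmem, hSK, ae_interior_of_ae_phase hQ] with p hp hSp hqp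
    simp only [hop p (subset_closure hp.2)]
    have hS0 : S p * ψ p = 0 := by
      by_cases hK : p.2.2 j ∈ K
      · simp [hψ, hκ0 _ hK]
      · simp [hSp hK]
    have h1 : -q p.2 ≤ Q := (neg_le_abs _).trans hqp
    have h2 : 0 ≤ z p ^ 2 * ψ p := mul_nonneg (sq_nonneg _) (hψ0 p)
    have h3 : z p ^ 2 * (-l * ψ p) + 2 * ((S p - q p.2 * z p) * z p * ψ p)
        = 2 * z p * (S p * ψ p) + (-l + 2 * (-q p.2)) * (z p ^ 2 * ψ p) := by ring
    have h4 : (-l + 2 * (-q p.2)) * (z p ^ 2 * ψ p) ≤ (-1) * (z p ^ 2 * ψ p) :=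
      mul_le_mul_of_nonneg_right (by linarith) h2
    rw [h3, hS0]
    linarith
  have hg0 : ∫ y, g y ^ 2 * ψ (0, y) ∂phaseMeasure Ω = 0 := by
    refine integral_eq_zero_of_ae ?_
    filter_upwards [hgK] with y hy
    by_cases hK : y.2 j ∈ K
    · simp [hψ, hκ0 _ hK]
    · simp [hy hK]
  have hd2 : Integrable (fun p => d p ^ 2 * ψ p) (outMeasure T Ω) := by
    refine hsol.memLp_trace.integrable_sq.mul_bdd (c := 1) (hψm _) ?_
    filter_upwards [hΩ.ae_out_mem] with p hp using hψ1 p hp.1.1.le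
  have hzn : 0 ≤ fun p => z p ^ 2 * ψ p := fun p => mul_nonneg (sq_nonneg _) (hψ0 p)
  have hdn : 0 ≤ fun p => d p ^ 2 * ψ p := fun p => mul_nonneg (sq_nonneg _) (hψ0 p)
  have hz0 := integral_nonneg (μ := interiorMeasure T Ω) hzn
  have hd0 := integral_nonneg (μ := outMeasure T Ω) hdn
  have e1 : ∫ p, z p ^ 2 * ψ p ∂interiorMeasure T Ω = 0 := by linarith
  have e2 : ∫ p, d p ^ 2 * ψ p ∂outMeasure T Ω = 0 := by linarith
  have hfin : ∀ {a : ℝ} {p : ℝ × Phase}, a ^ 2 * ψ p = 0 → p.2.2 j ∉ K → a = 0 := by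
    intro a p h hp
    have hψp : 0 < ψ p := mul_pos (hκpos _ hp) (Real.exp_pos _)
    simpa [hψp.ne'] using h
  constructor
  · filter_upwards [(integral_eq_zero_iff_of_nonneg hzn i1).1 e1] with p hp using hfin hp
  · filter_upwards [(integral_eq_zero_iff_of_nonneg hdn hd2).1 e2] with p hp using hfin hp

end Localization

/-! ### The Carleman estimate and observability. -/

section Carleman

variable {T C₁ C₂ Q : ℝ} {Ω W : Set R3} {E : R3 → R3} {q f g₀ : Phase → ℝ} {S σ z d : ℝ × Phase → ℝ}

/-- The weights may be unbounded for velocities outside `W`, but the solution and the data vanish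
there. -/
lemma integrable_mul_of_eq_zero_or_bound {X : Type*} [MeasurableSpace X] {μ : Measure X} {a b : X → ℝ}
    {B : ℝ} (ha : Integrable a μ) (hb : AEStronglyMeasurable b μ)
    (h : ∀ᵐ p ∂μ, a p = 0 ∨ |b p| ≤ B) : Integrable (fun p => a p * b p) μ := by
  refine (ha.norm.mul_const B).mono' (ha.1.mul hb) ?_
  filter_upwards [h] with p hp
  rcases hp with hp | hp
  · simp [hp]
  · rw [norm_mul]
    exact mul_le_mul_of_nonneg_left hp (norm_nonneg _)

/-- The transport operator applied to the exponential weight `exp (2 s (φ₀ - β t))`. -/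
lemma transportOp_exp_weight {φ₀ : Phase → ℝ} (hφ₀ : ContDiff ℝ 1 φ₀) (s β : ℝ) (p : ℝ × Phase) :
    transportOp E (fun p => Real.exp (2 * s * (φ₀ p.2 - β * p.1))) p
      = 2 * s * weightPsi E β φ₀ p.2 * Real.exp (2 * s * (φ₀ p.2 - β * p.1)) := by
  have h1 : HasFDerivAt (fun p : ℝ × Phase => φ₀ p.2)
      ((fderiv ℝ φ₀ p.2).comp (ContinuousLinearMap.snd ℝ ℝ Phase)) p :=
    (hφ₀.differentiable one_ne_zero p.2).hasFDerivAt.comp p hasFDerivAt_snd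
  have h2 : HasFDerivAt (fun p : ℝ × Phase => β * p.1) (β • ContinuousLinearMap.fst ℝ ℝ Phase) p :=
    hasFDerivAt_fst.const_mul β
  have h3 := ((h1.sub h2).const_mul (2 * s)).exp
  rw [transportOp]
  erw [h3.fderiv]
  simp [weightPsi, phaseTransport]
  ring

/-- The Carleman estimate with weight `exp (2 s (φ₀ - β t))`, for a fixed parameter `s`. -/
theorem IsTransportSolution.carleman_estimate
    (hsol : IsTransportSolution T Ω E (fun p => f p.2 * σ p - q p.2 * z p) z d g₀)
    (hS : IsSourceData T Ω C₁ C₂ f g₀ S σ) (hE : IsC1OnClosure Ω E) (hΩ : IsSmoothConvexDomain Ω)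
    (hT : 0 < T) (hQ : ∀ᵐ y ∂phaseMeasure Ω, |q y| ≤ Q) (hC₂ : 0 < C₂)
    (hzW : ∀ᵐ p ∂interiorMeasure T Ω, p.2.2 ∉ W → z p = 0)
    (hdW : ∀ᵐ p ∂outMeasure T Ω, p.2.2 ∉ W → d p = 0)
    (hfW : ∀ᵐ y ∂phaseMeasure Ω, y.2 ∉ W → f y = 0)
    {φ₀ : Phase → ℝ} (hφ₀ : ContDiff ℝ 1 φ₀) {β R γ₀ M₀ s : ℝ} (hβ : 0 < β) (hs : 0 < s)
    (hR : ∀ x ∈ closure Ω, ∀ v ∈ W, φ₀ (x, v) ≤ R)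
    (hΨ : ∀ x ∈ closure Ω, ∀ v ∈ W, γ₀ ≤ weightPsi E β φ₀ (x, v) ∧ |weightPsi E β φ₀ (x, v)| ≤ M₀)
    (hsQ : 1 + 2 * Q ≤ 2 * s * γ₀)
    {θ : ℝ → ℝ} (hθ : ContDiff ℝ 1 θ) (hθ01 : ∀ t, 0 ≤ θ t ∧ θ t ≤ 1) {T' T₁ M : ℝ} (hT' : T' < T)
    (hθT' : ∀ t, T' ≤ t → θ t = 0) (hT₁ : 0 < T₁) (hθT₁ : ∀ t, t ≤ T₁ → θ t = 1)
    (hM : ∀ t, |deriv θ t| ≤ M) :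
    C₂ ^ 2 * ∫ y, f y ^ 2 * Real.exp (2 * s * φ₀ y) ∂phaseMeasure Ω
      ≤ Real.exp (2 * s * R) * ∫ p, d p ^ 2 ∂outMeasure T Ω
        + M * Real.exp (2 * s * (R - β * T₁)) * ∫ p, z p ^ 2 ∂interiorMeasure T Ω
        + C₁ ^ 2 / (2 * s * β) * ∫ y, f y ^ 2 * Real.exp (2 * s * φ₀ y) ∂phaseMeasure Ω := by
  have hsf : SFinite (phaseMeasure Ω) := by unfold phaseMeasure; infer_instance
  have hM0 : 0 ≤ M := (abs_nonneg _).trans (hM 0)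
  set e : ℝ × Phase → ℝ := fun p => Real.exp (2 * s * (φ₀ p.2 - β * p.1)) with he
  set ψ : ℝ × Phase → ℝ := fun p => θ p.1 * e p with hψ
  have he0 : ∀ p, 0 < e p := fun p => Real.exp_pos _
  have heC : ContDiff ℝ 1 e := by
    have : ContDiff ℝ 1 fun p : ℝ × Phase => φ₀ p.2 := hφ₀.comp contDiff_snd
    fun_prop
  have hθC : ContDiff ℝ 1 fun p : ℝ × Phase => θ p.1 := hθ.comp contDiff_fst
  have hψC : ContDiff ℝ 1 ψ := hθC.mul heC
  have hψ0 : ∀ p, 0 ≤ ψ p := fun p => mul_nonneg (hθ01 _).1 (he0 p).le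
  have hψe : ∀ p, ψ p ≤ e p := fun p => mul_le_of_le_one_left (he0 p).le (hθ01 _).2
  have hop : ∀ p, transportOp E ψ p = deriv θ p.1 * e p + 2 * s * weightPsi E β φ₀ p.2 * ψ p := by
    intro p
    rw [hψ, transportOp_mul (hθC.differentiable one_ne_zero p) (heC.differentiable one_ne_zero p),
      transportOp_comp_fst (hθ.differentiable one_ne_zero), he, transportOp_exp_weight hφ₀]
    ring
  have heR : ∀ t, 0 ≤ t → ∀ x ∈ closure Ω, ∀ v ∈ W, e (t, x, v) ≤ Real.exp (2 * s * R) := by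
    intro t ht x hx v hv
    refine Real.exp_le_exp.2 (mul_le_mul_of_nonneg_left ?_ (by positivity))
    have := hR x hx v hv
    have : 0 ≤ β * t := by positivity
    simp only
    linarith
  -- Bounds the weight and both parts of its transport derivative, from θ' and from Ψ, on the
  -- velocities in `W`, where e ≤ exp(2sR) for t ≥ 0.
  set B := (1 + M + 2 * s * |M₀|) * Real.exp (2 * s * R) with hBdef
  have hB : ∀ t ∈ Icc 0 T, ∀ x ∈ closure Ω, ∀ v ∈ W, |ψ (t, x, v)| ≤ B ∧
      |transportOp E ψ (t, x, v)| ≤ B := by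
    intro t ht x hx v hv
    have h1 := heR t ht.1 x hx v hv
    have h2 := he0 (t, x, v)
    have h3 := hψe (t, x, v)
    have hsM : 0 ≤ 2 * s * |M₀| := by positivity
    constructor
    · rw [abs_of_nonneg (hψ0 _), hBdef]
      nlinarith
    · rw [hop]
      have h4 : |deriv θ t * e (t, x, v)| ≤ M * Real.exp (2 * s * R) := by
        rw [abs_mul, abs_of_pos h2]
        exact mul_le_mul (hM t) h1 h2.le hM0
      have h5 : |2 * s * weightPsi E β φ₀ (x, v) * ψ (t, x, v)| ≤ 2 * s * |M₀| * Real.exp (2 * s * R) := by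
        rw [abs_mul, abs_mul, abs_of_pos (by positivity : 0 < 2 * s), abs_of_nonneg (hψ0 _)]
        exact mul_le_mul (mul_le_mul_of_nonneg_left ((hΨ x hx v hv).2.trans (le_abs_self _))
          (by positivity)) (h3.trans h1) (hψ0 _) hsM
      refine (abs_add_le _ _).trans ((add_le_add h4 h5).trans ?_)
      rw [hBdef]
      nlinarith [Real.exp_pos (2 * s * R)]
  have hgW : ∀ᵐ y ∂phaseMeasure Ω, y.2 ∉ W → g₀ y = 0 := by
    filter_upwards [hfW, hS.bounds] with y h1 h2 hy
    have h3 := h2.1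
    rw [h1 hy, abs_zero, mul_zero] at h3
    exact abs_nonpos_iff.1 h3
  have hid := hsol.energy_identity hE hΩ hT hψC hT' (fun t y ht => by simp [hψ, hθT' t ht])
    hzW hdW hgW hB
  have hmem := ae_interior_mem (T := T) hΩ.isOpen
  have hz2 := hsol.memLp.integrable_sq
  have hd2 := hsol.memLp_trace.integrable_sq
  have hf2 := hS.memLp_profile.integrable_sq
  have hg2 := hS.memLp_initial.integrable_sq
  have hψm : ∀ μ : Measure (ℝ × Phase), AEStronglyMeasurable ψ μ :=
    fun μ => hψC.continuous.aestronglyMeasurable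
  have hbz : ∀ᵐ p ∂interiorMeasure T Ω, z p = 0 ∨ |ψ p| ≤ B ∧ |transportOp E ψ p| ≤ B := by
    filter_upwards [hmem, hzW] with p hp hz
    by_cases hW : p.2.2 ∈ W
    · exact Or.inr (hB p.1 (Ioo_subset_Icc_self hp.1) p.2.1 (subset_closure hp.2) p.2.2 hW)
    · exact Or.inl (hz hW)
  have i1 : Integrable (fun p => z p ^ 2 * transportOp E ψ p) (interiorMeasure T Ω) := by
    refine integrable_mul_of_eq_zero_or_bound (B := B) hz2
      (hE.aestronglyMeasurable_transportOp hΩ.isOpen hψC) ?_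
    filter_upwards [hbz] with p hp
    exact hp.imp (fun h => by simp [h]) fun h => h.2
  have i2 : Integrable (fun p => (f p.2 * σ p - q p.2 * z p) * z p * ψ p) (interiorMeasure T Ω) := by
    refine integrable_mul_of_eq_zero_or_bound (B := B) (hsol.memLp_source.integrable_mul hsol.memLp)
      (hψm _) ?_
    filter_upwards [hbz] with p hp
    exact hp.imp (fun h => by simp [h]) fun h => h.1
  have hexpm : AEStronglyMeasurable (fun y => Real.exp (2 * s * φ₀ y)) (phaseMeasure Ω) := by
    have := hφ₀.continuous
    exact Continuous.aestronglyMeasurable (by fun_prop)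
  have hbf : ∀ᵐ y ∂phaseMeasure Ω, f y = 0 ∨ |Real.exp (2 * s * φ₀ y)| ≤ Real.exp (2 * s * R) := by
    filter_upwards [ae_phase_mem hΩ.isOpen, hfW] with y hy hf
    by_cases hW : y.2 ∈ W
    · right
      rw [abs_of_pos (Real.exp_pos _)]
      exact Real.exp_le_exp.2 (mul_le_mul_of_nonneg_left (hR y.1 (subset_closure hy) y.2 hW) (by positivity))
    · exact Or.inl (hf hW)
  have i3 : Integrable (fun y => f y ^ 2 * Real.exp (2 * s * φ₀ y)) (phaseMeasure Ω) := by
    refine integrable_mul_of_eq_zero_or_bound (B := Real.exp (2 * s * R)) hf2 hexpm ?_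
    filter_upwards [hbf] with y hy
    exact hy.imp_left fun h => by simp [h]
  have i4 : Integrable (fun y => g₀ y ^ 2 * Real.exp (2 * s * φ₀ y)) (phaseMeasure Ω) := by
    refine integrable_mul_of_eq_zero_or_bound (B := Real.exp (2 * s * R)) hg2 hexpm ?_
    filter_upwards [hbf, hS.bounds] with y hy hb
    refine hy.imp_left fun h => ?_
    have h3 := hb.1
    rw [h, abs_zero, mul_zero] at h3
    simp [abs_nonpos_iff.1 h3]
  have i5 : Integrable (fun p : ℝ × Phase => Real.exp (-(2 * s * β) * p.1)
      * (f p.2 ^ 2 * Real.exp (2 * s * φ₀ p.2))) (interiorMeasure T Ω) := by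
    refine Integrable.mul_prod (f := fun t : ℝ => Real.exp (-(2 * s * β) * t)) ?_ i3
    exact (Continuous.integrableOn_Icc (by fun_prop)).mono_set Ioo_subset_Icc_self
  have e0 : ∫ y, g₀ y ^ 2 * ψ (0, y) ∂phaseMeasure Ω
      = ∫ y, g₀ y ^ 2 * Real.exp (2 * s * φ₀ y) ∂phaseMeasure Ω := by
    congr 1
    ext y
    simp [hψ, he, hθT₁ 0 hT₁.le]
  have b0 : C₂ ^ 2 * ∫ y, f y ^ 2 * Real.exp (2 * s * φ₀ y) ∂phaseMeasure Ω
      ≤ ∫ y, g₀ y ^ 2 * Real.exp (2 * s * φ₀ y) ∂phaseMeasure Ω := by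
    rw [← integral_const_mul]
    refine integral_mono_ae (i3.const_mul _) i4 ?_
    filter_upwards [hS.bounds] with y hy
    have h1 : (C₂ * |f y|) ^ 2 ≤ |g₀ y| ^ 2 := pow_le_pow_left₀ (by positivity) hy.2 2
    rw [mul_pow, sq_abs, sq_abs] at h1
    rw [← mul_assoc]
    exact mul_le_mul_of_nonneg_right h1 (Real.exp_pos _).le
  have b1 : ∫ p, d p ^ 2 * ψ p ∂outMeasure T Ω ≤ Real.exp (2 * s * R) * ∫ p, d p ^ 2 ∂outMeasure T Ω := by
    rw [← integral_const_mul]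
    refine integral_mono_of_nonneg (Filter.Eventually.of_forall fun p => mul_nonneg (sq_nonneg _) (hψ0 p))
      (hd2.const_mul _) ?_
    filter_upwards [hΩ.ae_out_mem, hdW] with p hp hd
    rw [mul_comm]
    by_cases hW : p.2.2 ∈ W
    · exact mul_le_mul_of_nonneg_right ((hψe p).trans
        (heR p.1 hp.1.1.le p.2.1 (frontier_subset_closure hp.2.1) p.2.2 hW)) (sq_nonneg _)
    · simp [hd hW]
  -- This is the gain of the estimate: the decay -βt of the weight makes the source term small
  -- compared with the initial term as s grows.
  have htime : ∫ t in Ioo 0 T, Real.exp (-(2 * s * β) * t) ≤ 1 / (2 * s * β) := by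
    have hc : 0 < 2 * s * β := by positivity
    have h1 := setIntegral_mono_set (f := fun t : ℝ => Real.exp (-(2 * s * β) * t)) (s := Ioo 0 T)
      (t := Ioi 0) (μ := volume) (integrableOn_exp_mul_Ioi (neg_neg_of_pos hc) 0)
      (Filter.Eventually.of_forall fun t => (Real.exp_pos _).le)
      (Filter.Eventually.of_forall fun t ht => ht.1)
    rw [integral_exp_mul_Ioi (neg_neg_of_pos hc)] at h1
    simpa [neg_div_neg_eq] using h1
  have b2 : C₁ ^ 2 * ∫ p : ℝ × Phase, Real.exp (-(2 * s * β) * p.1)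
      * (f p.2 ^ 2 * Real.exp (2 * s * φ₀ p.2)) ∂interiorMeasure T Ω
      ≤ C₁ ^ 2 / (2 * s * β) * ∫ y, f y ^ 2 * Real.exp (2 * s * φ₀ y) ∂phaseMeasure Ω := by
    have h1 : ∫ p : ℝ × Phase, Real.exp (-(2 * s * β) * p.1)
        * (f p.2 ^ 2 * Real.exp (2 * s * φ₀ p.2)) ∂interiorMeasure T Ω
        = (∫ t in Ioo 0 T, Real.exp (-(2 * s * β) * t))
          * ∫ y, f y ^ 2 * Real.exp (2 * s * φ₀ y) ∂phaseMeasure Ω :=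
      integral_prod_mul (fun t : ℝ => Real.exp (-(2 * s * β) * t))
        fun y => f y ^ 2 * Real.exp (2 * s * φ₀ y)
    rw [h1, ← mul_assoc, div_eq_mul_one_div]
    refine mul_le_mul_of_nonneg_right (mul_le_mul_of_nonneg_left htime (sq_nonneg _))
      (integral_nonneg fun y => mul_nonneg (sq_nonneg _) (Real.exp_pos _).le)
  have b3 : -(∫ p, z p ^ 2 * transportOp E ψ p ∂interiorMeasure T Ω
      + 2 * ∫ p, (f p.2 * σ p - q p.2 * z p) * z p * ψ p ∂interiorMeasure T Ω)
      ≤ C₁ ^ 2 * ∫ p : ℝ × Phase, Real.exp (-(2 * s * β) * p.1)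
          * (f p.2 ^ 2 * Real.exp (2 * s * φ₀ p.2)) ∂interiorMeasure T Ω
        + M * Real.exp (2 * s * (R - β * T₁)) * ∫ p, z p ^ 2 ∂interiorMeasure T Ω := by
    rw [← integral_const_mul, ← integral_const_mul, ← integral_const_mul,
      ← integral_add i1 (i2.const_mul 2), ← integral_neg, ← integral_add (i5.const_mul _) (hz2.const_mul _)]
    refine integral_mono_ae (i1.add (i2.const_mul 2)).neg ((i5.const_mul _).add (hz2.const_mul _)) ?_
    filter_upwards [hmem, hzW, ae_interior_of_ae_phase hQ] with p hp hz hqp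
    have hexp : Real.exp (-(2 * s * β) * p.1) * (f p.2 ^ 2 * Real.exp (2 * s * φ₀ p.2))
        = f p.2 ^ 2 * e p := by
      have : e p = Real.exp (-(2 * s * β) * p.1) * Real.exp (2 * s * φ₀ p.2) := by
        rw [← Real.exp_add, he]
        simp only
        congr 1
        ring
      rw [this]
      ring
    simp only [hexp]
    by_cases hW : p.2.2 ∈ W
    · have hx : p.2.1 ∈ closure Ω := subset_closure hp.2
      have k1 : -(2 * (f p.2 * σ p * z p)) ≤ C₁ ^ 2 * f p.2 ^ 2 + z p ^ 2 := by
        have h1 : σ p ^ 2 ≤ C₁ ^ 2 := sq_le_sq.2 ((hS.abs_le p).trans (le_abs_self _))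
        have h2 : f p.2 ^ 2 * σ p ^ 2 ≤ f p.2 ^ 2 * C₁ ^ 2 := mul_le_mul_of_nonneg_left h1 (sq_nonneg _)
        nlinarith [sq_nonneg (f p.2 * σ p + z p)]
      have k2 : 2 * (q p.2 * z p ^ 2) ≤ 2 * Q * z p ^ 2 := by
        have := mul_le_mul_of_nonneg_right ((le_abs_self _).trans hqp) (sq_nonneg (z p))
        linarith
      have k3 : (1 + 2 * Q) * z p ^ 2 ≤ 2 * s * weightPsi E β φ₀ p.2 * z p ^ 2 := by
        refine mul_le_mul_of_nonneg_right (hsQ.trans ?_) (sq_nonneg _)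
        exact mul_le_mul_of_nonneg_left (hΨ _ hx _ hW).1 (by positivity)
      -- Where θ is not constant one has t ≥ T₁, and there φ₀ - βt ≤ R - βT₁. This is the error made
      -- by cutting off before the final time.
      have k4 : -(deriv θ p.1 * e p) ≤ M * Real.exp (2 * s * (R - β * T₁)) := by
        rcases lt_or_ge p.1 T₁ with ht | ht
        · have h0 : deriv θ p.1 = 0 := by
            have : θ =ᶠ[𝓝 p.1] fun _ => 1 := by
              filter_upwards [Iio_mem_nhds ht] with t ht using hθT₁ t (le_of_lt ht)
            rw [this.deriv_eq, deriv_const]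
          rw [h0]
          simp only [zero_mul, neg_zero]
          positivity
        · rw [← neg_mul]
          refine mul_le_mul ((neg_le_abs _).trans (hM _)) ?_ (he0 p).le hM0
          refine Real.exp_le_exp.2 (mul_le_mul_of_nonneg_left ?_ (by positivity))
          have h1 := hR _ hx _ hW
          have h2 : β * T₁ ≤ β * p.1 := mul_le_mul_of_nonneg_left ht hβ.le
          have h3 : φ₀ p.2 ≤ R := h1
          linarith
      have k5 : (C₁ ^ 2 * f p.2 ^ 2) * ψ p ≤ (C₁ ^ 2 * f p.2 ^ 2) * e p :=
        mul_le_mul_of_nonneg_left (hψe p) (by positivity)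
      have k6 : z p ^ 2 * -(deriv θ p.1 * e p) ≤ z p ^ 2 * (M * Real.exp (2 * s * (R - β * T₁))) :=
        mul_le_mul_of_nonneg_left k4 (sq_nonneg _)
      -- The terms in z² have total coefficient at most 1 + 2Q - 2sΨ ≤ 0 by the choice of s, so only
      -- the source survives.
      have k7 : (-(2 * (f p.2 * σ p * z p)) + 2 * (q p.2 * z p ^ 2)
          - 2 * s * weightPsi E β φ₀ p.2 * z p ^ 2) * ψ p ≤ (C₁ ^ 2 * f p.2 ^ 2) * ψ p :=
        mul_le_mul_of_nonneg_right (by linarith) (hψ0 p)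
      have k8 : -(z p ^ 2 * transportOp E ψ p + 2 * ((f p.2 * σ p - q p.2 * z p) * z p * ψ p))
          = (-(2 * (f p.2 * σ p * z p)) + 2 * (q p.2 * z p ^ 2)
          - 2 * s * weightPsi E β φ₀ p.2 * z p ^ 2) * ψ p + z p ^ 2 * -(deriv θ p.1 * e p) := by
        rw [hop]
        ring
      rw [k8]
      linarith
    · simp only [hz hW]
      have : 0 ≤ C₁ ^ 2 * (f p.2 ^ 2 * e p) := by have := he0 p; positivity
      simpa using this
  rw [e0] at hid
  linarith

/-- All three requirements hold for large s. The last one does because R - r - βT₁ < 0, so that the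
cut-off error decays exponentially even relative to the smallest value exp(2sr) of the weight at
time zero. -/
lemma exists_carleman_parameter {β γ₀ M K R r T₁ : ℝ} (hβ : 0 < β) (hγ : 0 < γ₀) (hC₂ : 0 < C₂)
    (hT₁ : R - r < β * T₁) : ∃ s, 0 < s ∧ 1 + 2 * Q ≤ 2 * s * γ₀ ∧
      C₁ ^ 2 / (2 * s * β) ≤ C₂ ^ 2 / 2 ∧
      M * Real.exp (2 * s * (R - β * T₁)) * K ≤ C₂ ^ 2 / 4 * Real.exp (2 * s * r) := by
  have h1 : Filter.Tendsto (fun s : ℝ => 2 * s * γ₀) Filter.atTop Filter.atTop :=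
    (Filter.tendsto_id.const_mul_atTop two_pos).atTop_mul_const hγ
  have h2 : Filter.Tendsto (fun s : ℝ => C₁ ^ 2 / (2 * s * β)) Filter.atTop (𝓝 0) :=
    ((Filter.tendsto_id.const_mul_atTop two_pos).atTop_mul_const hβ).const_div_atTop _
  have h3 : Filter.Tendsto (fun s : ℝ => M * Real.exp (2 * s * (R - r - β * T₁)) * K) Filter.atTop
      (𝓝 (M * 0 * K)) := by
    refine ((Real.tendsto_exp_atBot.comp ?_).const_mul M).mul_const K
    exact (Filter.tendsto_id.const_mul_atTop two_pos).atTop_mul_const_of_neg (by linarith)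
  rw [mul_zero, zero_mul] at h3
  obtain ⟨s, hs0, hs1, hs2, hs3⟩ := ((Filter.eventually_gt_atTop 0).and
    ((h1.eventually_ge_atTop (1 + 2 * Q)).and ((h2.eventually_le_const (by positivity : 0 < C₂ ^ 2 / 2)).and
      (h3.eventually_le_const (by positivity : 0 < C₂ ^ 2 / 4))))).exists
  refine ⟨s, hs0, hs1, hs2, ?_⟩
  have : Real.exp (2 * s * (R - β * T₁)) = Real.exp (2 * s * (R - r - β * T₁)) * Real.exp (2 * s * r) := by
    rw [← Real.exp_add]
    congr 1
    ring
  rw [this]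
  have := mul_le_mul_of_nonneg_right hs3 (Real.exp_pos (2 * s * r)).le
  linarith

/-- Observability: the profile of the source is controlled by the time derivative of the outgoing
trace. -/
theorem exists_observability_constant (hT : 0 < T) (hΩ : IsSmoothConvexDomain Ω)
    (hE : IsC1OnClosure Ω E) {V : Set R3} (hV : CarlemanHypothesis T Ω E V) (hWV : W ⊆ V)
    (hQ : ∀ᵐ y ∂phaseMeasure Ω, |q y| ≤ Q) (hC₂ : 0 < C₂) (C₁ K : ℝ) :
    ∃ C > 0, ∀ (f g₀ : Phase → ℝ) (S σ z d : ℝ × Phase → ℝ),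
      IsTransportSolution T Ω E (fun p => f p.2 * σ p - q p.2 * z p) z d g₀ →
      IsSourceData T Ω C₁ C₂ f g₀ S σ →
      (∀ᵐ p ∂interiorMeasure T Ω, p.2.2 ∉ W → z p = 0) →
      (∀ᵐ p ∂outMeasure T Ω, p.2.2 ∉ W → d p = 0) →
      (∀ᵐ y ∂phaseMeasure Ω, y.2 ∉ W → f y = 0) →
      ∫ p, z p ^ 2 ∂interiorMeasure T Ω ≤ K * ∫ y, f y ^ 2 ∂phaseMeasure Ω →
      ∫ y, f y ^ 2 ∂phaseMeasure Ω ≤ C * ∫ p, d p ^ 2 ∂outMeasure T Ω := by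
  obtain ⟨-, -, φ₀, β, r, R, γ₀, M₀, -, hφ₀, hβ, -, hrR, hRT, hγ, hφR, hΨ, -⟩ := hV
  -- The time T₁ lies strictly between (R - r)/β and T: late enough for the weight to have decayed,
  -- early enough to leave room for the cut-off.
  obtain ⟨T₁, hT₁, hT₁T⟩ := exists_between hRT
  have hT₁0 : 0 < T₁ := (div_pos (by linarith) hβ).trans hT₁
  obtain ⟨θ, hθC, hθ01, hθd, hθT, hθM, hθ1⟩ := exists_time_cutoff T
  obtain ⟨n, hn⟩ := (hθ1 T₁ hT₁T).exists
  obtain ⟨T', hT', hθT'⟩ := hθT n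
  obtain ⟨M, hM⟩ := hθM n
  have hM0 : 0 ≤ M := (abs_nonneg _).trans (hM 0)
  have hanti : Antitone (θ n) := antitone_of_deriv_nonpos ((hθC n).differentiable one_ne_zero) (hθd n)
  have hone : ∀ t, t ≤ T₁ → θ n t = 1 := fun t ht => le_antisymm (hθ01 n t).2 (hn ▸ hanti ht)
  obtain ⟨s, hs, hs1, hs2, hs3⟩ := exists_carleman_parameter (C₁ := C₁) (Q := Q) (M := M) (K := K)
    (R := R) (r := r) (T₁ := T₁) hβ hγ hC₂ (by rw [div_lt_iff₀ hβ] at hT₁; linarith)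
  -- Of the left side C₂²G, one half absorbs the source. From the other half, bounded below by
  -- (C₂²/2)exp(2sr)F, half absorbs the cut-off error. What remains is (C₂²/4)exp(2sr)F ≤
  -- exp(2sR)‖d‖², which gives this constant.
  refine ⟨4 / C₂ ^ 2 * Real.exp (2 * s * R) / Real.exp (2 * s * r), by positivity, ?_⟩
  intro f g₀ S σ z d hsol hS hzW hdW hfW hzK
  have hest := hsol.carleman_estimate hS hE hΩ hT hQ hC₂ hzW hdW hfW
    (hφ₀.of_le one_le_two) hβ hs (fun x hx v hv => (hφR x hx v (hWV hv)).2)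
    (fun x hx v hv => hΨ x hx v (hWV hv)) hs1 (hθC n) (hθ01 n) hT' hθT' hT₁0 hone hM
  set F := ∫ y, f y ^ 2 ∂phaseMeasure Ω with hF
  set G := ∫ y, f y ^ 2 * Real.exp (2 * s * φ₀ y) ∂phaseMeasure Ω with hG
  have hf2 := hS.memLp_profile.integrable_sq
  have hG0 : Real.exp (2 * s * r) * F ≤ G := by
    rw [hF, hG, ← integral_const_mul]
    refine integral_mono_ae (hf2.const_mul _) ?_ ?_
    · refine integrable_mul_of_eq_zero_or_bound (B := Real.exp (2 * s * R)) hf2 ?_ ?_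
      · have := hφ₀.continuous
        exact Continuous.aestronglyMeasurable (by fun_prop)
      · filter_upwards [ae_phase_mem hΩ.isOpen, hfW] with y hy hf
        by_cases hW : y.2 ∈ W
        · right
          rw [abs_of_pos (Real.exp_pos _)]
          exact Real.exp_le_exp.2 (mul_le_mul_of_nonneg_left
            (hφR y.1 (subset_closure hy) y.2 (hWV hW)).2 (by positivity))
        · exact Or.inl (by simp [hf hW])
    · filter_upwards [ae_phase_mem hΩ.isOpen, hfW] with y hy hf
      by_cases hW : y.2 ∈ W
      · rw [mul_comm]
        refine mul_le_mul_of_nonneg_left (Real.exp_le_exp.2 (mul_le_mul_of_nonneg_left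
          (hφR y.1 (subset_closure hy) y.2 (hWV hW)).1 (by positivity))) (sq_nonneg _)
      · simp [hf hW]
  have hF0 : 0 ≤ F := integral_nonneg fun y => sq_nonneg _
  have hGn : 0 ≤ G := (by positivity : 0 ≤ Real.exp (2 * s * r) * F).trans hG0
  have h1 : C₁ ^ 2 / (2 * s * β) * G ≤ C₂ ^ 2 / 2 * G := mul_le_mul_of_nonneg_right hs2 hGn
  have h2 : M * Real.exp (2 * s * (R - β * T₁)) * ∫ p, z p ^ 2 ∂interiorMeasure T Ω
      ≤ C₂ ^ 2 / 4 * Real.exp (2 * s * r) * F := by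
    refine (mul_le_mul_of_nonneg_left hzK (by positivity)).trans ?_
    rw [← mul_assoc]
    exact mul_le_mul_of_nonneg_right hs3 hF0
  have h3 : C₂ ^ 2 / 2 * (Real.exp (2 * s * r) * F) ≤ C₂ ^ 2 / 2 * G :=
    mul_le_mul_of_nonneg_left hG0 (by positivity)
  have h4 : C₂ ^ 2 / 4 * Real.exp (2 * s * r) * F ≤ Real.exp (2 * s * R) * ∫ p, d p ^ 2 ∂outMeasure T Ω := by
    linarith
  have h5 : 4 / C₂ ^ 2 * Real.exp (2 * s * R) / Real.exp (2 * s * r) * ∫ p, d p ^ 2 ∂outMeasure T Ω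
      = (Real.exp (2 * s * R) * ∫ p, d p ^ 2 ∂outMeasure T Ω) / (C₂ ^ 2 / 4 * Real.exp (2 * s * r)) := by
    field_simp
  rw [h5, le_div_iff₀ (by positivity)]
  linarith

end Carleman

/-! ### From sources of class 𝒫_U to the stability estimate. -/

section Assembly

variable {T C₁ C₂ Q : ℝ} {Ω U : Set R3} {E : R3 → R3} {q f : Phase → ℝ} {S₀ : ℝ × Phase → ℝ}

/-- On the set where the profile does not vanish, a function of class `𝒫_U` has a bounded measurable
time derivative. -/
lemma MemP.exists_measurable_derivative (hP : MemP T Ω U C₁ C₂ S₀) (hC₁ : 0 < C₁) {A : Set Phase}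
    (hA : A ≤ᵐ[volume] Ω ×ˢ U) :
    ∃ σ : ℝ × Phase → ℝ, Measurable σ ∧ (∀ p, |σ p| ≤ C₁) ∧
      ∀ᵐ y ∂(volume : Measure Phase).restrict A, |S₀ (0, y)| ≤ C₁ ∧ C₂ ≤ |S₀ (0, y)| ∧
        ∀ t ∈ Icc 0 T, S₀ (t, y) = S₀ (0, y) + ∫ s in (0 : ℝ)..t, σ (s, y) := by
  obtain ⟨hb, f', hf'm, hf'b, hf'⟩ := hP
  have hac : (volume : Measure Phase).restrict A ≪ (volume : Measure Phase).restrict (Ω ×ˢ U) :=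
    Measure.absolutelyContinuous_of_le (Measure.restrict_mono_ae hA)
  have hac2 : ((volume : Measure ℝ).restrict (Icc 0 T)).prod ((volume : Measure Phase).restrict A)
      ≪ ((volume : Measure ℝ).restrict (Icc 0 T)).prod ((volume : Measure Phase).restrict (Ω ×ˢ U)) :=
    Measure.AbsolutelyContinuous.rfl.prod hac
  have hm := hf'm.mono_ac hac2
  set G := hm.mk f' with hG
  have hGm : Measurable G := hm.stronglyMeasurable_mk.measurable
  -- Clamping to [-C₁, C₁] changes the derivative only on a null set and makes the bound hold at
  -- every point.
  set σ : ℝ × Phase → ℝ := fun p => max (-C₁) (min C₁ (G p)) with hσ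
  have hσm : Measurable σ := measurable_const.max (measurable_const.min hGm)
  have hσb : ∀ p, |σ p| ≤ C₁ := fun p =>
    abs_le.2 ⟨le_max_left _ _, max_le (by linarith) (min_le_left _ _)⟩
  refine ⟨σ, hσm, hσb, ?_⟩
  have heq : ∀ᵐ p ∂((volume : Measure ℝ).restrict (Icc 0 T)).prod ((volume : Measure Phase).restrict A),
      f' p = σ p := by
    filter_upwards [hm.ae_eq_mk, hac2.ae_le hf'b] with p h1 h2
    have h3 := abs_le.1 h2
    rw [h1] at h3
    simp only [hσ]
    rw [min_eq_right h3.2, max_eq_right h3.1]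
    exact h1
  have heq2 := Measure.ae_ae_of_ae_prod (Measure.measurePreserving_swap.quasiMeasurePreserving.ae heq)
  filter_upwards [hac.ae_le hb, hac.ae_le hf', heq2] with y h1 h2 h3
  refine ⟨h1.1, h1.2, fun t ht => ?_⟩
  rw [h2 t ht]
  congr 1
  rw [intervalIntegral.integral_of_le ht.1, intervalIntegral.integral_of_le ht.1]
  refine integral_congr_ae ?_
  have hsub : Ioc 0 t ⊆ Icc 0 T := fun s hs => ⟨hs.1.le, hs.2.trans ht.2⟩
  exact ae_restrict_of_ae_restrict_of_subset hsub h3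

/-- A separated source `f S₀`, with `S₀` of class `𝒫_U` and `f` supported in `U`. -/
theorem MemP.exists_isSourceData (hP : MemP T Ω U C₁ C₂ S₀) (hT : 0 < T) (hΩ : IsOpen Ω) (hC₁ : 0 < C₁)
    (hf : MemLp f 2 (phaseMeasure Ω)) (hfU : ∀ z, z.1 ∈ Ω → f z ≠ 0 → z.2 ∈ U)
    (hS : MemLp (fun p : ℝ × Phase => f p.2 * S₀ p) 2 (interiorMeasure T Ω)) :
    ∃ σ : ℝ × Phase → ℝ, IsSourceData T Ω C₁ C₂ f (fun y => f y * S₀ (0, y)) (fun p => f p.2 * S₀ p) σ := by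
  have hsf : SFinite (phaseMeasure Ω) := by unfold phaseMeasure; infer_instance
  have hΩm : MeasurableSet (Ω ×ˢ (univ : Set R3)) := hΩ.measurableSet.prod MeasurableSet.univ
  set k := hf.1.mk f with hk
  have hkm : Measurable k := hf.1.stronglyMeasurable_mk.measurable
  have hkf : ∀ᵐ y ∂phaseMeasure Ω, f y = k y := hf.1.ae_eq_mk
  have hkf' : ∀ᵐ y ∂(volume : Measure Phase), y ∈ Ω ×ˢ (univ : Set R3) → f y = k y :=
    (ae_restrict_iff' hΩm).1 hkf
  -- The set `U` need not be measurable. The set where a measurable representative of f is nonzero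
  -- over Ω is measurable and almost contained in Ω × U; outside it f vanishes almost everywhere, so
  -- nothing about S₀ is needed there.
  set A : Set Phase := {y | k y ≠ 0} ∩ Ω ×ˢ univ with hA
  have hAm : MeasurableSet A := ((measurableSet_singleton 0).compl.preimage hkm).inter hΩm
  have hAU : A ≤ᵐ[volume] Ω ×ˢ U := by
    filter_upwards [hkf'] with y hy hyA
    refine ⟨hyA.2.1, hfU y hyA.2.1 ?_⟩
    rw [hy hyA.2]
    exact hyA.1
  obtain ⟨σ, hσm, hσb, hσ⟩ := hP.exists_measurable_derivative hC₁ hAU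
  have hdich : ∀ᵐ y ∂phaseMeasure Ω, f y = 0 ∨ (|S₀ (0, y)| ≤ C₁ ∧ C₂ ≤ |S₀ (0, y)| ∧
        ∀ t ∈ Icc 0 T, S₀ (t, y) = S₀ (0, y) + ∫ s in (0 : ℝ)..t, σ (s, y)) := by
    have h1 := ae_restrict_of_ae (s := Ω ×ˢ (univ : Set R3)) ((ae_restrict_iff' hAm).1 hσ)
    filter_upwards [hkf, h1, ae_restrict_mem hΩm] with y h2 h3 h4
    by_cases h5 : k y = 0
    · exact Or.inl (h2.trans h5)
    · exact Or.inr (h3 ⟨h5, h4⟩)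
  have hprim : ∀ᵐ y ∂phaseMeasure Ω, ∀ t ∈ Icc 0 T,
      f y * S₀ (t, y) = f y * S₀ (0, y) + ∫ s in (0 : ℝ)..t, f y * σ (s, y) := by
    filter_upwards [hdich] with y hy t ht
    rcases hy with hy | hy
    · simp [hy]
    · rw [hy.2.2 t ht, intervalIntegral.integral_const_mul]
      ring
  have hbounds : ∀ᵐ y ∂phaseMeasure Ω, |f y * S₀ (0, y)| ≤ C₁ * |f y| ∧
      C₂ * |f y| ≤ |f y * S₀ (0, y)| := by
    filter_upwards [hdich] with y hy
    rcases hy with hy | hy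
    · simp [hy]
    · rw [abs_mul, mul_comm |f y|]
      exact ⟨mul_le_mul_of_nonneg_right hy.1 (abs_nonneg _),
        mul_le_mul_of_nonneg_right hy.2.1 (abs_nonneg _)⟩
  -- Measurability of the initial slice is not part of the data. It is recovered from a slice at
  -- some positive time, measurable for almost every t by Fubini, by subtracting the primitive of
  -- the time derivative.
  have hmeas : AEStronglyMeasurable (fun y => f y * S₀ (0, y)) (phaseMeasure Ω) := by
    have h1 := AEStronglyMeasurable.prodMk_left (μ := (volume : Measure ℝ).restrict (Ioo 0 T))
      (ν := phaseMeasure Ω) hS.1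
    have hne : (ae ((volume : Measure ℝ).restrict (Ioo 0 T))).NeBot := by
      rw [ae_neBot, Ne, Measure.restrict_eq_zero, Real.volume_Ioo]
      simpa using hT
    obtain ⟨t, ht, htm⟩ := (h1.and (ae_restrict_mem measurableSet_Ioo)).exists
    have h2 : StronglyMeasurable fun y => ∫ s in Ioc 0 t, σ (s, y) :=
      hσm.stronglyMeasurable.integral_prod_left'
    refine (ht.sub (hf.1.mul h2.aestronglyMeasurable)).congr ?_
    filter_upwards [hprim] with y hy
    have h3 := hy t (Ioo_subset_Icc_self htm)
    rw [intervalIntegral.integral_const_mul, intervalIntegral.integral_of_le htm.1.le] at h3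
    simp only [Pi.sub_apply, Pi.mul_apply]
    linarith
  refine ⟨σ, hf, hS, hσm, hσb, ?_, hprim, hbounds⟩
  refine hf.of_le_mul (c := C₁) hmeas ?_
  filter_upwards [hbounds] with y hy using hy.1

/-- The difference of two weak solutions with the same data. -/
lemma IsWeakSolution.isTransportSolution_sub {S₁ S₂ h u₁ u₂ d₁ d₂ : ℝ × Phase → ℝ} {g : Phase → ℝ}
    (h₁ : IsWeakSolution T Ω E q S₁ g h u₁ d₁) (h₂ : IsWeakSolution T Ω E q S₂ g h u₂ d₂)
    (hE : IsC1OnClosure Ω E) (hΩ : IsSmoothConvexDomain Ω)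
    (hqm : AEStronglyMeasurable q (phaseMeasure Ω)) (hQ : ∀ᵐ y ∂phaseMeasure Ω, |q y| ≤ Q)
    (hS₁ : MemLp S₁ 2 (interiorMeasure T Ω)) (hS₂ : MemLp S₂ 2 (interiorMeasure T Ω)) :
    IsTransportSolution T Ω E (fun p => S₁ p - S₂ p - q p.2 * (u₁ p - u₂ p)) (fun p => u₁ p - u₂ p)
      (fun p => d₁ p - d₂ p) fun _ => 0 := by
  have hlf := hΩ.isLocallyFiniteMeasure_outMeasure T
  have hu : MemLp (fun p => u₁ p - u₂ p) 2 (interiorMeasure T Ω) := h₁.memLp.sub h₂.memLp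
  refine ⟨(hS₁.sub hS₂).sub (memLp_coefficient_mul hqm hQ hu), hu, h₁.memLp_out.sub h₂.memLp_out,
    MemLp.zero', fun φ hφ hφs hφT => ?_⟩
  have hφ2 : MemLp φ 2 (interiorMeasure T Ω) := hφ.continuous.memLp_of_hasCompactSupport hφs
  have hφ2' : MemLp φ 2 (outMeasure T Ω) := hφ.continuous.memLp_of_hasCompactSupport hφs
  have hqφ := memLp_coefficient_mul hqm hQ hφ2
  have hPφ := hE.memLp_transportOp (T := T) hΩ.isOpen hφ hφs
  have hsplit : ∀ {u : ℝ × Phase → ℝ}, MemLp u 2 (interiorMeasure T Ω) →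
      Integrable (fun p => u p * transportOp E φ p) (interiorMeasure T Ω) ∧
      Integrable (fun p => u p * (q p.2 * φ p)) (interiorMeasure T Ω) ∧
      ∫ p, u p * (-transportOp E φ p + q p.2 * φ p) ∂interiorMeasure T Ω
        = -∫ p, u p * transportOp E φ p ∂interiorMeasure T Ω
          + ∫ p, u p * (q p.2 * φ p) ∂interiorMeasure T Ω := by
    intro u hu
    have i1 : Integrable (fun p => u p * transportOp E φ p) (interiorMeasure T Ω) := hu.integrable_mul hPφ
    have i2 : Integrable (fun p => u p * (q p.2 * φ p)) (interiorMeasure T Ω) := hu.integrable_mul hqφ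
    refine ⟨i1, i2, ?_⟩
    rw [neg_add_eq_sub, ← integral_sub i2 i1]
    congr 1
    ext p
    ring
  obtain ⟨a1, b1, c1⟩ := hsplit h₁.memLp
  obtain ⟨a2, b2, c2⟩ := hsplit h₂.memLp
  have w1 := h₁.weak_eq φ hφ hφs hφT
  have w2 := h₂.weak_eq φ hφ hφs hφT
  rw [c1] at w1
  rw [c2] at w2
  have o1 : Integrable (fun p => d₁ p * φ p) (outMeasure T Ω) := h₁.memLp_out.integrable_mul hφ2'
  have o2 : Integrable (fun p => d₂ p * φ p) (outMeasure T Ω) := h₂.memLp_out.integrable_mul hφ2'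
  have s1 : Integrable (fun p => S₁ p * φ p) (interiorMeasure T Ω) := hS₁.integrable_mul hφ2
  have s2 : Integrable (fun p => S₂ p * φ p) (interiorMeasure T Ω) := hS₂.integrable_mul hφ2
  have e1 : ∫ p, (u₁ p - u₂ p) * transportOp E φ p ∂interiorMeasure T Ω
      = ∫ p, u₁ p * transportOp E φ p ∂interiorMeasure T Ω
        - ∫ p, u₂ p * transportOp E φ p ∂interiorMeasure T Ω := by
    rw [← integral_sub a1 a2]
    simp only [sub_mul]
  have e2 : ∫ p, (d₁ p - d₂ p) * φ p ∂outMeasure T Ω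
      = ∫ p, d₁ p * φ p ∂outMeasure T Ω - ∫ p, d₂ p * φ p ∂outMeasure T Ω := by
    rw [← integral_sub o1 o2]
    simp only [sub_mul]
  have e3 : ∫ p, (S₁ p - S₂ p - q p.2 * (u₁ p - u₂ p)) * φ p ∂interiorMeasure T Ω
      = (∫ p, S₁ p * φ p ∂interiorMeasure T Ω - ∫ p, S₂ p * φ p ∂interiorMeasure T Ω)
        - (∫ p, u₁ p * (q p.2 * φ p) ∂interiorMeasure T Ω
          - ∫ p, u₂ p * (q p.2 * φ p) ∂interiorMeasure T Ω) := by
    rw [← integral_sub s1 s2, ← integral_sub b1 b2,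
      ← integral_sub (f := fun p => S₁ p * φ p - S₂ p * φ p)
        (g := fun p => u₁ p * (q p.2 * φ p) - u₂ p * (q p.2 * φ p)) (s1.sub s2) (b1.sub b2)]
    congr 1
    ext p
    ring
  rw [e1, e2, e3]
  simp only [zero_mul, integral_zero, sub_zero]
  linarith

/-- Weak time derivatives are unique. -/
lemma IsWeakTimeDeriv.ae_eq {w d d' : ℝ × Phase → ℝ} (hΩ : IsSmoothConvexDomain Ω)
    (hd : IsWeakTimeDeriv T Ω w d) (hd' : IsWeakTimeDeriv T Ω w d') : d =ᵐ[outMeasure T Ω] d' := by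
  have hmul : ∀ {k θ : ℝ × Phase → ℝ}, LocallyIntegrableOn k (Ioo 0 T ×ˢ univ) (outMeasure T Ω) →
      Continuous θ → HasCompactSupport θ → tsupport θ ⊆ Ioo 0 T ×ˢ univ →
      Integrable (fun p => k p * θ p) (outMeasure T Ω) := by
    intro k θ hk hθ hθs hθT
    have h1 : IntegrableOn (fun p => k p * θ p) (tsupport θ) (outMeasure T Ω) :=
      (hk.integrableOn_compact_subset hθT hθs).mul_continuousOn hθ.continuousOn hθs
    refine (integrableOn_iff_integrable_of_support_subset fun p hp => ?_).1 h1
    exact subset_tsupport _ (right_ne_zero_of_mul hp)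
  have h0 := (isOpen_Ioo.prod isOpen_univ).ae_eq_zero_of_integral_contDiff_smul_eq_zero
    (hd.1.sub hd'.1) (fun θ hθ hθs hθT => by
      have hθ1 : ContDiff ℝ 1 θ := hθ.of_le (by exact_mod_cast le_top)
      have i1 := hmul hd.1 hθ.continuous hθs hθT
      have i2 := hmul hd'.1 hθ.continuous hθs hθT
      have e1 := hd.2 θ hθ1 hθs hθT
      have e2 := hd'.2 θ hθ1 hθs hθT
      have : ∫ p, θ p • (d - d') p ∂outMeasure T Ω
          = ∫ p, d p * θ p ∂outMeasure T Ω - ∫ p, d' p * θ p ∂outMeasure T Ω := by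
        rw [← integral_sub i1 i2]
        congr 1
        ext p
        simp only [smul_eq_mul, Pi.sub_apply]
        ring
      rw [this]
      linarith)
  filter_upwards [h0, hΩ.ae_out_mem] with p h1 h2
  exact sub_eq_zero.1 (h1 ⟨h2.1, mem_univ _⟩)

lemma eLpNorm_two_eq_sqrt {X : Type*} [MeasurableSpace X] {μ : Measure X} {a : X → ℝ}
    (ha : MemLp a 2 μ) : eLpNorm a 2 μ = ENNReal.ofReal √(∫ p, a p ^ 2 ∂μ) := by
  rw [MemLp.eLpNorm_eq_integral_rpow_norm two_ne_zero ENNReal.ofNat_ne_top ha]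
  simp [Real.sqrt_eq_rpow]

lemma eLpNorm_le_of_integral_sq_le {X Y : Type*} [MeasurableSpace X] [MeasurableSpace Y]
    {μ : Measure X} {ν : Measure Y} {a : X → ℝ} {b : Y → ℝ} (ha : MemLp a 2 μ) (hb : MemLp b 2 ν)
    {K : ℝ} (hK : 0 ≤ K) (h : ∫ p, a p ^ 2 ∂μ ≤ K * ∫ p, b p ^ 2 ∂ν) :
    eLpNorm a 2 μ ≤ ENNReal.ofReal √K * eLpNorm b 2 ν := by
  rw [eLpNorm_two_eq_sqrt ha, eLpNorm_two_eq_sqrt hb, ← ENNReal.ofReal_mul (Real.sqrt_nonneg _),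
    ← Real.sqrt_mul hK]
  exact ENNReal.ofReal_le_ofReal (Real.sqrt_le_sqrt h)

lemma exists_ae_bound_of_memLp_top {X : Type*} [MeasurableSpace X] {μ : Measure X} {a : X → ℝ}
    (ha : MemLp a ∞ μ) : ∃ Q, 0 ≤ Q ∧ ∀ᵐ x ∂μ, |a x| ≤ Q := by
  refine ⟨(eLpNormEssSup a μ).toReal, ENNReal.toReal_nonneg, ?_⟩
  have hfin : eLpNormEssSup a μ ≠ ∞ := by
    rw [← eLpNorm_exponent_top]
    exact ha.2.ne
  filter_upwards [ae_le_eLpNormEssSup (f := a) (μ := μ)] with x hx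
  have := ENNReal.toReal_mono hfin hx
  simpa using this

end Assembly

end

theorem theorem2
    (T : ℝ) (hT : 0 < T)
    (Ω : Set R3) (hΩ : IsSmoothConvexDomain Ω)
    (E : R3 → R3) (hE : IsC1OnClosure Ω E)
    (hEn : ∀ x ∈ frontier Ω, inner ℝ (outerNormal Ω x) (E x) = 0)
    (j : Fin 3) (hEj : ∀ x ∈ closure Ω, E x j = 0)
    (U V : Set R3) (hUV : SeparatedInDirection j U V)
    (hV : CarlemanHypothesis T Ω E V)
    (q : Phase → ℝ) (hq : MemLp q ∞ (phaseMeasure Ω))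
    (C₁ C₂ : ℝ) (hC₁ : 0 < C₁) (hC₂ : 0 < C₂) :
    ∃ c C : ℝ, 0 < c ∧ 0 < C ∧
      ∀ (S₀ : ℝ × Phase → ℝ) (S₁ S₂ : Phase → ℝ)
        (g : Phase → ℝ) (h u₁ u₂ u₁Out u₂Out : ℝ × Phase → ℝ),
        MemP T Ω U C₁ C₂ S₀ →
        MemLp (fun z => S₁ z - S₂ z) 2 (phaseMeasure Ω) →
        (∀ x ∈ Ω, tsupport (fun v => S₁ (x, v) - S₂ (x, v)) ⊆ U) →
        MemLp (fun p : ℝ × Phase => S₁ p.2 * S₀ p) 2 (interiorMeasure T Ω) →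
        MemLp (fun p : ℝ × Phase => S₂ p.2 * S₀ p) 2 (interiorMeasure T Ω) →
        MemLp g 2 (phaseMeasure Ω) →
        MemLp h 2 (inMeasure T Ω) →
        IsWeakSolution T Ω E q (fun p => S₁ p.2 * S₀ p) g h u₁ u₁Out →
        IsWeakSolution T Ω E q (fun p => S₂ p.2 * S₀ p) g h u₂ u₂Out →
        (∃ d, IsWeakTimeDeriv T Ω (fun p => u₁Out p - u₂Out p) d) ∧
        ∀ d, IsWeakTimeDeriv T Ω (fun p => u₁Out p - u₂Out p) d →
          ENNReal.ofReal c * eLpNorm d 2 (outMeasure T Ω)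
              ≤ eLpNorm (fun z => S₁ z - S₂ z) 2 (phaseMeasure Ω) ∧
          eLpNorm (fun z => S₁ z - S₂ z) 2 (phaseMeasure Ω)
              ≤ ENNReal.ofReal C * eLpNorm d 2 (outMeasure T Ω) := by
  obtain ⟨Q, hQ0, hQ⟩ := exists_ae_bound_of_memLp_top hq
  obtain ⟨I, -, hUI, hIV⟩ := hUV
  -- Closedness of `J` is what the localization requires, and separation places the cylinder `W`
  -- over it inside `V`.
  set J : Set ℝ := closure ((fun v : R3 => v j) '' U) with hJ
  set W : Set R3 := {v | v j ∈ J} with hW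
  set K : ℝ := Real.exp ((2 * Q + 2) * T) * (C₁ ^ 2 * T + (C₁ * (1 + T)) ^ 2 * (1 + 8 * Real.exp 1))
    with hK
  have hK0 : 0 < K := by positivity
  obtain ⟨C, hC0, hC⟩ := exists_observability_constant (W := W) hT hΩ hE hV
    (fun v hv => hIV v (hUI hv)) hQ hC₂ C₁ K
  -- The constant `K` is the common energy bound for z and for its trace. It enters the first
  -- inequality directly and the second one through the cut-off error; square roots pass from
  -- integrals of squares to norms.
  refine ⟨(√K)⁻¹, √C, by positivity, by positivity, ?_⟩
  intro S₀ S₁ S₂ g h u₁ u₂ d₁ d₂ hP hf hfU hS₁ hS₂ _ _ hu₁ hu₂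
  have hS : MemLp (fun p : ℝ × Phase => (S₁ p.2 - S₂ p.2) * S₀ p) 2 (interiorMeasure T Ω) := by
    simp only [sub_mul]
    exact hS₁.sub hS₂
  have hsupp : ∀ z : Phase, z.1 ∈ Ω → S₁ z - S₂ z ≠ 0 → z.2 ∈ U := fun z hz hne =>
    hfU z.1 hz (subset_tsupport _ hne)
  obtain ⟨σ, hσ⟩ := hP.exists_isSourceData hT hΩ.isOpen hC₁ hf hsupp hS
  have hsol : IsTransportSolution T Ω E
      (fun p => (S₁ p.2 - S₂ p.2) * S₀ p - q p.2 * (u₁ p - u₂ p)) (fun p => u₁ p - u₂ p)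
      (fun p => d₁ p - d₂ p) fun _ => 0 := by
    simpa only [sub_mul] using hu₁.isTransportSolution_sub hu₂ hE hΩ hq.1 hQ hS₁ hS₂
  obtain ⟨z, d', hz, hder, hd'K, hzK⟩ := hsol.exists_time_derivative hσ hE hΩ hT hq.1 hQ hQ0
  have hlf := hΩ.isLocallyFiniteMeasure_outMeasure T
  have hd'w : IsWeakTimeDeriv T Ω (fun p => d₁ p - d₂ p) d' :=
    ⟨(hz.memLp_trace.locallyIntegrable one_le_two).locallyIntegrableOn _, fun θ hθ hθs hθT =>
      hder θ hθ hθs (hθT.trans (prod_mono Ioo_subset_Iio_self Subset.rfl))⟩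
  have hfW : ∀ᵐ y ∂phaseMeasure Ω, y.2 j ∉ J → S₁ y - S₂ y = 0 := by
    filter_upwards [ae_phase_mem hΩ.isOpen] with y hy hyJ
    by_contra hne
    exact hyJ (subset_closure ⟨y.2, hsupp y hy hne, rfl⟩)
  obtain ⟨hzW, hdW⟩ := hz.ae_eq_zero_of_velocity_notMem hE hΩ hT hEj hQ hQ0
    (isClosed_closure (s := (fun v : R3 => v j) '' U))
    ((ae_interior_of_ae_phase hfW).mono fun p hp hpJ => by rw [hp hpJ, zero_mul])
    (hfW.mono fun y hy hyJ => by rw [hy hyJ, zero_mul])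
  have hobs := hC _ _ _ σ z d' hz hσ hzW hdW hfW hzK
  refine ⟨⟨d', hd'w⟩, fun d hd => ?_⟩
  -- Weak time derivatives are unique almost everywhere, so it suffices to estimate the one
  -- constructed above.
  rw [eLpNorm_congr_ae (hd.ae_eq hΩ hd'w)]
  constructor
  · have h1 := eLpNorm_le_of_integral_sq_le hz.memLp_trace hf hK0.le hd'K
    calc ENNReal.ofReal (√K)⁻¹ * eLpNorm d' 2 (outMeasure T Ω)
        ≤ ENNReal.ofReal (√K)⁻¹ * (ENNReal.ofReal √K
          * eLpNorm (fun z => S₁ z - S₂ z) 2 (phaseMeasure Ω)) := mul_le_mul_right h1 _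
      _ = eLpNorm (fun z => S₁ z - S₂ z) 2 (phaseMeasure Ω) := by
        rw [← mul_assoc, ← ENNReal.ofReal_mul (by positivity), inv_mul_cancel₀ (by positivity),
          ENNReal.ofReal_one, one_mul]
  · exact eLpNorm_le_of_integral_sq_le hf hz.memLp_trace hC0.le hobs
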